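/- Let $n\ge 1$ and let $(M_0,g_0)$, $(M_1,g_1)$ be $n$-dimensional smooth manifolds with compact boundary and $C^\infty$ Riemannian metrics, and let $\phi:\Gamma_0=\partial M_0\to\Gamma_1=\partial M_1$ be a (smooth) isometry of the boundaries; write $\Gamma$ for $\Gamma_0=_\phi\Gamma_1$. For a metric $g$ let $\mathcal I(g)(e_i\wedge e_j,e_k\wedge e_l)=g_{ik}g_{jl}-g_{jk}g_{il}$ and $\mathcal R(g)(e_i\wedge e_j,e_k\wedge e_l)=R_{ijkl}$ be the induced inner product and the curvature form on two-vectors, with the sign for which the sectional curvature of orthonormal $e_i,e_j$ is $R_{ijij}$; $\mathcal R(g)\ge\kappa\,\mathcal I(g)$ means $\mathcal R(g)(\alpha,\alpha)\ge\kappa\,\mathcal I(g)(\alpha,\alpha)$ for all two-vectors $\alpha$ at all points. Let $\kappa\in\mathbb R$, suppose $\mathcal R(g_i)\ge\kappa\,\mathcal I(g_i)$ on $M_i$ for $i=0,1$, and suppose that the sum $L=L_0+L_1$ on $\Gamma$ of the second fundamental forms of $\Gamma_0,\Gamma_1$ with respect to the inward normals is positive semidefinite. On $M_0$ let $x^n=d_{g_0}(\cdot,\Gamma)$.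 Let $r>0$ be so small that $x^n$ is smooth on the tube $U=\{x^n<r\}$ and $\{x^n\le s\}$ is compact for all $s<r$; put $N=\nabla x^n$ and $P^T=g_0-dx^n\otimes dx^n$ on $U$. Let $L$ also denote the smooth extension of $L$ to a symmetric $(0,2)$-tensor field on $U$ with $L(N,\cdot)=0$ and $\nabla_NL=0$. Let $\chi\in C^\infty(\mathbb R)$ be a cutoff function with $\chi=1$ on $[0,s_1]$ for some $s_1>0$ and $\chi=0$ on $[s_2,\infty)$ for some $s_2<r$. For $\delta>0$ let $f_\delta\in C^\infty([0,\infty),\mathbb R)$ satisfy $f_\delta(x)=1-x/\delta^4$ on $[0,\delta^4]$, $-\delta^2\le f_\delta\le0$ and $f_\delta'\le\delta$ on $[\delta^4,\delta]$, $f_\delta=0$ on $[\delta,\infty)$, and $\int_0^\delta f_\delta=0$. Put $F_\delta(x)=\int_0^xf_\delta$, $\mathcal F_\delta(x)=\int_0^xF_\delta$ and, for a constant $C$, $$g_\delta=g_0+2F_\delta(x^n)\,L-2C\,\chi(x^n)\,\mathcal F_\delta(x^n)\,P^T\ \text{ on }U,\qquad g_\delta=g_0\ \text{ on }M_0\setminus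 U.$$ Then there is a constant $C_0$, independent of $\chi$ and of the functions $f_\delta$, such that for every such $\chi$ and every $C\ge C_0$ there is a function $\varepsilon$ with $\varepsilon(\delta)\to0$ as $\delta\downarrow0$ such that, for all sufficiently small $\delta>0$ and every $f_\delta$ as above, $g_\delta$ is a smooth Riemannian metric on $M_0$ and $$\mathcal R(g_\delta)\ \ge\ (\kappa-\varepsilon(\delta))\,\mathcal I(g_\delta)\quad\text{on }M_0 .$$ -/

import Mathlib

open Set Filter Topology MeasureTheory Manifold ContDiff

noncomputable section

namespace Gluing

/-! ### Tensor fields and Riemannian metrics on a manifold with boundary -/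

/-- The `k`-th standard basis vector of `ℝⁿ`. -/
def stdVec {n : ℕ} (k : Fin n) : EuclideanSpace ℝ (Fin n) := EuclideanSpace.single k 1

/-- A field of bilinear forms on the tangent spaces of an `n`-manifold with boundary
(a `(0,2)`-tensor field, with no regularity required). -/
abbrev TensorField (n : ℕ) [NeZero n] (M : Type*) [TopologicalSpace M]
    [ChartedSpace (EuclideanHalfSpace n) M] : Type _ :=
  ∀ p : M, TangentSpace (𝓡∂ n) p →L[ℝ] TangentSpace (𝓡∂ n) p →L[ℝ] ℝ

/-- Smooth (`C^∞`) Riemannian metrics on an `n`-manifold with boundary. -/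
abbrev SmoothMetric (n : ℕ) [NeZero n] (M : Type*) [TopologicalSpace M]
    [ChartedSpace (EuclideanHalfSpace n) M] [IsManifold (𝓡∂ n) ∞ M] : Type _ :=
  Bundle.ContMDiffRiemannianMetric (𝓡∂ n) ∞ (EuclideanSpace ℝ (Fin n))
    (fun p : M => TangentSpace (𝓡∂ n) p)

section Coordinates

variable {n : ℕ} [NeZero n] {M : Type*} [TopologicalSpace M]
  [ChartedSpace (EuclideanHalfSpace n) M]

/-- The coefficient `h_{ij}` of the tensor field `h` in the coordinates given by the chart at `p`,
as a function on the half-space: the `(i,j)` entry of the pull-back of `h` by the inverse chart. -/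
def coeff (h : TensorField n M) (p : M) (i j : Fin n) (x : EuclideanSpace ℝ (Fin n)) : ℝ :=
  h ((extChartAt (𝓡∂ n) p).symm x)
    (mfderivWithin 𝓘(ℝ, EuclideanSpace ℝ (Fin n)) (𝓡∂ n) (extChartAt (𝓡∂ n) p).symm
      (range (𝓡∂ n)) x (stdVec i))
    (mfderivWithin 𝓘(ℝ, EuclideanSpace ℝ (Fin n)) (𝓡∂ n) (extChartAt (𝓡∂ n) p).symm
      (range (𝓡∂ n)) x (stdVec j))

/-- The partial derivative `∂_k f` of a function on the closed half-space (one-sided at boundary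
points). -/
def pderiv (k : Fin n) (f : EuclideanSpace ℝ (Fin n) → ℝ) (x : EuclideanSpace ℝ (Fin n)) : ℝ :=
  fderivWithin ℝ f (range (𝓡∂ n)) x (stdVec k)

/-- The inverse `g^{kl}` of the coefficient matrix `g_{kl}` in the chart at `p`. -/
def invCoeff (g : TensorField n M) (p : M) (k l : Fin n) (x : EuclideanSpace ℝ (Fin n)) : ℝ :=
  (Matrix.of fun i j => coeff g p i j x)⁻¹ k l

/-- The Christoffel symbol `Γ^k_{ij}` of `g` in the chart at `p`. -/
def christoffel (g : TensorField n M) (p : M) (k i j : Fin n)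
    (x : EuclideanSpace ℝ (Fin n)) : ℝ :=
  (1 / 2) * ∑ l, invCoeff g p k l x *
    (pderiv i (coeff g p j l) x + pderiv j (coeff g p i l) x - pderiv l (coeff g p i j) x)

/-- The Riemann tensor `R_{ijkl} = g(∇_j ∇_i ∂_k - ∇_i ∇_j ∂_k, ∂_l)` of `g` in the chart at `p`.
With this sign the sectional curvature of an orthonormal pair is `R_{ijij}`. -/
def riemann (g : TensorField n M) (p : M) (i j k l : Fin n)
    (x : EuclideanSpace ℝ (Fin n)) : ℝ :=
  ∑ m, coeff g p m l x *
    (pderiv j (christoffel g p m i k) x - pderiv i (christoffel g p m j k) x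
      + ∑ a, (christoffel g p a i k x * christoffel g p m j a x
          - christoffel g p a j k x * christoffel g p m i a x))

/-- The bilinear form of the curvature operator evaluated on `(α, α)` at `p`, where `α` is the
two-vector `∑_{i<j} α^{ij} e_i ∧ e_j` with antisymmetric coefficients `α^{ij}` and `e_i` is the
coordinate basis of the chart at `p`: `(1/4) R_{ijkl} α^{ij} α^{kl}`. -/
def curvatureForm (g : TensorField n M) (p : M) (α : Matrix (Fin n) (Fin n) ℝ) : ℝ :=
  (1 / 4) * ∑ i, ∑ j, ∑ k, ∑ l,
    riemann g p i j k l (extChartAt (𝓡∂ n) p p) * α i j * α k l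

/-- The inner product on two-vectors induced by `g`, evaluated on `(α, α)` at `p`:
`(1/4) (g_{ik} g_{jl} - g_{jk} g_{il}) α^{ij} α^{kl}`. -/
def bivectorForm (g : TensorField n M) (p : M) (α : Matrix (Fin n) (Fin n) ℝ) : ℝ :=
  (1 / 4) * ∑ i, ∑ j, ∑ k, ∑ l,
    (coeff g p i k (extChartAt (𝓡∂ n) p p) * coeff g p j l (extChartAt (𝓡∂ n) p p)
      - coeff g p j k (extChartAt (𝓡∂ n) p p) * coeff g p i l (extChartAt (𝓡∂ n) p p))
      * α i j * α k l

/-- `R(g) ≥ κ I(g)`: the curvature operator of `g` is at least `κ` at every point, that is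
`R(α, α) ≥ κ I(α, α)` for all two-vectors `α`. -/
def CurvatureGE (g : TensorField n M) (κ : ℝ) : Prop :=
  ∀ (p : M) (α : Matrix (Fin n) (Fin n) ℝ), α.transpose = -α →
    κ * bivectorForm g p α ≤ curvatureForm g p α

/-- The covariant derivative `(∇_k h)_{ij}` at `p` (with respect to the Levi-Civita connection
of `g`) of the `(0,2)`-tensor field `h`, in the chart at `p`. -/
def covDeriv (g h : TensorField n M) (p : M) (k i j : Fin n) : ℝ :=
  pderiv k (coeff h p i j) (extChartAt (𝓡∂ n) p p)
    - ∑ a, christoffel g p a k i (extChartAt (𝓡∂ n) p p) *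
        coeff h p a j (extChartAt (𝓡∂ n) p p)
    - ∑ a, christoffel g p a k j (extChartAt (𝓡∂ n) p p) *
        coeff h p i a (extChartAt (𝓡∂ n) p p)

/-- The `k`-th component at `p`, in the chart at `p`, of the gradient of `u` with respect
to `g`: `g^{kl} ∂_l u`. -/
def gradComp (g : TensorField n M) (u : M → ℝ) (p : M) (k : Fin n) : ℝ :=
  ∑ l, invCoeff g p k l (extChartAt (𝓡∂ n) p p) *
    pderiv l (u ∘ (extChartAt (𝓡∂ n) p).symm) (extChartAt (𝓡∂ n) p p)

/-! ### The second fundamental form of the boundary -/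

/-- The `k`-th component of the inward unit normal of the boundary at the boundary point `p`, in
the chart at `p`, in which the manifold is `{x_0 ≥ 0}`: `N^k = g^{k0} / √(g^{00})`. -/
def inwardNormal (g : TensorField n M) (p : M) (k : Fin n) : ℝ :=
  invCoeff g p k 0 (extChartAt (𝓡∂ n) p p) / √(invCoeff g p 0 0 (extChartAt (𝓡∂ n) p p))

/-- The second fundamental form `g(∇_X Y, N)` (which equals `-g(∇_X N, Y)`) of the boundary with
respect to the inward unit normal `N`, for vectors `X`, `Y` tangent to the boundary at `p`. Here
`Y` is extended with constant coefficients in the chart at `p`; this extension is tangent to the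
boundary. A tangent vector at `p` is an element of `ℝⁿ` through the chart at `p`. -/
def secondFundamentalForm (g : TensorField n M) (p : M) (X Y : EuclideanSpace ℝ (Fin n)) : ℝ :=
  ∑ k, ∑ l, coeff g p k l (extChartAt (𝓡∂ n) p p) *
    (∑ i, ∑ j, christoffel g p k i j (extChartAt (𝓡∂ n) p p) * X i * Y j) * inwardNormal g p l

end Coordinates

/-! ### The distance to the boundary -/

section Distance

variable {n : ℕ} [NeZero n] {M : Type*} [TopologicalSpace M]
  [ChartedSpace (EuclideanHalfSpace n) M] [IsManifold (𝓡∂ n) ∞ M]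

open scoped Bundle in
/-- The Riemannian distance of `p` to the boundary of `M` (infimum of lengths of curves); it is
`∞` if `p` cannot be joined to the boundary. -/
def boundaryEDist (g : SmoothMetric n M) (p : M) : ENNReal :=
  letI : Bundle.RiemannianBundle (fun q : M => TangentSpace (𝓡∂ n) q) := ⟨g.toRiemannianMetric⟩
  ⨅ q ∈ (𝓡∂ n).boundary M, riemannianEDist (𝓡∂ n) p q

/-- The Fermi coordinate `x^n`: the real-valued distance to the boundary. -/
def normalCoord (g : SmoothMetric n M) (p : M) : ℝ := (boundaryEDist g p).toReal

/-- The tube `{p | d(p, ∂M) < r}`. -/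
def tube (g : SmoothMetric n M) (r : ℝ) : Set M := {p | boundaryEDist g p < ENNReal.ofReal r}

/-- The width `r > 0` is small enough for Fermi coordinates: the distance function to the
boundary is smooth on the tube of width `r`, whose closed subtubes are compact. -/
structure IsFermiWidth (g : SmoothMetric n M) (r : ℝ) : Prop where
  pos : 0 < r
  smooth : ContMDiffOn (𝓡∂ n) 𝓘(ℝ, ℝ) ∞ (normalCoord g) (tube g r)
  compact : ∀ s < r, IsCompact {p : M | boundaryEDist g p ≤ ENNReal.ofReal s}

/-- The differential of `x^n`. On the tube it is the form `⟨N, ·⟩` with `N = ∂/∂x^n`. -/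
def dNormalCoord (g : SmoothMetric n M) (p : M) : TangentSpace (𝓡∂ n) p →L[ℝ] ℝ :=
  mfderiv (𝓡∂ n) 𝓘(ℝ, ℝ) (normalCoord g) p

/-- The tensor `P^T` of the orthogonal projection onto the tangent spaces of the hypersurfaces
equidistant to the boundary: `P^T = g - dx^n ⊗ dx^n`. -/
def tangentialPart (g : SmoothMetric n M) : TensorField n M := fun p =>
  g.inner p - (dNormalCoord g p).smulRight (dNormalCoord g p)

/-- `L` is a smooth symmetric tensor field on the tube of width `r` with `L(N, ·) = 0` and
`∇_N L = 0`, where `N` is the gradient of `x^n`; equivalently the self-adjoint operator `𝐋` with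
`L(v, w) = g(v, 𝐋 w)` satisfies `𝐋 N = 0` and `∇_N 𝐋 = 0`. -/
structure IsNormallyParallel (g : SmoothMetric n M) (r : ℝ) (L : TensorField n M) : Prop where
  smooth : ContMDiffOn (𝓡∂ n) ((𝓡∂ n).prod 𝓘(ℝ, EuclideanSpace ℝ (Fin n) →L[ℝ]
      EuclideanSpace ℝ (Fin n) →L[ℝ] ℝ)) ∞
    (fun p => Bundle.TotalSpace.mk' (EuclideanSpace ℝ (Fin n) →L[ℝ]
      EuclideanSpace ℝ (Fin n) →L[ℝ] ℝ)
      (E := fun q : M => TangentSpace (𝓡∂ n) q →L[ℝ] TangentSpace (𝓡∂ n) q →L[ℝ] ℝ)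
      p (L p)) (tube g r)
  symm : ∀ p ∈ tube g r, ∀ v w, L p v w = L p w v
  normal : ∀ p ∈ tube g r, ∀ j, ∑ k, gradComp g.inner (normalCoord g) p k *
    coeff L p k j (extChartAt (𝓡∂ n) p p) = 0
  parallel : ∀ p ∈ tube g r, ∀ i j,
    ∑ k, gradComp g.inner (normalCoord g) p k * covDeriv g.inner L p k i j = 0

end Distance

/-! ### The two glued manifolds -/

/-- `ι : Γ → M` is a smooth embedding of the closed `(n-1)`-manifold `Γ` (assumed compact) onto
the boundary of `M`, i.e. an identification of `Γ` with `∂M`. -/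
structure IsBoundaryEmbedding (m : ℕ) {Γ : Type*} [TopologicalSpace Γ]
    [ChartedSpace (EuclideanSpace ℝ (Fin m)) Γ] {M : Type*} [TopologicalSpace M]
    [ChartedSpace (EuclideanHalfSpace (m + 1)) M] (ι : Γ → M) : Prop where
  smooth : ContMDiff (𝓡 m) (𝓡∂ (m + 1)) ∞ ι
  injective : Function.Injective ι
  immersion : ∀ y, Function.Injective (mfderiv (𝓡 m) (𝓡∂ (m + 1)) ι y)
  range_eq : range ι = (𝓡∂ (m + 1)).boundary M

section Boundary

variable {m : ℕ} {Γ : Type*} [TopologicalSpace Γ] [ChartedSpace (EuclideanSpace ℝ (Fin m)) Γ]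
  {M₀ : Type*} [TopologicalSpace M₀] [ChartedSpace (EuclideanHalfSpace (m + 1)) M₀]
  {M₁ : Type*} [TopologicalSpace M₁] [ChartedSpace (EuclideanHalfSpace (m + 1)) M₁]

/-- The pull-back to `Γ` of the second fundamental form of `∂M` (inward normal). -/
def boundaryForm (g : TensorField (m + 1) M₀) (ι : Γ → M₀) (y : Γ)
    (X Y : TangentSpace (𝓡 m) y) : ℝ :=
  secondFundamentalForm g (ι y) (mfderiv (𝓡 m) (𝓡∂ (m + 1)) ι y X)
    (mfderiv (𝓡 m) (𝓡∂ (m + 1)) ι y Y)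

/-- The sum `L = L₀ + L₁` on `Γ` of the second fundamental forms of the two boundaries, each with
respect to the inward normal. -/
def sumForm (g₀ : TensorField (m + 1) M₀) (g₁ : TensorField (m + 1) M₁) (ι₀ : Γ → M₀)
    (ι₁ : Γ → M₁) (y : Γ) (X Y : TangentSpace (𝓡 m) y) : ℝ :=
  boundaryForm g₀ ι₀ y X Y + boundaryForm g₁ ι₁ y X Y

end Boundary

/-! ### The modified metric -/

/-- The conditions on the auxiliary function `f_δ` on `[0, ∞)`. -/
structure IsAuxFun (δ : ℝ) (f : ℝ → ℝ) : Prop where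
  smooth : ContDiffOn ℝ ∞ f (Ici 0)
  eq_linear : ∀ x ∈ Icc 0 (δ ^ 4), f x = 1 - x / δ ^ 4
  lower : ∀ x ∈ Icc (δ ^ 4) δ, -δ ^ 2 ≤ f x
  upper : ∀ x ∈ Icc (δ ^ 4) δ, f x ≤ 0
  deriv_le : ∀ x ∈ Icc (δ ^ 4) δ, derivWithin f (Ici 0) x ≤ δ
  eq_zero : ∀ x ∈ Ici δ, f x = 0
  integral_eq : ∫ t in (0 : ℝ)..δ, f t = 0

/-- `F(x) = ∫₀ˣ f`. -/
def primitive (f : ℝ → ℝ) (x : ℝ) : ℝ := ∫ t in (0 : ℝ)..x, f t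

/-- A smooth cutoff function in `x^n`, equal to `1` near `0` on `[0, ∞)` and to `0` on
`[s, ∞)` for some `s < r`. -/
structure IsCutoff (r : ℝ) (χ : ℝ → ℝ) : Prop where
  smooth : ContDiff ℝ ∞ χ
  eq_one : ∃ s > 0, ∀ x ∈ Icc 0 s, χ x = 1
  eq_zero : ∃ s < r, ∀ x ∈ Ici s, χ x = 0

open scoped Classical in
/-- The modified metric
`g_δ = g + 2 F_δ(x^n) L - 2 C χ(x^n) 𝓕_δ(x^n) P^T` on the tube of width `r`, `g_δ = g` outside,
where `F_δ = ∫ f_δ` and `𝓕_δ = ∫ F_δ`. -/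
def modifiedMetric {n : ℕ} [NeZero n] {M : Type*} [TopologicalSpace M]
    [ChartedSpace (EuclideanHalfSpace n) M] [IsManifold (𝓡∂ n) ∞ M]
    (g : SmoothMetric n M) (r : ℝ) (L : TensorField n M) (χ : ℝ → ℝ) (C : ℝ) (f : ℝ → ℝ) :
    TensorField n M := fun p =>
  if p ∈ tube g r then
    g.inner p + (2 * primitive f (normalCoord g p)) • L p
      - (2 * C * χ (normalCoord g p) * primitive (primitive f) (normalCoord g p)) •
        tangentialPart g p
  else g.inner p

end Gluing

end

/-!
# Smoothing the metric near the boundary with a lower bound on the curvature operator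

The metric `g_δ` differs from `g₀` only in a thin layer near the boundary, and there it is of the
form `g₀ + a(x^n) L + b(x^n) P^T` with `a = 2 F_δ` and `b = -2 C χ 𝓕_δ`. Tensor calculus is done in
charts: the curvature is an explicit continuous function `curvatureOf` of the `2`-jet of the metric,
and `curvatureForm_eq_chart` says that it does not depend on the chart. In this form the proof is a
continuity argument for the jets of `g_δ` at points which approach a given point `q` as `δ → 0`.

**The unbounded term.** As `δ → 0`, the functions `F_δ` and `𝓕_δ` tend to zero uniformly,
`F_δ' = f_δ` has values in `[-δ², 1]`, and `𝓕_δ'' = f_δ`; only `F_δ'' = f_δ'` is unbounded. By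
`frameForm_perturbedCurvature_add` the second derivatives of `a` and `b` contribute
`-f_δ' L(w, w)` and `C f_δ P^T(w, w)` to the curvature form of a two-vector `α`, where `w` is the
contraction of `α` with `dx^n`. Since `f_δ' ≤ δ`, the first of these is at least `-δ L(w, w)` as soon
as `L ≥ 0`. On the boundary this is a hypothesis, and `exists_tube_nonneg` extends it to a tube
because `L` is parallel along the normal direction: for `η > 0`, the form `L + (η x^n + c) g₀` with
the least `c ≥ 0` that makes it nonnegative would degenerate somewhere if `c` were positive, and
comparing it with its parallel translates towards the boundary excludes this
(`not_vanishing_of_nonneg`).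

**The limit at the boundary.** Near a boundary point `f_δ` may have any value `t ∈ [0, 1]` up to an
error `δ²`. Apart from the favourable term above, the limit of the curvature forms is that of
`g₀ + 2 t x^n L`, increased by `C t P^T(w, w)`. It has to be at least `κ` for all `t`; compactness
of `[0, 1]` then makes the estimate uniform (`eventually_hasLocalBound_boundary`).

**The boundary inequality.** All the metrics `g₀ + 2 t x^n L` induce the same metric on the
boundary. Because `|dx^n| = 1` there (`fderivWithin_normalCoordIn_gradient`), the second fundamental
form of the boundary is `(1 - t) L₀ - t L₁`. This interpolates between the form `L₀` of `g₀`
and the form `-L₁` of `g₁` with respect to the *outward* normal, which corresponds to `N` under the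
gluing. Now compare the curvature of `g₀ + 2 t x^n L` with the combination `(1 - t) R₀ + t R₁`, which
is at least `κ` (`IsHypersurfaceAt.frameForm_comparison`). By the Gauss equation the tangential part
of the difference is `t (1 - t) L ∧ L ≥ 0`. By the Codazzi equation, which is linear in the second
fundamental form, the components with one normal index cancel. What remains are the components
on two-vectors `N ∧ w`; the difference is a polynomial in `t` which vanishes at `t = 0`, hence it is
bounded by a multiple of `t |w|²`, and this is compensated by `C t P^T(w, w)` for `C ≥ C₀`
(`exists_curvature_collarMetric_ge`).

**Globalization.** At an interior point `F_δ` and `f_δ` vanish for small `δ`, and only a small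
constant `𝓕_δ` is left. A closed tube which contains the support of the cutoff function is compact,
hence the estimates near its points are uniform (`eventually_forall_hasLocalBound`). The function
`ε(δ)` is the infimum of the errors which are admissible for `δ`, increased by `δ`
(`exists_modified_metrics`).
-/

noncomputable section

set_option maxSynthPendingDepth 3

namespace Gluing

/-! ### Connection and curvature from the jet of a metric -/

section Jets

variable {V : Type*} [NormedAddCommGroup V] [NormedSpace ℝ V]

/-- Bilinear forms on `V`. -/
abbrev Bilin (V : Type*) [NormedAddCommGroup V] [NormedSpace ℝ V] : Type _ := V →L[ℝ] V →L[ℝ] ℝ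

/-- The Christoffel symbol of the first kind
`½ (D u v w + D v u w - D w u v)`, as a linear function of the derivative `D` of the metric. -/
def koszulForm : (V →L[ℝ] Bilin V) →L[ℝ] (V →L[ℝ] Bilin V) :=
  (1 / 2 : ℝ) • (ContinuousLinearMap.id ℝ _
    + (ContinuousLinearMap.flipₗᵢ ℝ V V (V →L[ℝ] ℝ)).toContinuousLinearEquiv.toContinuousLinearMap
    - (ContinuousLinearMap.compL ℝ V (Bilin V) (Bilin V)
        (ContinuousLinearMap.flipₗᵢ ℝ V V ℝ).toContinuousLinearEquiv.toContinuousLinearMap) ∘L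
      (ContinuousLinearMap.flipₗᵢ ℝ V V
        (V →L[ℝ] ℝ)).toContinuousLinearEquiv.toContinuousLinearMap)

theorem koszulForm_apply (D : V →L[ℝ] Bilin V) (u v w : V) :
    koszulForm D u v w = 1 / 2 * (D u v w + D v u w - D w u v) := by
  simp [koszulForm]

/-- The connection determined by the value `G` and the derivative `D` of a metric at a point:
`G (B u v) w` is the Christoffel symbol of the first kind. -/
def connectionOf (G : Bilin V) (D : V →L[ℝ] Bilin V) : V →L[ℝ] V →L[ℝ] V :=
  (ContinuousLinearMap.compL ℝ V (V →L[ℝ] ℝ) V G.inverse) ∘L koszulForm D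

theorem connectionOf_apply (G : Bilin V) (D : V →L[ℝ] Bilin V) (u v : V) :
    connectionOf G D u v = G.inverse (koszulForm D u v) := rfl

/-- The curvature `R(u,v,w,z)` determined by the value `G`, the derivative `D` and the second
derivative `H` of a metric at a point, with the sign for which the sectional curvature of
orthonormal vectors is `R(u,v,u,v)`. Only the Christoffel symbols of the first kind are
differentiated, so that the expression is affine in `H`. -/
def curvatureOf (G : Bilin V) (D : V →L[ℝ] Bilin V) (H : V →L[ℝ] V →L[ℝ] Bilin V)
    (u v w z : V) : ℝ :=
  koszulForm (H v) u w z - koszulForm D v z (connectionOf G D u w)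
    - (koszulForm (H u) v w z - koszulForm D u z (connectionOf G D v w))

/-- An inner product: a symmetric and positive definite bilinear form. -/
structure IsInner (G : Bilin V) : Prop where
  symm : ∀ u v, G u v = G v u
  pos : ∀ u, u ≠ 0 → 0 < G u u

theorem IsInner.injective {G : Bilin V} (hG : IsInner G) : Function.Injective G := by
  intro u v h
  by_contra hne
  have := hG.pos (u - v) (sub_ne_zero.2 hne)
  simp [h] at this

theorem IsInner.ext {G : Bilin V} (hG : IsInner G) {u v : V} (h : ∀ w, G u w = G v w) : u = v :=
  hG.injective (ContinuousLinearMap.ext h)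

/-- Compatibility of the connection with the metric, for the Christoffel symbols of the first
kind. -/
theorem koszulForm_add_flip {D : V →L[ℝ] Bilin V} (hD : ∀ u v w, D u v w = D u w v) (u v w : V) :
    koszulForm D u v w + koszulForm D u w v = D u v w := by
  simp only [koszulForm_apply]; linarith [hD u v w]

theorem koszulForm_symm {D : V →L[ℝ] Bilin V} (hD : ∀ u v w, D u v w = D u w v) (u v w : V) :
    koszulForm D u v w = koszulForm D v u w := by
  simp only [koszulForm_apply, hD w v u]; ring

theorem connectionOf_symm {G : Bilin V} {D : V →L[ℝ] Bilin V}
    (hD : ∀ u v w, D u v w = D u w v) (u v : V) :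
    connectionOf G D u v = connectionOf G D v u := by
  rw [connectionOf_apply, connectionOf_apply]
  congr 1
  ext w
  exact koszulForm_symm hD u v w

theorem curvatureOf_antisymm (G : Bilin V) (D : V →L[ℝ] Bilin V) (H : V →L[ℝ] V →L[ℝ] Bilin V)
    (u v w z : V) : curvatureOf G D H u v w z = - curvatureOf G D H v u w z := by
  unfold curvatureOf; ring

variable [FiniteDimensional ℝ V]

/-- The isomorphism of `V` with its dual given by an inner product. -/
def IsInner.toDual {G : Bilin V} (hG : IsInner G) : V ≃L[ℝ] (V →L[ℝ] ℝ) :=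
  ContinuousLinearEquiv.ofBijective G (LinearMap.ker_eq_bot.2 hG.injective)
    (LinearMap.range_eq_top.2 (by
      have h1 : Module.finrank ℝ V = Module.finrank ℝ (V →L[ℝ] ℝ) := by
        rw [← LinearEquiv.finrank_eq (LinearMap.toContinuousLinearMap (𝕜 := ℝ) (E := V) (F' := ℝ))]
        exact (Subspace.dual_finrank_eq (K := ℝ) (V := V)).symm
      exact (LinearMap.injective_iff_surjective_of_finrank_eq_finrank h1
        (f := (G : V →ₗ[ℝ] (V →L[ℝ] ℝ)))).1 hG.injective))

theorem IsInner.coe_toDual {G : Bilin V} (hG : IsInner G) :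
    (hG.toDual : V →L[ℝ] (V →L[ℝ] ℝ)) = G := by
  ext u v; rfl

theorem IsInner.apply_inverse {G : Bilin V} (hG : IsInner G) (φ : V →L[ℝ] ℝ) :
    G (G.inverse φ) = φ := by
  have : G.inverse = (hG.toDual.symm : (V →L[ℝ] ℝ) →L[ℝ] V) := by
    rw [← ContinuousLinearMap.inverse_equiv, hG.coe_toDual]
  rw [this]
  exact hG.toDual.apply_symm_apply φ

theorem IsInner.apply_connectionOf {G : Bilin V} (hG : IsInner G) (D : V →L[ℝ] Bilin V)
    (u v w : V) : G (connectionOf G D u v) w = koszulForm D u v w := by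
  rw [connectionOf_apply, hG.apply_inverse]

theorem IsInner.curvatureOf_pair_symm {G : Bilin V} (hG : IsInner G) {D : V →L[ℝ] Bilin V}
    (hD : ∀ u v w, D u v w = D u w v) {H : V →L[ℝ] V →L[ℝ] Bilin V}
    (hH : ∀ a u v w, H a u v w = H a u w v) (hH' : ∀ a b v w, H a b v w = H b a v w)
    (u v w z : V) : curvatureOf G D H u v w z = curvatureOf G D H w z u v := by
  unfold curvatureOf
  simp only [← hG.apply_connectionOf D]
  rw [connectionOf_symm hD z u, connectionOf_symm hD w u, connectionOf_symm hD z v,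
    connectionOf_symm hD w v]
  rw [hG.symm (connectionOf G D v w) (connectionOf G D u z)]
  simp only [koszulForm_apply]
  linarith [hH' v w u z, hH' v z u w, hH' u w v z, hH' u z v w, hH' v u w z, hH' w z u v,
    hH z v u w, hH w u v z, hH z u v w, hH w v u z, hH v z w u, hH v w u z, hH u w v z, hH u z v w]

theorem IsInner.curvatureOf_antisymm' {G : Bilin V} (hG : IsInner G) {D : V →L[ℝ] Bilin V}
    (hD : ∀ u v w, D u v w = D u w v) {H : V →L[ℝ] V →L[ℝ] Bilin V}
    (hH : ∀ a u v w, H a u v w = H a u w v) (hH' : ∀ a b v w, H a b v w = H b a v w)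
    (u v w z : V) : curvatureOf G D H u v w z = - curvatureOf G D H u v z w := by
  rw [hG.curvatureOf_pair_symm hD hH hH', curvatureOf_antisymm,
    hG.curvatureOf_pair_symm hD hH hH']

end Jets

/-! ### Riemannian metrics on convex sets -/

section Calculus

variable {V : Type*} [NormedAddCommGroup V] [NormedSpace ℝ V]
  {W : Type*} [NormedAddCommGroup W] [NormedSpace ℝ W]

/-- A convex set with nonempty interior: on such sets derivatives within the set are unique and
second derivatives are symmetric. -/
structure IsBody (s : Set V) : Prop where
  convex : Convex ℝ s
  nonempty : (interior s).Nonempty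

theorem IsBody.uniqueDiffOn {s : Set V} (hs : IsBody s) : UniqueDiffOn ℝ s :=
  uniqueDiffOn_convex hs.convex hs.nonempty

theorem IsBody.subset_closure_interior {s : Set V} (hs : IsBody s) : s ⊆ closure (interior s) :=
  subset_closure.trans
    (hs.convex.closure_interior_eq_closure_of_nonempty_interior hs.nonempty).ge

/-- Symmetry of second derivatives, also at the points of `s` which are not interior. -/
theorem IsBody.second_symm {s : Set V} (hs : IsBody s) {f : V → W} {x : V} (hx : x ∈ s)
    (hf : ContDiffWithinAt ℝ 2 f s x) (u v : V) :
    fderivWithin ℝ (fderivWithin ℝ f s) s x u v = fderivWithin ℝ (fderivWithin ℝ f s) s x v u :=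
  hf.isSymmSndFDerivWithinAt (by simp) hs.uniqueDiffOn (hs.subset_closure_interior hx) hx u v

theorem isBody_univ : IsBody (univ : Set V) := ⟨convex_univ, by simp⟩

theorem _root_.HasFDerivWithinAt.apply_const {U : Type*} [NormedAddCommGroup U] [NormedSpace ℝ U]
    {c : V → W →L[ℝ] U} {c' : V →L[ℝ] W →L[ℝ] U} {s : Set V} {x : V}
    (hc : HasFDerivWithinAt c c' s x) (u : W) :
    HasFDerivWithinAt (fun y => c y u) (c'.flip u) s x := by
  convert hc.clm_apply (hasFDerivWithinAt_const u x s) using 1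
  ext a; simp

theorem contDiffWithinAt_fderivWithin {s : Set V} (hs : IsBody s) {f : V → W} {x : V}
    (hx : x ∈ s) (hf : ContDiffWithinAt ℝ ∞ f s x) :
    ContDiffWithinAt ℝ ∞ (fderivWithin ℝ f s) s x :=
  hf.fderivWithin_right hs.uniqueDiffOn (by simp) hx

theorem two_le_infty : (2 : WithTop ℕ∞) ≤ ∞ := by
  exact WithTop.coe_le_coe.2 (le_top : (2 : ℕ∞) ≤ ⊤)

theorem eventually_contDiffWithinAt_two {s : Set V} {f : V → W} {x : V} (hx : x ∈ s)
    (hf : ContDiffWithinAt ℝ ∞ f s x) : ∀ᶠ y in 𝓝[s] x, ContDiffWithinAt ℝ 2 f s y := by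
  have := (hf.of_le (m := 2) (two_le_infty)).eventually (by simp)
  rwa [insert_eq_of_mem hx] at this

/-- The Levi-Civita connection `B(x)(u, v) = Γ^k_{ij} u^i v^j e_k` of a metric `G` on the set
`s`. -/
def connection (s : Set V) (G : V → Bilin V) (x : V) : V →L[ℝ] V →L[ℝ] V :=
  connectionOf (G x) (fderivWithin ℝ G s x)

/-- The curvature `R(u,v,w,z)` of a metric `G` on the set `s`, with derivatives within `s`. -/
def curvature (s : Set V) (G : V → Bilin V) (x : V) (u v w z : V) : ℝ :=
  curvatureOf (G x) (fderivWithin ℝ G s x) (fderivWithin ℝ (fderivWithin ℝ G s) s x) u v w z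

/-- `G` is a smooth Riemannian metric on the set `s` near the point `x` of `s`. -/
structure IsMetricAt (s : Set V) (G : V → Bilin V) (x : V) : Prop where
  mem : x ∈ s
  smooth : ContDiffWithinAt ℝ ∞ G s x
  inner : ∀ᶠ y in 𝓝[s] x, IsInner (G y)

variable {s : Set V} {G : V → Bilin V} {x : V}

theorem fderivWithin_bilin_symm (hs : IsBody s) (hx : x ∈ s) (hd : DifferentiableWithinAt ℝ G s x)
    (hsymm : ∀ᶠ y in 𝓝[s] x, ∀ u v, G y u v = G y v u) (a u v : V) :
    fderivWithin ℝ G s x a u v = fderivWithin ℝ G s x a v u := by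
  have key : ∀ u v, HasFDerivWithinAt (fun y => G y u v)
      ((fderivWithin ℝ G s x).flip u |>.flip v) s x := by
    intro u v
    exact (hd.hasFDerivWithinAt.apply_const u).apply_const v
  have h2 : HasFDerivWithinAt (fun y => G y u v) ((fderivWithin ℝ G s x).flip v |>.flip u) s x :=
    (key v u).congr_of_eventuallyEq (hsymm.mono fun y hy => hy u v)
      (hsymm.self_of_nhdsWithin hx u v)
  have := (hs.uniqueDiffOn x hx).eq (key u v) h2
  simpa using DFunLike.congr_fun this a

theorem IsMetricAt.isInner (h : IsMetricAt s G x) : IsInner (G x) :=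
  h.inner.self_of_nhdsWithin h.mem

theorem IsMetricAt.differentiableWithinAt (h : IsMetricAt s G x) : DifferentiableWithinAt ℝ G s x :=
  h.smooth.differentiableWithinAt (by simp)

theorem IsMetricAt.deriv_symm (hs : IsBody s) (h : IsMetricAt s G x) (a u v : V) :
    fderivWithin ℝ G s x a u v = fderivWithin ℝ G s x a v u :=
  fderivWithin_bilin_symm hs h.mem h.differentiableWithinAt (h.inner.mono fun _ hy => hy.symm) a u v

theorem IsMetricAt.eventually_deriv_symm (hs : IsBody s) (h : IsMetricAt s G x) :
    ∀ᶠ y in 𝓝[s] x, ∀ a u v, fderivWithin ℝ G s y a u v = fderivWithin ℝ G s y a v u := by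
  have h3 := eventually_eventually_nhdsWithin.2 h.inner
  filter_upwards [eventually_contDiffWithinAt_two h.mem h.smooth, h3, self_mem_nhdsWithin]
    with y hy h3 hys
  exact fderivWithin_bilin_symm hs hys (hy.differentiableWithinAt (by simp))
    (h3.mono fun _ hy => hy.symm)

theorem IsMetricAt.second_deriv_symm (hs : IsBody s) (h : IsMetricAt s G x) (a b u v : V) :
    fderivWithin ℝ (fderivWithin ℝ G s) s x a b u v
      = fderivWithin ℝ (fderivWithin ℝ G s) s x a b v u := by
  have hd : DifferentiableWithinAt ℝ (fderivWithin ℝ G s) s x :=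
    (contDiffWithinAt_fderivWithin hs h.mem h.smooth).differentiableWithinAt (by simp)
  have h1 := hd.hasFDerivWithinAt.apply_const b
  have h2 := fderivWithin_bilin_symm (G := fun y => fderivWithin ℝ G s y b) hs h.mem
    h1.differentiableWithinAt ((h.eventually_deriv_symm hs).mono fun y hy u v => hy b u v) a u v
  rw [h1.fderivWithin (hs.uniqueDiffOn x h.mem)] at h2
  simpa using h2

theorem IsMetricAt.second_deriv_symm' (hs : IsBody s) (h : IsMetricAt s G x) (a b : V) :
    fderivWithin ℝ (fderivWithin ℝ G s) s x a b = fderivWithin ℝ (fderivWithin ℝ G s) s x b a :=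
  hs.second_symm h.mem (h.smooth.of_le (two_le_infty)) a b

variable [FiniteDimensional ℝ V]

theorem IsInner.contDiffAt_inverse {A : Bilin V} (hA : IsInner A) {n : WithTop ℕ∞} :
    ContDiffAt ℝ n (ContinuousLinearMap.inverse : Bilin V → _) A := by
  have := FiniteDimensional.complete ℝ V
  rw [← hA.coe_toDual]
  exact contDiffAt_map_inverse hA.toDual

theorem IsMetricAt.contDiffWithinAt_connection (hs : IsBody s) (h : IsMetricAt s G x) :
    ContDiffWithinAt ℝ ∞ (connection s G) s x := by
  have h1 : ContDiffWithinAt ℝ ∞ (fun y => (G y).inverse) s x :=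
    h.isInner.contDiffAt_inverse.comp_contDiffWithinAt x h.smooth
  have h2 := contDiffWithinAt_fderivWithin hs h.mem h.smooth
  exact ((ContinuousLinearMap.contDiff _).comp_contDiffWithinAt h1).clm_comp
    ((koszulForm (V := V)).contDiff.comp_contDiffWithinAt h2)

/-- The Levi-Civita connection is compatible with the metric. -/
theorem IsMetricAt.deriv_eq (hs : IsBody s) (h : IsMetricAt s G x) (a p q : V) :
    fderivWithin ℝ G s x a p q = G x (connection s G x a p) q + G x p (connection s G x a q) := by
  rw [h.isInner.symm p, connection, h.isInner.apply_connectionOf, h.isInner.apply_connectionOf,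
    koszulForm_add_flip (h.deriv_symm hs)]

/-- The curvature is the commutator of covariant derivatives. -/
theorem IsMetricAt.curvature_eq (hs : IsBody s) (h : IsMetricAt s G x) (u v w z : V) :
    curvature s G x u v w z = G x (fderivWithin ℝ (connection s G) s x v u w
      - fderivWithin ℝ (connection s G) s x u v w
      + connection s G x v (connection s G x u w) - connection s G x u (connection s G x v w)) z := by
  have hB := ((h.contDiffWithinAt_connection hs).differentiableWithinAt
    (by simp)).hasFDerivWithinAt
  have hD := ((contDiffWithinAt_fderivWithin hs h.mem h.smooth).differentiableWithinAt
    (by simp)).hasFDerivWithinAt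
  have key : ∀ v u w, koszulForm (fderivWithin ℝ (fderivWithin ℝ G s) s x v) u w z
      = fderivWithin ℝ G s x v (connection s G x u w) z
        + G x (fderivWithin ℝ (connection s G) s x v u w) z := by
    intro v u w
    have e1 := (h.differentiableWithinAt.hasFDerivWithinAt.clm_apply
      ((hB.apply_const u).apply_const w)).apply_const z
    have e2 := (((koszulForm (V := V)).hasFDerivAt.comp_hasFDerivWithinAt x hD).apply_const u
      |>.apply_const w).apply_const z
    have e3 := e1.congr_of_eventuallyEq (f₁ := fun y => koszulForm (fderivWithin ℝ G s y) u w z)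
      (h.inner.mono fun y hy => (hy.apply_connectionOf _ u w z).symm)
      (h.isInner.apply_connectionOf _ u w z).symm
    have := DFunLike.congr_fun ((hs.uniqueDiffOn x h.mem).eq e2 e3) v
    simp at this
    linarith
  have k2 := koszulForm_add_flip (h.deriv_symm hs)
  unfold curvature curvatureOf
  rw [key, key]
  have e : ∀ a b, koszulForm (fderivWithin ℝ G s x) a z b = fderivWithin ℝ G s x a b z
    - G x (connection s G x a b) z := by
    intro a b
    rw [connection, h.isInner.apply_connectionOf, ← k2]; ring
  rw [e, e]
  simp only [map_add, map_sub, add_apply, sub_apply]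
  simp only [connection]
  ring

end Calculus

/-! ### The Gauss and Codazzi equations -/

section GaussCodazzi

variable {V : Type*} [NormedAddCommGroup V] [NormedSpace ℝ V]
  {W : Type*} [NormedAddCommGroup W] [NormedSpace ℝ W]

/-- The bilinear form `G` pulled back by the linear map `A`. -/
def pullBilin (A : W →L[ℝ] V) (G : Bilin V) : Bilin W := G.bilinearComp A A

@[simp] theorem pullBilin_apply (A : W →L[ℝ] V) (G : Bilin V) (u v : W) :
    pullBilin A G u v = G (A u) (A v) := rfl

/-- The second fundamental form, with values in `V`, of a map `Ψ` from the Riemannian set `(t, γ)`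
to the Riemannian set `(s, G)`: the covariant Hessian `B(Ψ' u, Ψ' v) + Ψ''(u, v) - Ψ' (b(u, v))`,
where `B` and `b` are the two Levi-Civita connections. -/
def covHessian (s : Set V) (G : V → Bilin V) (t : Set W) (γ : W → Bilin W) (Ψ : W → V) (x : W)
    (u v : W) : V :=
  connection s G (Ψ x) (fderivWithin ℝ Ψ t x u) (fderivWithin ℝ Ψ t x v)
    + fderivWithin ℝ (fderivWithin ℝ Ψ t) t x u v
    - fderivWithin ℝ Ψ t x (connection t γ x u v)

/-- `Ψ` is near `x` a smooth map from `t` to `s` for which the metric `γ` is the pull-back of the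
metric `G`. -/
structure IsIsometricAt (s : Set V) (G : V → Bilin V) (t : Set W) (γ : W → Bilin W) (Ψ : W → V)
    (x : W) : Prop where
  target : IsMetricAt s G (Ψ x)
  source : IsMetricAt t γ x
  smooth : ContDiffWithinAt ℝ ∞ Ψ t x
  mapsTo : ∀ᶠ y in 𝓝[t] x, Ψ y ∈ s
  pull : ∀ᶠ y in 𝓝[t] x, γ y = pullBilin (fderivWithin ℝ Ψ t y) (G (Ψ y))

variable {s : Set V} {G : V → Bilin V} {t : Set W} {γ : W → Bilin W} {Ψ : W → V} {x : W}

theorem IsIsometricAt.tendsto (h : IsIsometricAt s G t γ Ψ x) :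
    Tendsto Ψ (𝓝[t] x) (𝓝[s] (Ψ x)) :=
  tendsto_nhdsWithin_iff.2 ⟨h.smooth.continuousWithinAt, h.mapsTo⟩

theorem hasFDerivWithinAt_comp_eventually {U : Type*} [NormedAddCommGroup U] [NormedSpace ℝ U]
    {c : V → U} {c' : V →L[ℝ] U} {Ψ' : W →L[ℝ] V}
    (hc : HasFDerivWithinAt c c' s (Ψ x)) (hΨ : HasFDerivWithinAt Ψ Ψ' t x)
    (hm : ∀ᶠ y in 𝓝[t] x, Ψ y ∈ s) : HasFDerivWithinAt (fun y => c (Ψ y)) (c' ∘L Ψ') t x := by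
  rw [← hasFDerivWithinAt_inter' hm]
  rw [← hasFDerivWithinAt_inter' hm] at hΨ
  exact hc.comp x hΨ (fun y hy => hy.2)

/-- The derivative of a pulled back metric. -/
theorem fderivWithin_pull (ht : IsBody t) (hx : x ∈ t)
    (hG : DifferentiableWithinAt ℝ G s (Ψ x)) (hΨ : ContDiffWithinAt ℝ 2 Ψ t x)
    (hm : ∀ᶠ y in 𝓝[t] x, Ψ y ∈ s)
    (hp : ∀ᶠ y in 𝓝[t] x, γ y = pullBilin (fderivWithin ℝ Ψ t y) (G (Ψ y)))
    (hd : DifferentiableWithinAt ℝ γ t x) (a u v : W) :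
    fderivWithin ℝ γ t x a u v =
      fderivWithin ℝ G s (Ψ x) (fderivWithin ℝ Ψ t x a) (fderivWithin ℝ Ψ t x u)
        (fderivWithin ℝ Ψ t x v)
      + G (Ψ x) (fderivWithin ℝ (fderivWithin ℝ Ψ t) t x a u) (fderivWithin ℝ Ψ t x v)
      + G (Ψ x) (fderivWithin ℝ Ψ t x u) (fderivWithin ℝ (fderivWithin ℝ Ψ t) t x a v) := by
  have h1 : HasFDerivWithinAt Ψ (fderivWithin ℝ Ψ t x) t x :=
    (hΨ.differentiableWithinAt (by simp)).hasFDerivWithinAt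
  have h2 : HasFDerivWithinAt (fderivWithin ℝ Ψ t) (fderivWithin ℝ (fderivWithin ℝ Ψ t) t x) t x :=
    ((hΨ.fderivWithin_right (m := 1) ht.uniqueDiffOn (by norm_num) hx).differentiableWithinAt
      (by simp)).hasFDerivWithinAt
  have e1 := ((hasFDerivWithinAt_comp_eventually hG.hasFDerivWithinAt h1 hm).clm_apply
    (h2.apply_const u)).clm_apply (h2.apply_const v)
  have e2 := (hd.hasFDerivWithinAt.apply_const u).apply_const v
  have e3 := e2.congr_of_eventuallyEq
    (f₁ := fun y => G (Ψ y) (fderivWithin ℝ Ψ t y u) (fderivWithin ℝ Ψ t y v))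
    (hp.mono fun y hy => by simp only [hy, pullBilin_apply])
    (by simp only [hp.self_of_nhdsWithin hx, pullBilin_apply])
  have := DFunLike.congr_fun ((ht.uniqueDiffOn x hx).eq e3 e1) a
  simp at this
  linarith

/-- The first order transformation law: the Christoffel symbols of the first kind. -/
theorem koszulForm_pull (ht : IsBody t) (hx : x ∈ t) (hsymm : ∀ u v, G (Ψ x) u v = G (Ψ x) v u)
    (hG : DifferentiableWithinAt ℝ G s (Ψ x)) (hΨ : ContDiffWithinAt ℝ 2 Ψ t x)
    (hm : ∀ᶠ y in 𝓝[t] x, Ψ y ∈ s)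
    (hp : ∀ᶠ y in 𝓝[t] x, γ y = pullBilin (fderivWithin ℝ Ψ t y) (G (Ψ y)))
    (hd : DifferentiableWithinAt ℝ γ t x) (u v w : W) :
    koszulForm (fderivWithin ℝ γ t x) u v w =
      koszulForm (fderivWithin ℝ G s (Ψ x)) (fderivWithin ℝ Ψ t x u) (fderivWithin ℝ Ψ t x v)
        (fderivWithin ℝ Ψ t x w)
      + G (Ψ x) (fderivWithin ℝ (fderivWithin ℝ Ψ t) t x u v) (fderivWithin ℝ Ψ t x w) := by
  simp only [koszulForm_apply, fderivWithin_pull ht hx hG hΨ hm hp hd]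
  rw [ht.second_symm hx hΨ w u, ht.second_symm hx hΨ w v, ht.second_symm hx hΨ v u]
  rw [hsymm (fderivWithin ℝ Ψ t x u) (fderivWithin ℝ (fderivWithin ℝ Ψ t) t x v w),
    hsymm (fderivWithin ℝ Ψ t x v) (fderivWithin ℝ (fderivWithin ℝ Ψ t) t x u w)]
  ring

variable [FiniteDimensional ℝ V] [FiniteDimensional ℝ W]

/-- The covariant Hessian of an isometric map is normal to its image. -/
theorem IsIsometricAt.eventually_normal (ht : IsBody t)
    (h : IsIsometricAt s G t γ Ψ x) :
    ∀ᶠ y in 𝓝[t] x, ∀ u v w,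
      G (Ψ y) (covHessian s G t γ Ψ y u v) (fderivWithin ℝ Ψ t y w) = 0 := by
  filter_upwards [h.tendsto.eventually h.target.inner, h.source.inner,
    h.tendsto.eventually (eventually_contDiffWithinAt_two h.target.mem h.target.smooth),
    eventually_contDiffWithinAt_two h.source.mem h.source.smooth,
    eventually_contDiffWithinAt_two h.source.mem h.smooth, self_mem_nhdsWithin,
    eventually_eventually_nhdsWithin.2 h.mapsTo, eventually_eventually_nhdsWithin.2 h.pull]
    with y h1 h2 h3 h4 h5 h6 h7 h8 u v w
  have e := koszulForm_pull ht h6 h1.symm (h3.differentiableWithinAt (by simp)) h5 h7 h8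
    (h4.differentiableWithinAt (by simp)) u v w
  have hq : ∀ a b, γ y a b = G (Ψ y) (fderivWithin ℝ Ψ t y a) (fderivWithin ℝ Ψ t y b) := by
    intro a b; rw [h8.self_of_nhdsWithin h6]; rfl
  rw [← h2.apply_connectionOf, ← h1.apply_connectionOf, hq] at e
  unfold covHessian connection
  simp only [map_add, map_sub, add_apply, sub_apply]
  linarith

/-- The derivative of the covariant Hessian in the direction `z`. -/
theorem IsIsometricAt.hasFDerivWithinAt_covHessian (hs : IsBody s) (ht : IsBody t)
    (h : IsIsometricAt s G t γ Ψ x) (u v : W) :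
    ∃ S' : W →L[ℝ] V, HasFDerivWithinAt (fun y => covHessian s G t γ Ψ y u v) S' t x ∧ ∀ z,
      S' z = fderivWithin ℝ (connection s G) s (Ψ x) (fderivWithin ℝ Ψ t x z)
          (fderivWithin ℝ Ψ t x u) (fderivWithin ℝ Ψ t x v)
        + connection s G (Ψ x) (fderivWithin ℝ (fderivWithin ℝ Ψ t) t x z u)
          (fderivWithin ℝ Ψ t x v)
        + connection s G (Ψ x) (fderivWithin ℝ Ψ t x u)
          (fderivWithin ℝ (fderivWithin ℝ Ψ t) t x z v)
        + fderivWithin ℝ (fderivWithin ℝ (fderivWithin ℝ Ψ t) t) t x z u v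
        - fderivWithin ℝ (fderivWithin ℝ Ψ t) t x z (connection t γ x u v)
        - fderivWithin ℝ Ψ t x (fderivWithin ℝ (connection t γ) t x z u v) := by
  have hx := h.source.mem
  have hΨ := (h.smooth.differentiableWithinAt (by simp)).hasFDerivWithinAt
  have c1 := contDiffWithinAt_fderivWithin ht hx h.smooth
  have hJ := (c1.differentiableWithinAt (by simp)).hasFDerivWithinAt
  have hH := ((contDiffWithinAt_fderivWithin ht hx c1).differentiableWithinAt
    (by simp)).hasFDerivWithinAt
  have hB := ((h.target.contDiffWithinAt_connection hs).differentiableWithinAt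
    (by simp)).hasFDerivWithinAt
  have hb := ((h.source.contDiffWithinAt_connection ht).differentiableWithinAt
    (by simp)).hasFDerivWithinAt
  refine ⟨_, ((((hasFDerivWithinAt_comp_eventually hB hΨ h.mapsTo).clm_apply
    (hJ.apply_const u)).clm_apply (hJ.apply_const v)).add ((hH.apply_const u).apply_const v)).sub
      (hJ.clm_apply ((hb.apply_const u).apply_const v)), fun z => ?_⟩
  simp
  abel

/-- The covariant derivative along `Ψ`, in the direction `z`, of the vector field `covHessian u v`
with constant `u` and `v`. -/
def covHessianDeriv (s : Set V) (G : V → Bilin V) (t : Set W) (γ : W → Bilin W) (Ψ : W → V) (x : W)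
    (z u v : W) : V :=
  fderivWithin ℝ (fun y => covHessian s G t γ Ψ y u v) t x z
    + connection s G (Ψ x) (fderivWithin ℝ Ψ t x z) (covHessian s G t γ Ψ x u v)

/-- The Gauss and Codazzi equations in one: the curvature operator of the target, on vectors
tangent to the image of `Ψ`. -/
theorem IsIsometricAt.curvature_vector (hs : IsBody s) (ht : IsBody t)
    (h : IsIsometricAt s G t γ Ψ x) (u v w : W) (Z : V) :
    curvature s G (Ψ x) (fderivWithin ℝ Ψ t x u) (fderivWithin ℝ Ψ t x v) (fderivWithin ℝ Ψ t x w) Z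
      = G (Ψ x) (fderivWithin ℝ Ψ t x (fderivWithin ℝ (connection t γ) t x v u w
          - fderivWithin ℝ (connection t γ) t x u v w
          + connection t γ x v (connection t γ x u w)
          - connection t γ x u (connection t γ x v w))) Z
        + G (Ψ x) (covHessianDeriv s G t γ Ψ x v u w
            + covHessian s G t γ Ψ x v (connection t γ x u w)) Z
        - G (Ψ x) (covHessianDeriv s G t γ Ψ x u v w
            + covHessian s G t γ Ψ x u (connection t γ x v w)) Z := by
  have hx := h.source.mem
  obtain ⟨S1, hS1, e1⟩ := h.hasFDerivWithinAt_covHessian hs ht u w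
  obtain ⟨S2, hS2, e2⟩ := h.hasFDerivWithinAt_covHessian hs ht v w
  have hu := ht.uniqueDiffOn x hx
  rw [h.target.curvature_eq hs]
  unfold covHessianDeriv
  rw [hS1.fderivWithin hu, hS2.fderivWithin hu, e1, e2]
  have s2 := ht.second_symm hx (h.smooth.of_le two_le_infty) u v
  have s3 := ht.second_symm hx
    ((contDiffWithinAt_fderivWithin ht hx h.smooth).of_le two_le_infty) u v
  simp only [covHessian, map_add, map_sub, add_apply, sub_apply, s2, s3]
  ring

/-- The Gauss equation. -/
theorem IsIsometricAt.gauss (hs : IsBody s) (ht : IsBody t)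
    (h : IsIsometricAt s G t γ Ψ x) (u v w z : W) :
    curvature s G (Ψ x) (fderivWithin ℝ Ψ t x u) (fderivWithin ℝ Ψ t x v) (fderivWithin ℝ Ψ t x w)
        (fderivWithin ℝ Ψ t x z)
      = curvature t γ x u v w z
        - G (Ψ x) (covHessian s G t γ Ψ x u w) (covHessian s G t γ Ψ x v z)
        + G (Ψ x) (covHessian s G t γ Ψ x v w) (covHessian s G t γ Ψ x u z) := by
  have hx := h.source.mem
  have hu := ht.uniqueDiffOn x hx
  have hn := h.eventually_normal ht
  have hn0 := hn.self_of_nhdsWithin hx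
  have hΨ := (h.smooth.differentiableWithinAt (by simp)).hasFDerivWithinAt
  have hJ := ((contDiffWithinAt_fderivWithin ht hx h.smooth).differentiableWithinAt
    (by simp)).hasFDerivWithinAt
  -- differentiate the orthogonality of the covariant Hessian and the tangent vectors
  have key : ∀ v u w, G (Ψ x) (covHessianDeriv s G t γ Ψ x v u w) (fderivWithin ℝ Ψ t x z)
      = - G (Ψ x) (covHessian s G t γ Ψ x u w) (covHessian s G t γ Ψ x v z) := by
    intro v u w
    obtain ⟨S1, hS1, -⟩ := h.hasFDerivWithinAt_covHessian hs ht u w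
    have e1 := ((hasFDerivWithinAt_comp_eventually
      h.target.differentiableWithinAt.hasFDerivWithinAt hΨ h.mapsTo).clm_apply hS1).clm_apply
        (hJ.apply_const z)
    have e2 : HasFDerivWithinAt (fun y => G (Ψ y) (covHessian s G t γ Ψ y u w)
        (fderivWithin ℝ Ψ t y z)) (0 : W →L[ℝ] ℝ) t x := (hasFDerivWithinAt_const (0 : ℝ) x t).congr_of_eventuallyEq
      (hn.mono fun y hy => hy u w z) (hn0 u w z)
    have e3 := DFunLike.congr_fun (hu.eq e1 e2) v
    simp [h.target.deriv_eq hs] at e3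
    rw [covHessianDeriv, hS1.fderivWithin hu]
    have e4 := hn0 u w (connection t γ x v z)
    conv_rhs => rw [covHessian.eq_1 s G t γ Ψ x v z]
    simp only [map_add, map_sub, add_apply]
    linarith
  have hq : ∀ a b, γ x a b = G (Ψ x) (fderivWithin ℝ Ψ t x a) (fderivWithin ℝ Ψ t x b) := by
    intro a b; rw [h.pull.self_of_nhdsWithin hx]; rfl
  rw [h.curvature_vector hs ht, h.source.curvature_eq ht, hq]
  simp only [map_add (G (Ψ x)), add_apply, key, hn0]
  ring

/-- The Codazzi equation for a hypersurface with unit normal field `N` and scalar second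
fundamental form `II`. -/
theorem IsIsometricAt.codazzi (hs : IsBody s) (ht : IsBody t)
    (h : IsIsometricAt s G t γ Ψ x) {N : W → V} (hN : DifferentiableWithinAt ℝ N t x)
    (hunit : ∀ᶠ y in 𝓝[t] x, G (Ψ y) (N y) (N y) = 1)
    (hz : ∀ a, G (Ψ x) (fderivWithin ℝ Ψ t x a) (N x) = 0) {II : W → W → W → ℝ}
    (hII : ∀ᶠ y in 𝓝[t] x, ∀ u v, covHessian s G t γ Ψ y u v = II y u v • N y) (u v w : W) :
    curvature s G (Ψ x) (fderivWithin ℝ Ψ t x u) (fderivWithin ℝ Ψ t x v) (fderivWithin ℝ Ψ t x w)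
        (N x)
      = fderivWithin ℝ (fun y => II y u w) t x v + II x v (connection t γ x u w)
        - (fderivWithin ℝ (fun y => II y v w) t x u + II x u (connection t γ x v w)) := by
  have hx := h.source.mem
  have hu := ht.uniqueDiffOn x hx
  have hII0 := hII.self_of_nhdsWithin hx
  have hunit0 := hunit.self_of_nhdsWithin hx
  have hsymm := h.target.isInner.symm
  have hΨ := (h.smooth.differentiableWithinAt (by simp)).hasFDerivWithinAt
  have hG := hasFDerivWithinAt_comp_eventually
    h.target.differentiableWithinAt.hasFDerivWithinAt hΨ h.mapsTo
  -- the derivative of the unit normal field is orthogonal to it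
  have hNN : ∀ v, G (Ψ x) (N x) (connection s G (Ψ x) (fderivWithin ℝ Ψ t x v) (N x)
      + fderivWithin ℝ N t x v) = 0 := by
    intro v
    have e1 := (hG.clm_apply hN.hasFDerivWithinAt).clm_apply hN.hasFDerivWithinAt
    have e2 : HasFDerivWithinAt (fun y => G (Ψ y) (N y) (N y)) (0 : W →L[ℝ] ℝ) t x :=
      (hasFDerivWithinAt_const (1 : ℝ) x t).congr_of_eventuallyEq hunit hunit0
    have e3 := DFunLike.congr_fun (hu.eq e1 e2) v
    simp [h.target.deriv_eq hs] at e3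
    have e4 := hsymm (connection s G (Ψ x) (fderivWithin ℝ Ψ t x v) (N x)) (N x)
    have e5 := hsymm (fderivWithin ℝ N t x v) (N x)
    rw [map_add]
    linarith
  have key : ∀ v u w, G (Ψ x) (covHessianDeriv s G t γ Ψ x v u w) (N x)
      = fderivWithin ℝ (fun y => II y u w) t x v := by
    intro v u w
    obtain ⟨S1, hS1, -⟩ := h.hasFDerivWithinAt_covHessian hs ht u w
    have e1 := (hG.clm_apply hS1).clm_apply hN.hasFDerivWithinAt
    have hc : (fun y => II y u w) =ᶠ[𝓝[t] x]
        fun y => G (Ψ y) (covHessian s G t γ Ψ y u w) (N y) := by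
      filter_upwards [hunit, hII] with y h1 h2
      simp [h2, h1]
    rw [(e1.congr_of_eventuallyEq hc (hc.self_of_nhdsWithin hx)).fderivWithin hu, covHessianDeriv,
      hS1.fderivWithin hu]
    have e3 := hNN v
    simp [h.target.deriv_eq hs, hII0] at e3 ⊢
    linear_combination (-II x u w) * e3
  rw [h.curvature_vector hs ht, hz]
  simp only [map_add (G (Ψ x)), add_apply, key, hII0]
  simp [hunit0]

end GaussCodazzi

/-! ### Quadratic forms on two-vectors -/

section Bivectors

variable {ι : Type*}

/-- The symmetries of a curvature tensor. -/
structure IsCurvatureLike (T : ι → ι → ι → ι → ℝ) : Prop where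
  antisymm : ∀ i j k l, T i j k l = - T j i k l
  antisymm' : ∀ i j k l, T i j k l = - T i j l k
  pair : ∀ i j k l, T i j k l = T k l i j

theorem IsCurvatureLike.self_right {T : ι → ι → ι → ι → ℝ} (hT : IsCurvatureLike T) (i j k : ι) :
    T i j k k = 0 := by linarith [hT.antisymm' i j k k]

variable [Fintype ι]

/-- The quadratic form `¼ T_{ijkl} α^{ij} α^{kl}` on two-vectors defined by a tensor `T`. -/
def quadForm (T : ι → ι → ι → ι → ℝ) (α : Matrix ι ι ℝ) : ℝ :=
  (1 / 4) * ∑ i, ∑ j, ∑ k, ∑ l, T i j k l * α i j * α k l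

/-- The inner product on two-vectors induced by a bilinear form, as a tensor with four indices. -/
def bivectorTensor (g : Matrix ι ι ℝ) (i j k l : ι) : ℝ := g i k * g j l - g j k * g i l

theorem quadForm_add (T T' : ι → ι → ι → ι → ℝ) (α : Matrix ι ι ℝ) :
    quadForm (fun i j k l => T i j k l + T' i j k l) α = quadForm T α + quadForm T' α := by
  simp only [quadForm, add_mul, Finset.sum_add_distrib, mul_add]

theorem quadForm_const_mul (c : ℝ) (T : ι → ι → ι → ι → ℝ) (α : Matrix ι ι ℝ) :
    quadForm (fun i j k l => c * T i j k l) α = c * quadForm T α := by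
  simp only [quadForm, mul_assoc, ← Finset.mul_sum]
  ring

theorem quadForm_smul (c : ℝ) (T : ι → ι → ι → ι → ℝ) (α : Matrix ι ι ℝ) :
    quadForm T (c • α) = c ^ 2 * quadForm T α := by
  simp only [quadForm, Matrix.smul_apply, smul_eq_mul, Finset.mul_sum]
  refine Finset.sum_congr rfl fun i _ => Finset.sum_congr rfl fun j _ =>
    Finset.sum_congr rfl fun k _ => Finset.sum_congr rfl fun l _ => by ring

/-- On antisymmetric matrices the inner product on two-vectors is half the tensor square of `g`,
from which it inherits its positivity. -/
theorem quadForm_bivectorTensor [DecidableEq ι] (g : Matrix ι ι ℝ) {α : Matrix ι ι ℝ}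
    (hα : α.transpose = -α) :
    quadForm (bivectorTensor g) α = (1 / 2) * (star (fun p : ι × ι => α p.1 p.2) ⬝ᵥ
      (Matrix.kroneckerMap (· * ·) g g).mulVec (fun p : ι × ι => α p.1 p.2)) := by
  have h : ∀ i j, α j i = - α i j := fun i j => congrFun (congrFun hα i) j
  have e1 : ∑ i, ∑ j, ∑ k, ∑ l, g j k * g i l * α i j * α k l
      = - ∑ i, ∑ j, ∑ k, ∑ l, g i k * g j l * α i j * α k l := by
    rw [Finset.sum_comm]
    simp only [← Finset.sum_neg_distrib]
    refine Finset.sum_congr rfl fun i _ => Finset.sum_congr rfl fun j _ =>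
      Finset.sum_congr rfl fun k _ => Finset.sum_congr rfl fun l _ => ?_
    rw [h i j]; ring
  have e2 : star (fun p : ι × ι => α p.1 p.2) ⬝ᵥ
      (Matrix.kroneckerMap (· * ·) g g).mulVec (fun p : ι × ι => α p.1 p.2)
      = ∑ i, ∑ j, ∑ k, ∑ l, g i k * g j l * α i j * α k l := by
    simp only [dotProduct, Matrix.mulVec, Fintype.sum_prod_type, Matrix.kroneckerMap_apply,
      Pi.star_apply, star_trivial, Finset.mul_sum]
    refine Finset.sum_congr rfl fun i _ => Finset.sum_congr rfl fun j _ =>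
      Finset.sum_congr rfl fun k _ => Finset.sum_congr rfl fun l _ => by ring
  rw [e2]
  simp only [quadForm, bivectorTensor, sub_mul, Finset.sum_sub_distrib, e1]
  ring

theorem quadForm_bivectorTensor_nonneg {g : Matrix ι ι ℝ} (hg : g.PosSemidef) {α : Matrix ι ι ℝ}
    (hα : α.transpose = -α) : 0 ≤ quadForm (bivectorTensor g) α := by
  classical
  rw [quadForm_bivectorTensor g hα]
  exact mul_nonneg (by norm_num) ((hg.kronecker hg).dotProduct_mulVec_nonneg _)

theorem quadForm_bivectorTensor_pos {g : Matrix ι ι ℝ} (hg : g.PosDef) {α : Matrix ι ι ℝ}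
    (hα : α.transpose = -α) (h0 : α ≠ 0) : 0 < quadForm (bivectorTensor g) α := by
  classical
  rw [quadForm_bivectorTensor g hα]
  refine mul_pos (by norm_num) ((hg.kronecker hg).dotProduct_mulVec_pos fun h => h0 ?_)
  ext i j
  exact congrFun h (i, j)

/-- The part `N ∧ w` of a two-vector which involves the first vector `N` of the frame. -/
def mixedPart {m : ℕ} (α : Matrix (Fin (m + 1)) (Fin (m + 1)) ℝ) :
    Matrix (Fin (m + 1)) (Fin (m + 1)) ℝ :=
  fun i j => if i = 0 ∨ j = 0 then α i j else 0

theorem mixedPart_transpose {m : ℕ} {α : Matrix (Fin (m + 1)) (Fin (m + 1)) ℝ}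
    (hα : α.transpose = -α) : (mixedPart α).transpose = - mixedPart α := by
  ext i j
  have := congrFun (congrFun hα i) j
  simp only [Matrix.transpose_apply, Matrix.neg_apply] at this ⊢
  unfold mixedPart
  by_cases h : i = 0 ∨ j = 0
  · rw [if_pos h, if_pos h.symm, this]
  · rw [if_neg h, if_neg (fun h' => h h'.symm), neg_zero]

/-- If the tangential part of a curvature-like tensor is a nonnegative multiple of `l ∧ l` with
`l` positive semidefinite, and the components with exactly one normal index vanish, then only the
mixed part of a two-vector can contribute negatively. -/
theorem quadForm_mixedPart_le {m : ℕ} {T : Fin (m + 1) → Fin (m + 1) → Fin (m + 1) → Fin (m + 1) → ℝ}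
    (hT : IsCurvatureLike T) {c : ℝ} (hc : 0 ≤ c) {l : Matrix (Fin m) (Fin m) ℝ}
    (hl : l.PosSemidef)
    (htan : ∀ a b d e : Fin m, T a.succ b.succ d.succ e.succ = c * bivectorTensor l a b d e)
    (hmix : ∀ a b d : Fin m, T a.succ b.succ d.succ 0 = 0)
    {α : Matrix (Fin (m + 1)) (Fin (m + 1)) ℝ} (hα : α.transpose = -α) :
    quadForm T (mixedPart α) ≤ quadForm T α := by
  set β : Matrix (Fin (m + 1)) (Fin (m + 1)) ℝ := α - mixedPart α with hβ
  have hβ0 : ∀ i j, i = 0 ∨ j = 0 → β i j = 0 := by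
    intro i j h; simp [hβ, mixedPart, h]
  have hγ0 : ∀ a b : Fin m, mixedPart α a.succ b.succ = 0 := by
    intro a b; simp [mixedPart]
  -- the tangential and the mixed part are orthogonal for `T`
  have hcross : ∀ i j k l, T i j k l * β i j * mixedPart α k l = 0 := by
    intro i j k l
    rcases Fin.eq_zero_or_eq_succ i with rfl | ⟨a, rfl⟩
    · rw [hβ0 0 j (Or.inl rfl)]; ring
    rcases Fin.eq_zero_or_eq_succ j with rfl | ⟨b, rfl⟩
    · rw [hβ0 _ 0 (Or.inr rfl)]; ring
    rcases Fin.eq_zero_or_eq_succ k with rfl | ⟨d, rfl⟩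
    · rcases Fin.eq_zero_or_eq_succ l with rfl | ⟨e, rfl⟩
      · rw [hT.self_right]; ring
      · rw [hT.antisymm', hmix]; ring
    · rcases Fin.eq_zero_or_eq_succ l with rfl | ⟨e, rfl⟩
      · rw [hmix]; ring
      · rw [hγ0]; ring
  have hcross' : ∀ i j k l, T i j k l * mixedPart α i j * β k l = 0 := by
    intro i j k l
    rw [hT.pair]
    linarith [hcross k l i j]
  have e : quadForm T α = quadForm T β + quadForm T (mixedPart α) := by
    have : ∀ i j k l, T i j k l * α i j * α k l
        = T i j k l * β i j * β k l + T i j k l * mixedPart α i j * mixedPart α k l := by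
      intro i j k l
      have e1 : ∀ i j, α i j = β i j + mixedPart α i j := by intro i j; simp [hβ]
      rw [e1 i j, e1 k l]
      linarith [hcross i j k l, hcross' i j k l]
    simp only [quadForm, this, Finset.sum_add_distrib, mul_add]
  have hβt : quadForm T β = c * quadForm (bivectorTensor l) (α.submatrix Fin.succ Fin.succ) := by
    rw [← quadForm_const_mul]
    unfold quadForm
    simp only [Fin.sum_univ_succ, hβ0 _ _ (Or.inl rfl), hβ0 _ _ (Or.inr rfl), mul_zero, zero_mul,
      Finset.sum_const_zero, zero_add]
    have e2 : ∀ a b : Fin m, β a.succ b.succ = α a.succ b.succ := by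
      intro a b; simp [hβ, mixedPart]
    simp only [htan, e2, Matrix.submatrix_apply]
  have := quadForm_bivectorTensor_nonneg hl (α := α.submatrix Fin.succ Fin.succ) (by
    ext a b; exact congrFun (congrFun hα a.succ) b.succ)
  rw [e, hβt]
  nlinarith

end Bivectors

section Frames

variable {V : Type*} [NormedAddCommGroup V] [NormedSpace ℝ V] {ι κ : Type*} [Fintype ι] [Fintype κ]

/-- A function of four vectors, linear in each of them. -/
structure IsQuadrilinear (T : V → V → V → V → ℝ) : Prop where
  map1 : ∀ v w z, IsLinearMap ℝ (fun u => T u v w z)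
  map2 : ∀ u w z, IsLinearMap ℝ (fun v => T u v w z)
  map3 : ∀ u v z, IsLinearMap ℝ (fun w => T u v w z)
  map4 : ∀ u v w, IsLinearMap ℝ (fun z => T u v w z)

theorem isLinearMap_sum_smul {f : V → ℝ} (hf : IsLinearMap ℝ f) (c : ι → ℝ) (e : ι → V) :
    f (∑ i, c i • e i) = ∑ i, c i * f (e i) := by
  have : f = hf.mk' f := rfl
  rw [this, map_sum]
  simp

theorem bilinear_frame {f : V → V → ℝ} (h1 : ∀ v, IsLinearMap ℝ (fun u => f u v))
    (h2 : ∀ u, IsLinearMap ℝ (f u)) {e : ι → V} {e' : κ → V} {J : Matrix ι κ ℝ}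
    (he : ∀ j, e' j = ∑ i, J i j • e i) (α : Matrix κ κ ℝ) :
    ∑ i, ∑ j, f (e' i) (e' j) * α i j
      = ∑ a, ∑ b, f (e a) (e b) * (J * α * J.transpose) a b := by
  have e1 : ∀ i j, f (e' i) (e' j) = ∑ a, ∑ b, J a i * J b j * f (e a) (e b) := by
    intro i j
    rw [he i, isLinearMap_sum_smul (h1 _)]
    refine Finset.sum_congr rfl fun a _ => ?_
    rw [he j, isLinearMap_sum_smul (h2 _), Finset.mul_sum]
    exact Finset.sum_congr rfl fun b _ => by ring
  have e2 : ∀ a b, (J * α * J.transpose) a b = ∑ i, ∑ j, J a i * α i j * J b j := by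
    intro a b
    simp only [Matrix.mul_apply, Matrix.transpose_apply, Finset.sum_mul]
    exact Finset.sum_comm
  simp only [e1, e2, Finset.sum_mul, Finset.mul_sum]
  calc _ = ∑ i, ∑ a, ∑ j, ∑ b, J a i * J b j * f (e a) (e b) * α i j :=
        Finset.sum_congr rfl fun i _ => Finset.sum_comm
    _ = ∑ a, ∑ i, ∑ j, ∑ b, J a i * J b j * f (e a) (e b) * α i j := Finset.sum_comm
    _ = ∑ a, ∑ i, ∑ b, ∑ j, J a i * J b j * f (e a) (e b) * α i j :=
        Finset.sum_congr rfl fun a _ => Finset.sum_congr rfl fun i _ => Finset.sum_comm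
    _ = ∑ a, ∑ b, ∑ i, ∑ j, J a i * J b j * f (e a) (e b) * α i j :=
        Finset.sum_congr rfl fun a _ => Finset.sum_comm
    _ = _ := by
        refine Finset.sum_congr rfl fun a _ => Finset.sum_congr rfl fun b _ =>
          Finset.sum_congr rfl fun i _ => Finset.sum_congr rfl fun j _ => by ring

/-- The quadratic form of a tensor with respect to a frame `e`. -/
def frameForm (T : V → V → V → V → ℝ) (e : ι → V) (α : Matrix ι ι ℝ) : ℝ :=
  quadForm (fun i j k l => T (e i) (e j) (e k) (e l)) α

theorem IsQuadrilinear.frameForm_change {T : V → V → V → V → ℝ} (hT : IsQuadrilinear T)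
    {e : ι → V} {e' : κ → V} {J : Matrix ι κ ℝ} (he : ∀ j, e' j = ∑ i, J i j • e i)
    (α : Matrix κ κ ℝ) : frameForm T e' α = frameForm T e (J * α * J.transpose) := by
  unfold frameForm quadForm
  congr 1
  have e1 : ∀ u v, ∑ k, ∑ l, T u v (e' k) (e' l) * α k l
      = ∑ c, ∑ d, T u v (e c) (e d) * (J * α * J.transpose) c d := fun u v =>
    bilinear_frame (f := T u v) (fun w => hT.map3 u v w) (fun w => hT.map4 u v w) he α
  have e2 := bilinear_frame (f := fun u v => ∑ c, ∑ d, T u v (e c) (e d)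
    * (J * α * J.transpose) c d) (fun v => ?_) (fun u => ?_) he α
  · calc _ = ∑ i, ∑ j, (∑ k, ∑ l, T (e' i) (e' j) (e' k) (e' l) * α k l) * α i j := by
          simp only [Finset.sum_mul]
          refine Finset.sum_congr rfl fun i _ => Finset.sum_congr rfl fun j _ =>
            Finset.sum_congr rfl fun k _ => Finset.sum_congr rfl fun l _ => by ring
      _ = ∑ a, ∑ b, (∑ c, ∑ d, T (e a) (e b) (e c) (e d) * (J * α * J.transpose) c d)
            * (J * α * J.transpose) a b := by
          simp only [e1]
          exact e2
      _ = _ := by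
          simp only [Finset.sum_mul]
          refine Finset.sum_congr rfl fun i _ => Finset.sum_congr rfl fun j _ =>
            Finset.sum_congr rfl fun k _ => Finset.sum_congr rfl fun l _ => by ring
  · constructor
    · intro x y
      simp only [(hT.map1 v _ _).map_add, add_mul, Finset.sum_add_distrib]
    · intro c x
      simp only [(hT.map1 v _ _).map_smul, smul_eq_mul, mul_assoc, Finset.mul_sum]
  · constructor
    · intro x y
      simp only [(hT.map2 u _ _).map_add, add_mul, Finset.sum_add_distrib]
    · intro c x
      simp only [(hT.map2 u _ _).map_smul, smul_eq_mul, mul_assoc, Finset.mul_sum]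

/-- The inner product on two-vectors, as a function of four vectors. -/
def bivec (G : Bilin V) (u v w z : V) : ℝ := G u w * G v z - G v w * G u z

theorem isQuadrilinear_bivec (G : Bilin V) : IsQuadrilinear (bivec G) := by
  refine ⟨fun v w z => ⟨?_, ?_⟩, fun v w z => ⟨?_, ?_⟩, fun v w z => ⟨?_, ?_⟩,
    fun v w z => ⟨?_, ?_⟩⟩ <;> intros <;> simp [bivec] <;> ring

theorem isQuadrilinear_curvatureOf (G : Bilin V) (D : V →L[ℝ] Bilin V)
    (H : V →L[ℝ] V →L[ℝ] Bilin V) : IsQuadrilinear (curvatureOf G D H) := by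
  refine ⟨fun v w z => ⟨?_, ?_⟩, fun v w z => ⟨?_, ?_⟩, fun v w z => ⟨?_, ?_⟩,
    fun v w z => ⟨?_, ?_⟩⟩ <;> intros <;> simp [curvatureOf] <;> ring

theorem isQuadrilinear_curvature (s : Set V) (G : V → Bilin V) (x : V) :
    IsQuadrilinear (curvature s G x) := isQuadrilinear_curvatureOf _ _ _

/-- The Gram matrix of a bilinear form in a frame. -/
def gram (G : Bilin V) (e : ι → V) : Matrix ι ι ℝ := fun i j => G (e i) (e j)

theorem frameForm_bivec (G : Bilin V) (e : ι → V) (α : Matrix ι ι ℝ) :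
    frameForm (bivec G) e α = quadForm (bivectorTensor (gram G e)) α := rfl

theorem gram_quadratic (G : Bilin V) (e : ι → V) (x : ι → ℝ) :
    star x ⬝ᵥ (gram G e).mulVec x = G (∑ i, x i • e i) (∑ i, x i • e i) := by
  simp only [map_sum, map_smul, sum_apply, smul_apply,
    dotProduct, Matrix.mulVec, gram, Pi.star_apply, star_trivial, smul_eq_mul, Finset.mul_sum]
  refine (Finset.sum_comm).trans (Finset.sum_congr rfl fun i _ => Finset.sum_congr rfl fun j _ => ?_)
  ring

theorem gram_posSemidef {G : Bilin V} (hs : ∀ u v, G u v = G v u) (hG : ∀ u, 0 ≤ G u u)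
    (e : ι → V) : (gram G e).PosSemidef :=
  .of_dotProduct_mulVec_nonneg (by ext i j; simp [gram, hs (e j)])
    fun x => by rw [gram_quadratic]; exact hG _

theorem IsInner.gram_posDef {G : Bilin V} (hG : IsInner G) {e : ι → V}
    (he : LinearIndependent ℝ e) : (gram G e).PosDef :=
  .of_dotProduct_mulVec_pos (by ext i j; simp [gram, hG.symm (e j)])
    fun x hx => by
      rw [gram_quadratic]
      refine hG.pos _ fun h => hx ?_
      ext i
      exact (Fintype.linearIndependent_iff.1 he) x h i

end Frames

/-! ### Tensor fields in charts -/

section Charts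

variable {n : ℕ} [NeZero n] {M : Type*} [TopologicalSpace M]
  [ChartedSpace (EuclideanHalfSpace n) M]

/-- The closed half-space `{x | 0 ≤ x 0}`, the model of a manifold with boundary. -/
abbrev halfSpace (n : ℕ) [NeZero n] : Set (EuclideanSpace ℝ (Fin n)) := range (𝓡∂ n)

theorem mem_halfSpace {x : EuclideanSpace ℝ (Fin n)} : x ∈ halfSpace n ↔ 0 ≤ x 0 := by
  rw [halfSpace, range_modelWithCornersEuclideanHalfSpace]; rfl

theorem isBody_halfSpace : IsBody (halfSpace n) :=
  ⟨(𝓡∂ n).convex_range, (𝓡∂ n).nonempty_interior⟩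

/-- The derivative of the inverse of the chart at `p`, whose columns are the coordinate vector
fields. -/
def chartFrame (p : M) (x : EuclideanSpace ℝ (Fin n)) :
    EuclideanSpace ℝ (Fin n) →L[ℝ] EuclideanSpace ℝ (Fin n) :=
  mfderivWithin 𝓘(ℝ, EuclideanSpace ℝ (Fin n)) (𝓡∂ n) (extChartAt (𝓡∂ n) p).symm
    (range (𝓡∂ n)) x

/-- The value of a tensor field at a point, as a bilinear form on the model space. -/
def tensorAt (h : TensorField n M) (p : M) : Bilin (EuclideanSpace ℝ (Fin n)) := h p

/-- The tensor field `h` in the coordinates of the chart at `p`. -/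
def inChart (h : TensorField n M) (p : M) (x : EuclideanSpace ℝ (Fin n)) :
    Bilin (EuclideanSpace ℝ (Fin n)) :=
  pullBilin (chartFrame p x) (tensorAt h ((extChartAt (𝓡∂ n) p).symm x))

theorem coeff_eq (h : TensorField n M) (p : M) (i j : Fin n) (x : EuclideanSpace ℝ (Fin n)) :
    coeff h p i j x = inChart h p x (stdVec i) (stdVec j) := rfl

/-- The change of coordinates from the chart at `p` to the chart at `q`. -/
def transition (p q : M) : EuclideanSpace ℝ (Fin n) → EuclideanSpace ℝ (Fin n) :=
  extChartAt (𝓡∂ n) q ∘ (extChartAt (𝓡∂ n) p).symm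

theorem transition_mem (p q : M) (x : EuclideanSpace ℝ (Fin n)) :
    transition p q x ∈ halfSpace n := ⟨_, rfl⟩

/-- A property which holds for points near `p'` holds near its image in a chart. -/
theorem eventually_chart {p p' : M} (hp : p' ∈ (extChartAt (𝓡∂ n) p).source) {P : M → Prop}
    (h : ∀ᶠ r in 𝓝 p', P r) : ∀ᶠ x in 𝓝[halfSpace n] (extChartAt (𝓡∂ n) p p'),
      x ∈ (extChartAt (𝓡∂ n) p).target ∧ P ((extChartAt (𝓡∂ n) p).symm x) := by
  refine Filter.Eventually.and (extChartAt_target_mem_nhdsWithin' hp) ?_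
  have := (continuousAt_extChartAt_symm' (I := 𝓡∂ n) hp).continuousWithinAt (s := halfSpace n)
  rw [ContinuousWithinAt, (extChartAt (𝓡∂ n) p).left_inv hp] at this
  exact this.eventually h

variable [IsManifold (𝓡∂ n) ∞ M]

theorem isManifold_one : IsManifold (𝓡∂ n) 1 M :=
  IsManifold.of_le (n := ∞) (by exact_mod_cast (le_top : (1 : ℕ∞) ≤ ⊤))

theorem chartFrame_eq {p p' : M} (hp : p' ∈ (extChartAt (𝓡∂ n) p).source) :
    chartFrame p (extChartAt (𝓡∂ n) p p') = tangentCoordChange (𝓡∂ n) p p' p' := by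
  have := isManifold_one (n := n) (M := M)
  rw [extChartAt_source] at hp
  have h1 := TangentBundle.symmL_trivializationAt (I := 𝓡∂ n) hp
  have h2 := TangentBundle.symmL_trivializationAt_eq_core (I := 𝓡∂ n) hp
  exact h1.symm.trans h2

theorem fderivWithin_transition {p q p' : M} :
    fderivWithin ℝ (transition (n := n) p q) (halfSpace n) (extChartAt (𝓡∂ n) p p')
      = tangentCoordChange (𝓡∂ n) p q p' := rfl

theorem chartFrame_self (p : M) :
    chartFrame p (extChartAt (𝓡∂ n) p p) = ContinuousLinearMap.id ℝ (EuclideanSpace ℝ (Fin n)) := by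
  rw [chartFrame_eq (mem_extChartAt_source p)]
  ext1 v
  exact tangentCoordChange_self (mem_extChartAt_source p)

theorem inChart_self (h : TensorField n M) (p : M) :
    inChart h p (extChartAt (𝓡∂ n) p p) = tensorAt h p := by
  rw [inChart, chartFrame_self, extChartAt_to_inv]
  ext u v; rfl

/-- The transformation law of tensor fields under a change of coordinates. -/
theorem inChart_transition (h : TensorField n M) {p q p' : M}
    (hp : p' ∈ (extChartAt (𝓡∂ n) p).source) (hq : p' ∈ (extChartAt (𝓡∂ n) q).source) :
    inChart h p (extChartAt (𝓡∂ n) p p') = pullBilin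
      (fderivWithin ℝ (transition p q) (halfSpace n) (extChartAt (𝓡∂ n) p p'))
      (inChart h q (extChartAt (𝓡∂ n) q p')) := by
  have := isManifold_one (n := n) (M := M)
  rw [inChart, inChart, chartFrame_eq hp, chartFrame_eq hq, fderivWithin_transition,
    (extChartAt (𝓡∂ n) p).left_inv hp, (extChartAt (𝓡∂ n) q).left_inv hq]
  ext u v
  simp only [pullBilin_apply]
  have e : ∀ v, tangentCoordChange (𝓡∂ n) p p' p' v = tangentCoordChange (𝓡∂ n) q p' p'
      (tangentCoordChange (𝓡∂ n) p q p' v) := fun v =>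
    (tangentCoordChange_comp ⟨⟨hp, hq⟩, mem_extChartAt_source p'⟩).symm
  rw [e u, e v]

theorem tangentCoordChange_bijective {p q p' : M}
    (hp : p' ∈ (extChartAt (𝓡∂ n) p).source) (hq : p' ∈ (extChartAt (𝓡∂ n) q).source) :
    Function.Bijective (tangentCoordChange (𝓡∂ n) p q p') := by
  have := isManifold_one (n := n) (M := M)
  have key : ∀ p q : M, p' ∈ (extChartAt (𝓡∂ n) p).source → p' ∈ (extChartAt (𝓡∂ n) q).source →
      ∀ v, tangentCoordChange (𝓡∂ n) q p p' (tangentCoordChange (𝓡∂ n) p q p' v) = v := by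
    intro p q hp hq v
    rw [tangentCoordChange_comp ⟨⟨hp, hq⟩, hp⟩, tangentCoordChange_self hp]
  exact ⟨Function.LeftInverse.injective (key p q hp hq),
    Function.RightInverse.surjective (key q p hq hp)⟩

theorem chartFrame_bijective {p p' : M} (hp : p' ∈ (extChartAt (𝓡∂ n) p).source) :
    Function.Bijective (chartFrame (n := n) p (extChartAt (𝓡∂ n) p p')) := by
  rw [chartFrame_eq hp]
  exact tangentCoordChange_bijective hp (mem_extChartAt_source p')

theorem contDiffWithinAt_transition {p q p' : M}
    (hp : p' ∈ (extChartAt (𝓡∂ n) p).source) (hq : p' ∈ (extChartAt (𝓡∂ n) q).source) :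
    ContDiffWithinAt ℝ ∞ (transition (n := n) p q) (halfSpace n) (extChartAt (𝓡∂ n) p p') := by
  have := contDiffWithinAt_ext_coord_change (I := 𝓡∂ n) (n := ∞) q p
    (y := extChartAt (𝓡∂ n) p p') ?_
  · exact this
  · rw [PartialEquiv.trans_source]
    refine ⟨(extChartAt (𝓡∂ n) p).map_source hp, ?_⟩
    change (extChartAt (𝓡∂ n) p).symm (extChartAt (𝓡∂ n) p p') ∈ (extChartAt (𝓡∂ n) q).source
    rwa [(extChartAt (𝓡∂ n) p).left_inv hp]

theorem eventually_inChart_transition (h : TensorField n M) {p q p' : M}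
    (hp : p' ∈ (extChartAt (𝓡∂ n) p).source) (hq : p' ∈ (extChartAt (𝓡∂ n) q).source) :
    ∀ᶠ x in 𝓝[halfSpace n] (extChartAt (𝓡∂ n) p p'), inChart h p x = pullBilin
      (fderivWithin ℝ (transition p q) (halfSpace n) x) (inChart h q (transition p q x)) := by
  filter_upwards [eventually_chart hp ((isOpen_extChartAt_source (I := 𝓡∂ n) q).mem_nhds hq)]
    with x hx
  have := inChart_transition h ((extChartAt (𝓡∂ n) p).map_target hx.1) hx.2
  rw [(extChartAt (𝓡∂ n) p).right_inv hx.1] at this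
  exact this

end Charts

section Smooth

variable {n : ℕ} [NeZero n] {M : Type*} [TopologicalSpace M]
  [ChartedSpace (EuclideanHalfSpace n) M] [IsManifold (𝓡∂ n) ∞ M]

/-- A tensor field, as a section of the bundle of bilinear forms. -/
def tensorSection (h : TensorField n M) (p : M) :
    Bundle.TotalSpace (EuclideanSpace ℝ (Fin n) →L[ℝ] EuclideanSpace ℝ (Fin n) →L[ℝ] ℝ)
      (fun q : M => TangentSpace (𝓡∂ n) q →L[ℝ] TangentSpace (𝓡∂ n) q →L[ℝ] ℝ) :=
  Bundle.TotalSpace.mk' (EuclideanSpace ℝ (Fin n) →L[ℝ] EuclideanSpace ℝ (Fin n) →L[ℝ] ℝ) p (h p)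

/-- Smoothness of a tensor field near a point. -/
def IsSmoothAt (h : TensorField n M) (p : M) : Prop :=
  ContMDiffAt (𝓡∂ n) ((𝓡∂ n).prod 𝓘(ℝ, EuclideanSpace ℝ (Fin n) →L[ℝ]
    EuclideanSpace ℝ (Fin n) →L[ℝ] ℝ)) ∞ (tensorSection h) p

theorem inCoordinates_tensor (h : TensorField n M) {p p' : M}
    (hp : p' ∈ (extChartAt (𝓡∂ n) p).source) :
    ContinuousLinearMap.inCoordinates (EuclideanSpace ℝ (Fin n)) (TangentSpace (𝓡∂ n))
      (EuclideanSpace ℝ (Fin n) →L[ℝ] ℝ) (fun q : M => TangentSpace (𝓡∂ n) q →L[ℝ] ℝ) p p' p p'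
      (h p') = inChart h p (extChartAt (𝓡∂ n) p p') := by
  have := isManifold_one (n := n) (M := M)
  have hp' := hp
  rw [extChartAt_source] at hp'
  have h1 := TangentBundle.symmL_trivializationAt (I := 𝓡∂ n) hp'
  ext u v
  rw [inCoordinates_apply_eq₂ hp' hp' (Set.mem_univ _)]
  have e : ∀ v, (trivializationAt (EuclideanSpace ℝ (Fin n)) (TangentSpace (𝓡∂ n)) p).symm p' v
      = chartFrame p (extChartAt (𝓡∂ n) p p') v := fun v =>
    ((trivializationAt (EuclideanSpace ℝ (Fin n)) (TangentSpace (𝓡∂ n)) p).symmL_apply (R := ℝ)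
      hp' v).symm.trans (DFunLike.congr_fun h1 v)
  rw [e u, e v, inChart, pullBilin_apply, (extChartAt (𝓡∂ n) p).left_inv hp]
  simp
  rfl

theorem contMDiffAt_iff_chart {W : Type*} [NormedAddCommGroup W] [NormedSpace ℝ W] {f : M → W}
    {p p' : M} (hp : p' ∈ (extChartAt (𝓡∂ n) p).source) :
    ContMDiffAt (𝓡∂ n) 𝓘(ℝ, W) ∞ f p' ↔
      ContDiffWithinAt ℝ ∞ (f ∘ (extChartAt (𝓡∂ n) p).symm) (halfSpace n)
        (extChartAt (𝓡∂ n) p p') := by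
  rw [extChartAt_source] at hp
  rw [contMDiffAt_iff_source_of_mem_source hp, contMDiffWithinAt_iff_contDiffWithinAt]

theorem isSmoothAt_iff (h : TensorField n M) (p : M) : IsSmoothAt h p ↔
    ContDiffWithinAt ℝ ∞ (inChart h p) (halfSpace n) (extChartAt (𝓡∂ n) p p) := by
  have hp := mem_extChartAt_source (I := 𝓡∂ n) p
  have h1 : (fun p' => ContinuousLinearMap.inCoordinates (EuclideanSpace ℝ (Fin n))
      (TangentSpace (𝓡∂ n)) (EuclideanSpace ℝ (Fin n) →L[ℝ] ℝ)
      (fun q : M => TangentSpace (𝓡∂ n) q →L[ℝ] ℝ) p p' p p' (h p'))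
      =ᶠ[𝓝 p] fun p' => inChart h p (extChartAt (𝓡∂ n) p p') := by
    filter_upwards [(isOpen_extChartAt_source (I := 𝓡∂ n) p).mem_nhds hp] with p' hp'
    exact inCoordinates_tensor h hp'
  have h2 : ((fun p' => inChart h p (extChartAt (𝓡∂ n) p p')) ∘ (extChartAt (𝓡∂ n) p).symm)
      =ᶠ[𝓝[halfSpace n] (extChartAt (𝓡∂ n) p p)] inChart h p := by
    filter_upwards [extChartAt_target_mem_nhdsWithin (I := 𝓡∂ n) p] with x hx
    simp only [Function.comp_apply, (extChartAt (𝓡∂ n) p).right_inv hx]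
  have h3 : ContMDiffAt (𝓡∂ n) 𝓘(ℝ, Bilin (EuclideanSpace ℝ (Fin n))) ∞
      (fun p' => inChart h p (extChartAt (𝓡∂ n) p p')) p ↔
      ContDiffWithinAt ℝ ∞ (inChart h p) (halfSpace n) (extChartAt (𝓡∂ n) p p) := by
    rw [contMDiffAt_iff_chart hp]
    exact Filter.EventuallyEq.congr_contDiffWithinAt h2 (h2.self_of_nhdsWithin ⟨_, rfl⟩)
  rw [← h3, IsSmoothAt, contMDiffAt_hom_bundle]
  refine ⟨fun H => H.2.congr_of_eventuallyEq h1.symm, fun H => ⟨contMDiffAt_id, ?_⟩⟩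
  exact H.congr_of_eventuallyEq h1

theorem contDiffWithinAt_clm_apply {V W U : Type*} [NormedAddCommGroup V] [NormedSpace ℝ V]
    [NormedAddCommGroup W] [NormedSpace ℝ W] [FiniteDimensional ℝ W] [NormedAddCommGroup U]
    [NormedSpace ℝ U] {f : V → W →L[ℝ] U} {s : Set V} {x : V} {k : WithTop ℕ∞} :
    ContDiffWithinAt ℝ k f s x ↔ ∀ y, ContDiffWithinAt ℝ k (fun x => f x y) s x := by
  refine ⟨fun h y => h.clm_apply contDiffWithinAt_const, fun h => ?_⟩
  let d := Module.finrank ℝ W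
  have hd : d = Module.finrank ℝ (Fin d → ℝ) := (Module.finrank_fin_fun ℝ).symm
  let e₁ := ContinuousLinearEquiv.ofFinrankEq hd
  let e₂ := (e₁.arrowCongr (1 : U ≃L[ℝ] U)).trans (ContinuousLinearEquiv.piRing (Fin d))
  rw [← Function.id_comp f, ← e₂.symm_comp_self]
  exact e₂.symm.contDiff.comp_contDiffWithinAt (contDiffWithinAt_pi.mpr fun i => h _)

theorem contDiffWithinAt_pullBilin {X V W : Type*} [NormedAddCommGroup X] [NormedSpace ℝ X]
    [NormedAddCommGroup V] [NormedSpace ℝ V] [NormedAddCommGroup W] [NormedSpace ℝ W]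
    [FiniteDimensional ℝ W] {A : X → W →L[ℝ] V} {G : X → Bilin V} {s : Set X} {x : X}
    {k : WithTop ℕ∞} (hA : ContDiffWithinAt ℝ k A s x) (hG : ContDiffWithinAt ℝ k G s x) :
    ContDiffWithinAt ℝ k (fun y => pullBilin (A y) (G y)) s x :=
  contDiffWithinAt_clm_apply.2 fun _ => contDiffWithinAt_clm_apply.2 fun _ =>
    (hG.clm_apply (hA.clm_apply contDiffWithinAt_const)).clm_apply
      (hA.clm_apply contDiffWithinAt_const)

/-- A smooth tensor field is smooth in every chart. -/
theorem IsSmoothAt.contDiffWithinAt {h : TensorField n M} {p p' : M} (hh : IsSmoothAt h p')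
    (hp : p' ∈ (extChartAt (𝓡∂ n) p).source) :
    ContDiffWithinAt ℝ ∞ (inChart h p) (halfSpace n) (extChartAt (𝓡∂ n) p p') := by
  have hp' := mem_extChartAt_source (I := 𝓡∂ n) p'
  have hmem : extChartAt (𝓡∂ n) p p' ∈ halfSpace n := ⟨_, rfl⟩
  have e := eventually_inChart_transition h hp hp'
  refine ContDiffWithinAt.congr_of_eventuallyEq ?_ e (e.self_of_nhdsWithin hmem)
  have ht := contDiffWithinAt_transition (n := n) hp hp'
  have h1 := contDiffWithinAt_fderivWithin isBody_halfSpace hmem ht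
  have e2 : transition (n := n) p p' (extChartAt (𝓡∂ n) p p') = extChartAt (𝓡∂ n) p' p' := by
    rw [transition, Function.comp_apply, (extChartAt (𝓡∂ n) p).left_inv hp]
  have h2 : ContDiffWithinAt ℝ ∞ (fun x => inChart h p' (transition p p' x)) (halfSpace n)
      (extChartAt (𝓡∂ n) p p') := by
    refine ContDiffWithinAt.comp (g := inChart h p') (t := halfSpace n) _ ?_ ht (fun x _ => transition_mem p p' x)
    rw [e2]
    exact (isSmoothAt_iff h p').1 hh
  exact contDiffWithinAt_pullBilin h1 h2

end Smooth

/-! ### The curvature form in charts -/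

section Components

variable {n : ℕ}

theorem sum_smul_stdVec (v : EuclideanSpace ℝ (Fin n)) : ∑ k, v k • stdVec k = v := by
  ext i
  simp [stdVec, Finset.sum_apply, Pi.single_apply]

theorem linearIndependent_stdVec :
    LinearIndependent ℝ (stdVec : Fin n → EuclideanSpace ℝ (Fin n)) := by
  rw [Fintype.linearIndependent_iff]
  intro c hc i
  have := congrArg (fun v : EuclideanSpace ℝ (Fin n) => v i) hc
  simpa [stdVec, Pi.single_apply] using this

theorem map_eq_sum_stdVec {W : Type*} [NormedAddCommGroup W] [NormedSpace ℝ W]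
    (φ : EuclideanSpace ℝ (Fin n) →L[ℝ] W) (v : EuclideanSpace ℝ (Fin n)) :
    φ v = ∑ k, v k • φ (stdVec k) := by
  conv_lhs => rw [← sum_smul_stdVec v]
  simp

/-- The inverse of an inner product, in components. -/
theorem IsInner.inverse_component {G : Bilin (EuclideanSpace ℝ (Fin n))} (hG : IsInner G)
    (φ : EuclideanSpace ℝ (Fin n) →L[ℝ] ℝ) (k : Fin n) :
    (G.inverse φ) k = ∑ l, (gram G stdVec)⁻¹ k l * φ (stdVec l) := by
  have hdet : IsUnit (gram G stdVec).det :=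
    (Matrix.isUnit_iff_isUnit_det _).1 (hG.gram_posDef linearIndependent_stdVec).isUnit
  set c := G.inverse φ with hc
  have e1 : (fun l => φ (stdVec l)) = (gram G stdVec).mulVec (fun k => c k) := by
    ext l
    rw [← hG.apply_inverse φ, ← hc, hG.symm, map_eq_sum_stdVec (G (stdVec l)) c]
    simp [Matrix.mulVec, dotProduct, gram, mul_comm]
  have e2 : (gram G stdVec)⁻¹.mulVec (fun l => φ (stdVec l)) = fun k => c k := by
    rw [e1, Matrix.mulVec_mulVec, Matrix.nonsing_inv_mul _ hdet, Matrix.one_mulVec]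
  exact (congrFun e2 k).symm

end Components

section ChartComponents

variable {n : ℕ} [NeZero n] {M : Type*} [TopologicalSpace M]
  [ChartedSpace (EuclideanHalfSpace n) M]

theorem invCoeff_eq (g : TensorField n M) (p : M) (k l : Fin n) (x : EuclideanSpace ℝ (Fin n)) :
    invCoeff g p k l x = (gram (inChart g p x) stdVec)⁻¹ k l := rfl

theorem pderiv_coeff {g : TensorField n M} {p : M} {x : EuclideanSpace ℝ (Fin n)}
    (hx : x ∈ halfSpace n) (hd : DifferentiableWithinAt ℝ (inChart g p) (halfSpace n) x)
    (k i j : Fin n) : pderiv k (coeff g p i j) x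
      = fderivWithin ℝ (inChart g p) (halfSpace n) x (stdVec k) (stdVec i) (stdVec j) := by
  have h := (hd.hasFDerivWithinAt.apply_const (stdVec i)).apply_const (stdVec j)
  exact DFunLike.congr_fun (h.fderivWithin (isBody_halfSpace.uniqueDiffOn x hx)) (stdVec k)

theorem christoffel_eq {g : TensorField n M} {p : M} {x : EuclideanSpace ℝ (Fin n)}
    (hx : x ∈ halfSpace n) (hd : DifferentiableWithinAt ℝ (inChart g p) (halfSpace n) x)
    (hi : IsInner (inChart g p x)) (k i j : Fin n) : christoffel g p k i j x
      = connection (halfSpace n) (inChart g p) x (stdVec i) (stdVec j) k := by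
  rw [connection, connectionOf_apply, hi.inverse_component, christoffel, Finset.mul_sum]
  refine Finset.sum_congr rfl fun l _ => ?_
  rw [pderiv_coeff hx hd, pderiv_coeff hx hd, pderiv_coeff hx hd, invCoeff_eq, koszulForm_apply]
  ring

theorem riemann_eq {g : TensorField n M} {p : M} {x : EuclideanSpace ℝ (Fin n)}
    (h : IsMetricAt (halfSpace n) (inChart g p) x) (i j k l : Fin n) : riemann g p i j k l x
      = curvature (halfSpace n) (inChart g p) x (stdVec i) (stdVec j) (stdVec k) (stdVec l) := by
  set B := connection (halfSpace n) (inChart g p) with hB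
  have hu := isBody_halfSpace.uniqueDiffOn x h.mem
  have hBd := ((h.contDiffWithinAt_connection isBody_halfSpace).differentiableWithinAt
    (by simp)).hasFDerivWithinAt
  have hc : ∀ m i j, christoffel g p m i j
      =ᶠ[𝓝[halfSpace n] x] fun y => B y (stdVec i) (stdVec j) m := by
    intro m i j
    filter_upwards [h.inner, eventually_contDiffWithinAt_two h.mem h.smooth, self_mem_nhdsWithin]
      with y h1 h2 h3
    exact christoffel_eq h3 (h2.differentiableWithinAt (by simp)) h1 m i j
  have hp : ∀ a m i j, pderiv a (christoffel g p m i j) x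
      = fderivWithin ℝ B (halfSpace n) x (stdVec a) (stdVec i) (stdVec j) m := by
    intro a m i j
    have e1 := (EuclideanSpace.proj (𝕜 := ℝ) m : EuclideanSpace ℝ (Fin n) →L[ℝ] ℝ).hasFDerivAt
      |>.comp_hasFDerivWithinAt x ((hBd.apply_const (stdVec i)).apply_const (stdVec j))
    have e2 := e1.congr_of_eventuallyEq (hc m i j) ((hc m i j).self_of_nhdsWithin h.mem)
    exact DFunLike.congr_fun (e2.fderivWithin hu) (stdVec a)
  have hc0 : ∀ m i j, christoffel g p m i j x = B x (stdVec i) (stdVec j) m := fun m i j =>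
    (hc m i j).self_of_nhdsWithin h.mem
  rw [h.curvature_eq isBody_halfSpace, h.isInner.symm, map_eq_sum_stdVec (inChart g p x (stdVec l)),
    riemann]
  refine Finset.sum_congr rfl fun m _ => ?_
  rw [coeff_eq, h.isInner.symm, smul_eq_mul, mul_comm, hp, hp]
  congr 1
  have e : ∀ a b c, B x (stdVec a) (B x (stdVec b) (stdVec c)) m
      = ∑ d, B x (stdVec b) (stdVec c) d * B x (stdVec a) (stdVec d) m := by
    intro a b c
    rw [map_eq_sum_stdVec (B x (stdVec a))]
    simp
  simp only [hc0, Finset.sum_sub_distrib, PiLp.add_apply, PiLp.sub_apply, ← hB, e]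
  ring

end ChartComponents

section Tensoriality

variable {n : ℕ} [NeZero n] {M : Type*} [TopologicalSpace M]
  [ChartedSpace (EuclideanHalfSpace n) M] [IsManifold (𝓡∂ n) ∞ M]

/-- The tensor field `h` is a smooth Riemannian metric near the point `p`. -/
structure IsMetricNear (h : TensorField n M) (p : M) : Prop where
  smooth : IsSmoothAt h p
  inner : ∀ᶠ q in 𝓝 p, IsInner (tensorAt h q)

theorem IsInner.pullBilin {V W : Type*} [NormedAddCommGroup V] [NormedSpace ℝ V]
    [NormedAddCommGroup W] [NormedSpace ℝ W] {G : Bilin V} (hG : IsInner G) {A : W →L[ℝ] V}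
    (hA : Function.Injective A) : IsInner (pullBilin A G) :=
  ⟨fun _ _ => hG.symm _ _, fun _ hu => hG.pos _ fun h => hu (hA (h.trans (map_zero A).symm))⟩

theorem IsMetricNear.isMetricAt {h : TensorField n M} {p q : M} (hh : IsMetricNear h p)
    (hq : p ∈ (extChartAt (𝓡∂ n) q).source) :
    IsMetricAt (halfSpace n) (inChart h q) (extChartAt (𝓡∂ n) q p) where
  mem := ⟨_, rfl⟩
  smooth := hh.smooth.contDiffWithinAt hq
  inner := by
    filter_upwards [eventually_chart hq hh.inner] with x hx
    refine hx.2.pullBilin ?_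
    have := (chartFrame_bijective ((extChartAt (𝓡∂ n) q).map_target hx.1)).1
    rwa [(extChartAt (𝓡∂ n) q).right_inv hx.1] at this

theorem curvatureForm_eq {h : TensorField n M} {p : M} (hh : IsMetricNear h p)
    (α : Matrix (Fin n) (Fin n) ℝ) : curvatureForm h p α
      = frameForm (curvature (halfSpace n) (inChart h p) (extChartAt (𝓡∂ n) p p)) stdVec α := by
  simp only [curvatureForm, frameForm, quadForm,
    riemann_eq (hh.isMetricAt (mem_extChartAt_source p))]

omit [IsManifold (𝓡∂ n) ∞ M] in
theorem bivectorForm_eq (h : TensorField n M) (p : M) (α : Matrix (Fin n) (Fin n) ℝ) :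
    bivectorForm h p α = frameForm (bivec (inChart h p (extChartAt (𝓡∂ n) p p))) stdVec α := rfl

/-- The Jacobi matrix of the change of coordinates from the chart at `p` to that at `q`. -/
def jacobiMatrix (p q : M) : Matrix (Fin n) (Fin n) ℝ := fun i j =>
  fderivWithin ℝ (transition p q) (halfSpace n) (extChartAt (𝓡∂ n) p p) (stdVec j) i

omit [IsManifold (𝓡∂ n) ∞ M] in
theorem jacobiMatrix_spec (p q : M) (j : Fin n) :
    fderivWithin ℝ (transition p q) (halfSpace n) (extChartAt (𝓡∂ n) p p) (stdVec j)
      = ∑ i, jacobiMatrix (n := n) p q i j • stdVec i := (sum_smul_stdVec _).symm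

/-- The covariant Hessian is normal to the image, hence zero if the derivative is onto. This is the
transformation law of the Christoffel symbols. -/
theorem IsIsometricAt.covHessian_eq_zero {V W : Type*} [NormedAddCommGroup V]
    [NormedSpace ℝ V] [NormedAddCommGroup W] [NormedSpace ℝ W] [FiniteDimensional ℝ V]
    [FiniteDimensional ℝ W] {s : Set V} {G : V → Bilin V} {t : Set W} {γ : W → Bilin W} {Ψ : W → V}
    {x : W} (ht : IsBody t) (h : IsIsometricAt s G t γ Ψ x)
    (hsurj : Function.Surjective (fderivWithin ℝ Ψ t x)) (u v : W) :
    covHessian s G t γ Ψ x u v = 0 := by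
  obtain ⟨y, hy⟩ := hsurj (covHessian s G t γ Ψ x u v)
  by_contra hne
  have := (h.eventually_normal ht).self_of_nhdsWithin h.source.mem u v y
  rw [hy] at this
  exact (h.target.isInner.pos _ hne).ne' this

/-- Curvature is invariant under isometric maps whose derivative is onto. -/
theorem IsIsometricAt.curvature_eq_of_surjective {V W : Type*} [NormedAddCommGroup V]
    [NormedSpace ℝ V] [NormedAddCommGroup W] [NormedSpace ℝ W] [FiniteDimensional ℝ V]
    [FiniteDimensional ℝ W] {s : Set V} {G : V → Bilin V} {t : Set W} {γ : W → Bilin W} {Ψ : W → V}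
    {x : W} (hs : IsBody s) (ht : IsBody t) (h : IsIsometricAt s G t γ Ψ x)
    (hsurj : Function.Surjective (fderivWithin ℝ Ψ t x)) (u v w z : W) :
    curvature s G (Ψ x) (fderivWithin ℝ Ψ t x u) (fderivWithin ℝ Ψ t x v) (fderivWithin ℝ Ψ t x w)
      (fderivWithin ℝ Ψ t x z) = curvature t γ x u v w z := by
  have h0 := h.covHessian_eq_zero ht hsurj
  rw [h.gauss hs ht]
  simp [h0]

theorem IsMetricNear.isIsometricAt {h : TensorField n M} {p p' q : M} (hh : IsMetricNear h p')
    (hp : p' ∈ (extChartAt (𝓡∂ n) p).source) (hq : p' ∈ (extChartAt (𝓡∂ n) q).source) :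
    IsIsometricAt (halfSpace n) (inChart h q) (halfSpace n) (inChart h p) (transition p q)
      (extChartAt (𝓡∂ n) p p') where
  target := by
    rw [transition, Function.comp_apply, (extChartAt (𝓡∂ n) p).left_inv hp]
    exact hh.isMetricAt hq
  source := hh.isMetricAt hp
  smooth := contDiffWithinAt_transition hp hq
  mapsTo := .of_forall fun x => transition_mem p q x
  pull := eventually_inChart_transition h hp hq

/-- The curvature form at `p`, computed in the chart at another point `q`. -/
theorem curvatureForm_eq_chart {h : TensorField n M} {p q : M} (hh : IsMetricNear h p)
    (hq : p ∈ (extChartAt (𝓡∂ n) q).source) (α : Matrix (Fin n) (Fin n) ℝ) :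
    curvatureForm h p α = frameForm (curvature (halfSpace n) (inChart h q) (extChartAt (𝓡∂ n) q p))
      stdVec (jacobiMatrix p q * α * (jacobiMatrix p q).transpose) := by
  have hp := mem_extChartAt_source (I := 𝓡∂ n) p
  rw [curvatureForm_eq hh, ← (isQuadrilinear_curvature _ _ _).frameForm_change
    (jacobiMatrix_spec p q)]
  have := (hh.isIsometricAt hp hq).curvature_eq_of_surjective isBody_halfSpace isBody_halfSpace
    (by rw [fderivWithin_transition]; exact (tangentCoordChange_bijective hp hq).2)
  rw [transition, Function.comp_apply, (extChartAt (𝓡∂ n) p).left_inv hp] at this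
  unfold frameForm
  congr 1
  ext i j k l
  exact (this _ _ _ _).symm

theorem bivectorForm_eq_chart (h : TensorField n M) {p q : M}
    (hq : p ∈ (extChartAt (𝓡∂ n) q).source) (α : Matrix (Fin n) (Fin n) ℝ) :
    bivectorForm h p α = frameForm (bivec (inChart h q (extChartAt (𝓡∂ n) q p)))
      stdVec (jacobiMatrix p q * α * (jacobiMatrix p q).transpose) := by
  have hp := mem_extChartAt_source (I := 𝓡∂ n) p
  rw [bivectorForm_eq, ← (isQuadrilinear_bivec _).frameForm_change (jacobiMatrix_spec p q),
    inChart_transition h hp hq]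
  rfl

end Tensoriality

/-! ### Second order jets of products and compositions -/

section Jet

variable {V W : Type*} [NormedAddCommGroup V] [NormedSpace ℝ V] [NormedAddCommGroup W]
  [NormedSpace ℝ W]

/-- On the set `s`, the function `f` has the derivative `f'` near `x` and the second derivative `H`
at `x`. -/
structure HasJetWithinAt (f : V → W) (f' : V → V →L[ℝ] W) (H : V →L[ℝ] V →L[ℝ] W) (s : Set V)
    (x : V) : Prop where
  mem : x ∈ s
  first : ∀ᶠ y in 𝓝[s] x, HasFDerivWithinAt f (f' y) s y
  second : HasFDerivWithinAt f' H s x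

variable {s : Set V} {x : V}

theorem ContDiffWithinAt.hasJetWithinAt {f : V → W} (hs : IsBody s) (hx : x ∈ s)
    (hf : ContDiffWithinAt ℝ ∞ f s x) : HasJetWithinAt f (fderivWithin ℝ f s)
      (fderivWithin ℝ (fderivWithin ℝ f s) s x) s x where
  mem := hx
  first := (eventually_contDiffWithinAt_two hx hf).mono fun _ hy =>
    (hy.differentiableWithinAt (by simp)).hasFDerivWithinAt
  second := ((contDiffWithinAt_fderivWithin hs hx hf).differentiableWithinAt
    (by simp)).hasFDerivWithinAt

namespace HasJetWithinAt

variable {f g : V → W} {f' g' : V → V →L[ℝ] W} {H K : V →L[ℝ] V →L[ℝ] W}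

theorem eventually_fderivWithin_eq (hs : IsBody s) (hf : HasJetWithinAt f f' H s x) :
    fderivWithin ℝ f s =ᶠ[𝓝[s] x] f' := by
  filter_upwards [hf.first, self_mem_nhdsWithin] with y hy hys
  exact hy.fderivWithin (hs.uniqueDiffOn y hys)

theorem fderivWithin_eq (hs : IsBody s) (hf : HasJetWithinAt f f' H s x) :
    fderivWithin ℝ f s x = f' x :=
  (hf.eventually_fderivWithin_eq hs).eq_of_nhdsWithin hf.mem

theorem second_fderivWithin_eq (hs : IsBody s) (hf : HasJetWithinAt f f' H s x) :
    fderivWithin ℝ (fderivWithin ℝ f s) s x = H :=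
  (hf.second.congr_of_eventuallyEq (hf.eventually_fderivWithin_eq hs)
    (hf.fderivWithin_eq hs)).fderivWithin (hs.uniqueDiffOn x hf.mem)

theorem add (hf : HasJetWithinAt f f' H s x) (hg : HasJetWithinAt g g' K s x) :
    HasJetWithinAt (fun y => f y + g y) (fun y => f' y + g' y) (H + K) s x where
  mem := hf.mem
  first := (hf.first.and hg.first).mono fun _ h => h.1.add h.2
  second := hf.second.add hg.second

end HasJetWithinAt

/-- The derivative of a product `φ • L` from those of the factors. -/
def prodDeriv (c : ℝ) (c₁ : V →L[ℝ] ℝ) (L : W) (L₁ : V →L[ℝ] W) : V →L[ℝ] W :=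
  c • L₁ + c₁.smulRight L

/-- The second derivative of a product `φ • L` from the derivatives of the factors. -/
def prodDeriv₂ (c : ℝ) (c₁ : V →L[ℝ] ℝ) (c₂ : V →L[ℝ] V →L[ℝ] ℝ) (L : W) (L₁ : V →L[ℝ] W)
    (L₂ : V →L[ℝ] V →L[ℝ] W) : V →L[ℝ] V →L[ℝ] W :=
  (c • L₂ + c₁.smulRight L₁) + ((ContinuousLinearMap.smulRightL ℝ V W c₁) ∘L L₁
    + ((ContinuousLinearMap.smulRightL ℝ V W).flip L) ∘L c₂)

theorem prodDeriv₂_add_smul (c : ℝ) (c₁ : V →L[ℝ] ℝ) (c₂ c₂' : V →L[ℝ] V →L[ℝ] ℝ) (a : ℝ) (L : W)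
    (L₁ : V →L[ℝ] W) (L₂ : V →L[ℝ] V →L[ℝ] W) :
    prodDeriv₂ c c₁ (c₂ + a • c₂') L L₁ L₂ = prodDeriv₂ c c₁ c₂ L L₁ L₂
      + a • (((ContinuousLinearMap.smulRightL ℝ V W).flip L) ∘L c₂') := by
  rw [prodDeriv₂, prodDeriv₂, ContinuousLinearMap.comp_add, ContinuousLinearMap.comp_smul]
  abel

theorem HasJetWithinAt.smul {φ : V → ℝ} {φ' : V → V →L[ℝ] ℝ} {φ'' : V →L[ℝ] V →L[ℝ] ℝ}
    {L : V → W} {L' : V → V →L[ℝ] W} {L'' : V →L[ℝ] V →L[ℝ] W}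
    (hφ : HasJetWithinAt φ φ' φ'' s x) (hL : HasJetWithinAt L L' L'' s x) :
    HasJetWithinAt (fun y => φ y • L y) (fun y => prodDeriv (φ y) (φ' y) (L y) (L' y))
      (prodDeriv₂ (φ x) (φ' x) φ'' (L x) (L' x) L'') s x where
  mem := hφ.mem
  first := (hφ.first.and hL.first).mono fun _ h => h.1.smul h.2
  second := by
    have h1 := (hφ.first.self_of_nhdsWithin hφ.mem).smul hL.second
    have h2 := ((ContinuousLinearMap.smulRightL ℝ V W).hasFDerivWithinAt_of_bilinear hφ.second
      (hL.first.self_of_nhdsWithin hφ.mem))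
    convert! h1.add h2 using 1

/-- The chain rule for `a ∘ u`, where the derivatives of `a` are one-sided at the end point of
`[0, ∞)`. -/
theorem HasJetWithinAt.comp_halfLine {a a₁ : ℝ → ℝ} {a₂ : ℝ} {u : V → ℝ} {u' : V → V →L[ℝ] ℝ}
    {u'' : V →L[ℝ] V →L[ℝ] ℝ} (hu : HasJetWithinAt u u' u'' s x) (hu0 : ∀ y, 0 ≤ u y)
    (ha : ∀ t ∈ Ici (0 : ℝ), HasDerivWithinAt a (a₁ t) (Ici 0) t)
    (ha₁ : HasDerivWithinAt a₁ a₂ (Ici 0) (u x)) :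
    HasJetWithinAt (fun y => a (u y)) (fun y => a₁ (u y) • u' y)
      (a₁ (u x) • u'' + a₂ • (u' x).smulRight (u' x)) s x where
  mem := hu.mem
  first := hu.first.mono fun y hy =>
    (ha (u y) (hu0 y)).comp_hasFDerivWithinAt (f := u) y hy (fun z _ => hu0 z)
  second := by
    have h1 := ha₁.comp_hasFDerivWithinAt (f := u) x (hu.first.self_of_nhdsWithin hu.mem)
      (fun z _ => hu0 z)
    have h2 := h1.smul hu.second
    have e : (a₂ • u' x).smulRight (u' x) = a₂ • (u' x).smulRight (u' x) := by
      ext v w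
      simp [mul_assoc]
    rw [e] at h2
    exact h2

end Jet

/-! ### The curvature as a function of the jet of the metric -/

section CurvatureOf

variable {V : Type*} [NormedAddCommGroup V] [NormedSpace ℝ V]

theorem HasJetWithinAt.curvature_eq {G : V → Bilin V} {G' : V → V →L[ℝ] Bilin V}
    {H : V →L[ℝ] V →L[ℝ] Bilin V} {s : Set V} {x : V} (hs : IsBody s)
    (h : HasJetWithinAt G G' H s x) : curvature s G x = curvatureOf (G x) (G' x) H := by
  ext u v w z
  rw [curvature, h.fderivWithin_eq hs, h.second_fderivWithin_eq hs]

theorem smulRightL_apply {W : Type*} [NormedAddCommGroup W] [NormedSpace ℝ W] (φ : V →L[ℝ] ℝ)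
    (w : W) (v : V) : ContinuousLinearMap.smulRightL ℝ V W φ w v = φ v • w := rfl

theorem curvatureOf_add_smul (G : Bilin V) (D : V →L[ℝ] Bilin V) (H K : V →L[ℝ] V →L[ℝ] Bilin V)
    (a : ℝ) (u v w z : V) : curvatureOf G D (H + a • K) u v w z = curvatureOf G D H u v w z
      + a * (koszulForm (K v) u w z - koszulForm (K u) v w z) := by
  simp only [curvatureOf, add_apply, map_add, smul_apply, map_smul, smul_eq_mul]
  ring

variable {ι : Type*} [Fintype ι]

/-- The contraction of a two-vector `α^{ij} e_i ∧ e_j` with a linear form. -/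
def contraction (φ : V →L[ℝ] ℝ) (e : ι → V) (α : Matrix ι ι ℝ) : V :=
  ∑ j, (∑ i, α i j * φ (e i)) • e j

/-- The contribution to the curvature operator of the second normal derivative of the metric: adding
`a φ ⊗ φ ⊗ L` to the second derivative changes the curvature form of `α` by `-a/2 L(w, w)`, where
`w` is the contraction of `α` with `φ`. -/
theorem frameForm_curvatureOf_add_normal (G : Bilin V) (D : V →L[ℝ] Bilin V)
    (H : V →L[ℝ] V →L[ℝ] Bilin V) (a : ℝ) (φ : V →L[ℝ] ℝ) (L : Bilin V)
    (e : ι → V) {α : Matrix ι ι ℝ} (hα : α.transpose = -α) :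
    frameForm (curvatureOf G D (H + a •
      (((ContinuousLinearMap.smulRightL ℝ V (Bilin V)).flip L) ∘L φ.smulRight φ))) e α
      = frameForm (curvatureOf G D H) e α
        - a / 2 * L (contraction φ e α) (contraction φ e α) := by
  have hα' : ∀ i j, α j i = - α i j := fun i j => congrFun (congrFun hα i) j
  have h1 : ∀ u v w z, curvatureOf G D (H + a •
      (((ContinuousLinearMap.smulRightL ℝ V (Bilin V)).flip L) ∘L φ.smulRight φ)) u v w z
      = curvatureOf G D H u v w z + a * ((1 / 2) * (φ v * φ w * L u z - φ v * φ z * L u w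
        - φ u * φ w * L v z + φ u * φ z * L v w)) := by
    intro u v w z
    rw [curvatureOf_add_smul]
    simp only [koszulForm_apply, ContinuousLinearMap.comp_apply, ContinuousLinearMap.smulRight_apply,
      ContinuousLinearMap.flip_apply, smulRightL_apply, smul_apply, smul_eq_mul,
      map_smul]
    ring
  -- by antisymmetry of `α` the four terms have the same contribution
  let S : (ι → ι → ι → ι → ℝ) → ℝ := fun f => ∑ i, ∑ j, ∑ k, ∑ l, f i j k l * α i j * α k l
  have S1 : ∀ f : ι → ι → ι → ι → ℝ, S (fun i j k l => f j i k l) = - S f := by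
    intro f
    simp only [S]
    rw [Finset.sum_comm, ← Finset.sum_neg_distrib]
    refine Finset.sum_congr rfl fun i _ => ?_
    rw [← Finset.sum_neg_distrib]
    refine Finset.sum_congr rfl fun j _ => ?_
    simp only [hα' i j, ← Finset.sum_neg_distrib, mul_neg, neg_mul]
  have S2 : ∀ f : ι → ι → ι → ι → ℝ, S (fun i j k l => f i j l k) = - S f := by
    intro f
    simp only [S]
    simp only [← Finset.sum_neg_distrib]
    refine Finset.sum_congr rfl fun i _ => Finset.sum_congr rfl fun j _ => ?_
    rw [Finset.sum_comm]
    refine Finset.sum_congr rfl fun k _ => Finset.sum_congr rfl fun l _ => ?_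
    rw [hα' k l]
    ring
  let f₀ : ι → ι → ι → ι → ℝ := fun i j k l => φ (e i) * φ (e k) * L (e j) (e l)
  have hf₀ : S f₀ = L (contraction φ e α) (contraction φ e α) := by
    have : L (contraction φ e α) (contraction φ e α)
        = ∑ j, ∑ l, (∑ i, α i j * φ (e i)) * ((∑ k, α k l * φ (e k)) * L (e j) (e l)) := by
      simp only [contraction, map_sum, map_smul, sum_apply, smul_apply, smul_eq_mul,
        Finset.mul_sum]
      rw [Finset.sum_comm]
      exact Finset.sum_congr rfl fun j _ => Finset.sum_congr rfl fun l _ => by ring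
    rw [this]
    simp only [S, f₀, Finset.sum_mul, Finset.mul_sum]
    rw [Finset.sum_comm]
    refine Finset.sum_congr rfl fun j _ => ?_
    rw [Finset.sum_congr rfl fun i _ => Finset.sum_comm, Finset.sum_comm]
    refine Finset.sum_congr rfl fun l _ => ?_
    rw [Finset.sum_comm]
    refine Finset.sum_congr rfl fun i _ => Finset.sum_congr rfl fun k _ => ?_
    ring
  have h3 := S1 f₀
  have h4 := S2 f₀
  have h5 := S2 fun i j k l => f₀ j i k l
  have h6 : frameForm (curvatureOf G D (H + a •
      (((ContinuousLinearMap.smulRightL ℝ V (Bilin V)).flip L) ∘L φ.smulRight φ))) e α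
      = frameForm (curvatureOf G D H) e α + (1 / 4) * (a * ((1 / 2) *
        (S (fun i j k l => f₀ j i k l) - S (fun i j k l => f₀ j i l k) - S f₀
          + S (fun i j k l => f₀ i j l k)))) := by
    simp only [frameForm, quadForm, h1, S, f₀, Finset.mul_sum, ← Finset.sum_add_distrib,
      ← Finset.sum_sub_distrib]
    refine Finset.sum_congr rfl fun i _ => Finset.sum_congr rfl fun j _ =>
      Finset.sum_congr rfl fun k _ => Finset.sum_congr rfl fun l _ => ?_
    ring
  rw [h6, ← hf₀]
  rw [h3] at h5
  rw [h3, h4, h5]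
  ring

variable [FiniteDimensional ℝ V]

theorem tendsto_clm_apply {X V W : Type*} [NormedAddCommGroup V] [NormedSpace ℝ V]
    [NormedAddCommGroup W] [NormedSpace ℝ W] {l : Filter X} {f : X → V →L[ℝ] W} {v : X → V}
    {f₀ : V →L[ℝ] W} {v₀ : V} (hf : Tendsto f l (𝓝 f₀)) (hv : Tendsto v l (𝓝 v₀)) :
    Tendsto (fun i => f i (v i)) l (𝓝 (f₀ v₀)) :=
  (isBoundedBilinearMap_apply.continuous.tendsto (f₀, v₀)).comp (hf.prodMk_nhds hv)

theorem tendsto_curvatureOf {X : Type*} {l : Filter X} {G : X → Bilin V} {D : X → V →L[ℝ] Bilin V}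
    {H : X → V →L[ℝ] V →L[ℝ] Bilin V} {G₀ : Bilin V} {D₀ : V →L[ℝ] Bilin V}
    {H₀ : V →L[ℝ] V →L[ℝ] Bilin V} (hG₀ : IsInner G₀) (hG : Tendsto G l (𝓝 G₀))
    (hD : Tendsto D l (𝓝 D₀)) (hH : Tendsto H l (𝓝 H₀)) (u v w z : V) :
    Tendsto (fun i => curvatureOf (G i) (D i) (H i) u v w z) l
      (𝓝 (curvatureOf G₀ D₀ H₀ u v w z)) := by
  have hi : Tendsto (fun i => (G i).inverse) l (𝓝 G₀.inverse) :=
    (hG₀.contDiffAt_inverse (n := 0)).continuousAt.tendsto.comp hG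
  have hk : Tendsto (fun i => koszulForm (D i)) l (𝓝 (koszulForm D₀)) :=
    ((koszulForm (V := V)).continuous.tendsto _).comp hD
  have hkH : ∀ v, Tendsto (fun i => koszulForm (H i v)) l (𝓝 (koszulForm (H₀ v))) := fun v =>
    ((koszulForm (V := V)).continuous.tendsto _).comp (tendsto_clm_apply hH tendsto_const_nhds)
  have hb : ∀ u v, Tendsto (fun i => connectionOf (G i) (D i) u v) l
      (𝓝 (connectionOf G₀ D₀ u v)) := fun u v => by
    simp only [connectionOf_apply]
    exact tendsto_clm_apply hi
      (tendsto_clm_apply (tendsto_clm_apply hk tendsto_const_nhds) tendsto_const_nhds)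
  refine Tendsto.sub (Tendsto.sub ?_ ?_) (Tendsto.sub ?_ ?_)
  · exact tendsto_clm_apply (tendsto_clm_apply (tendsto_clm_apply (hkH v) tendsto_const_nhds)
      tendsto_const_nhds) tendsto_const_nhds
  · exact tendsto_clm_apply (tendsto_clm_apply (tendsto_clm_apply hk tendsto_const_nhds)
      tendsto_const_nhds) (hb u w)
  · exact tendsto_clm_apply (tendsto_clm_apply (tendsto_clm_apply (hkH u) tendsto_const_nhds)
      tendsto_const_nhds) tendsto_const_nhds
  · exact tendsto_clm_apply (tendsto_clm_apply (tendsto_clm_apply hk tendsto_const_nhds)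
      tendsto_const_nhds) (hb v w)

end CurvatureOf

/-! ### Positivity is an open condition -/

section Open

/-- A function which is continuous, homogeneous of degree two in the second variable and positive on
a closed cone for the parameter `a` is positive there for nearby parameters. -/
theorem eventually_pos_of_homogeneous {A E : Type*} [TopologicalSpace A] [NormedAddCommGroup E]
    [NormedSpace ℝ E] [FiniteDimensional ℝ E] {Q : A → E → ℝ} (hQ : Continuous (Function.uncurry Q))
    (hom : ∀ a (c : ℝ) v, Q a (c • v) = c ^ 2 * Q a v) {K : Set E} (hK : IsClosed K)
    (hK' : ∀ (c : ℝ), ∀ v ∈ K, c • v ∈ K) {a : A} (ha : ∀ v ∈ K, v ≠ 0 → 0 < Q a v) :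
    ∀ᶠ b in 𝓝 a, ∀ v ∈ K, v ≠ 0 → 0 < Q b v := by
  have := FiniteDimensional.proper ℝ E
  have hc : IsCompact (K ∩ Metric.sphere 0 1) := (isCompact_sphere 0 1).inter_left hK
  have h1 : ∀ᶠ b in 𝓝 a, ∀ v ∈ K ∩ Metric.sphere 0 1, 0 < Q b v := by
    refine hc.eventually_forall_of_forall_eventually fun v hv => ?_
    have hne : v ≠ 0 := by
      rintro rfl
      simpa using hv.2
    exact hQ.continuousAt.eventually (lt_mem_nhds (ha v hv.1 hne))
  filter_upwards [h1] with b hb v hv hne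
  have hn : 0 < ‖v‖ := norm_pos_iff.2 hne
  have h2 := hb (‖v‖⁻¹ • v) ⟨hK' _ v hv, by simp [norm_smul, hn.ne']⟩
  rw [hom] at h2
  exact (pos_iff_pos_of_mul_pos h2).1 (by positivity)

/-- Symmetric forms close to an inner product are inner products. -/
theorem IsInner.eventually {V : Type*} [NormedAddCommGroup V] [NormedSpace ℝ V]
    [FiniteDimensional ℝ V] {G : Bilin V} (hG : IsInner G) :
    ∀ᶠ B in 𝓝 G, (∀ u v, B u v = B v u) → IsInner B := by
  have := eventually_pos_of_homogeneous (Q := fun (B : Bilin V) u => B u u) (K := univ) (a := G)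
    (by fun_prop) (by intro a c v; simp; ring) isClosed_univ (by simp)
    (fun v _ hv => hG.pos v hv)
  filter_upwards [this] with B hB hs
  exact ⟨hs, fun u hu => hB u trivial hu⟩

/-- A tensor which is positive on two-vectors is nonnegative on them after a small change. No
symmetry of the nearby tensors is needed. -/
theorem eventually_quadForm_nonneg {ι : Type*} [Fintype ι] {T : ι → ι → ι → ι → ℝ}
    (hT : ∀ α : Matrix ι ι ℝ, α.transpose = -α → α ≠ 0 → 0 < quadForm T α) :
    ∀ᶠ S in 𝓝 T, ∀ α : Matrix ι ι ℝ, α.transpose = -α → 0 ≤ quadForm S α := by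
  have := eventually_pos_of_homogeneous (A := ι → ι → ι → ι → ℝ) (E := ι → ι → ℝ)
    (Q := fun S α => quadForm S (Matrix.of α)) (K := {α | ∀ i j, α j i = - α i j}) (a := T)
    (by simp only [Function.uncurry_def, quadForm, Matrix.of_apply]; fun_prop)
    (fun S c α => quadForm_smul c S (Matrix.of α))
    (by simp only [Set.ofPred_forall]
        exact isClosed_iInter fun i => isClosed_iInter fun j =>
          isClosed_eq (by fun_prop) (by fun_prop))
    (fun c v hv i j => by simp [hv i j])
    (fun α hα h0 => hT α (by ext i j; exact hα i j) h0)
  filter_upwards [this] with S hS α hα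
  by_cases h0 : α = 0
  · simp [h0, quadForm]
  · exact (hS α (fun i j => congrFun (congrFun hα i) j) h0).le

end Open

/-! ### The boundary in charts -/

section BoundaryCharts

variable {n : ℕ} [NeZero n] {M : Type*} [TopologicalSpace M]
  [ChartedSpace (EuclideanHalfSpace n) M] [IsManifold (𝓡∂ n) ∞ M]

theorem mem_boundary_iff {p q : M} (hp : p ∈ (extChartAt (𝓡∂ n) q).source) :
    p ∈ (𝓡∂ n).boundary M ↔ extChartAt (𝓡∂ n) q p 0 = 0 := by
  rw [extChartAt_source] at hp
  have h1 := ModelWithCorners.mem_interior_range_iff_of_mem_atlas (I := 𝓡∂ n) (n := ∞) (by simp)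
    (chart_mem_atlas _ p) (chart_mem_atlas _ q) (mem_chart_source _ p) hp
  have h2 : (extChartAt (𝓡∂ n) q p : EuclideanSpace ℝ (Fin n)) ∈ halfSpace n := ⟨_, rfl⟩
  have h3 : p ∈ (𝓡∂ n).boundary M ↔ ¬ (𝓡∂ n).IsInteriorPoint p := by
    rw [← ModelWithCorners.compl_interior]; rfl
  have h4 : (extChartAt (𝓡∂ n) q p : EuclideanSpace ℝ (Fin n)) ∈
      interior ((extChartAt (𝓡∂ n) q).target) ↔ extChartAt (𝓡∂ n) q p ∈ interior (halfSpace n) := by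
    refine ⟨fun h => interior_mono (extChartAt_target_subset_range q) h, fun h => ?_⟩
    have h5 := extChartAt_target_mem_nhdsWithin' (I := 𝓡∂ n) (x := q) (y := p)
      (by rwa [extChartAt_source])
    rw [nhdsWithin_eq_nhds.2 (mem_interior_iff_mem_nhds.1 h)] at h5
    exact mem_interior_iff_mem_nhds.2 h5
  rw [h3, ModelWithCorners.isInteriorPoint_iff, ← not_iff_not, not_not]
  refine (h1.trans h4).trans ?_
  rw [interior_range_modelWithCornersEuclideanHalfSpace]
  have := mem_halfSpace.1 h2
  exact ⟨fun h => ne_of_gt h, fun h => lt_of_le_of_ne this (Ne.symm h)⟩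

end BoundaryCharts

theorem locallyCompactSpace (n : ℕ) [NeZero n] (M : Type*) [TopologicalSpace M]
    [ChartedSpace (EuclideanHalfSpace n) M] : LocallyCompactSpace M :=
  have : LocallyCompactSpace (EuclideanHalfSpace n) := (𝓡∂ n).locallyCompactSpace
  ChartedSpace.locallyCompactSpace (EuclideanHalfSpace n) M

/-- The differential of a function on a manifold with boundary. -/
def differential {n : ℕ} [NeZero n] {M : Type*} [TopologicalSpace M]
    [ChartedSpace (EuclideanHalfSpace n) M] (u : M → ℝ) (p : M) :
    TangentSpace (𝓡∂ n) p →L[ℝ] ℝ :=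
  mfderiv (𝓡∂ n) 𝓘(ℝ, ℝ) u p


section Distance

open scoped Bundle

variable {n : ℕ} [NeZero n] {M : Type*} [TopologicalSpace M]
  [ChartedSpace (EuclideanHalfSpace n) M] [IsManifold (𝓡∂ n) ∞ M] (g : SmoothMetric n M)

/-- The Riemannian distance of two points. -/
def metricEDist (p q : M) : ENNReal :=
  letI : Bundle.RiemannianBundle (fun q : M => TangentSpace (𝓡∂ n) q) := ⟨g.toRiemannianMetric⟩
  riemannianEDist (𝓡∂ n) p q

/-- This makes the results of Mathlib on `riemannianEDist` available for the metric `g`. -/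
theorem isContinuousRiemannianBundle :
    let : Bundle.RiemannianBundle (fun q : M => TangentSpace (𝓡∂ n) q) := ⟨g.toRiemannianMetric⟩
    IsContinuousRiemannianBundle (EuclideanSpace ℝ (Fin n))
      (fun q : M => TangentSpace (𝓡∂ n) q) :=
  let : Bundle.RiemannianBundle (fun q : M => TangentSpace (𝓡∂ n) q) := ⟨g.toRiemannianMetric⟩
  ⟨g.inner, g.contMDiff.continuous, fun _ _ _ => rfl⟩

theorem boundaryEDist_eq (p : M) :
    boundaryEDist g p = ⨅ q ∈ (𝓡∂ n).boundary M, metricEDist g p q := rfl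

theorem boundaryEDist_of_mem {p : M} (hp : p ∈ (𝓡∂ n).boundary M) : boundaryEDist g p = 0 := by
  let : Bundle.RiemannianBundle (fun q : M => TangentSpace (𝓡∂ n) q) := ⟨g.toRiemannianMetric⟩
  exact le_antisymm ((iInf₂_le p hp).trans_eq riemannianEDist_self) bot_le

theorem metricEDist_comm (p q : M) : metricEDist g p q = metricEDist g q p := by
  let : Bundle.RiemannianBundle (fun q : M => TangentSpace (𝓡∂ n) q) := ⟨g.toRiemannianMetric⟩
  exact riemannianEDist_comm

theorem metricEDist_triangle (p q r : M) :
    metricEDist g p r ≤ metricEDist g p q + metricEDist g q r := by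
  let : Bundle.RiemannianBundle (fun q : M => TangentSpace (𝓡∂ n) q) := ⟨g.toRiemannianMetric⟩
  have := isManifold_one (n := n) (M := M)
  exact riemannianEDist_triangle

theorem boundaryEDist_le_add (p q : M) :
    boundaryEDist g p ≤ metricEDist g p q + boundaryEDist g q := by
  rw [boundaryEDist_eq, boundaryEDist_eq, ENNReal.add_iInf]
  refine le_iInf fun b => ?_
  by_cases hb : b ∈ (𝓡∂ n).boundary M
  · simp only [hb, iInf_pos]
    exact (iInf₂_le b hb).trans (metricEDist_triangle g p q b)
  · simp [hb]

theorem eventually_metricEDist_lt (p : M) {c : ENNReal} (hc : 0 < c) :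
    ∀ᶠ q in 𝓝 p, metricEDist g p q < c := by
  let : Bundle.RiemannianBundle (fun q : M => TangentSpace (𝓡∂ n) q) := ⟨g.toRiemannianMetric⟩
  have := isManifold_one (n := n) (M := M)
  have := isContinuousRiemannianBundle g
  exact eventually_riemannianEDist_lt (𝓡∂ n) p hc

theorem exists_metricEDist_lt_subset [T2Space M] {p : M} {s : Set M} (hs : s ∈ 𝓝 p) :
    ∃ c > 0, {q | metricEDist g p q < c} ⊆ s := by
  let : Bundle.RiemannianBundle (fun q : M => TangentSpace (𝓡∂ n) q) := ⟨g.toRiemannianMetric⟩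
  have := isManifold_one (n := n) (M := M)
  have := locallyCompactSpace n M
  have := isContinuousRiemannianBundle g
  exact setOfPred_riemannianEDist_lt_subset_nhds' (𝓡∂ n) hs

theorem isOpen_tube (r : ℝ) : IsOpen (tube g r) := by
  rw [isOpen_iff_mem_nhds]
  intro p hp
  have hp' : boundaryEDist g p < ENNReal.ofReal r := hp
  have h1 : 0 < ENNReal.ofReal r - boundaryEDist g p := tsub_pos_of_lt hp'
  filter_upwards [eventually_metricEDist_lt g p h1] with q hq
  have h2 := boundaryEDist_le_add g q p
  rw [metricEDist_comm] at h2
  exact h2.trans_lt (by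
    have := ENNReal.add_lt_add_right (hp'.ne_top) hq
    rwa [tsub_add_cancel_of_le hp'.le] at this)

theorem boundaryEDist_pos [T2Space M] {p : M} (hp : p ∉ (𝓡∂ n).boundary M) :
    0 < boundaryEDist g p := by
  obtain ⟨c, hc, h⟩ := exists_metricEDist_lt_subset g
    ((ModelWithCorners.isClosed_boundary (I := 𝓡∂ n) (n := ∞) (M := M)
      (by simp)).isOpen_compl.mem_nhds hp)
  refine hc.trans_le (le_iInf₂ fun q hq => ?_)
  by_contra hlt
  exact h (not_le.1 hlt) hq

theorem normalCoord_of_mem {p : M} (hp : p ∈ (𝓡∂ n).boundary M) : normalCoord g p = 0 := by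
  rw [normalCoord, boundaryEDist_of_mem g hp, ENNReal.toReal_zero]

theorem normalCoord_nonneg (p : M) : 0 ≤ normalCoord g p := ENNReal.toReal_nonneg

theorem ofReal_normalCoord {r : ℝ} {p : M} (hp : p ∈ tube g r) :
    ENNReal.ofReal (normalCoord g p) = boundaryEDist g p :=
  ENNReal.ofReal_toReal (LT.lt.ne_top hp)

theorem normalCoord_pos [T2Space M] {r : ℝ} {p : M} (hp : p ∈ tube g r)
    (hb : p ∉ (𝓡∂ n).boundary M) : 0 < normalCoord g p :=
  ENNReal.toReal_pos (boundaryEDist_pos g hb).ne' (LT.lt.ne_top hp)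

theorem mem_tube_of_mem {r : ℝ} (hr : 0 < r) {p : M} (hp : p ∈ (𝓡∂ n).boundary M) :
    p ∈ tube g r := by
  change boundaryEDist g p < _
  rw [boundaryEDist_of_mem g hp]
  exact ENNReal.ofReal_pos.2 hr

theorem boundaryEDist_le_iff {r : ℝ} {p : M} (hp : p ∈ tube g r) {s : ℝ} (hs : 0 ≤ s) :
    boundaryEDist g p ≤ ENNReal.ofReal s ↔ normalCoord g p ≤ s := by
  rw [← ofReal_normalCoord g hp, ENNReal.ofReal_le_ofReal_iff hs]

/-- A curve of speed at most `c` bounds the distance of its end points. -/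
theorem metricEDist_le_of_speed_le {γ : ℝ → M} {T c : ℝ} (hT : 0 ≤ T) (hc : 0 ≤ c)
    (hγ : ContMDiffOn 𝓘(ℝ, ℝ) (𝓡∂ n) 1 γ (Icc 0 T))
    (hs : ∀ t ∈ Icc 0 T, g.inner (γ t) (mfderivWithin 𝓘(ℝ, ℝ) (𝓡∂ n) γ (Icc 0 T) t (1 : ℝ))
      (mfderivWithin 𝓘(ℝ, ℝ) (𝓡∂ n) γ (Icc 0 T) t (1 : ℝ)) ≤ c ^ 2) :
    metricEDist g (γ 0) (γ T) ≤ ENNReal.ofReal (c * T) := by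
  let : Bundle.RiemannianBundle (fun q : M => TangentSpace (𝓡∂ n) q) := ⟨g.toRiemannianMetric⟩
  have := isManifold_one (n := n) (M := M)
  refine (riemannianEDist_le_pathELength hγ rfl rfl hT).trans ?_
  rw [pathELength_eq_lintegral_mfderivWithin_Icc]
  have : ∫⁻ t in Icc 0 T, ‖mfderivWithin 𝓘(ℝ, ℝ) (𝓡∂ n) γ (Icc 0 T) t (1 : ℝ)‖ₑ
      ≤ ∫⁻ t in Icc 0 T, ENNReal.ofReal c := by
    refine setLIntegral_mono' measurableSet_Icc fun t ht => ?_
    rw [← ofReal_norm]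
    refine ENNReal.ofReal_le_ofReal ?_
    refine abs_le_of_sq_le_sq' ?_ hc |>.2
    rw [← real_inner_self_eq_norm_sq]
    exact hs t ht
  refine this.trans ?_
  simp [ENNReal.ofReal_mul hc]

/-- A function whose differential has norm at most `a` on a metric ball changes by at most `a d`
between the centre and a point at distance less than `d`. -/
theorem abs_sub_le_of_differential_le {u : M → ℝ} {p q : M} {a : ℝ} (ha : 0 ≤ a) {d : ENNReal}
    (hd : d ≠ ⊤)
    (hu : ∀ p', metricEDist g p p' < d → ContMDiffAt (𝓡∂ n) 𝓘(ℝ, ℝ) ∞ u p')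
    (hdu : ∀ p', metricEDist g p p' < d → ∀ v,
      (differential u p' v) ^ 2 ≤ a ^ 2 * g.inner p' v v)
    (hpq : metricEDist g p q < d) : |u q - u p| ≤ a * d.toReal := by
  let : Bundle.RiemannianBundle (fun q : M => TangentSpace (𝓡∂ n) q) := ⟨g.toRiemannianMetric⟩
  have := isManifold_one (n := n) (M := M)
  obtain ⟨γ, h0, h1, hγ, hl⟩ := exists_lt_of_riemannianEDist_lt (I := 𝓡∂ n) (x := p) (y := q) hpq
  have hball : ∀ t ∈ Icc (0 : ℝ) 1, metricEDist g p (γ t) < d := by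
    intro t ht
    refine LE.le.trans_lt ?_ hl
    refine (riemannianEDist_le_pathELength (hγ.mono (Icc_subset_Icc_right ht.2)) h0 rfl ht.1).trans ?_
    exact pathELength_mono le_rfl ht.2
  have hsm : ContMDiffOn 𝓘(ℝ, ℝ) 𝓘(ℝ, ℝ) 1 (u ∘ γ) (Icc 0 1) := fun t ht =>
    ((hu _ (hball t ht)).of_le (by exact_mod_cast (le_top : (1 : ℕ∞) ≤ ⊤))).comp_contMDiffWithinAt
      t (hγ t ht)
  have h2 : ‖(u ∘ γ) 1 - (u ∘ γ) 0‖ₑ ≤ ENNReal.ofReal a * d := calc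
    ‖(u ∘ γ) 1 - (u ∘ γ) 0‖ₑ ≤ ∫⁻ t in Icc (0 : ℝ) 1, ‖derivWithin (u ∘ γ) (Icc 0 1) t‖ₑ :=
        enorm_sub_le_lintegral_derivWithin_Icc_of_contDiffOn_Icc
          (contMDiffOn_iff_contDiffOn.1 hsm) zero_le_one
    _ ≤ ∫⁻ t in Icc (0 : ℝ) 1, ENNReal.ofReal a
          * ‖mfderivWithin 𝓘(ℝ, ℝ) (𝓡∂ n) γ (Icc 0 1) t (1 : ℝ)‖ₑ := by
        refine setLIntegral_mono' measurableSet_Icc fun t ht => ?_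
        have e : mfderivWithin 𝓘(ℝ, ℝ) 𝓘(ℝ, ℝ) (u ∘ γ) (Icc 0 1) t
            = (mfderiv (𝓡∂ n) 𝓘(ℝ, ℝ) u (γ t)) ∘L (mfderivWithin 𝓘(ℝ, ℝ) (𝓡∂ n) γ (Icc 0 1) t) := by
          apply mfderiv_comp_mfderivWithin
          · exact (hu _ (hball t ht)).mdifferentiableAt (by simp)
          · exact (hγ t ht).mdifferentiableWithinAt (by simp)
          · rw [uniqueMDiffWithinAt_iff_uniqueDiffWithinAt]
            exact uniqueDiffOn_Icc zero_lt_one t ht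
        have e2 : derivWithin (u ∘ γ) (Icc 0 1) t = differential u (γ t)
            (mfderivWithin 𝓘(ℝ, ℝ) (𝓡∂ n) γ (Icc 0 1) t (1 : ℝ)) := by
          rw [← fderivWithin_derivWithin, ← mfderivWithin_eq_fderivWithin]
          exact congr($e (1 : ℝ))
        have e3 := hdu _ (hball t ht) (mfderivWithin 𝓘(ℝ, ℝ) (𝓡∂ n) γ (Icc 0 1) t (1 : ℝ))
        rw [e2]
        generalize (mfderivWithin 𝓘(ℝ, ℝ) (𝓡∂ n) γ (Icc 0 1) t (1 : ℝ) :
          TangentSpace (𝓡∂ n) (γ t)) = w at e3 ⊢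
        rw [← ofReal_norm, ← ofReal_norm w, ← ENNReal.ofReal_mul ha]
        refine ENNReal.ofReal_le_ofReal ?_
        rw [Real.norm_eq_abs]
        refine abs_le_of_sq_le_sq ?_ (by positivity)
        rw [mul_pow, ← real_inner_self_eq_norm_sq]
        exact e3
    _ = ENNReal.ofReal a * pathELength (𝓡∂ n) γ 0 1 := by
        rw [lintegral_const_mul' _ _ ENNReal.ofReal_ne_top,
          pathELength_eq_lintegral_mfderivWithin_Icc]
        rfl
    _ ≤ ENNReal.ofReal a * d := by gcongr
  have h3 := ENNReal.toReal_mono (ENNReal.mul_ne_top ENNReal.ofReal_ne_top hd) h2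
  rw [ENNReal.toReal_mul, ENNReal.toReal_ofReal ha, toReal_enorm, Function.comp_apply,
    Function.comp_apply, h0, h1] at h3
  exact h3

end Distance

theorem IsInner.cauchy_schwarz {V : Type*} [NormedAddCommGroup V] [NormedSpace ℝ V] {G : Bilin V}
    (hG : IsInner G) (u v : V) : G u v ^ 2 ≤ G u u * G v v := by
  by_cases hv : v = 0
  · simp [hv]
  have h1 := hG.pos v hv
  have h2 : 0 ≤ G (G v v • u - G u v • v) (G v v • u - G u v • v) := by
    by_cases h : G v v • u - G u v • v = 0
    · simp [h]
    · exact (hG.pos _ h).le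
  simp only [map_sub, map_smul, sub_apply, smul_apply, smul_eq_mul, hG.symm v u] at h2
  have h3 : 0 ≤ G v v * (G u u * G v v - G u v ^ 2) := by linarith
  linarith [nonneg_of_mul_nonneg_right h3 h1]

/-! ### The differential of the distance to the boundary -/

section NormalDerivative

variable {n : ℕ} [NeZero n] {M : Type*} [TopologicalSpace M]
  [ChartedSpace (EuclideanHalfSpace n) M]

/-- The distance to the boundary in the chart at `q`. -/
def normalCoordIn [IsManifold (𝓡∂ n) ∞ M] (g : SmoothMetric n M) (q : M)
    (x : EuclideanSpace ℝ (Fin n)) : ℝ := normalCoord g ((extChartAt (𝓡∂ n) q).symm x)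

theorem chart_mem (q p : M) : extChartAt (𝓡∂ n) q p ∈ halfSpace n := ⟨_, rfl⟩

/-- Points near `p` have coordinates near those of `p`. -/
theorem tendsto_chart {q p : M} (hp : p ∈ (extChartAt (𝓡∂ n) q).source) :
    Tendsto (extChartAt (𝓡∂ n) q) (𝓝 p) (𝓝[halfSpace n] (extChartAt (𝓡∂ n) q p)) :=
  tendsto_nhdsWithin_iff.2 ⟨(continuousAt_extChartAt' hp).tendsto, .of_forall fun _ => ⟨_, rfl⟩⟩

/-- For a direction `v` pointing into the half-space, the points `x + t v` approach `x` in the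
half-space. -/
theorem tendsto_ray {x v : EuclideanSpace ℝ (Fin n)} (hx : x ∈ halfSpace n) (hv : 0 ≤ v 0) :
    Tendsto (fun t : ℝ => x + t • v) (𝓝[≥] 0) (𝓝[halfSpace n] x) := by
  refine tendsto_nhdsWithin_iff.2 ⟨?_, ?_⟩
  · have : Tendsto (fun t : ℝ => x + t • v) (𝓝 0) (𝓝 (x + (0 : ℝ) • v)) := by
      apply Continuous.tendsto; fun_prop
    simp only [zero_smul, add_zero] at this
    exact this.mono_left nhdsWithin_le_nhds
  · filter_upwards [self_mem_nhdsWithin] with t ht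
    rw [mem_halfSpace] at hx ⊢
    simp only [PiLp.add_apply, PiLp.smul_apply, smul_eq_mul]
    exact add_nonneg hx (mul_nonneg ht hv)

variable [IsManifold (𝓡∂ n) ∞ M] (g : SmoothMetric n M) {r : ℝ}

theorem SmoothMetric.isInner (p : M) : IsInner (tensorAt g.inner p) :=
  ⟨fun u v => g.symm p u v, fun u hu => g.pos p u hu⟩

theorem SmoothMetric.isMetricNear (p : M) : IsMetricNear g.inner p :=
  ⟨g.contMDiff p, .of_forall fun q => SmoothMetric.isInner g q⟩

theorem contMDiffAt_normalCoord (hr : IsFermiWidth g r) {p : M} (hp : p ∈ tube g r) :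
    ContMDiffAt (𝓡∂ n) 𝓘(ℝ, ℝ) ∞ (normalCoord g) p :=
  hr.smooth.contMDiffAt ((isOpen_tube g r).mem_nhds hp)

theorem contDiffWithinAt_normalCoordIn (hr : IsFermiWidth g r) {p q : M} (hp : p ∈ tube g r)
    (hq : p ∈ (extChartAt (𝓡∂ n) q).source) :
    ContDiffWithinAt ℝ ∞ (normalCoordIn g q) (halfSpace n) (extChartAt (𝓡∂ n) q p) :=
  (contMDiffAt_iff_chart hq).1 (contMDiffAt_normalCoord g hr hp)

theorem fderivWithin_comp_chart {u : M → ℝ} {p q : M} (hu : ContMDiffAt (𝓡∂ n) 𝓘(ℝ, ℝ) ∞ u p)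
    (hq : p ∈ (extChartAt (𝓡∂ n) q).source) (v : EuclideanSpace ℝ (Fin n)) :
    fderivWithin ℝ (u ∘ (extChartAt (𝓡∂ n) q).symm) (halfSpace n) (extChartAt (𝓡∂ n) q p) v
      = differential u p (chartFrame q (extChartAt (𝓡∂ n) q p) v) := by
  have := isManifold_one (n := n) (M := M)
  have e : mfderivWithin 𝓘(ℝ, EuclideanSpace ℝ (Fin n)) 𝓘(ℝ, ℝ)
      (u ∘ (extChartAt (𝓡∂ n) q).symm) (halfSpace n) (extChartAt (𝓡∂ n) q p)
      = (mfderiv (𝓡∂ n) 𝓘(ℝ, ℝ) u ((extChartAt (𝓡∂ n) q).symm (extChartAt (𝓡∂ n) q p))) ∘L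
        (mfderivWithin 𝓘(ℝ, EuclideanSpace ℝ (Fin n)) (𝓡∂ n) (extChartAt (𝓡∂ n) q).symm
          (halfSpace n) (extChartAt (𝓡∂ n) q p)) := by
    apply mfderiv_comp_mfderivWithin
    · rw [(extChartAt (𝓡∂ n) q).left_inv hq]
      exact hu.mdifferentiableAt (by simp)
    · exact mdifferentiableWithinAt_extChartAt_symm ((extChartAt (𝓡∂ n) q).map_source hq)
    · rw [uniqueMDiffWithinAt_iff_uniqueDiffWithinAt]
      exact isBody_halfSpace.uniqueDiffOn _ (chart_mem q p)
  rw [mfderivWithin_eq_fderivWithin] at e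
  have e2 := DFunLike.congr_fun e v
  refine e2.trans ?_
  have key : ∀ p', p' = p → ∀ w : EuclideanSpace ℝ (Fin n),
      (mfderiv (𝓡∂ n) 𝓘(ℝ, ℝ) u p' : EuclideanSpace ℝ (Fin n) →L[ℝ] ℝ) w
        = differential u p w := by
    rintro p' rfl w; rfl
  exact key _ ((extChartAt (𝓡∂ n) q).left_inv hq) _

/-- Straight segments in the chart at `q` bound the distance to the boundary point `q`. -/
theorem normalCoordIn_ray_le {q : M} (hq : q ∈ (𝓡∂ n).boundary M) {v : EuclideanSpace ℝ (Fin n)}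
    (hv : 0 ≤ v 0) {c : ℝ} (hc : 0 < c)
    (hvc : inChart g.inner q (extChartAt (𝓡∂ n) q q) v v < c ^ 2) :
    ∀ᶠ t in 𝓝[≥] (0 : ℝ), normalCoordIn g q (extChartAt (𝓡∂ n) q q + t • v) ≤ c * t := by
  have := isManifold_one (n := n) (M := M)
  have hs := mem_extChartAt_source (I := 𝓡∂ n) q
  set x := extChartAt (𝓡∂ n) q q with hx
  have hcont : ContinuousWithinAt (fun y => inChart g.inner q y v v) (halfSpace n) x :=
    ((IsMetricNear.isMetricAt (SmoothMetric.isMetricNear g q) hs).smooth.continuousWithinAt.clm_apply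
      continuousWithinAt_const).clm_apply continuousWithinAt_const
  have h1 : ∀ᶠ y in 𝓝[halfSpace n] x, y ∈ (extChartAt (𝓡∂ n) q).target ∧
      inChart g.inner q y v v < c ^ 2 :=
    Filter.Eventually.and (extChartAt_target_mem_nhdsWithin (I := 𝓡∂ n) q)
      (hcont.eventually (gt_mem_nhds hvc))
  have h2 := (tendsto_ray (chart_mem q q) hv).eventually h1
  obtain ⟨T, hT, hTs⟩ := mem_nhdsGE_iff_exists_Icc_subset.1 h2
  filter_upwards [Icc_mem_nhdsGE (show (0 : ℝ) < T from hT)] with t ht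
  have hsub : ∀ τ ∈ Icc 0 t, x + τ • v ∈ (extChartAt (𝓡∂ n) q).target ∧
      inChart g.inner q (x + τ • v) v v < c ^ 2 := fun τ hτ => hTs ⟨hτ.1, hτ.2.trans ht.2⟩
  rcases ht.1.eq_or_lt with rfl | ht0
  · rw [normalCoordIn, zero_smul, add_zero, hx, extChartAt_to_inv, normalCoord_of_mem g hq, mul_zero]
  have hη : ContMDiffOn 𝓘(ℝ, ℝ) 𝓘(ℝ, EuclideanSpace ℝ (Fin n)) 1 (fun τ : ℝ => x + τ • v)
      (Icc 0 t) := by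
    rw [contMDiffOn_iff_contDiffOn]
    fun_prop
  have hγ : ContMDiffOn 𝓘(ℝ, ℝ) (𝓡∂ n) 1
      ((extChartAt (𝓡∂ n) q).symm ∘ fun τ : ℝ => x + τ • v) (Icc 0 t) :=
    (contMDiffOn_extChartAt_symm q).comp hη fun τ hτ => (hsub τ hτ).1
  have hspeed : ∀ τ ∈ Icc 0 t, mfderivWithin 𝓘(ℝ, ℝ) (𝓡∂ n)
      ((extChartAt (𝓡∂ n) q).symm ∘ fun τ : ℝ => x + τ • v) (Icc 0 t) τ (1 : ℝ)
      = chartFrame q (x + τ • v) v := by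
    intro τ hτ
    have hu : UniqueDiffWithinAt ℝ (Icc 0 t) τ := uniqueDiffOn_Icc ht0 τ hτ
    have e : mfderivWithin 𝓘(ℝ, ℝ) (𝓡∂ n)
        ((extChartAt (𝓡∂ n) q).symm ∘ fun τ : ℝ => x + τ • v) (Icc 0 t) τ
        = (mfderivWithin 𝓘(ℝ, EuclideanSpace ℝ (Fin n)) (𝓡∂ n) (extChartAt (𝓡∂ n) q).symm
          (halfSpace n) (x + τ • v)) ∘L (mfderivWithin 𝓘(ℝ, ℝ) 𝓘(ℝ, EuclideanSpace ℝ (Fin n))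
            (fun τ : ℝ => x + τ • v) (Icc 0 t) τ) := by
      apply mfderivWithin_comp (I' := 𝓘(ℝ, EuclideanSpace ℝ (Fin n)))
      · exact mdifferentiableWithinAt_extChartAt_symm (hsub τ hτ).1
      · exact (hη τ hτ).mdifferentiableWithinAt (by simp)
      · exact fun τ' hτ' => extChartAt_target_subset_range q (hsub τ' hτ').1
      · rw [uniqueMDiffWithinAt_iff_uniqueDiffWithinAt]; exact hu
    have e2 : (mfderivWithin 𝓘(ℝ, ℝ) 𝓘(ℝ, EuclideanSpace ℝ (Fin n))
            (fun τ : ℝ => x + τ • v) (Icc 0 t) τ) (1 : ℝ) = v := by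
      rw [mfderivWithin_eq_fderivWithin]
      have : HasDerivWithinAt (fun τ : ℝ => x + τ • v) v (Icc 0 t) τ := by
        simpa using ((hasDerivWithinAt_id τ (Icc 0 t)).smul_const v).const_add x
      have h3 := this.hasFDerivWithinAt.fderivWithin hu
      have h4 := DFunLike.congr_fun h3 (1 : ℝ)
      refine h4.trans ?_
      simp
    have e3 := DFunLike.congr_fun e (1 : ℝ)
    refine e3.trans ?_
    exact congrArg (chartFrame q (x + τ • v)) e2
  have hle := metricEDist_le_of_speed_le g ht0.le hc.le hγ (fun τ hτ => by
    have := (hsub τ hτ).2.le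
    rw [hspeed τ hτ]
    exact this)
  simp only [Function.comp_apply, zero_smul, add_zero] at hle
  rw [hx, extChartAt_to_inv, metricEDist_comm] at hle
  have h5 := boundaryEDist_le_add g ((extChartAt (𝓡∂ n) q).symm (x + t • v)) q
  rw [boundaryEDist_of_mem g hq, add_zero] at h5
  have h6 := ENNReal.toReal_mono ENNReal.ofReal_ne_top (h5.trans hle)
  rw [ENNReal.toReal_ofReal (mul_nonneg hc.le ht0.le)] at h6
  exact h6

variable {g}

theorem hasDerivWithinAt_ray {f : EuclideanSpace ℝ (Fin n) → ℝ} {x v : EuclideanSpace ℝ (Fin n)}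
    (hx : x ∈ halfSpace n) (hf : DifferentiableWithinAt ℝ f (halfSpace n) x) (hv : 0 ≤ v 0) :
    HasDerivWithinAt (fun t : ℝ => f (x + t • v)) (fderivWithin ℝ f (halfSpace n) x v) (Ici 0) 0 := by
  have h1 : HasDerivWithinAt (fun t : ℝ => x + t • v) v (Ici 0) 0 := by
    simpa using ((hasDerivWithinAt_id (0 : ℝ) (Ici 0)).smul_const v).const_add x
  have h2 : HasFDerivWithinAt f (fderivWithin ℝ f (halfSpace n) x) (halfSpace n)
      (x + (0 : ℝ) • v) := by simpa using hf.hasFDerivWithinAt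
  refine h2.comp_hasDerivWithinAt (0 : ℝ) h1 fun t ht => ?_
  rw [mem_halfSpace] at hx ⊢
  simp only [PiLp.add_apply, PiLp.smul_apply, smul_eq_mul]
  exact add_nonneg hx (mul_nonneg ht hv)

theorem le_of_hasDerivWithinAt_Ici {f : ℝ → ℝ} {f' c : ℝ} (hf : HasDerivWithinAt f f' (Ici 0) 0)
    (h : ∀ᶠ t in 𝓝[≥] (0 : ℝ), f t ≤ f 0 + c * t) : f' ≤ c := by
  rw [hasDerivWithinAt_iff_tendsto_slope, Ici_sdiff_left] at hf
  refine le_of_tendsto hf ?_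
  filter_upwards [h.filter_mono (nhdsWithin_mono _ Ioi_subset_Ici_self), self_mem_nhdsWithin]
    with t ht ht0
  rw [slope_def_field, div_le_iff₀ (by simpa using ht0)]
  linarith

theorem ge_of_hasDerivWithinAt_Ici {f : ℝ → ℝ} {f' c : ℝ} (hf : HasDerivWithinAt f f' (Ici 0) 0)
    (h : ∀ᶠ t in 𝓝[≥] (0 : ℝ), f 0 + c * t ≤ f t) : c ≤ f' := by
  have := le_of_hasDerivWithinAt_Ici (f := fun t => - f t) (c := -c) hf.neg
    (h.mono fun t ht => by linarith)
  linarith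


section Boundary

variable {q : M} (hr : IsFermiWidth g r) (hq : q ∈ (𝓡∂ n).boundary M)
include hr hq

theorem differentiableWithinAt_normalCoordIn_boundary :
    DifferentiableWithinAt ℝ (normalCoordIn g q) (halfSpace n) (extChartAt (𝓡∂ n) q q) :=
  (contDiffWithinAt_normalCoordIn g hr (mem_tube_of_mem g hr.pos hq)
    (mem_extChartAt_source q)).differentiableWithinAt (by simp)

omit hr in
theorem normalCoordIn_self : normalCoordIn g q (extChartAt (𝓡∂ n) q q) = 0 := by
  rw [normalCoordIn, extChartAt_to_inv, normalCoord_of_mem g hq]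

theorem fderivWithin_normalCoordIn_nonneg {v : EuclideanSpace ℝ (Fin n)} (hv : 0 ≤ v 0) :
    0 ≤ fderivWithin ℝ (normalCoordIn g q) (halfSpace n) (extChartAt (𝓡∂ n) q q) v := by
  refine ge_of_hasDerivWithinAt_Ici (hasDerivWithinAt_ray (chart_mem q q)
    (differentiableWithinAt_normalCoordIn_boundary hr hq) hv) (.of_forall fun t => ?_)
  simp only [zero_smul, add_zero, zero_mul, normalCoordIn_self hq]
  exact normalCoord_nonneg g _

theorem fderivWithin_normalCoordIn_tangent {v : EuclideanSpace ℝ (Fin n)} (hv : v 0 = 0) :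
    fderivWithin ℝ (normalCoordIn g q) (halfSpace n) (extChartAt (𝓡∂ n) q q) v = 0 := by
  have h1 := fderivWithin_normalCoordIn_nonneg hr hq hv.ge
  have h2 := fderivWithin_normalCoordIn_nonneg (v := -v) hr hq (by simp [hv])
  rw [map_neg] at h2
  linarith

/-- The differential of the distance to the boundary has norm at most one at the boundary, by
`normalCoordIn_ray_le`. -/
theorem fderivWithin_normalCoordIn_sq_le (v : EuclideanSpace ℝ (Fin n)) :
    fderivWithin ℝ (normalCoordIn g q) (halfSpace n) (extChartAt (𝓡∂ n) q q) v ^ 2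
      ≤ inChart g.inner q (extChartAt (𝓡∂ n) q q) v v := by
  have key : ∀ v : EuclideanSpace ℝ (Fin n), 0 ≤ v 0 →
      fderivWithin ℝ (normalCoordIn g q) (halfSpace n) (extChartAt (𝓡∂ n) q q) v ^ 2
        ≤ inChart g.inner q (extChartAt (𝓡∂ n) q q) v v := by
    intro v hv
    have h0 : 0 ≤ inChart g.inner q (extChartAt (𝓡∂ n) q q) v v := by
      rw [inChart_self]
      by_cases h : v = 0
      · simp [h]
      · exact ((SmoothMetric.isInner g q).pos v h).le
    refine ((sq_le_sq₀ (fderivWithin_normalCoordIn_nonneg hr hq hv) (Real.sqrt_nonneg _)).2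
      ?_).trans_eq (Real.sq_sqrt h0)
    refine le_of_forall_gt_imp_ge_of_dense fun c hc => ?_
    have hc0 : 0 < c := (Real.sqrt_nonneg _).trans_lt hc
    refine le_of_hasDerivWithinAt_Ici (hasDerivWithinAt_ray (chart_mem q q)
      (differentiableWithinAt_normalCoordIn_boundary hr hq) hv) ?_
    filter_upwards [normalCoordIn_ray_le g hq hv hc0 ((Real.sqrt_lt' hc0).1 hc)] with t ht
    simp only [zero_smul, add_zero, normalCoordIn_self hq, zero_add]
    exact ht
  -- either `v` or `-v` points into the half-space
  rcases le_total 0 (v 0) with h | h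
  · exact key v h
  · have := key (-v) (by simpa using h)
    simpa using this

/-- The differential of the distance to the boundary does not have norm less than one at the
boundary: otherwise the distance would decrease too slowly along almost minimal curves from
interior points to the boundary. -/
theorem exists_lt_fderivWithin_normalCoordIn_sq [T2Space M] {a : ℝ} (ha : 0 ≤ a) (ha1 : a < 1) :
    ∃ v, a ^ 2 * inChart g.inner q (extChartAt (𝓡∂ n) q q) v v
      < fderivWithin ℝ (normalCoordIn g q) (halfSpace n) (extChartAt (𝓡∂ n) q q) v ^ 2 := by
  by_contra! hcon
  have hs := mem_extChartAt_source (I := 𝓡∂ n) q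
  have hqt := mem_tube_of_mem g hr.pos hq
  obtain ⟨b, hab, hb1⟩ := exists_between ha1
  have hb0 : 0 < b := ha.trans_lt hab
  set x := extChartAt (𝓡∂ n) q q with hx
  set f := normalCoordIn g q with hf
  have hfs : ContDiffWithinAt ℝ ∞ f (halfSpace n) x := contDiffWithinAt_normalCoordIn g hr hqt hs
  have hG := IsMetricNear.isMetricAt (SmoothMetric.isMetricNear g q) hs
  -- near the boundary point the differential still has norm less than one
  let T : EuclideanSpace ℝ (Fin n) → Bilin (EuclideanSpace ℝ (Fin n)) := fun y =>
    b ^ 2 • inChart g.inner q y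
      - (fderivWithin ℝ f (halfSpace n) y).smulRight (fderivWithin ℝ f (halfSpace n) y)
  have hTc : Tendsto T (𝓝[halfSpace n] x) (𝓝 (T x)) := by
    have h1 := hG.smooth.continuousWithinAt
    have h2 := (contDiffWithinAt_fderivWithin isBody_halfSpace (chart_mem q q)
      hfs).continuousWithinAt
    exact Tendsto.sub (h1.tendsto.const_smul _) ((ContinuousLinearMap.smulRightL ℝ
      (EuclideanSpace ℝ (Fin n)) (EuclideanSpace ℝ (Fin n) →L[ℝ] ℝ)).isBoundedBilinearMap.continuous.tendsto
        (_, _) |>.comp (h2.tendsto.prodMk_nhds h2.tendsto))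
  have hTx : IsInner (T x) := by
    refine ⟨fun u v => ?_, fun u hu => ?_⟩
    · have h1 : inChart g.inner q x u v = inChart g.inner q x v u := hG.isInner.symm u v
      simp only [T, sub_apply, smul_apply, ContinuousLinearMap.smulRight_apply, smul_eq_mul, h1]
      ring
    · simp only [T, sub_apply, smul_apply, ContinuousLinearMap.smulRight_apply, smul_eq_mul]
      have h1 := hcon u
      have h2 := hG.isInner.pos u hu
      nlinarith [mul_pos h2 (show 0 < b ^ 2 - a ^ 2 by nlinarith)]
  have hT : ∀ᶠ y in 𝓝[halfSpace n] x, ∀ v,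
      fderivWithin ℝ f (halfSpace n) y v ^ 2 ≤ b ^ 2 * inChart g.inner q y v v := by
    filter_upwards [hTc.eventually hTx.eventually, hG.inner] with y h1 h2 v
    have h3 := h1 fun u v => by
      simp only [T, sub_apply, smul_apply, ContinuousLinearMap.smulRight_apply, smul_eq_mul,
        h2.symm u v]
      ring
    by_cases hv : v = 0
    · simp [hv]
    have h4 := h3.pos v hv
    simp only [T, sub_apply, smul_apply, ContinuousLinearMap.smulRight_apply, smul_eq_mul] at h4
    nlinarith
  have hM : ∀ᶠ p in 𝓝 q, p ∈ tube g r ∧ ∀ v,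
      differential (normalCoord g) p v ^ 2 ≤ b ^ 2 * g.inner p v v := by
    filter_upwards [(tendsto_chart hs).eventually hT, (isOpen_tube g r).mem_nhds hqt,
      (isOpen_extChartAt_source (I := 𝓡∂ n) q).mem_nhds hs] with p h1 h2 h3
    refine ⟨h2, fun v => ?_⟩
    obtain ⟨w, rfl⟩ := (chartFrame_bijective h3).2 v
    have h4 := h1 w
    rw [hf, show normalCoordIn g q = normalCoord g ∘ (extChartAt (𝓡∂ n) q).symm from rfl,
      fderivWithin_comp_chart (contMDiffAt_normalCoord g hr h2) h3, inChart, pullBilin_apply,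
      (extChartAt (𝓡∂ n) q).left_inv h3] at h4
    exact h4
  obtain ⟨c₀, hc₀, hball⟩ := exists_metricEDist_lt_subset g hM
  obtain ⟨c, hc, hcc⟩ : ∃ c : ℝ, 0 < c ∧ ENNReal.ofReal c ≤ c₀ := by
    refine ⟨(min c₀ 1).toReal, ENNReal.toReal_pos (by simp [hc₀.ne'])
      ((min_le_right _ _).trans_lt ENNReal.one_lt_top).ne, ?_⟩
    rw [ENNReal.ofReal_toReal ((min_le_right _ _).trans_lt ENNReal.one_lt_top).ne]
    exact min_le_left _ _
  -- an interior point close to `q`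
  obtain ⟨p, hpc, hpb⟩ : ∃ p, metricEDist g q p < ENNReal.ofReal (c / 4)
      ∧ p ∉ (𝓡∂ n).boundary M := by
    have h1 := eventually_metricEDist_lt g q (c := ENNReal.ofReal (c / 4))
      (ENNReal.ofReal_pos.2 (by positivity))
    have h2 := (tendsto_ray (v := stdVec 0) (chart_mem q q) (by simp [stdVec])).eventually
      (eventually_chart hs h1)
    obtain ⟨t, ⟨h3, h4⟩, h5⟩ := ((h2.filter_mono (nhdsWithin_mono _ Ioi_subset_Ici_self)).and
      (self_mem_nhdsWithin : Ioi (0 : ℝ) ∈ 𝓝[>] 0)).exists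
    refine ⟨_, h4, fun h6 => ?_⟩
    rw [mem_boundary_iff ((extChartAt (𝓡∂ n) q).map_target h3),
      (extChartAt (𝓡∂ n) q).right_inv h3] at h6
    rw [mem_boundary_iff hs] at hq
    simp only [PiLp.add_apply, PiLp.smul_apply, smul_eq_mul, hq, stdVec] at h6
    simp at h6
    exact (ne_of_gt h5) h6
  have hpt : p ∈ tube g r := (hball (hpc.trans_le ((ENNReal.ofReal_le_ofReal (by linarith)).trans
    hcc))).1
  have hd0 := normalCoord_pos g hpt hpb
  set d := normalCoord g p with hd
  have hdE : boundaryEDist g p = ENNReal.ofReal d := (ofReal_normalCoord g hpt).symm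
  have hdc : d < c / 4 := by
    have := boundaryEDist_le_add g p q
    rw [boundaryEDist_of_mem g hq, add_zero, hdE, metricEDist_comm] at this
    exact (ENNReal.ofReal_lt_ofReal_iff (by positivity)).1 (this.trans_lt hpc)
  -- a boundary point at distance less than `k d`, where `1 < k ≤ 2` and `b k < 1`
  set k := 2 / (1 + b) with hk
  have hk1 : 1 < k := by rw [hk, lt_div_iff₀ (by positivity)]; linarith
  have hk2 : k ≤ 2 := by rw [hk, div_le_iff₀ (by positivity)]; linarith
  have hbk : b * k < 1 := by
    rw [hk, mul_div_assoc', div_lt_one (by positivity)]; linarith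
  obtain ⟨e, he, hpe⟩ : ∃ e ∈ (𝓡∂ n).boundary M, metricEDist g p e < ENNReal.ofReal (k * d) := by
    have : boundaryEDist g p < ENNReal.ofReal (k * d) := by
      rw [hdE]
      exact (ENNReal.ofReal_lt_ofReal_iff (by positivity)).2 (by nlinarith)
    rw [boundaryEDist_eq] at this
    simpa [iInf_lt_iff] using this
  have hsub : ∀ p', metricEDist g p p' < ENNReal.ofReal (k * d) → metricEDist g q p' < c₀ := by
    intro p' hp'
    refine lt_of_lt_of_le ?_ hcc
    calc metricEDist g q p' ≤ metricEDist g q p + metricEDist g p p' := metricEDist_triangle g q p p'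
      _ < ENNReal.ofReal (c / 4) + ENNReal.ofReal (k * d) := ENNReal.add_lt_add hpc hp'
      _ = ENNReal.ofReal (c / 4 + k * d) := (ENNReal.ofReal_add (by positivity) (by positivity)).symm
      _ ≤ ENNReal.ofReal c := ENNReal.ofReal_le_ofReal (by nlinarith)
  -- along a curve to that point `x^n` falls from `d` to `0`, but by at most `b k d < d`
  have hfin := abs_sub_le_of_differential_le g (u := normalCoord g) hb0.le ENNReal.ofReal_ne_top
    (fun p' hp' => contMDiffAt_normalCoord g hr (hball (hsub p' hp')).1)
    (fun p' hp' => (hball (hsub p' hp')).2) hpe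
  rw [normalCoord_of_mem g he, zero_sub, abs_neg, ← hd, abs_of_pos hd0,
    ENNReal.toReal_ofReal (by positivity)] at hfin
  nlinarith

/-- The gradient of the distance to the boundary has norm one on the boundary. -/
theorem fderivWithin_normalCoordIn_gradient [T2Space M] :
    fderivWithin ℝ (normalCoordIn g q) (halfSpace n) (extChartAt (𝓡∂ n) q q)
      ((inChart g.inner q (extChartAt (𝓡∂ n) q q)).inverse
        (fderivWithin ℝ (normalCoordIn g q) (halfSpace n) (extChartAt (𝓡∂ n) q q))) = 1 := by
  have hG : IsInner (inChart g.inner q (extChartAt (𝓡∂ n) q q)) := by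
    rw [inChart_self]; exact SmoothMetric.isInner g q
  have h1 := fderivWithin_normalCoordIn_sq_le hr hq
  have h2 := fun (a : ℝ) => exists_lt_fderivWithin_normalCoordIn_sq (a := a) hr hq
  generalize fderivWithin ℝ (normalCoordIn g q) (halfSpace n) (extChartAt (𝓡∂ n) q q) = φ at h1 h2 ⊢
  generalize inChart g.inner q (extChartAt (𝓡∂ n) q q) = G at hG h1 h2 ⊢
  have hw : ∀ v, G (G.inverse φ) v = φ v := fun v => by rw [hG.apply_inverse]
  have h3 := h1 (G.inverse φ)
  rw [hw] at h3
  have h4 : φ (G.inverse φ) ≤ 1 := by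
    by_contra! h
    nlinarith
  have h0 : 0 ≤ φ (G.inverse φ) := (sq_nonneg _).trans h3
  refine le_antisymm h4 (not_lt.1 fun h5 => ?_)
  -- otherwise the norm of `φ` itself is an admissible bound `a < 1`
  obtain ⟨v, hv⟩ := h2 (√(φ (G.inverse φ))) (Real.sqrt_nonneg _)
    ((Real.sqrt_lt' one_pos).2 (by simpa using h5))
  rw [Real.sq_sqrt h0] at hv
  have h6 := hG.cauchy_schwarz (G.inverse φ) v
  rw [hw, hw] at h6
  exact absurd hv (not_lt.2 h6)

end Boundary

end NormalDerivative

/-! ### The unit normal of the boundary of the half-space -/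

section UnitNormal

variable {n : ℕ} [NeZero n]

/-- The first coordinate, which vanishes on the boundary of the half-space. -/
def firstCoord (n : ℕ) [NeZero n] : EuclideanSpace ℝ (Fin n) →L[ℝ] ℝ := EuclideanSpace.proj 0

@[simp] theorem firstCoord_apply (v : EuclideanSpace ℝ (Fin n)) : firstCoord n v = v 0 := rfl

/-- The inward unit normal of the boundary of the half-space with respect to `G`. -/
def unitNormal (G : Bilin (EuclideanSpace ℝ (Fin n))) : EuclideanSpace ℝ (Fin n) :=
  (√(firstCoord n (G.inverse (firstCoord n))))⁻¹ • G.inverse (firstCoord n)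

variable {G : Bilin (EuclideanSpace ℝ (Fin n))}

theorem IsInner.inverse_firstCoord_pos (hG : IsInner G) :
    0 < firstCoord n (G.inverse (firstCoord n)) := by
  have h : G.inverse (firstCoord n) ≠ 0 := by
    intro h
    have h1 := hG.apply_inverse (firstCoord n)
    rw [h, map_zero] at h1
    have := DFunLike.congr_fun h1 (stdVec 0)
    simp [stdVec] at this
  have := hG.pos _ h
  rwa [hG.apply_inverse] at this

theorem IsInner.unitNormal_apply (hG : IsInner G) (v : EuclideanSpace ℝ (Fin n)) :
    G (unitNormal G) v = (√(firstCoord n (G.inverse (firstCoord n))))⁻¹ * v 0 := by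
  rw [unitNormal, map_smul, smul_apply, hG.apply_inverse, smul_eq_mul]
  rfl

theorem IsInner.unitNormal_tangent (hG : IsInner G) {v : EuclideanSpace ℝ (Fin n)} (hv : v 0 = 0) :
    G (unitNormal G) v = 0 := by
  rw [hG.unitNormal_apply, hv, mul_zero]

theorem IsInner.unitNormal_zero_pos (hG : IsInner G) : 0 < unitNormal G 0 := by
  have h := hG.inverse_firstCoord_pos
  have : unitNormal G 0 = (√(firstCoord n (G.inverse (firstCoord n))))⁻¹
    * firstCoord n (G.inverse (firstCoord n)) := rfl
  rw [this]
  have := Real.sqrt_pos.2 h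
  positivity

theorem IsInner.unitNormal_unit (hG : IsInner G) : G (unitNormal G) (unitNormal G) = 1 := by
  have h := hG.inverse_firstCoord_pos
  have h1 : unitNormal G 0 = (√(firstCoord n (G.inverse (firstCoord n))))⁻¹
    * firstCoord n (G.inverse (firstCoord n)) := rfl
  rw [hG.unitNormal_apply, h1, ← mul_assoc, ← mul_inv, Real.mul_self_sqrt h.le,
    inv_mul_cancel₀ h.ne']

/-- The inward unit normal is the only inward pointing unit vector which is orthogonal to the
boundary. -/
theorem IsInner.eq_unitNormal (hG : IsInner G) {v : EuclideanSpace ℝ (Fin n)}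
    (h0 : 0 ≤ v 0) (h1 : G v v = 1) (hv : ∀ w : EuclideanSpace ℝ (Fin n), w 0 = 0 → G v w = 0) :
    v = unitNormal G := by
  have hp := hG.unitNormal_zero_pos
  set c := v 0 / unitNormal G 0 with hc
  have hc0 : 0 ≤ c := div_nonneg h0 hp.le
  have ht : (v - c • unitNormal G) 0 = 0 := by
    simp only [PiLp.sub_apply, PiLp.smul_apply, smul_eq_mul, hc]
    field_simp
    ring
  have e : v - c • unitNormal G = 0 := by
    by_contra hne
    have h2 := hG.pos _ hne
    rw [map_sub, hG.symm _ v, hv _ ht, map_smul, hG.symm _ (unitNormal G),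
      hG.unitNormal_tangent ht] at h2
    simp at h2
  have e2 : v = c • unitNormal G := sub_eq_zero.1 e
  rw [e2, map_smul, map_smul, smul_apply, hG.unitNormal_unit] at h1
  have : c = 1 := by
    simp only [smul_eq_mul] at h1
    nlinarith
  rw [e2, this, one_smul]

/-- The inward unit normal is preserved by linear isometries which preserve the half-space. -/
theorem IsInner.map_unitNormal (hG : IsInner G)
    {A : EuclideanSpace ℝ (Fin n) →L[ℝ] EuclideanSpace ℝ (Fin n)} (hA : Function.Bijective A)
    {c : ℝ} (hc : 0 < c) (hA0 : ∀ v, A v 0 = c * v 0) :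
    A (unitNormal (Gluing.pullBilin A G)) = unitNormal G := by
  have hP : IsInner (Gluing.pullBilin A G) := hG.pullBilin hA.1
  refine hG.eq_unitNormal ?_ hP.unitNormal_unit fun w hw => ?_
  · rw [hA0]
    exact (mul_pos hc hP.unitNormal_zero_pos).le
  · obtain ⟨v, rfl⟩ := hA.2 w
    have hv : v 0 = 0 := by
      rw [hA0] at hw
      exact (mul_eq_zero.1 hw).resolve_left hc.ne'
    exact hP.unitNormal_tangent hv

theorem ContDiffWithinAt.unitNormal {X : Type*} [NormedAddCommGroup X] [NormedSpace ℝ X]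
    {G : X → Bilin (EuclideanSpace ℝ (Fin n))} {s : Set X} {x : X} (hG : IsInner (G x))
    {k : WithTop ℕ∞} (h : ContDiffWithinAt ℝ k G s x) :
    ContDiffWithinAt ℝ k (fun y => unitNormal (G y)) s x := by
  have h1 : ContDiffWithinAt ℝ k (fun y => (G y).inverse (firstCoord n)) s x :=
    (hG.contDiffAt_inverse.comp_contDiffWithinAt x h).clm_apply contDiffWithinAt_const
  have h2 : ContDiffWithinAt ℝ k (fun y => firstCoord n ((G y).inverse (firstCoord n))) s x :=
    (firstCoord n).contDiff.comp_contDiffWithinAt h1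
  have h3 := hG.inverse_firstCoord_pos
  exact ((h2.sqrt h3.ne').inv (Real.sqrt_pos.2 h3).ne').smul h1

/-- A linear map which preserves the half-space multiplies the first coordinate by a positive
factor. -/
theorem exists_firstCoord_eq {A : EuclideanSpace ℝ (Fin n) →L[ℝ] EuclideanSpace ℝ (Fin n)}
    (hA : Function.Surjective A) (h : ∀ v : EuclideanSpace ℝ (Fin n), 0 ≤ v 0 → 0 ≤ A v 0) :
    ∃ c > 0, ∀ v, A v 0 = c * v 0 := by
  have h0 : ∀ v : EuclideanSpace ℝ (Fin n), v 0 = 0 → A v 0 = 0 := by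
    intro v hv
    have h1 := h v hv.ge
    have h2 := h (-v) (by simp [hv])
    simp only [map_neg, PiLp.neg_apply] at h2
    linarith
  have key : ∀ v, A v 0 = A (stdVec 0) 0 * v 0 := by
    intro v
    have h1 := h0 (v - v 0 • stdVec 0) (by simp [stdVec])
    simp only [map_sub, map_smul, PiLp.sub_apply, PiLp.smul_apply, smul_eq_mul] at h1
    linarith
  refine ⟨A (stdVec 0) 0, lt_of_le_of_ne (h _ (by simp [stdVec])) fun hne => ?_, key⟩
  obtain ⟨v, hv⟩ := hA (stdVec 0)
  have := key v
  rw [hv, ← hne] at this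
  simp [stdVec] at this

end UnitNormal

/-! ### The Hessian of a map into a Riemannian manifold -/

section Hessian

variable {V V' W W' : Type*} [NormedAddCommGroup V] [NormedSpace ℝ V] [NormedAddCommGroup V']
  [NormedSpace ℝ V'] [NormedAddCommGroup W] [NormedSpace ℝ W] [NormedAddCommGroup W']
  [NormedSpace ℝ W']

/-- The Hessian of a map `Ψ` from the flat set `t` to the Riemannian set `(s, G)`. -/
def hessian (s : Set V) (G : V → Bilin V) (t : Set W) (Ψ : W → V) (x : W) (u v : W) : V :=
  connection s G (Ψ x) (fderivWithin ℝ Ψ t x u) (fderivWithin ℝ Ψ t x v)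
    + fderivWithin ℝ (fderivWithin ℝ Ψ t) t x u v

theorem covHessian_eq_hessian_sub (s : Set V) (G : V → Bilin V) (t : Set W) (γ : W → Bilin W)
    (Ψ : W → V) (x u v : W) : covHessian s G t γ Ψ x u v
      = hessian s G t Ψ x u v - fderivWithin ℝ Ψ t x (connection t γ x u v) := rfl

variable {s : Set V} {t : Set W} {Φ : V → V'} {Ψ : W → V} {x : W}

theorem eventually_fderivWithin_comp (ht : IsBody t) (hx : x ∈ t)
    (hΨx : Ψ x ∈ s) (hΦ : ContDiffWithinAt ℝ ∞ Φ s (Ψ x)) (hΨ : ContDiffWithinAt ℝ ∞ Ψ t x)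
    (hm : ∀ᶠ y in 𝓝[t] x, Ψ y ∈ s) :
    ∀ᶠ y in 𝓝[t] x, fderivWithin ℝ (Φ ∘ Ψ) t y
      = (fderivWithin ℝ Φ s (Ψ y)) ∘L (fderivWithin ℝ Ψ t y) := by
  have hΨt : Tendsto Ψ (𝓝[t] x) (𝓝[s] (Ψ x)) :=
    tendsto_nhdsWithin_iff.2 ⟨hΨ.continuousWithinAt, hm⟩
  filter_upwards [hΨt.eventually (eventually_contDiffWithinAt_two hΨx hΦ),
    eventually_contDiffWithinAt_two hx hΨ, self_mem_nhdsWithin,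
    eventually_eventually_nhdsWithin.2 hm] with y h1 h2 h3 h4
  exact (hasFDerivWithinAt_comp_eventually
    (h1.differentiableWithinAt (by simp)).hasFDerivWithinAt
    (h2.differentiableWithinAt (by simp)).hasFDerivWithinAt h4).fderivWithin (ht.uniqueDiffOn y h3)

theorem second_fderivWithin_comp (hs : IsBody s) (ht : IsBody t) (hx : x ∈ t)
    (hΨx : Ψ x ∈ s) (hΦ : ContDiffWithinAt ℝ ∞ Φ s (Ψ x)) (hΨ : ContDiffWithinAt ℝ ∞ Ψ t x)
    (hm : ∀ᶠ y in 𝓝[t] x, Ψ y ∈ s) (u v : W) :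
    fderivWithin ℝ (fderivWithin ℝ (Φ ∘ Ψ) t) t x u v
      = fderivWithin ℝ (fderivWithin ℝ Φ s) s (Ψ x) (fderivWithin ℝ Ψ t x u)
          (fderivWithin ℝ Ψ t x v)
        + fderivWithin ℝ Φ s (Ψ x) (fderivWithin ℝ (fderivWithin ℝ Ψ t) t x u v) := by
  have h1 := eventually_fderivWithin_comp ht hx hΨx hΦ hΨ hm
  have h2 := ((contDiffWithinAt_fderivWithin hs hΨx hΦ).differentiableWithinAt
    (by simp)).hasFDerivWithinAt
  have h3 := ((contDiffWithinAt_fderivWithin ht hx hΨ).differentiableWithinAt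
    (by simp)).hasFDerivWithinAt
  have h4 := (hΨ.differentiableWithinAt (by simp)).hasFDerivWithinAt
  have h5 := (hasFDerivWithinAt_comp_eventually h2 h4 hm).clm_comp h3
  have h6 := h5.congr_of_eventuallyEq (h1.mono fun y hy => hy) (h1.self_of_nhdsWithin hx)
  rw [h6.fderivWithin (ht.uniqueDiffOn x hx)]
  simp
  abel

theorem hessian_congr {G : V → Bilin V} {Ψ' : W → V} (hx : x ∈ t) (h : Ψ =ᶠ[𝓝[t] x] Ψ') (u v : W) :
    hessian s G t Ψ x u v = hessian s G t Ψ' x u v := by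
  have h1 : fderivWithin ℝ Ψ t =ᶠ[𝓝[t] x] fderivWithin ℝ Ψ' t := h.fderivWithin
  rw [hessian, hessian, h.eq_of_nhdsWithin hx, h1.eq_of_nhdsWithin hx,
    h1.fderivWithin_eq (h1.eq_of_nhdsWithin hx)]

/-- Composition with a map `Φ` whose covariant Hessian vanishes, such as a change of coordinates. -/
theorem hessian_comp_left {s' : Set V'} {G' : V' → Bilin V'} {G : V → Bilin V} (hs : IsBody s)
    (ht : IsBody t) (hx : x ∈ t) (hΨx : Ψ x ∈ s) (hΦ : ContDiffWithinAt ℝ ∞ Φ s (Ψ x))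
    (hΨ : ContDiffWithinAt ℝ ∞ Ψ t x) (hm : ∀ᶠ y in 𝓝[t] x, Ψ y ∈ s)
    (h0 : ∀ a b, covHessian s' G' s G Φ (Ψ x) a b = 0) (u v : W) :
    hessian s' G' t (Φ ∘ Ψ) x u v = fderivWithin ℝ Φ s (Ψ x) (hessian s G t Ψ x u v) := by
  have h1 := h0 (fderivWithin ℝ Ψ t x u) (fderivWithin ℝ Ψ t x v)
  rw [covHessian_eq_hessian_sub, hessian, sub_eq_zero] at h1
  rw [hessian, second_fderivWithin_comp hs ht hx hΨx hΦ hΨ hm,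
    (eventually_fderivWithin_comp ht hx hΨx hΦ hΨ hm).self_of_nhdsWithin hx, hessian, map_add,
    ← h1]
  simp [add_assoc]

theorem hessian_comp_right {s' : Set V'} {G' : V' → Bilin V'} (hs : IsBody s)
    (ht : IsBody t) (hx : x ∈ t) (hΨx : Ψ x ∈ s) (hΦ : ContDiffWithinAt ℝ ∞ Φ s (Ψ x))
    (hΨ : ContDiffWithinAt ℝ ∞ Ψ t x) (hm : ∀ᶠ y in 𝓝[t] x, Ψ y ∈ s) (u v : W) :
    hessian s' G' t (Φ ∘ Ψ) x u v
      = hessian s' G' s Φ (Ψ x) (fderivWithin ℝ Ψ t x u) (fderivWithin ℝ Ψ t x v)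
        + fderivWithin ℝ Φ s (Ψ x) (fderivWithin ℝ (fderivWithin ℝ Ψ t) t x u v) := by
  rw [hessian, second_fderivWithin_comp hs ht hx hΨx hΦ hΨ hm,
    (eventually_fderivWithin_comp ht hx hΨx hΦ hΨ hm).self_of_nhdsWithin hx, hessian]
  simp [add_assoc]

end Hessian

/-! ### The second fundamental form of the boundary in charts -/

/-- A change of coordinates preserves the half-space, to first order, at boundary points. -/
theorem transition_firstCoord {n : ℕ} [NeZero n] {M : Type*} [TopologicalSpace M]
    [ChartedSpace (EuclideanHalfSpace n) M] [IsManifold (𝓡∂ n) ∞ M] {p q b : M}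
    (hb : b ∈ (𝓡∂ n).boundary M)
    (hp : b ∈ (extChartAt (𝓡∂ n) p).source) (hq : b ∈ (extChartAt (𝓡∂ n) q).source) :
    ∃ c > 0, ∀ v, fderivWithin ℝ (transition (n := n) p q) (halfSpace n)
      (extChartAt (𝓡∂ n) p b) v 0 = c * v 0 := by
  refine exists_firstCoord_eq ?_ fun v hv => ?_
  · rw [fderivWithin_transition]
    exact (tangentCoordChange_bijective hp hq).2
  · have hd := (contDiffWithinAt_transition (n := n) hp hq).differentiableWithinAt (by simp)
    have hd0 : HasFDerivWithinAt (fun x => transition (n := n) p q x 0) (firstCoord n ∘L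
        fderivWithin ℝ (transition (n := n) p q) (halfSpace n) (extChartAt (𝓡∂ n) p b))
        (halfSpace n) (extChartAt (𝓡∂ n) p b) :=
      (firstCoord n).hasFDerivAt.comp_hasFDerivWithinAt _ hd.hasFDerivWithinAt
    have h1 := hasDerivWithinAt_ray (chart_mem p b) hd0.differentiableWithinAt hv
    rw [hd0.fderivWithin (isBody_halfSpace.uniqueDiffOn _ (chart_mem p b))] at h1
    refine ge_of_hasDerivWithinAt_Ici h1 (.of_forall fun t => ?_)
    have e : transition (n := n) p q (extChartAt (𝓡∂ n) p b + (0 : ℝ) • v) 0 = 0 := by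
      rw [zero_smul, add_zero, transition, Function.comp_apply,
        (extChartAt (𝓡∂ n) p).left_inv hp]
      exact (mem_boundary_iff hq).1 hb
    simp only [e, zero_mul, add_zero]
    exact mem_halfSpace.1 (transition_mem p q _)

/-- The second fundamental form, in terms of the connection and the unit normal. -/
theorem secondFundamentalForm_eq {n : ℕ} [NeZero n] {M : Type*} [TopologicalSpace M]
    [ChartedSpace (EuclideanHalfSpace n) M] [IsManifold (𝓡∂ n) ∞ M] {g : TensorField n M} {p : M}
    (hg : IsMetricNear g p) (X Y : EuclideanSpace ℝ (Fin n)) : secondFundamentalForm g p X Y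
      = inChart g p (extChartAt (𝓡∂ n) p p)
        (connection (halfSpace n) (inChart g p) (extChartAt (𝓡∂ n) p p) X Y)
        (unitNormal (inChart g p (extChartAt (𝓡∂ n) p p))) := by
  have hm := hg.isMetricAt (mem_extChartAt_source p)
  have hN : ∀ l, inwardNormal g p l
      = unitNormal (inChart g p (extChartAt (𝓡∂ n) p p)) l := by
    intro l
    have h1 : ∀ k, invCoeff g p k 0 (extChartAt (𝓡∂ n) p p)
        = ((inChart g p (extChartAt (𝓡∂ n) p p)).inverse (firstCoord n)) k := by
      intro k
      rw [hm.isInner.inverse_component, invCoeff_eq]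
      simp [stdVec]
    rw [inwardNormal, h1, h1, unitNormal, PiLp.smul_apply, smul_eq_mul, div_eq_inv_mul]
    rfl
  have hB : ∀ k, ∑ i, ∑ j, christoffel g p k i j (extChartAt (𝓡∂ n) p p) * X i * Y j
      = connection (halfSpace n) (inChart g p) (extChartAt (𝓡∂ n) p p) X Y k := by
    intro k
    have h1 : connection (halfSpace n) (inChart g p) (extChartAt (𝓡∂ n) p p) X Y
        = ∑ i, X i • ∑ j, Y j • connection (halfSpace n) (inChart g p) (extChartAt (𝓡∂ n) p p)
            (stdVec i) (stdVec j) := by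
      rw [map_eq_sum_stdVec (connection (halfSpace n) (inChart g p) (extChartAt (𝓡∂ n) p p)) X,
        sum_apply]
      refine Finset.sum_congr rfl fun i _ => ?_
      rw [smul_apply, map_eq_sum_stdVec (connection (halfSpace n) (inChart g p)
        (extChartAt (𝓡∂ n) p p) (stdVec i)) Y]
    rw [h1]
    simp only [christoffel_eq hm.mem hm.differentiableWithinAt hm.isInner, Finset.sum_apply,
      PiLp.smul_apply, smul_eq_mul, Finset.mul_sum, WithLp.ofLp_sum]
    refine Finset.sum_congr rfl fun i _ => Finset.sum_congr rfl fun j _ => ?_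
    ring
  simp only [secondFundamentalForm, hN, hB, coeff_eq]
  conv_rhs => rw [map_eq_sum_stdVec (inChart g p (extChartAt (𝓡∂ n) p p)), sum_apply]
  refine Finset.sum_congr rfl fun k _ => ?_
  rw [smul_apply, map_eq_sum_stdVec (inChart g p (extChartAt (𝓡∂ n) p p) (stdVec k)),
    smul_eq_mul, Finset.mul_sum]
  refine Finset.sum_congr rfl fun l _ => ?_
  rw [smul_eq_mul]
  ring

section Embedding

variable {m : ℕ} {Γ : Type*} [TopologicalSpace Γ] [ChartedSpace (EuclideanSpace ℝ (Fin m)) Γ]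
  {M : Type*} [TopologicalSpace M] [ChartedSpace (EuclideanHalfSpace (m + 1)) M]

/-- The map `ι` in the charts at `y` and `ι y`. -/
def boundaryChart (ι : Γ → M) (y : Γ) (x : EuclideanSpace ℝ (Fin m)) :
    EuclideanSpace ℝ (Fin (m + 1)) :=
  extChartAt (𝓡∂ (m + 1)) (ι y) (ι ((extChartAt (𝓡 m) y).symm x))

/-- The change of coordinates of a manifold without boundary. -/
def closedTransition (y y' : Γ) (x : EuclideanSpace ℝ (Fin m)) : EuclideanSpace ℝ (Fin m) :=
  extChartAt (𝓡 m) y' ((extChartAt (𝓡 m) y).symm x)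

theorem closedTransition_apply {y₀ y : Γ} (hy : y ∈ (extChartAt (𝓡 m) y₀).source) :
    closedTransition y₀ y (extChartAt (𝓡 m) y₀ y) = extChartAt (𝓡 m) y y := by
  rw [closedTransition, (extChartAt (𝓡 m) y₀).left_inv hy]

theorem contDiffWithinAt_closedTransition [IsManifold (𝓡 m) ∞ Γ] {y₀ y : Γ}
    (hy : y ∈ (extChartAt (𝓡 m) y₀).source) :
    ContDiffWithinAt ℝ ∞ (closedTransition (m := m) y₀ y) univ (extChartAt (𝓡 m) y₀ y) := by
  have := contDiffWithinAt_ext_coord_change (I := 𝓡 m) (n := ∞) y y₀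
    (y := extChartAt (𝓡 m) y₀ y) ?_
  · rw [ModelWithCorners.range_eq_univ] at this
    exact this
  · rw [PartialEquiv.trans_source]
    refine ⟨(extChartAt (𝓡 m) y₀).map_source hy, ?_⟩
    change (extChartAt (𝓡 m) y₀).symm (extChartAt (𝓡 m) y₀ y) ∈ (extChartAt (𝓡 m) y).source
    rw [(extChartAt (𝓡 m) y₀).left_inv hy]
    exact mem_extChartAt_source y

variable {ι : Γ → M}

theorem eventually_closedChart {y₀ y : Γ} (hy : y ∈ (extChartAt (𝓡 m) y₀).source) {P : Γ → Prop}
    (h : ∀ᶠ z in 𝓝 y, P z) : ∀ᶠ x in 𝓝[univ] (extChartAt (𝓡 m) y₀ y),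
      x ∈ (extChartAt (𝓡 m) y₀).target ∧ P ((extChartAt (𝓡 m) y₀).symm x) := by
  rw [nhdsWithin_univ]
  refine Filter.Eventually.and ?_ ?_
  · exact (isOpen_extChartAt_target y₀).mem_nhds ((extChartAt (𝓡 m) y₀).map_source hy)
  · have := (continuousAt_extChartAt_symm' (I := 𝓡 m) hy).tendsto
    rw [(extChartAt (𝓡 m) y₀).left_inv hy] at this
    exact this.eventually h

variable (hι : IsBoundaryEmbedding m ι)
include hι

theorem IsBoundaryEmbedding.mem_boundary (y : Γ) : ι y ∈ (𝓡∂ (m + 1)).boundary M := by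
  rw [← hι.range_eq]; exact ⟨y, rfl⟩

theorem IsBoundaryEmbedding.mfderiv_eq (y : Γ) : mfderiv (𝓡 m) (𝓡∂ (m + 1)) ι y
    = fderivWithin ℝ (boundaryChart ι y) univ (extChartAt (𝓡 m) y y) := by
  rw [MDifferentiableAt.mfderiv ((hι.smooth y).mdifferentiableAt (by simp)),
    ModelWithCorners.range_eq_univ]
  rfl

theorem IsBoundaryEmbedding.eventually_source {y₀ y : Γ}
    (hy' : ι y ∈ (extChartAt (𝓡∂ (m + 1)) (ι y₀)).source) :
    ∀ᶠ z in 𝓝 y, ι z ∈ (extChartAt (𝓡∂ (m + 1)) (ι y₀)).source :=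
  hι.smooth.continuous.continuousAt.eventually
    ((isOpen_extChartAt_source (I := 𝓡∂ (m + 1)) (ι y₀)).mem_nhds hy')

variable [IsManifold (𝓡 m) ∞ Γ] [IsManifold (𝓡∂ (m + 1)) ∞ M] {y₀ y : Γ}
  (hy : y ∈ (extChartAt (𝓡 m) y₀).source)
  (hy' : ι y ∈ (extChartAt (𝓡∂ (m + 1)) (ι y₀)).source)
include hy hy'

theorem IsBoundaryEmbedding.contDiffWithinAt :
    ContDiffWithinAt ℝ ∞ (boundaryChart ι y₀) univ (extChartAt (𝓡 m) y₀ y) := by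
  have h := hι.smooth y
  rw [extChartAt_source] at hy hy'
  rw [contMDiffAt_iff_of_mem_source hy hy', ModelWithCorners.range_eq_univ] at h
  exact h.2

omit [IsManifold (𝓡 m) ∞ Γ] in
theorem IsBoundaryEmbedding.eventually_firstCoord :
    ∀ᶠ x in 𝓝[univ] (extChartAt (𝓡 m) y₀ y), boundaryChart ι y₀ x 0 = 0 := by
  filter_upwards [eventually_closedChart hy (hι.eventually_source hy')] with x hx
  exact (mem_boundary_iff hx.2).1 (hι.mem_boundary _)

omit [IsManifold (𝓡 m) ∞ Γ] [IsManifold (𝓡∂ (m + 1)) ∞ M] hι hy hy' in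
theorem boundaryChart_mem (x : EuclideanSpace ℝ (Fin m)) :
    boundaryChart ι y₀ x ∈ halfSpace (m + 1) := chart_mem _ _

theorem IsBoundaryEmbedding.eventually_fderivWithin_firstCoord :
    ∀ᶠ x in 𝓝[univ] (extChartAt (𝓡 m) y₀ y), ∀ v,
      fderivWithin ℝ (boundaryChart ι y₀) univ x v 0 = 0 := by
  filter_upwards [eventually_eventually_nhdsWithin.2 (hι.eventually_firstCoord hy hy'),
    eventually_contDiffWithinAt_two (mem_univ _) (hι.contDiffWithinAt hy hy')] with x h1 h2 v
  have h3 := (firstCoord (m + 1)).hasFDerivAt.comp_hasFDerivWithinAt x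
    (h2.differentiableWithinAt (by simp)).hasFDerivWithinAt
  have h4 : HasFDerivWithinAt (fun x => boundaryChart ι y₀ x 0)
      (0 : EuclideanSpace ℝ (Fin m) →L[ℝ] ℝ) univ x :=
    (hasFDerivWithinAt_const (0 : ℝ) x univ).congr_of_eventuallyEq h1
      (h1.self_of_nhdsWithin (mem_univ x))
  exact DFunLike.congr_fun (uniqueDiffWithinAt_univ.eq h3 h4) v

theorem IsBoundaryEmbedding.second_firstCoord (u v : EuclideanSpace ℝ (Fin m)) :
    fderivWithin ℝ (fderivWithin ℝ (boundaryChart ι y₀) univ) univ (extChartAt (𝓡 m) y₀ y) u v 0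
      = 0 := by
  have h2 := contDiffWithinAt_fderivWithin isBody_univ (mem_univ _) (hι.contDiffWithinAt hy hy')
  have h3 := (firstCoord (m + 1)).hasFDerivAt.comp_hasFDerivWithinAt (extChartAt (𝓡 m) y₀ y)
    ((h2.differentiableWithinAt (by simp)).hasFDerivWithinAt.apply_const v)
  have h1 := hι.eventually_fderivWithin_firstCoord hy hy'
  have h4 : HasFDerivWithinAt (fun x => fderivWithin ℝ (boundaryChart ι y₀) univ x v 0)
      (0 : EuclideanSpace ℝ (Fin m) →L[ℝ] ℝ) univ (extChartAt (𝓡 m) y₀ y) :=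
    (hasFDerivWithinAt_const (0 : ℝ) _ univ).congr_of_eventuallyEq (h1.mono fun x hx => hx v)
      (h1.self_of_nhdsWithin (mem_univ _) v)
  exact DFunLike.congr_fun (uniqueDiffWithinAt_univ.eq h3 h4) u

omit [IsManifold (𝓡 m) ∞ Γ] [IsManifold (𝓡∂ (m + 1)) ∞ M] hι hy' in
theorem boundaryChart_apply :
    boundaryChart ι y₀ (extChartAt (𝓡 m) y₀ y) = extChartAt (𝓡∂ (m + 1)) (ι y₀) (ι y) := by
  rw [boundaryChart, (extChartAt (𝓡 m) y₀).left_inv hy]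

omit [IsManifold (𝓡 m) ∞ Γ] [IsManifold (𝓡∂ (m + 1)) ∞ M] in
theorem IsBoundaryEmbedding.boundaryChart_eq :
    ∀ᶠ x in 𝓝[univ] (extChartAt (𝓡 m) y₀ y), boundaryChart ι y₀ x
      = transition (ι y) (ι y₀) (boundaryChart ι y (closedTransition y₀ y x)) := by
  have hs := mem_extChartAt_source (I := 𝓡 m) y
  have hs' := mem_extChartAt_source (I := 𝓡∂ (m + 1)) (ι y)
  filter_upwards [eventually_closedChart hy (Filter.Eventually.and (hι.eventually_source hy')
    (Filter.Eventually.and (hι.eventually_source hs')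
      ((isOpen_extChartAt_source (I := 𝓡 m) y).mem_nhds hs)))] with x hx
  obtain ⟨-, h1, h2, h3⟩ := hx
  rw [boundaryChart, boundaryChart, closedTransition, transition, Function.comp_apply,
    (extChartAt (𝓡 m) y).left_inv h3, (extChartAt (𝓡∂ (m + 1)) (ι y)).left_inv h2]

omit hy' in
theorem IsBoundaryEmbedding.contDiffWithinAt_comp :
    ContDiffWithinAt ℝ ∞ (boundaryChart ι y ∘ closedTransition y₀ y) univ
      (extChartAt (𝓡 m) y₀ y) := by
  have h1 := hι.contDiffWithinAt (mem_extChartAt_source y) (mem_extChartAt_source (ι y))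
  rw [← closedTransition_apply hy] at h1
  exact h1.comp _ (contDiffWithinAt_closedTransition hy) (fun _ _ => mem_univ _)

/-- The derivative of `ι` in the charts at `y₀` and `ι y₀`, at another point `y`. -/
theorem IsBoundaryEmbedding.fderivWithin_eq (v : EuclideanSpace ℝ (Fin m)) :
    fderivWithin ℝ (boundaryChart ι y₀) univ (extChartAt (𝓡 m) y₀ y) v
      = fderivWithin ℝ (transition (ι y) (ι y₀)) (halfSpace (m + 1))
          (extChartAt (𝓡∂ (m + 1)) (ι y) (ι y))
          (fderivWithin ℝ (boundaryChart ι y) univ (extChartAt (𝓡 m) y y)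
            (fderivWithin ℝ (closedTransition y₀ y) univ (extChartAt (𝓡 m) y₀ y) v)) := by
  have hs := mem_extChartAt_source (I := 𝓡 m) y
  have hs' := mem_extChartAt_source (I := 𝓡∂ (m + 1)) (ι y)
  have e1 := closedTransition_apply hy
  have e2 : (boundaryChart ι y ∘ closedTransition y₀ y) (extChartAt (𝓡 m) y₀ y)
      = extChartAt (𝓡∂ (m + 1)) (ι y) (ι y) := by
    rw [Function.comp_apply, e1, boundaryChart_apply hs]
  have hT := contDiffWithinAt_transition (n := m + 1) hs' hy'
  have hΨ := hι.contDiffWithinAt hs hs'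
  have hθ := contDiffWithinAt_closedTransition hy
  rw [← e2] at hT
  rw [← e1] at hΨ
  have h1 := hι.boundaryChart_eq hy hy'
  have h2 : fderivWithin ℝ (boundaryChart ι y₀) univ (extChartAt (𝓡 m) y₀ y)
      = fderivWithin ℝ (transition (ι y) (ι y₀) ∘ (boundaryChart ι y ∘ closedTransition y₀ y)) univ
        (extChartAt (𝓡 m) y₀ y) :=
    Filter.EventuallyEq.fderivWithin_eq h1 (h1.self_of_nhdsWithin (mem_univ _))
  rw [h2, (eventually_fderivWithin_comp (Ψ := boundaryChart ι y ∘ closedTransition y₀ y) isBody_univ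
    (mem_univ _) (boundaryChart_mem _) hT
    (hι.contDiffWithinAt_comp hy) (.of_forall fun _ => boundaryChart_mem _)).self_of_nhdsWithin
      (mem_univ _), ContinuousLinearMap.comp_apply, e2,
    (eventually_fderivWithin_comp isBody_univ (mem_univ _) (mem_univ _) hΨ hθ
      (.of_forall fun _ => mem_univ _)).self_of_nhdsWithin (mem_univ _),
    ContinuousLinearMap.comp_apply, e1]

/-- Tensors on tangent vectors of the boundary, in the charts at `y₀` and `ι y₀`. -/
theorem IsBoundaryEmbedding.inChart_apply (h : TensorField (m + 1) M)
    (u v : EuclideanSpace ℝ (Fin m)) :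
    inChart h (ι y₀) (boundaryChart ι y₀ (extChartAt (𝓡 m) y₀ y))
        (fderivWithin ℝ (boundaryChart ι y₀) univ (extChartAt (𝓡 m) y₀ y) u)
        (fderivWithin ℝ (boundaryChart ι y₀) univ (extChartAt (𝓡 m) y₀ y) v)
      = h (ι y)
        (mfderiv (𝓡 m) (𝓡∂ (m + 1)) ι y
          (fderivWithin ℝ (closedTransition y₀ y) univ (extChartAt (𝓡 m) y₀ y) u))
        (mfderiv (𝓡 m) (𝓡∂ (m + 1)) ι y
          (fderivWithin ℝ (closedTransition y₀ y) univ (extChartAt (𝓡 m) y₀ y) v)) := by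
  have hs' := mem_extChartAt_source (I := 𝓡∂ (m + 1)) (ι y)
  have e := inChart_transition h hs' hy'
  rw [inChart_self] at e
  rw [hι.fderivWithin_eq hy hy', hι.fderivWithin_eq hy hy', hι.mfderiv_eq, boundaryChart_apply hy]
  generalize fderivWithin ℝ (closedTransition y₀ y) univ (extChartAt (𝓡 m) y₀ y) u = u'
  generalize fderivWithin ℝ (closedTransition y₀ y) univ (extChartAt (𝓡 m) y₀ y) v = v'
  generalize fderivWithin ℝ (boundaryChart ι y) univ (extChartAt (𝓡 m) y y) = A
  have e3 := DFunLike.congr_fun (DFunLike.congr_fun e (A u')) (A v')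
  exact e3.symm

/-- The second fundamental form of the boundary in the charts at `y₀` and `ι y₀`. -/
theorem IsBoundaryEmbedding.hessian_normal {g : TensorField (m + 1) M}
    (hg : IsMetricNear g (ι y)) (u v : EuclideanSpace ℝ (Fin m)) :
    inChart g (ι y₀) (boundaryChart ι y₀ (extChartAt (𝓡 m) y₀ y))
        (hessian (halfSpace (m + 1)) (inChart g (ι y₀)) univ (boundaryChart ι y₀)
          (extChartAt (𝓡 m) y₀ y) u v)
        (unitNormal (inChart g (ι y₀) (boundaryChart ι y₀ (extChartAt (𝓡 m) y₀ y))))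
      = boundaryForm g ι y
          (fderivWithin ℝ (closedTransition y₀ y) univ (extChartAt (𝓡 m) y₀ y) u)
          (fderivWithin ℝ (closedTransition y₀ y) univ (extChartAt (𝓡 m) y₀ y) v) := by
  have hs := mem_extChartAt_source (I := 𝓡 m) y
  have hs' := mem_extChartAt_source (I := 𝓡∂ (m + 1)) (ι y)
  have e1 := closedTransition_apply hy
  have e2 : (boundaryChart ι y ∘ closedTransition y₀ y) (extChartAt (𝓡 m) y₀ y)
      = extChartAt (𝓡∂ (m + 1)) (ι y) (ι y) := by
    rw [Function.comp_apply, e1, boundaryChart_apply hs]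
  have hT := contDiffWithinAt_transition (n := m + 1) hs' hy'
  have hΨ := hι.contDiffWithinAt hs hs'
  have hθ := contDiffWithinAt_closedTransition hy
  have hTi := (hg.isIsometricAt hs' hy').covHessian_eq_zero isBody_halfSpace
    (by rw [fderivWithin_transition]; exact (tangentCoordChange_bijective hs' hy').2)
  have hbij : Function.Bijective (fderivWithin ℝ (transition (n := m + 1) (ι y) (ι y₀))
      (halfSpace (m + 1)) (extChartAt (𝓡∂ (m + 1)) (ι y) (ι y))) := by
    rw [fderivWithin_transition]; exact tangentCoordChange_bijective hs' hy'
  have hG := (hg.isMetricAt hs').isInner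
  have hG' := (hg.isMetricAt hy').isInner
  obtain ⟨c, hc, hc'⟩ := transition_firstCoord (hι.mem_boundary y) hs' hy'
  have htan : ∀ w, fderivWithin ℝ (boundaryChart ι y) univ (extChartAt (𝓡 m) y y) w 0 = 0 :=
    (hι.eventually_fderivWithin_firstCoord hs hs').self_of_nhdsWithin (mem_univ _)
  have hsec := hι.second_firstCoord hs hs'
  have hpull := inChart_transition g hs' hy'
  rw [boundaryChart_apply hy, ← hG'.map_unitNormal hbij hc hc', ← hpull]
  have h1 := hι.boundaryChart_eq hy hy'
  rw [hessian_congr (x := extChartAt (𝓡 m) y₀ y) (mem_univ _) (Ψ' := transition (ι y) (ι y₀) ∘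
    (boundaryChart ι y ∘ closedTransition y₀ y)) h1]
  rw [← e2] at hT hTi
  rw [hessian_comp_left (Ψ := boundaryChart ι y ∘ closedTransition y₀ y) isBody_halfSpace
    isBody_univ (mem_univ _) (boundaryChart_mem _) hT
    (hι.contDiffWithinAt_comp hy) (.of_forall fun _ => boundaryChart_mem _) hTi]
  rw [← e1] at hΨ
  rw [hessian_comp_right isBody_univ isBody_univ (mem_univ _) (mem_univ _) hΨ hθ
      (.of_forall fun _ => mem_univ _), e2, e1]
  have h2 := DFunLike.congr_fun (DFunLike.congr_fun hpull
    (hessian (halfSpace (m + 1)) (inChart g (ι y)) univ (boundaryChart ι y) (extChartAt (𝓡 m) y y)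
      (fderivWithin ℝ (closedTransition y₀ y) univ (extChartAt (𝓡 m) y₀ y) u)
      (fderivWithin ℝ (closedTransition y₀ y) univ (extChartAt (𝓡 m) y₀ y) v)
    + fderivWithin ℝ (boundaryChart ι y) univ (extChartAt (𝓡 m) y y)
      (fderivWithin ℝ (fderivWithin ℝ (closedTransition y₀ y) univ) univ
        (extChartAt (𝓡 m) y₀ y) u v)))
    (unitNormal (inChart g (ι y) (extChartAt (𝓡∂ (m + 1)) (ι y) (ι y))))
  rw [pullBilin_apply] at h2
  refine h2.symm.trans ?_
  have h3 : ∀ X Y : EuclideanSpace ℝ (Fin m), boundaryForm g ι y X Y = secondFundamentalForm g (ι y)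
      (fderivWithin ℝ (boundaryChart ι y) univ (extChartAt (𝓡 m) y y) X)
      (fderivWithin ℝ (boundaryChart ι y) univ (extChartAt (𝓡 m) y y) Y) := by
    intro X Y
    rw [← hι.mfderiv_eq]
    rfl
  rw [h3, secondFundamentalForm_eq hg]
  rw [map_add, add_apply, hG.symm (fderivWithin ℝ (boundaryChart ι y) univ _ _),
    hG.unitNormal_tangent (htan _), hessian, map_add, add_apply,
    hG.symm (fderivWithin ℝ (fderivWithin ℝ (boundaryChart ι y) univ) univ _ _ _),
    hG.unitNormal_tangent (hsec _ _), boundaryChart_apply hs]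
  simp

end Embedding

/-! ### Comparison of three metrics with the same boundary -/

section Hypersurface

variable {V : Type*} [NormedAddCommGroup V] [NormedSpace ℝ V]
  {W : Type*} [NormedAddCommGroup W] [NormedSpace ℝ W]

/-- Near `x`, the map `Ψ` embeds the Riemannian set `(t, γ)` isometrically as a hypersurface of the
Riemannian set `(s, G)`, with unit normal field `N` and scalar second fundamental form `II`. -/
structure IsHypersurfaceAt (s : Set V) (G : V → Bilin V) (t : Set W) (γ : W → Bilin W)
    (Ψ : W → V) (N : W → V) (II : W → W → W → ℝ) (x : W) : Prop where
  isometric : IsIsometricAt s G t γ Ψ x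
  normal : DifferentiableWithinAt ℝ N t x
  unit : ∀ᶠ y in 𝓝[t] x, G (Ψ y) (N y) (N y) = 1
  orthogonal : ∀ a, G (Ψ x) (fderivWithin ℝ Ψ t x a) (N x) = 0
  hessian : ∀ᶠ y in 𝓝[t] x, ∀ u v, covHessian s G t γ Ψ y u v = II y u v • N y

/-- The frame of `V` which consists of the normal and of the image of a frame of `W`. -/
def normalFrame {m : ℕ} (N : V) (A : W →L[ℝ] V) (e : Fin m → W) : Fin (m + 1) → V :=
  Fin.cons N fun a => A (e a)

variable {s : Set V} {G : V → Bilin V} {t : Set W} {γ : W → Bilin W} {Ψ N : W → V}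
  {II : W → W → W → ℝ} {x : W}

theorem IsHypersurfaceAt.neg (h : IsHypersurfaceAt s G t γ Ψ N II x) :
    IsHypersurfaceAt s G t γ Ψ (fun y => - N y) (fun y u v => - II y u v) x where
  isometric := h.isometric
  normal := h.normal.neg
  unit := h.unit.mono fun y hy => by simpa using hy
  orthogonal a := by simpa using h.orthogonal a
  hessian := h.hessian.mono fun y hy u v => by simpa using hy u v

theorem IsHypersurfaceAt.gram_eq {m : ℕ} (h : IsHypersurfaceAt s G t γ Ψ N II x) (e : Fin m → W) :
    gram (G (Ψ x)) (normalFrame (N x) (fderivWithin ℝ Ψ t x) e) = fun i j =>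
      Fin.cases (Fin.cases (1 : ℝ) (fun _ => 0) j) (fun a => Fin.cases 0 (fun b => γ x (e a) (e b)) j)
        i := by
  have hx := h.isometric.source.mem
  have hs := h.isometric.target.isInner.symm
  ext i j
  refine Fin.cases (Fin.cases ?_ (fun b => ?_) j) (fun a => Fin.cases ?_ (fun b => ?_) j) i
  · exact h.unit.self_of_nhdsWithin hx
  · exact (hs _ _).trans (h.orthogonal (e b))
  · exact h.orthogonal (e a)
  · rw [h.isometric.pull.self_of_nhdsWithin hx]; rfl

variable [FiniteDimensional ℝ V] [FiniteDimensional ℝ W]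

theorem IsHypersurfaceAt.hasFDerivWithinAt (hs : IsBody s) (ht : IsBody t)
    (h : IsHypersurfaceAt s G t γ Ψ N II x) (u v : W) :
    DifferentiableWithinAt ℝ (fun y => II y u v) t x := by
  obtain ⟨S, hS, -⟩ := h.isometric.hasFDerivWithinAt_covHessian hs ht u v
  have hx := h.isometric.source.mem
  have h1 := ((hasFDerivWithinAt_comp_eventually
    h.isometric.target.differentiableWithinAt.hasFDerivWithinAt
    (h.isometric.smooth.differentiableWithinAt (by simp)).hasFDerivWithinAt
    h.isometric.mapsTo).clm_apply hS).clm_apply h.normal.hasFDerivWithinAt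
  have h2 : (fun y => II y u v) =ᶠ[𝓝[t] x]
      fun y => G (Ψ y) (covHessian s G t γ Ψ y u v) (N y) := by
    filter_upwards [h.unit, h.hessian] with y hy hy'
    simp [hy', hy]
  exact (h1.congr_of_eventuallyEq h2 (h2.eq_of_nhdsWithin hx)).differentiableWithinAt

theorem IsHypersurfaceAt.gauss (hs : IsBody s) (ht : IsBody t)
    (h : IsHypersurfaceAt s G t γ Ψ N II x) (u v w z : W) :
    curvature s G (Ψ x) (fderivWithin ℝ Ψ t x u) (fderivWithin ℝ Ψ t x v) (fderivWithin ℝ Ψ t x w)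
        (fderivWithin ℝ Ψ t x z)
      = curvature t γ x u v w z - II x u w * II x v z + II x v w * II x u z := by
  have hx := h.isometric.source.mem
  have h1 := h.hessian.self_of_nhdsWithin hx
  have h2 := h.unit.self_of_nhdsWithin hx
  rw [h.isometric.gauss hs ht]
  simp only [h1, map_smul, smul_apply, h2, smul_eq_mul, mul_one]
  ring

omit [FiniteDimensional ℝ W] in
theorem IsHypersurfaceAt.isCurvatureLike {m : ℕ} (hs : IsBody s)
    (h : IsHypersurfaceAt s G t γ Ψ N II x) (e : Fin m → V) :
    IsCurvatureLike fun i j k l => curvature s G (Ψ x) (e i) (e j) (e k) (e l) := by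
  have hG := h.isometric.target
  refine ⟨fun i j k l => curvatureOf_antisymm _ _ _ _ _ _ _, fun i j k l => ?_, fun i j k l => ?_⟩
  · exact hG.isInner.curvatureOf_antisymm' (hG.deriv_symm hs) (hG.second_deriv_symm hs)
      (fun a b v w => by rw [hG.second_deriv_symm' hs a b]) _ _ _ _
  · exact hG.isInner.curvatureOf_pair_symm (hG.deriv_symm hs) (hG.second_deriv_symm hs)
      (fun a b v w => by rw [hG.second_deriv_symm' hs a b]) _ _ _ _

/-- If the second fundamental form of a hypersurface is, for three ambient metrics which induce the
same metric on it, the combination `(1-τ) II₀ + τ II₁`, then the corresponding combination of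
curvatures is controlled by its values on the two-vectors `N ∧ w`: by the Gauss equation the
tangential part of the difference is `τ (1-τ)` times the square of `II₀ - II₁`, and by the Codazzi
equation the mixed terms cancel. -/
theorem IsHypersurfaceAt.frameForm_comparison {V₀ V₁ : Type*} [NormedAddCommGroup V₀]
    [NormedSpace ℝ V₀] [FiniteDimensional ℝ V₀] [NormedAddCommGroup V₁] [NormedSpace ℝ V₁]
    [FiniteDimensional ℝ V₁] {s₀ : Set V₀} {G₀ : V₀ → Bilin V₀} {Ψ₀ N₀ : W → V₀}
    {II₀ : W → W → W → ℝ} {s₁ : Set V₁} {G₁ : V₁ → Bilin V₁} {Ψ₁ N₁ : W → V₁}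
    {II₁ : W → W → W → ℝ} (hs : IsBody s) (hs₀ : IsBody s₀) (hs₁ : IsBody s₁) (ht : IsBody t)
    (h : IsHypersurfaceAt s G t γ Ψ N II x) (h₀ : IsHypersurfaceAt s₀ G₀ t γ Ψ₀ N₀ II₀ x)
    (h₁ : IsHypersurfaceAt s₁ G₁ t γ Ψ₁ N₁ II₁ x) {τ : ℝ} (hτ : τ ∈ Icc (0 : ℝ) 1)
    (hII : ∀ᶠ y in 𝓝[t] x, ∀ u v, II y u v = (1 - τ) * II₀ y u v + τ * II₁ y u v)
    {m : ℕ} (e : Fin m → W)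
    (hl : (Matrix.of fun a b => II₀ x (e a) (e b) - II₁ x (e a) (e b)).PosSemidef)
    {α : Matrix (Fin (m + 1)) (Fin (m + 1)) ℝ} (hα : α.transpose = -α) :
    frameForm (curvature s G (Ψ x)) (normalFrame (N x) (fderivWithin ℝ Ψ t x) e) (mixedPart α)
      - (1 - τ) * frameForm (curvature s₀ G₀ (Ψ₀ x))
          (normalFrame (N₀ x) (fderivWithin ℝ Ψ₀ t x) e) (mixedPart α)
      - τ * frameForm (curvature s₁ G₁ (Ψ₁ x))
          (normalFrame (N₁ x) (fderivWithin ℝ Ψ₁ t x) e) (mixedPart α)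
    ≤ frameForm (curvature s G (Ψ x)) (normalFrame (N x) (fderivWithin ℝ Ψ t x) e) α
      - (1 - τ) * frameForm (curvature s₀ G₀ (Ψ₀ x))
          (normalFrame (N₀ x) (fderivWithin ℝ Ψ₀ t x) e) α
      - τ * frameForm (curvature s₁ G₁ (Ψ₁ x))
          (normalFrame (N₁ x) (fderivWithin ℝ Ψ₁ t x) e) α := by
  have hx := h.isometric.source.mem
  have hII0 := hII.self_of_nhdsWithin hx
  set F := normalFrame (N x) (fderivWithin ℝ Ψ t x) e with hF
  set F₀ := normalFrame (N₀ x) (fderivWithin ℝ Ψ₀ t x) e with hF₀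
  set F₁ := normalFrame (N₁ x) (fderivWithin ℝ Ψ₁ t x) e with hF₁
  have c := h.isCurvatureLike hs F
  have c₀ := h₀.isCurvatureLike hs₀ F₀
  have c₁ := h₁.isCurvatureLike hs₁ F₁
  set R := fun i j k l => curvature s G (Ψ x) (F i) (F j) (F k) (F l) with hR
  set R₀ := fun i j k l => curvature s₀ G₀ (Ψ₀ x) (F₀ i) (F₀ j) (F₀ k) (F₀ l) with hR₀
  set R₁ := fun i j k l => curvature s₁ G₁ (Ψ₁ x) (F₁ i) (F₁ j) (F₁ k) (F₁ l) with hR₁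
  have hsplit : ∀ β, frameForm (curvature s G (Ψ x)) F β
      - (1 - τ) * frameForm (curvature s₀ G₀ (Ψ₀ x)) F₀ β
      - τ * frameForm (curvature s₁ G₁ (Ψ₁ x)) F₁ β
      = quadForm (fun i j k l => R i j k l + (-(1 - τ) * R₀ i j k l + -τ * R₁ i j k l)) β := by
    intro β
    rw [quadForm_add, quadForm_add, quadForm_const_mul, quadForm_const_mul]
    simp only [frameForm, R, R₀, R₁]
    ring
  rw [hsplit, hsplit]
  refine quadForm_mixedPart_le (c := τ * (1 - τ)) ⟨fun i j k l => ?_, fun i j k l => ?_,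
    fun i j k l => ?_⟩ (mul_nonneg hτ.1 (sub_nonneg.2 hτ.2)) hl (fun a b d f => ?_)
    (fun a b d => ?_) hα
  · rw [c.antisymm i j k l, c₀.antisymm i j k l, c₁.antisymm i j k l]; ring
  · rw [c.antisymm' i j k l, c₀.antisymm' i j k l, c₁.antisymm' i j k l]; ring
  · rw [c.pair i j k l, c₀.pair i j k l, c₁.pair i j k l]
  · have e1 := h.gauss hs ht (e a) (e b) (e d) (e f)
    have e2 := h₀.gauss hs₀ ht (e a) (e b) (e d) (e f)
    have e3 := h₁.gauss hs₁ ht (e a) (e b) (e d) (e f)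
    change R a.succ b.succ d.succ f.succ = _ at e1
    change R₀ a.succ b.succ d.succ f.succ = _ at e2
    change R₁ a.succ b.succ d.succ f.succ = _ at e3
    rw [e1, e2, e3]
    simp only [hII0, bivectorTensor, Matrix.of_apply]
    ring
  · have e1 := h.isometric.codazzi hs ht h.normal h.unit h.orthogonal h.hessian (e a) (e b) (e d)
    have e2 := h₀.isometric.codazzi hs₀ ht h₀.normal h₀.unit h₀.orthogonal h₀.hessian (e a) (e b)
      (e d)
    have e3 := h₁.isometric.codazzi hs₁ ht h₁.normal h₁.unit h₁.orthogonal h₁.hessian (e a) (e b)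
      (e d)
    change R a.succ b.succ d.succ 0 = _ at e1
    change R₀ a.succ b.succ d.succ 0 = _ at e2
    change R₁ a.succ b.succ d.succ 0 = _ at e3
    have hd : ∀ u v w, fderivWithin ℝ (fun y => II y u v) t x w
        = (1 - τ) * fderivWithin ℝ (fun y => II₀ y u v) t x w
          + τ * fderivWithin ℝ (fun y => II₁ y u v) t x w := by
      intro u v w
      have d := ((h₀.hasFDerivWithinAt hs₀ ht u v).hasFDerivWithinAt.const_mul (1 - τ)).add
        ((h₁.hasFDerivWithinAt hs₁ ht u v).hasFDerivWithinAt.const_mul τ)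
      have hc : (fun y => II y u v) =ᶠ[𝓝[t] x]
        fun y => (1 - τ) * II₀ y u v + τ * II₁ y u v := hII.mono fun y hy => hy u v
      rw [(d.congr_of_eventuallyEq hc (hc.eq_of_nhdsWithin hx)).fderivWithin
        (ht.uniqueDiffOn x hx)]
      simp
    rw [e1, e2, e3]
    simp only [hII0, hd]
    ring

end Hypersurface

/-! ### The boundary as a hypersurface in charts -/

section BoundaryHypersurface

/-- A hyperplane of dimension `m` contained in the tangent space of the boundary is equal to it. -/
theorem exists_eq_of_tangent {m : ℕ} {A : EuclideanSpace ℝ (Fin m) →L[ℝ]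
    EuclideanSpace ℝ (Fin (m + 1))} (hA : Function.Injective A) (h0 : ∀ v, A v 0 = 0)
    {w : EuclideanSpace ℝ (Fin (m + 1))} (hw : w 0 = 0) : ∃ v, A v = w := by
  let P : EuclideanSpace ℝ (Fin (m + 1)) →ₗ[ℝ] EuclideanSpace ℝ (Fin m) :=
    { toFun := fun v => WithLp.toLp 2 fun a => v a.succ
      map_add' := fun u v => by ext; simp
      map_smul' := fun c v => by ext; simp }
  have hP : ∀ v w : EuclideanSpace ℝ (Fin (m + 1)), v 0 = 0 → w 0 = 0 → P v = P w → v = w := by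
    intro v w hv hw h
    ext i
    refine Fin.cases (hv.trans hw.symm) (fun a => ?_) i
    exact congrArg (fun z : EuclideanSpace ℝ (Fin m) => z a) h
  have hinj : Function.Injective (P ∘ₗ (A : EuclideanSpace ℝ (Fin m) →ₗ[ℝ] _)) := fun u v h =>
    hA (hP _ _ (h0 u) (h0 v) h)
  obtain ⟨v, hv⟩ := (LinearMap.injective_iff_surjective.1 hinj) (P w)
  exact ⟨v, hP _ _ (h0 v) hw hv⟩

/-- A vector which is orthogonal to the tangent space of the boundary is a multiple of the unit
normal. -/
theorem IsInner.eq_smul_unitNormal {m : ℕ} {G : Bilin (EuclideanSpace ℝ (Fin (m + 1)))}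
    (hG : IsInner G) {A : EuclideanSpace ℝ (Fin m) →L[ℝ] EuclideanSpace ℝ (Fin (m + 1))}
    (hA : Function.Injective A) (h0 : ∀ v, A v 0 = 0) {z : EuclideanSpace ℝ (Fin (m + 1))}
    (hz : ∀ v, G z (A v) = 0) : z = G z (unitNormal G) • unitNormal G := by
  have hp := hG.unitNormal_zero_pos
  refine hG.ext fun w => ?_
  obtain ⟨v, hv⟩ := exists_eq_of_tangent hA h0 (w := w - (w 0 / unitNormal G 0) • unitNormal G) (by
    simp only [PiLp.sub_apply, PiLp.smul_apply, smul_eq_mul]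
    field_simp
    ring)
  have e : w = A v + (w 0 / unitNormal G 0) • unitNormal G := by rw [hv]; abel
  rw [e]
  simp only [map_add, map_smul, smul_apply, smul_eq_mul, hz, hG.unitNormal_tangent (h0 v),
    hG.unitNormal_unit]
  ring

variable {m : ℕ} {Γ : Type*} [TopologicalSpace Γ] [ChartedSpace (EuclideanSpace ℝ (Fin m)) Γ]
  {M : Type*} [TopologicalSpace M] [ChartedSpace (EuclideanHalfSpace (m + 1)) M]
  [IsManifold (𝓡∂ (m + 1)) ∞ M]

/-- The metric induced by `g` on the boundary, in the chart at `y₀`. -/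
def inducedMetric (g : TensorField (m + 1) M) (ι : Γ → M) (y₀ : Γ) (x : EuclideanSpace ℝ (Fin m)) :
    Bilin (EuclideanSpace ℝ (Fin m)) :=
  pullBilin (fderivWithin ℝ (boundaryChart ι y₀) univ x) (inChart g (ι y₀) (boundaryChart ι y₀ x))

/-- The inward unit normal along the boundary, in the charts at `y₀` and `ι y₀`. -/
def normalAlong (g : TensorField (m + 1) M) (ι : Γ → M) (y₀ : Γ) (x : EuclideanSpace ℝ (Fin m)) :
    EuclideanSpace ℝ (Fin (m + 1)) := unitNormal (inChart g (ι y₀) (boundaryChart ι y₀ x))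

/-- The second fundamental form of the boundary, in the chart at `y₀`. -/
def boundaryFormIn (g : TensorField (m + 1) M) (ι : Γ → M) (y₀ : Γ) (x u v : EuclideanSpace ℝ (Fin m)) :
    ℝ :=
  inChart g (ι y₀) (boundaryChart ι y₀ x)
    (hessian (halfSpace (m + 1)) (inChart g (ι y₀)) univ (boundaryChart ι y₀) x u v)
    (normalAlong g ι y₀ x)

/-- Statements about points `y` of the boundary near `y₀`, in terms of the chart. -/
theorem eventually_of_closedChart {y₀ : Γ} {P : EuclideanSpace ℝ (Fin m) → Prop}
    (h : ∀ᶠ y in 𝓝 y₀, y ∈ (extChartAt (𝓡 m) y₀).source → P (extChartAt (𝓡 m) y₀ y)) :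
    ∀ᶠ x in 𝓝[univ] (extChartAt (𝓡 m) y₀ y₀), P x := by
  filter_upwards [eventually_closedChart (mem_extChartAt_source y₀) h] with x hx
  have := hx.2 ((extChartAt (𝓡 m) y₀).map_target hx.1)
  rwa [(extChartAt (𝓡 m) y₀).right_inv hx.1] at this

variable [IsManifold (𝓡 m) ∞ Γ] {ι : Γ → M} (hι : IsBoundaryEmbedding m ι)
include hι

omit [IsManifold (𝓡∂ (m + 1)) ∞ M] [IsManifold (𝓡 m) ∞ Γ] in
theorem IsBoundaryEmbedding.injective_fderivWithin (y : Γ) : Function.Injective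
    (fderivWithin ℝ (boundaryChart ι y) univ (extChartAt (𝓡 m) y y)) := by
  rw [← hι.mfderiv_eq]
  exact hι.immersion y

/-- The boundary is a hypersurface with the inward unit normal and the second fundamental form
`boundaryFormIn`, also in the directions along it: the data are given in fixed charts near `y₀`, so
that they can be differentiated. The induced metric may be given by any function `γ` which is
locally equal to it; this allows several ambient metrics to share it. -/
theorem IsBoundaryEmbedding.isHypersurfaceAt {g : TensorField (m + 1) M} {y₀ : Γ}
    (hg : IsMetricNear g (ι y₀)) {γ : EuclideanSpace ℝ (Fin m) → Bilin (EuclideanSpace ℝ (Fin m))}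
    (hγ : γ =ᶠ[𝓝[univ] (extChartAt (𝓡 m) y₀ y₀)] inducedMetric g ι y₀) :
    IsHypersurfaceAt (halfSpace (m + 1)) (inChart g (ι y₀)) univ γ (boundaryChart ι y₀)
      (normalAlong g ι y₀) (boundaryFormIn g ι y₀) (extChartAt (𝓡 m) y₀ y₀) := by
  have hs := mem_extChartAt_source (I := 𝓡 m) y₀
  have hs' := mem_extChartAt_source (I := 𝓡∂ (m + 1)) (ι y₀)
  have hΨ := hι.contDiffWithinAt hs hs'
  have htar := hg.isMetricAt hs'
  rw [← boundaryChart_apply hs] at htar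
  have hx : extChartAt (𝓡 m) y₀ y₀ ∈ (univ : Set (EuclideanSpace ℝ (Fin m))) := mem_univ _
  have hm : ∀ᶠ y in 𝓝[univ] (extChartAt (𝓡 m) y₀ y₀),
    boundaryChart ι y₀ y ∈ halfSpace (m + 1) := .of_forall fun _ => boundaryChart_mem _
  have hten : Tendsto (boundaryChart ι y₀) (𝓝[univ] (extChartAt (𝓡 m) y₀ y₀))
    (𝓝[halfSpace (m + 1)] (boundaryChart ι y₀ (extChartAt (𝓡 m) y₀ y₀))) :=
    tendsto_nhdsWithin_iff.2 ⟨hΨ.continuousWithinAt, hm⟩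
  have hGc : ContDiffWithinAt ℝ ∞ (fun y => inChart g (ι y₀) (boundaryChart ι y₀ y)) univ
      (extChartAt (𝓡 m) y₀ y₀) :=
    htar.smooth.comp _ hΨ fun _ _ => boundaryChart_mem _
  have hIn := hten.eventually htar.inner
  have hsm : ContDiffWithinAt ℝ ∞ γ univ (extChartAt (𝓡 m) y₀ y₀) :=
    (contDiffWithinAt_pullBilin (contDiffWithinAt_fderivWithin isBody_univ hx hΨ)
      hGc).congr_of_eventuallyEq hγ (hγ.eq_of_nhdsWithin hx)
  have hγ0 : IsInner (γ (extChartAt (𝓡 m) y₀ y₀)) := by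
    rw [hγ.eq_of_nhdsWithin hx]
    exact htar.isInner.pullBilin (hι.injective_fderivWithin y₀)
  have hinner : ∀ᶠ y in 𝓝[univ] (extChartAt (𝓡 m) y₀ y₀), IsInner (γ y) := by
    filter_upwards [hsm.continuousWithinAt.eventually hγ0.eventually, hγ, hIn] with y h1 h2 h3
    refine h1 fun u v => ?_
    rw [h2]
    exact h3.symm _ _
  have hiso : IsIsometricAt (halfSpace (m + 1)) (inChart g (ι y₀)) univ γ (boundaryChart ι y₀)
      (extChartAt (𝓡 m) y₀ y₀) :=
    { target := htar
      source := ⟨hx, hsm, hinner⟩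
      smooth := hΨ
      mapsTo := hm
      pull := hγ }
  have htan := hι.eventually_fderivWithin_firstCoord hs hs'
  have hN : ContDiffWithinAt ℝ ∞ (normalAlong g ι y₀) univ (extChartAt (𝓡 m) y₀ y₀) :=
    ContDiffWithinAt.unitNormal (G := fun y => inChart g (ι y₀) (boundaryChart ι y₀ y))
      htar.isInner hGc
  refine ⟨hiso, hN.differentiableWithinAt (by simp), hIn.mono fun y hy => hy.unitNormal_unit, fun a => ?_, ?_⟩
  · rw [htar.isInner.symm]
    exact htar.isInner.unitNormal_tangent (htan.self_of_nhdsWithin hx a)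
  · filter_upwards [hIn, hinner, hγ, htan, hiso.eventually_normal isBody_univ] with y h1 h2 h3 h4 h5
      u v
    have hinj : Function.Injective (fderivWithin ℝ (boundaryChart ι y₀) univ y) := by
      refine (injective_iff_map_eq_zero _).2 fun w hw => ?_
      by_contra hne
      have := h2.pos w hne
      rw [h3, inducedMetric, pullBilin_apply, hw] at this
      simp at this
    have h6 := h1.eq_smul_unitNormal hinj h4 (h5 u v)
    refine h6.trans ?_
    rw [boundaryFormIn, normalAlong, covHessian_eq_hessian_sub, map_sub, sub_apply,
      h1.symm (fderivWithin ℝ (boundaryChart ι y₀) univ y _), h1.unitNormal_tangent (h4 _), sub_zero]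

end BoundaryHypersurface

/-! ### Local bounds on the curvature operator -/

section LocalBounds

variable {n : ℕ} [NeZero n] {M : Type*} [TopologicalSpace M]
  [ChartedSpace (EuclideanHalfSpace n) M] [IsManifold (𝓡∂ n) ∞ M]

/-- Positivity of a smooth symmetric tensor field is an open condition. -/
theorem IsMetricNear.of_isInner {h : TensorField n M} {p : M} (hs : IsSmoothAt h p)
    (hsymm : ∀ᶠ q in 𝓝 p, ∀ u v, tensorAt h q u v = tensorAt h q v u)
    (hp : IsInner (tensorAt h p)) : IsMetricNear h p := by
  refine ⟨hs, ?_⟩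
  have hm := mem_extChartAt_source (I := 𝓡∂ n) p
  rw [← inChart_self] at hp
  have h1 : ∀ᶠ q in 𝓝 p, (∀ u v, inChart h p (extChartAt (𝓡∂ n) p q) u v
      = inChart h p (extChartAt (𝓡∂ n) p q) v u) → IsInner (inChart h p (extChartAt (𝓡∂ n) p q)) :=
    (tendsto_chart hm).eventually
      ((hs.contDiffWithinAt hm).continuousWithinAt.eventually hp.eventually)
  filter_upwards [h1, hsymm, (isOpen_extChartAt_source (I := 𝓡∂ n) p).mem_nhds hm] with q h2 h3 h4
  have e : inChart h p (extChartAt (𝓡∂ n) p q)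
      = pullBilin (chartFrame p (extChartAt (𝓡∂ n) p q)) (tensorAt h q) := by
    rw [inChart, (extChartAt (𝓡∂ n) p).left_inv h4]
  have h5 := h2 fun u v => by rw [e]; exact h3 _ _
  rw [e] at h5
  refine ⟨h3, fun u hu => ?_⟩
  obtain ⟨v, rfl⟩ := (chartFrame_bijective h4).2 u
  exact h5.pos v fun hv => hu (by rw [hv, map_zero])

theorem IsMetricAt.tendsto_curvature {V : Type*} [NormedAddCommGroup V] [NormedSpace ℝ V]
    [FiniteDimensional ℝ V] {s : Set V} {G : V → Bilin V} {x : V} (hs : IsBody s)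
    (h : IsMetricAt s G x) (u v w z : V) :
    Tendsto (fun y => curvature s G y u v w z) (𝓝[s] x) (𝓝 (curvature s G x u v w z)) := by
  have h1 := contDiffWithinAt_fderivWithin hs h.mem h.smooth
  have h2 := contDiffWithinAt_fderivWithin hs h.mem h1
  exact tendsto_curvatureOf h.isInner h.smooth.continuousWithinAt h1.continuousWithinAt
    h2.continuousWithinAt u v w z

theorem transpose_congruence {κ ι : Type*} [Fintype κ] {α : Matrix κ κ ℝ}
    (hα : α.transpose = -α) (J : Matrix ι κ ℝ) :
    (J * α * J.transpose).transpose = -(J * α * J.transpose) := by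
  rw [Matrix.transpose_mul, Matrix.transpose_mul, Matrix.transpose_transpose, hα, Matrix.neg_mul,
    Matrix.mul_neg, Matrix.mul_assoc]

/-- Near a point the curvature operator is bounded by a multiple of the inner product: the forms
`I ± s R` are positive for small `s`. -/
theorem IsMetricNear.exists_abs_curvatureForm_le {h : TensorField n M} {p₀ : M}
    (hh : ∀ᶠ p in 𝓝 p₀, IsMetricNear h p) : ∃ K, ∀ᶠ p in 𝓝 p₀, ∀ K' ≥ K,
      ∀ α : Matrix (Fin n) (Fin n) ℝ, α.transpose = -α →
        |curvatureForm h p α| ≤ K' * bivectorForm h p α := by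
  have hm := mem_extChartAt_source (I := 𝓡∂ n) p₀
  have hA := hh.self_of_nhds.isMetricAt hm
  set x₀ := extChartAt (𝓡∂ n) p₀ p₀ with hx₀
  set G := inChart h p₀ with hG
  have hI : ∀ u v w z, Tendsto (fun x => bivec (G x) u v w z) (𝓝[halfSpace n] x₀)
      (𝓝 (bivec (G x₀) u v w z)) := by
    intro u v w z
    have hc : ∀ a b, Tendsto (fun x => G x a b) (𝓝[halfSpace n] x₀) (𝓝 (G x₀ a b)) := fun a b =>
      tendsto_clm_apply (tendsto_clm_apply hA.smooth.continuousWithinAt tendsto_const_nhds)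
        tendsto_const_nhds
    exact ((hc u w).mul (hc v z)).sub ((hc v w).mul (hc u z))
  have hT : Tendsto (fun (z : ℝ × EuclideanSpace ℝ (Fin n)) (i j k l : Fin n) =>
      bivec (G z.2) (stdVec i) (stdVec j) (stdVec k) (stdVec l)
        + z.1 * curvature (halfSpace n) G z.2 (stdVec i) (stdVec j) (stdVec k) (stdVec l))
      (𝓝 0 ×ˢ 𝓝[halfSpace n] x₀)
      (𝓝 fun i j k l => bivec (G x₀) (stdVec i) (stdVec j) (stdVec k) (stdVec l)) := by
    refine tendsto_pi_nhds.2 fun i => tendsto_pi_nhds.2 fun j => tendsto_pi_nhds.2 fun k =>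
      tendsto_pi_nhds.2 fun l => ?_
    have h1 := ((hI (stdVec i) (stdVec j) (stdVec k) (stdVec l)).comp
      (tendsto_snd (f := 𝓝 (0 : ℝ)))).add ((tendsto_fst (f := 𝓝 (0 : ℝ))
        (g := 𝓝[halfSpace n] x₀)).mul ((hA.tendsto_curvature isBody_halfSpace (stdVec i) (stdVec j)
          (stdVec k) (stdVec l)).comp (tendsto_snd (f := 𝓝 (0 : ℝ)))))
    simpa using h1
  have hpos := hT.eventually (eventually_quadForm_nonneg fun α hα h0 =>
    quadForm_bivectorTensor_pos (hA.isInner.gram_posDef linearIndependent_stdVec) hα h0)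
  obtain ⟨P, hP, Q, hQ, hPQ⟩ := eventually_prod_iff.1 hpos
  obtain ⟨ε, hε, hball⟩ := Metric.eventually_nhds_iff.1 hP
  refine ⟨2 / ε, ?_⟩
  filter_upwards [hh, (tendsto_chart hm).eventually hQ,
    (isOpen_extChartAt_source (I := 𝓡∂ n) p₀).mem_nhds hm] with p hp hq hps K' hK α hα
  rw [curvatureForm_eq_chart hp hps, bivectorForm_eq_chart h hps]
  have hβ := transpose_congruence hα (jacobiMatrix (n := n) p p₀)
  set β := jacobiMatrix (n := n) p p₀ * α * (jacobiMatrix p p₀).transpose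
  have h1 := hPQ (hball (y := ε / 2) (by simp [abs_of_pos hε]; linarith)) hq β hβ
  have h2 := hPQ (hball (y := -(ε / 2)) (by simp [abs_of_pos hε]; linarith)) hq β hβ
  simp only [quadForm_add, quadForm_const_mul] at h1 h2
  change 0 ≤ frameForm (bivec (G (extChartAt (𝓡∂ n) p₀ p))) stdVec β + ε / 2 *
    frameForm (curvature (halfSpace n) G (extChartAt (𝓡∂ n) p₀ p)) stdVec β at h1
  change 0 ≤ frameForm (bivec (G (extChartAt (𝓡∂ n) p₀ p))) stdVec β + -(ε / 2) *
    frameForm (curvature (halfSpace n) G (extChartAt (𝓡∂ n) p₀ p)) stdVec β at h2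
  generalize frameForm (bivec (G (extChartAt (𝓡∂ n) p₀ p))) stdVec β = I at h1 h2 ⊢
  generalize frameForm (curvature (halfSpace n) G (extChartAt (𝓡∂ n) p₀ p)) stdVec β = T at h1 h2 ⊢
  have h3 : 0 ≤ I := by linarith
  refine le_trans ?_ (mul_le_mul_of_nonneg_right hK h3)
  rw [div_mul_eq_mul_div, le_div_iff₀ hε]
  rcases abs_cases T with ⟨h4, -⟩ | ⟨h4, -⟩ <;> rw [h4] <;> nlinarith

/-- On a compact set, the curvature operator of a metric is bounded. -/
theorem exists_abs_curvatureForm_le {h : TensorField n M} {S : Set M} (hS : IsCompact S)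
    (hh : ∀ q ∈ S, ∀ᶠ p in 𝓝 q, IsMetricNear h p) : ∃ K, ∀ p ∈ S, ∀ K' ≥ K,
      ∀ α : Matrix (Fin n) (Fin n) ℝ, α.transpose = -α →
        |curvatureForm h p α| ≤ K' * bivectorForm h p α := by
  refine hS.induction_on (p := fun S => ∃ K, ∀ p ∈ S, ∀ K' ≥ K,
      ∀ α : Matrix (Fin n) (Fin n) ℝ, α.transpose = -α →
        |curvatureForm h p α| ≤ K' * bivectorForm h p α) ⟨0, by simp⟩
    (fun s t hst ⟨K, hK⟩ => ⟨K, fun p hp => hK p (hst hp)⟩) ?_ fun q hq => ?_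
  · rintro s t ⟨K₁, h₁⟩ ⟨K₂, h₂⟩
    refine ⟨max K₁ K₂, fun p hp K' hK => ?_⟩
    rcases hp with hp | hp
    · exact h₁ p hp K' ((le_max_left _ _).trans hK)
    · exact h₂ p hp K' ((le_max_right _ _).trans hK)
  · obtain ⟨K, hK⟩ := IsMetricNear.exists_abs_curvatureForm_le (hh q hq)
    exact ⟨_, nhdsWithin_le_nhds hK, K, fun p hp => hp⟩

/-- The matrix whose columns are the vectors of a frame. -/
def frameMatrix {ι : Type*} (F : ι → EuclideanSpace ℝ (Fin n)) : Matrix (Fin n) ι ℝ := fun i j => F j i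

/-- The curvature form of the two-vector which has the matrix `β` in the frame `F`. -/
theorem curvatureForm_frame {h : TensorField n M} {p : M} (hh : IsMetricNear h p) {ι : Type*}
    [Fintype ι] (F : ι → EuclideanSpace ℝ (Fin n)) (β : Matrix ι ι ℝ) :
    curvatureForm h p (frameMatrix F * β * (frameMatrix F).transpose)
      = frameForm (curvature (halfSpace n) (inChart h p) (extChartAt (𝓡∂ n) p p)) F β := by
  rw [curvatureForm_eq hh, ← (isQuadrilinear_curvature _ _ _).frameForm_change (e' := F)
    (J := frameMatrix F) fun j => (sum_smul_stdVec (F j)).symm]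

omit [IsManifold (𝓡∂ n) ∞ M] in
theorem bivectorForm_frame (h : TensorField n M) (p : M) {ι : Type*}
    [Fintype ι] (F : ι → EuclideanSpace ℝ (Fin n)) (β : Matrix ι ι ℝ) :
    bivectorForm h p (frameMatrix F * β * (frameMatrix F).transpose)
      = frameForm (bivec (inChart h p (extChartAt (𝓡∂ n) p p))) F β := by
  rw [bivectorForm_eq, ← (isQuadrilinear_bivec _).frameForm_change (e' := F)
    (J := frameMatrix F) fun j => (sum_smul_stdVec (F j)).symm]

end LocalBounds

section Contraction

variable {V : Type*} [NormedAddCommGroup V] [NormedSpace ℝ V] {ι κ : Type*} [Fintype ι] [Fintype κ]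

/-- The contraction of a two-vector does not depend on the frame. -/
theorem contraction_change (φ : V →L[ℝ] ℝ) {e : ι → V} {e' : κ → V} {J : Matrix ι κ ℝ}
    (he : ∀ j, e' j = ∑ i, J i j • e i) (α : Matrix κ κ ℝ) :
    contraction φ e' α = contraction φ e (J * α * J.transpose) := by
  have h1 : ∀ i, φ (e' i) = ∑ a, J a i * φ (e a) := fun i => by rw [he i]; simp
  have h2 : contraction φ e' α = ∑ j, ∑ b, ((∑ i, α i j * φ (e' i)) * J b j) • e b := by
    simp only [contraction]
    refine Finset.sum_congr rfl fun j _ => ?_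
    conv_lhs => rw [he j]
    simp only [Finset.smul_sum, smul_smul]
  rw [h2, Finset.sum_comm]
  refine Finset.sum_congr rfl fun b _ => ?_
  rw [← Finset.sum_smul]
  congr 1
  simp only [h1, Matrix.mul_apply, Matrix.transpose_apply, Finset.sum_mul, Finset.mul_sum]
  rw [Finset.sum_comm' (t' := Finset.univ) (s' := fun _ => Finset.univ) (by simp)]
  calc _ = ∑ i, ∑ a, ∑ j, α i j * (J a i * φ (e a)) * J b j :=
        Finset.sum_congr rfl fun i _ => Finset.sum_comm
    _ = ∑ a, ∑ i, ∑ j, α i j * (J a i * φ (e a)) * J b j := Finset.sum_comm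
    _ = ∑ a, ∑ j, ∑ i, α i j * (J a i * φ (e a)) * J b j :=
        Finset.sum_congr rfl fun a _ => Finset.sum_comm
    _ = _ := Finset.sum_congr rfl fun a _ => Finset.sum_congr rfl fun j _ =>
        Finset.sum_congr rfl fun i _ => by ring

end Contraction

/-! ### The tensor field `L` and the metrics `g + 2 t x^n L` -/

section NormalField

variable {n : ℕ} [NeZero n] {M : Type*} [TopologicalSpace M]
  [ChartedSpace (EuclideanHalfSpace n) M] [IsManifold (𝓡∂ n) ∞ M]

/-- The metric in the chart at `p`, at the centre of the chart. -/
abbrev centreMetric (g : SmoothMetric n M) (p : M) : Bilin (EuclideanSpace ℝ (Fin n)) :=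
  inChart g.inner p (extChartAt (𝓡∂ n) p p)

/-- The differential of the distance to the boundary, in the chart at `p`, at the centre of the
chart. -/
abbrev centreDifferential (g : SmoothMetric n M) (p : M) : EuclideanSpace ℝ (Fin n) →L[ℝ] ℝ :=
  fderivWithin ℝ (normalCoordIn g p) (halfSpace n) (extChartAt (𝓡∂ n) p p)

/-- The gradient of the distance to the boundary, in the chart at `p`, at the centre of the
chart. -/
def normalField (g : SmoothMetric n M) (p : M) : EuclideanSpace ℝ (Fin n) :=
  (centreMetric g p).inverse (centreDifferential g p)

theorem isInner_centreMetric (g : SmoothMetric n M) (p : M) : IsInner (centreMetric g p) := by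
  rw [centreMetric, inChart_self]
  exact SmoothMetric.isInner g p

theorem centreMetric_normalField (g : SmoothMetric n M) (p : M) :
    centreMetric g p (normalField g p) = centreDifferential g p :=
  (isInner_centreMetric g p).apply_inverse _

theorem gradComp_eq (g : SmoothMetric n M) (p : M) (k : Fin n) :
    gradComp g.inner (normalCoord g) p k = normalField g p k := by
  rw [normalField, (isInner_centreMetric g p).inverse_component]
  rfl

/-- At the boundary the gradient of `x^n` is the inward unit normal. -/
theorem normalField_boundary [T2Space M] {g : SmoothMetric n M} {r : ℝ} (hr : IsFermiWidth g r)
    {q : M} (hq : q ∈ (𝓡∂ n).boundary M) : normalField g q = unitNormal (centreMetric g q) := by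
  have h1 := fderivWithin_normalCoordIn_gradient hr hq
  have h2 := centreMetric_normalField g q
  refine (isInner_centreMetric g q).eq_unitNormal ?_ ?_ fun w hw => ?_
  · by_contra! hneg
    have h3 := fderivWithin_normalCoordIn_nonneg (v := -normalField g q) hr hq
      (by simpa using hneg.le)
    rw [map_neg] at h3
    have h4 : centreDifferential g q (normalField g q) = 1 := h1
    linarith
  · rw [h2]; exact h1
  · rw [h2]; exact fderivWithin_normalCoordIn_tangent hr hq hw

variable {g : SmoothMetric n M} {r : ℝ} {L : TensorField n M}

theorem IsNormallyParallel.isSmoothAt (hL : IsNormallyParallel g r L) {p : M} (hp : p ∈ tube g r) :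
    IsSmoothAt L p := hL.smooth.contMDiffAt ((isOpen_tube g r).mem_nhds hp)

theorem IsNormallyParallel.inChart_symm (hL : IsNormallyParallel g r L) {p q : M}
    (hp : p ∈ tube g r) (hq : p ∈ (extChartAt (𝓡∂ n) q).source) (u v : EuclideanSpace ℝ (Fin n)) :
    inChart L q (extChartAt (𝓡∂ n) q p) u v = inChart L q (extChartAt (𝓡∂ n) q p) v u := by
  rw [inChart, (extChartAt (𝓡∂ n) q).left_inv hq]
  exact hL.symm p hp _ _

theorem IsNormallyParallel.apply_normalField (hL : IsNormallyParallel g r L) {p : M}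
    (hp : p ∈ tube g r) (v : EuclideanSpace ℝ (Fin n)) :
    inChart L p (extChartAt (𝓡∂ n) p p) (normalField g p) v = 0 := by
  have h : ∀ j, inChart L p (extChartAt (𝓡∂ n) p p) (normalField g p) (stdVec j) = 0 := by
    intro j
    rw [map_eq_sum_stdVec (inChart L p (extChartAt (𝓡∂ n) p p)) (normalField g p), ← hL.normal p hp j]
    simp [gradComp_eq, coeff_eq]
  rw [map_eq_sum_stdVec (inChart L p (extChartAt (𝓡∂ n) p p) (normalField g p)) v]
  exact Finset.sum_eq_zero fun j _ => by rw [h, smul_zero]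

/-- `∇_N L = 0`, in the chart at `p`. -/
theorem IsNormallyParallel.fderivWithin_normalField (hL : IsNormallyParallel g r L) {p : M}
    (hp : p ∈ tube g r) (v w : EuclideanSpace ℝ (Fin n)) :
    fderivWithin ℝ (inChart L p) (halfSpace n) (extChartAt (𝓡∂ n) p p) (normalField g p) v w
      = inChart L p (extChartAt (𝓡∂ n) p p) (connection (halfSpace n) (inChart g.inner p)
          (extChartAt (𝓡∂ n) p p) (normalField g p) v) w
        + inChart L p (extChartAt (𝓡∂ n) p p) v (connection (halfSpace n) (inChart g.inner p)
          (extChartAt (𝓡∂ n) p p) (normalField g p) w) := by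
  have hs := mem_extChartAt_source (I := 𝓡∂ n) p
  have hx : extChartAt (𝓡∂ n) p p ∈ halfSpace n := chart_mem p p
  have hLd := ((hL.isSmoothAt hp).contDiffWithinAt hs).differentiableWithinAt (by simp)
  have hgm := (SmoothMetric.isMetricNear g p).isMetricAt hs
  have hpar := hL.parallel p hp
  have hg := gradComp_eq g p
  set x := extChartAt (𝓡∂ n) p p with hxdef
  set N := normalField g p
  set B := connection (halfSpace n) (inChart g.inner p) x with hB
  have h1 : ∀ k i j, covDeriv g.inner L p k i j
      = fderivWithin ℝ (inChart L p) (halfSpace n) x (stdVec k) (stdVec i) (stdVec j)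
        - inChart L p x (B (stdVec k) (stdVec i)) (stdVec j)
        - inChart L p x (stdVec i) (B (stdVec k) (stdVec j)) := by
    intro k i j
    rw [covDeriv, pderiv_coeff hx hLd, map_eq_sum_stdVec (inChart L p x) (B (stdVec k) (stdVec i)),
      map_eq_sum_stdVec (inChart L p x (stdVec i)) (B (stdVec k) (stdVec j))]
    simp only [christoffel_eq hx hgm.differentiableWithinAt hgm.isInner, ← hxdef, ← hB, coeff_eq,
      sum_apply, smul_apply, smul_eq_mul]
  -- both sides are bilinear in `v` and `w`, hence it suffices to take basis vectors
  let Q : Bilin (EuclideanSpace ℝ (Fin n)) := fderivWithin ℝ (inChart L p) (halfSpace n) x N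
    - (inChart L p x) ∘L (B N) - ((ContinuousLinearMap.compL ℝ _ _ ℝ).flip (B N)) ∘L (inChart L p x)
  have hQ : ∀ v w, Q v w = fderivWithin ℝ (inChart L p) (halfSpace n) x N v w
      - inChart L p x (B N v) w - inChart L p x v (B N w) := fun v w => rfl
  have h2 : ∀ i j, Q (stdVec i) (stdVec j) = 0 := by
    intro i j
    rw [← hpar i j, hQ, map_eq_sum_stdVec (fderivWithin ℝ (inChart L p) (halfSpace n) x) N,
      map_eq_sum_stdVec B N]
    simp only [h1, hg, sum_apply, smul_apply, map_sum, map_smul, smul_eq_mul, mul_sub,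
      Finset.sum_sub_distrib]
  have h3 : Q v w = 0 := by
    rw [map_eq_sum_stdVec Q v]
    simp only [sum_apply, smul_apply]
    refine Finset.sum_eq_zero fun i _ => ?_
    rw [map_eq_sum_stdVec (Q (stdVec i)) w]
    simp [h2]
  rw [hQ] at h3
  linarith

end NormalField

section Collar

/-- The curvature is a quadratic polynomial in `t` along a line of jets with a fixed value of the
metric. Its coefficients are expressed by the values at `t = 0, 1, -1`. -/
theorem curvatureOf_quadratic {V : Type*} [NormedAddCommGroup V] [NormedSpace ℝ V] (G : Bilin V)
    (D D' : V →L[ℝ] Bilin V) (H H' : V →L[ℝ] V →L[ℝ] Bilin V) (t : ℝ) (u v w z : V) :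
    curvatureOf G (D + t • D') (H + t • H') u v w z = curvatureOf G D H u v w z
      + (t * (1 / 2) * (curvatureOf G (D + (1 : ℝ) • D') (H + (1 : ℝ) • H') u v w z
          + -1 * curvatureOf G (D + (-1 : ℝ) • D') (H + (-1 : ℝ) • H') u v w z)
        + t ^ 2 * ((1 / 2) * (curvatureOf G (D + (1 : ℝ) • D') (H + (1 : ℝ) • H') u v w z
            + curvatureOf G (D + (-1 : ℝ) • D') (H + (-1 : ℝ) • H') u v w z)
          + -1 * curvatureOf G D H u v w z)) := by
  simp only [curvatureOf, connectionOf_apply, map_add, map_smul, add_apply, smul_apply, smul_eq_mul]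
  ring

variable {n : ℕ} [NeZero n] {M : Type*} [TopologicalSpace M]
  [ChartedSpace (EuclideanHalfSpace n) M] [IsManifold (𝓡∂ n) ∞ M]

/-- The tensor field `g + 2 t x^n L`, a Riemannian metric near the boundary. -/
def collarMetric (g : SmoothMetric n M) (L : TensorField n M) (t : ℝ) : TensorField n M := fun p =>
  g.inner p + (2 * t * normalCoord g p) • L p

variable {g : SmoothMetric n M} {r : ℝ} {L : TensorField n M}

theorem inChart_collarMetric (g : SmoothMetric n M) (L : TensorField n M) (t : ℝ) (q : M) :
    inChart (collarMetric g L t) q = fun x => inChart g.inner q x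
      + (2 * t * normalCoordIn g q x) • inChart L q x := rfl

theorem isSmoothAt_collarMetric (hr : IsFermiWidth g r) (hL : IsNormallyParallel g r L) (t : ℝ)
    {p : M} (hp : p ∈ tube g r) : IsSmoothAt (collarMetric g L t) p := by
  have hs := mem_extChartAt_source (I := 𝓡∂ n) p
  rw [isSmoothAt_iff, inChart_collarMetric]
  exact (((SmoothMetric.isMetricNear g p).isMetricAt hs).smooth).add
    ((contDiffWithinAt_const.mul (contDiffWithinAt_normalCoordIn g hr hp hs)).smul
      ((hL.isSmoothAt hp).contDiffWithinAt hs))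

theorem isMetricNear_collarMetric (hr : IsFermiWidth g r) (hL : IsNormallyParallel g r L) (t : ℝ)
    {q : M} (hq : q ∈ (𝓡∂ n).boundary M) : IsMetricNear (collarMetric g L t) q := by
  have hqt := mem_tube_of_mem g hr.pos hq
  refine IsMetricNear.of_isInner (isSmoothAt_collarMetric hr hL t hqt) ?_ ?_
  · filter_upwards [(isOpen_tube g r).mem_nhds hqt] with p hp u v
    have h1 : g.inner p u v = g.inner p v u := g.symm p u v
    have h2 : L p u v = L p v u := hL.symm p hp u v
    change g.inner p u v + (2 * t * normalCoord g p) * L p u v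
      = g.inner p v u + (2 * t * normalCoord g p) * L p v u
    rw [h1, h2]
  · have : tensorAt (collarMetric g L t) q = tensorAt g.inner q := by
      change g.inner q + (2 * t * normalCoord g q) • L q = g.inner q
      rw [normalCoord_of_mem g hq]
      simp
    rw [this]
    exact SmoothMetric.isInner g q

theorem eventually_isMetricNear_collarMetric (hr : IsFermiWidth g r)
    (hL : IsNormallyParallel g r L) (t : ℝ) {q : M} (hq : q ∈ (𝓡∂ n).boundary M) :
    ∀ᶠ p in 𝓝 q, IsMetricNear (collarMetric g L t) p := by
  filter_upwards [(isOpen_tube g r).mem_nhds (mem_tube_of_mem g hr.pos hq),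
    eventually_eventually_nhds.2 (isMetricNear_collarMetric hr hL t hq).inner] with p hp h
  exact ⟨isSmoothAt_collarMetric hr hL t hp, h⟩

variable (hr : IsFermiWidth g r) (hL : IsNormallyParallel g r L) {q : M}
  (hq : q ∈ (𝓡∂ n).boundary M)
include hr hL hq

/-- At a boundary point, where `x^n = 0`, the first and second derivatives of `g + 2 t x^n L` are
affine functions of `t`. -/
theorem exists_hasJetWithinAt_collarMetric : ∃ H', ∀ t : ℝ, ∃ D,
    HasJetWithinAt (inChart (collarMetric g L t) q) D
      (fderivWithin ℝ (fderivWithin ℝ (inChart g.inner q) (halfSpace n)) (halfSpace n)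
        (extChartAt (𝓡∂ n) q q) + t • H') (halfSpace n) (extChartAt (𝓡∂ n) q q) ∧
    D (extChartAt (𝓡∂ n) q q) = fderivWithin ℝ (inChart g.inner q) (halfSpace n)
        (extChartAt (𝓡∂ n) q q)
      + t • (2 : ℝ) • (centreDifferential g q).smulRight (inChart L q (extChartAt (𝓡∂ n) q q)) := by
  have hqt := mem_tube_of_mem g hr.pos hq
  have hs := mem_extChartAt_source (I := 𝓡∂ n) q
  have hx := chart_mem (n := n) q q
  have j1 := ContDiffWithinAt.hasJetWithinAt isBody_halfSpace hx
    (((SmoothMetric.isMetricNear g q).isMetricAt hs).smooth)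
  have j2 := ContDiffWithinAt.hasJetWithinAt isBody_halfSpace hx
    (contDiffWithinAt_normalCoordIn g hr hqt hs)
  have j3 := ContDiffWithinAt.hasJetWithinAt isBody_halfSpace hx
    ((hL.isSmoothAt hqt).contDiffWithinAt hs)
  have j4 := j2.smul j3
  refine ⟨(2 : ℝ) • prodDeriv₂ 0 (centreDifferential g q)
        (fderivWithin ℝ (fderivWithin ℝ (normalCoordIn g q) (halfSpace n)) (halfSpace n)
          (extChartAt (𝓡∂ n) q q))
        (inChart L q (extChartAt (𝓡∂ n) q q))
        (fderivWithin ℝ (inChart L q) (halfSpace n) (extChartAt (𝓡∂ n) q q))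
        (fderivWithin ℝ (fderivWithin ℝ (inChart L q) (halfSpace n)) (halfSpace n)
          (extChartAt (𝓡∂ n) q q)), fun t => ?_⟩
  have j5 : HasJetWithinAt (fun x => (2 * t) • (normalCoordIn g q x • inChart L q x))
      (fun x => (2 * t) • prodDeriv (normalCoordIn g q x)
        (fderivWithin ℝ (normalCoordIn g q) (halfSpace n) x) (inChart L q x)
        (fderivWithin ℝ (inChart L q) (halfSpace n) x)) _ (halfSpace n) (extChartAt (𝓡∂ n) q q) :=
    ⟨hx, j4.first.mono fun y hy => hy.const_smul (2 * t), j4.second.const_smul (2 * t)⟩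
  have j6 := j1.add j5
  rw [normalCoordIn_self hq] at j6
  refine ⟨fun x => fderivWithin ℝ (inChart g.inner q) (halfSpace n) x
    + (2 * t) • prodDeriv (normalCoordIn g q x)
        (fderivWithin ℝ (normalCoordIn g q) (halfSpace n) x) (inChart L q x)
        (fderivWithin ℝ (inChart L q) (halfSpace n) x), ?_, ?_⟩
  · convert j6 using 1
    · ext1 x
      rw [inChart_collarMetric, smul_smul]
    · rw [smul_smul, mul_comm]
  · simp only [normalCoordIn_self hq, prodDeriv, zero_smul, zero_add, smul_smul, mul_comm]

omit hr hL in
theorem inChart_collarMetric_self (t : ℝ) :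
    inChart (collarMetric g L t) q (extChartAt (𝓡∂ n) q q) = centreMetric g q := by
  simp only [inChart_collarMetric, normalCoordIn_self hq, mul_zero, zero_smul, add_zero]

/-- The curvature of `g + 2 t x^n L` at a boundary point is a quadratic polynomial in `t`. -/
theorem curvature_collarMetric (t : ℝ) (u v w z : EuclideanSpace ℝ (Fin n)) :
    curvature (halfSpace n) (inChart (collarMetric g L t) q) (extChartAt (𝓡∂ n) q q) u v w z
      = curvature (halfSpace n) (inChart g.inner q) (extChartAt (𝓡∂ n) q q) u v w z
        + (t * (1 / 2) * (curvature (halfSpace n) (inChart (collarMetric g L 1) q)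
              (extChartAt (𝓡∂ n) q q) u v w z
            + -1 * curvature (halfSpace n) (inChart (collarMetric g L (-1)) q)
              (extChartAt (𝓡∂ n) q q) u v w z)
          + t ^ 2 * ((1 / 2) * (curvature (halfSpace n) (inChart (collarMetric g L 1) q)
              (extChartAt (𝓡∂ n) q q) u v w z
            + curvature (halfSpace n) (inChart (collarMetric g L (-1)) q)
              (extChartAt (𝓡∂ n) q q) u v w z)
            + -1 * curvature (halfSpace n) (inChart g.inner q) (extChartAt (𝓡∂ n) q q) u v w z)) := by
  obtain ⟨H', hH'⟩ := exists_hasJetWithinAt_collarMetric hr hL hq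
  set D := fderivWithin ℝ (inChart g.inner q) (halfSpace n) (extChartAt (𝓡∂ n) q q) with hD
  set H := fderivWithin ℝ (fderivWithin ℝ (inChart g.inner q) (halfSpace n)) (halfSpace n)
    (extChartAt (𝓡∂ n) q q) with hH
  set D' := (2 : ℝ) • (centreDifferential g q).smulRight (inChart L q (extChartAt (𝓡∂ n) q q))
  have key : ∀ t, curvature (halfSpace n) (inChart (collarMetric g L t) q)
      (extChartAt (𝓡∂ n) q q) = curvatureOf (centreMetric g q) (D + t • D') (H + t • H') := by
    intro t
    obtain ⟨E, hE, hE0⟩ := hH' t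
    rw [hE.curvature_eq isBody_halfSpace, hE0, inChart_collarMetric_self hq]
  have k0 : curvature (halfSpace n) (inChart g.inner q) (extChartAt (𝓡∂ n) q q)
      = curvatureOf (centreMetric g q) D H := rfl
  rw [key t, key 1, key (-1), k0]
  exact curvatureOf_quadratic _ D D' H H' t u v w z

end Collar

/-! ### Boundary data of the metrics `g + 2 t x^n L` -/

section MixedPart

variable {V : Type*} [NormedAddCommGroup V] [NormedSpace ℝ V]

/-- For a frame which starts with a unit normal vector, the norm of the part `N ∧ w` of a two-vector
is that of the tangential part of its contraction with the conormal. -/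
theorem quadForm_mixedPart_eq {m : ℕ} {G : Bilin V} {φ : V →L[ℝ] ℝ} {F : Fin (m + 1) → V}
    (hs : ∀ u v, G u v = G v u) (h00 : G (F 0) (F 0) = 1) (h0 : ∀ a : Fin m, G (F 0) (F a.succ) = 0)
    (hφ0 : φ (F 0) = 1) (hφ : ∀ a : Fin m, φ (F a.succ) = 0)
    {β : Matrix (Fin (m + 1)) (Fin (m + 1)) ℝ} (hβ : β.transpose = -β) :
    quadForm (bivectorTensor (gram G F)) (mixedPart β)
      = G (contraction φ F β) (contraction φ F β)
        - φ (contraction φ F β) * φ (contraction φ F β) := by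
  have hβ' : ∀ i j, β j i = - β i j := fun i j => congrFun (congrFun hβ i) j
  have hb0 : β 0 0 = 0 := by linarith [hβ' 0 0]
  have hw : contraction φ F β = ∑ a : Fin m, β 0 a.succ • F a.succ := by
    rw [contraction, Fin.sum_univ_succ]
    simp [Fin.sum_univ_succ, hφ0, hφ, hb0]
  have hm00 : mixedPart β 0 0 = 0 := by simp [mixedPart, hb0]
  have hm0 : ∀ a : Fin m, mixedPart β 0 a.succ = β 0 a.succ := fun a => by simp [mixedPart]
  have hm1 : ∀ a : Fin m, mixedPart β a.succ 0 = - β 0 a.succ := fun a => by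
    simp [mixedPart, hβ' 0 a.succ]
  have hm2 : ∀ a b : Fin m, mixedPart β a.succ b.succ = 0 := fun a b => by simp [mixedPart]
  have h0' : ∀ a : Fin m, G (F a.succ) (F 0) = 0 := fun a => (hs _ _).trans (h0 a)
  have hφw : φ (contraction φ F β) = 0 := by rw [hw]; simp [hφ]
  rw [hφw, hw]
  simp only [quadForm, bivectorTensor, gram, Fin.sum_univ_succ, hm00, hm0, hm1, hm2, h00, h0, h0',
    map_sum, map_smul, sum_apply, smul_apply, smul_eq_mul, mul_zero, zero_mul, add_zero, zero_add,
    sub_zero, zero_sub, one_mul, mul_one, Finset.sum_const_zero, Finset.mul_sum]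
  simp only [← Finset.sum_add_distrib]
  rw [Finset.mul_sum]
  refine Finset.sum_congr rfl fun a _ => ?_
  rw [Finset.mul_sum]
  refine Finset.sum_congr rfl fun b _ => ?_
  rw [hs (F b.succ)]
  ring

end MixedPart

section BoundaryForms

variable {m : ℕ} {M : Type*} [TopologicalSpace M] [T2Space M]
  [ChartedSpace (EuclideanHalfSpace (m + 1)) M] [IsManifold (𝓡∂ (m + 1)) ∞ M]
  {g : SmoothMetric (m + 1) M} {r : ℝ} {L : TensorField (m + 1) M}

theorem centreDifferential_unitNormal (hr : IsFermiWidth g r) {q : M}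
    (hq : q ∈ (𝓡∂ (m + 1)).boundary M) :
    centreDifferential g q (unitNormal (centreMetric g q)) = 1 := by
  rw [← normalField_boundary hr hq]
  exact fderivWithin_normalCoordIn_gradient hr hq

/-- Adding `2 t x^n L` to the metric changes the second fundamental form of the boundary by `-t L`,
because the normal derivative of `x^n` is one. -/
theorem secondFundamentalForm_collarMetric (hr : IsFermiWidth g r) (hL : IsNormallyParallel g r L)
    {q : M} (hq : q ∈ (𝓡∂ (m + 1)).boundary M) (t : ℝ) {X Y : EuclideanSpace ℝ (Fin (m + 1))}
    (hX : X 0 = 0) (hY : Y 0 = 0) :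
    secondFundamentalForm (collarMetric g L t) q X Y
      = secondFundamentalForm g.inner q X Y - t * inChart L q (extChartAt (𝓡∂ (m + 1)) q q) X Y := by
  obtain ⟨H', hH'⟩ := exists_hasJetWithinAt_collarMetric hr hL hq
  obtain ⟨D, hD, hD0⟩ := hH' t
  have hG := isInner_centreMetric g q
  rw [secondFundamentalForm_eq (isMetricNear_collarMetric hr hL t hq),
    secondFundamentalForm_eq (SmoothMetric.isMetricNear g q), inChart_collarMetric_self hq,
    connection, connection, inChart_collarMetric_self hq, hG.apply_connectionOf,
    hG.apply_connectionOf, hD.fderivWithin_eq isBody_halfSpace, hD0]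
  have h1 := centreDifferential_unitNormal hr hq
  have h2 : centreDifferential g q X = 0 := fderivWithin_normalCoordIn_tangent hr hq hX
  have h3 : centreDifferential g q Y = 0 := fderivWithin_normalCoordIn_tangent hr hq hY
  simp only [map_add, map_smul, add_apply, smul_apply, smul_eq_mul, koszulForm_apply,
    ContinuousLinearMap.smulRight_apply, h1, h2, h3]
  ring

end BoundaryForms

section BoundaryInequality

variable {m : ℕ}
    {M₀ : Type*} [TopologicalSpace M₀] [T2Space M₀]
    [ChartedSpace (EuclideanHalfSpace (m + 1)) M₀] [IsManifold (𝓡∂ (m + 1)) ∞ M₀]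
    {M₁ : Type*} [TopologicalSpace M₁]
    [ChartedSpace (EuclideanHalfSpace (m + 1)) M₁] [IsManifold (𝓡∂ (m + 1)) ∞ M₁]
    {Γ : Type*} [TopologicalSpace Γ]
    [ChartedSpace (EuclideanSpace ℝ (Fin m)) Γ] [IsManifold (𝓡 m) ∞ Γ]
    {g₀ : SmoothMetric (m + 1) M₀} {g₁ : SmoothMetric (m + 1) M₁}
    {ι₀ : Γ → M₀} {ι₁ : Γ → M₁}
    (hι₀ : IsBoundaryEmbedding m ι₀) (hι₁ : IsBoundaryEmbedding m ι₁)
    {r : ℝ} (hr : IsFermiWidth g₀ r)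
    {L : TensorField (m + 1) M₀} (hpar : IsNormallyParallel g₀ r L)

include hι₀ in
omit [T2Space M₀] in
theorem eventually_inducedMetric_collarMetric (t : ℝ) (y₀ : Γ) :
    inducedMetric g₀.inner ι₀ y₀ =ᶠ[𝓝[univ] (extChartAt (𝓡 m) y₀ y₀)]
      inducedMetric (collarMetric g₀ L t) ι₀ y₀ := by
  have hs' := mem_extChartAt_source (I := 𝓡∂ (m + 1)) (ι₀ y₀)
  refine eventually_of_closedChart ?_
  filter_upwards [hι₀.eventually_source hs'] with y hy' hy
  ext u v
  simp only [inducedMetric, pullBilin_apply]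
  rw [hι₀.inChart_apply hy hy', hι₀.inChart_apply hy hy']
  change _ = (g₀.inner (ι₀ y) + (2 * t * normalCoord g₀ (ι₀ y)) • L (ι₀ y)) _ _
  rw [normalCoord_of_mem g₀ (hι₀.mem_boundary y)]
  simp

include hι₀ hι₁ in
omit [T2Space M₀] in
theorem eventually_inducedMetric_eq (hiso : ∀ (y : Γ) (X Y : TangentSpace (𝓡 m) y),
      g₀.inner (ι₀ y) (mfderiv (𝓡 m) (𝓡∂ (m + 1)) ι₀ y X) (mfderiv (𝓡 m) (𝓡∂ (m + 1)) ι₀ y Y) =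
      g₁.inner (ι₁ y) (mfderiv (𝓡 m) (𝓡∂ (m + 1)) ι₁ y X) (mfderiv (𝓡 m) (𝓡∂ (m + 1)) ι₁ y Y))
    (y₀ : Γ) : inducedMetric g₀.inner ι₀ y₀ =ᶠ[𝓝[univ] (extChartAt (𝓡 m) y₀ y₀)]
      inducedMetric g₁.inner ι₁ y₀ := by
  have hs₀ := mem_extChartAt_source (I := 𝓡∂ (m + 1)) (ι₀ y₀)
  have hs₁ := mem_extChartAt_source (I := 𝓡∂ (m + 1)) (ι₁ y₀)
  refine eventually_of_closedChart ?_
  filter_upwards [hι₀.eventually_source hs₀, hι₁.eventually_source hs₁] with y h0 h1 hy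
  ext u v
  simp only [inducedMetric, pullBilin_apply]
  rw [hι₀.inChart_apply hy h0, hι₁.inChart_apply hy h1]
  exact hiso y _ _

include hι₀ hι₁ hr hpar in
/-- With `L = L₀ + L₁` on the boundary, the second fundamental form of `g₀ + 2 t x^n L` is
`(1 - t) L₀ - t L₁`. -/
theorem eventually_boundaryFormIn (hext : ∀ (y : Γ) (X Y : TangentSpace (𝓡 m) y),
      L (ι₀ y) (mfderiv (𝓡 m) (𝓡∂ (m + 1)) ι₀ y X) (mfderiv (𝓡 m) (𝓡∂ (m + 1)) ι₀ y Y) =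
        sumForm g₀.inner g₁.inner ι₀ ι₁ y X Y) (t : ℝ) (y₀ : Γ) :
    ∀ᶠ x in 𝓝[univ] (extChartAt (𝓡 m) y₀ y₀), ∀ u v,
      boundaryFormIn (collarMetric g₀ L t) ι₀ y₀ x u v
        = (1 - t) * boundaryFormIn g₀.inner ι₀ y₀ x u v
          + t * -boundaryFormIn g₁.inner ι₁ y₀ x u v := by
  have hs₀ := mem_extChartAt_source (I := 𝓡∂ (m + 1)) (ι₀ y₀)
  have hs₁ := mem_extChartAt_source (I := 𝓡∂ (m + 1)) (ι₁ y₀)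
  refine eventually_of_closedChart ?_
  filter_upwards [hι₀.eventually_source hs₀, hι₁.eventually_source hs₁] with y h0 h1 hy u v
  have hb := hι₀.mem_boundary y
  rw [boundaryFormIn, normalAlong,
    hι₀.hessian_normal hy h0 (isMetricNear_collarMetric hr hpar t hb),
    boundaryFormIn, normalAlong, hι₀.hessian_normal hy h0 (SmoothMetric.isMetricNear g₀ _),
    boundaryFormIn, normalAlong, hι₁.hessian_normal hy h1 (SmoothMetric.isMetricNear g₁ _)]
  have h2 := hext y (fderivWithin ℝ (closedTransition y₀ y) univ (extChartAt (𝓡 m) y₀ y) u)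
    (fderivWithin ℝ (closedTransition y₀ y) univ (extChartAt (𝓡 m) y₀ y) v)
  have htan : ∀ w : EuclideanSpace ℝ (Fin m),
      firstCoord (m + 1) (mfderiv (𝓡 m) (𝓡∂ (m + 1)) ι₀ y w) = 0 := by
    intro w
    rw [hι₀.mfderiv_eq]
    exact (hι₀.eventually_fderivWithin_firstCoord (mem_extChartAt_source y)
      (mem_extChartAt_source (ι₀ y))).self_of_nhdsWithin (mem_univ _) w
  generalize fderivWithin ℝ (closedTransition y₀ y) univ (extChartAt (𝓡 m) y₀ y) u = u' at h2 ⊢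
  generalize fderivWithin ℝ (closedTransition y₀ y) univ (extChartAt (𝓡 m) y₀ y) v = v' at h2 ⊢
  have h3 := secondFundamentalForm_collarMetric hr hpar hb t (htan u') (htan v')
  rw [inChart_self] at h3
  have h4 : tensorAt L (ι₀ y) (mfderiv (𝓡 m) (𝓡∂ (m + 1)) ι₀ y u')
    (mfderiv (𝓡 m) (𝓡∂ (m + 1)) ι₀ y v') = boundaryForm g₀.inner ι₀ y u' v'
      + boundaryForm g₁.inner ι₁ y u' v' := h2
  rw [h4] at h3
  have h5 : boundaryForm (collarMetric g₀ L t) ι₀ y u' v' = boundaryForm g₀.inner ι₀ y u' v'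
    - t * (boundaryForm g₀.inner ι₀ y u' v' + boundaryForm g₁.inner ι₁ y u' v') := h3
  rw [h5]
  ring

end BoundaryInequality

/-! ### The curvature inequality at the boundary -/

section BoundaryBound

/-- Every two-vector is a combination of the wedge products of the vectors of a frame which consists
of a vector transversal to the boundary and of vectors tangent to it. -/
theorem exists_congruence_eq {m : ℕ} {φ : EuclideanSpace ℝ (Fin (m + 1)) →L[ℝ] ℝ}
    {N : EuclideanSpace ℝ (Fin (m + 1))}
    {A : EuclideanSpace ℝ (Fin m) →L[ℝ] EuclideanSpace ℝ (Fin (m + 1))} (hN : φ N = 1)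
    (hA : ∀ v, φ (A v) = 0) (hinj : Function.Injective A)
    {α : Matrix (Fin (m + 1)) (Fin (m + 1)) ℝ} (hα : α.transpose = -α) :
    ∃ β : Matrix (Fin (m + 1)) (Fin (m + 1)) ℝ, β.transpose = -β ∧
      frameMatrix (normalFrame N A stdVec) * β * (frameMatrix (normalFrame N A stdVec)).transpose
        = α := by
  set J := frameMatrix (normalFrame N A stdVec) with hJ
  have hmul : ∀ v : Fin (m + 1) → ℝ, WithLp.toLp 2 (J.mulVec v)
      = v 0 • N + A (WithLp.toLp 2 fun a => v a.succ) := by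
    intro v
    have h1 : WithLp.toLp 2 (J.mulVec v) = ∑ j, v j • normalFrame N A stdVec j := by
      ext i
      simp [J, frameMatrix, Matrix.mulVec, dotProduct, mul_comm]
    rw [h1, Fin.sum_univ_succ, map_eq_sum_stdVec A]
    rfl
  have hJi : Function.Injective J.mulVec := by
    refine (injective_iff_map_eq_zero J.mulVecLin).2 fun v hv => ?_
    have h1 := hmul v
    rw [show J.mulVec v = 0 from hv] at h1
    have h2 := congrArg φ h1
    simp only [map_add, map_smul, hN, hA, WithLp.toLp_zero, map_zero, smul_eq_mul, mul_one,
      add_zero] at h2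
    rw [← h2, zero_smul, zero_add, WithLp.toLp_zero] at h1
    have h3 := hinj (h1.symm.trans (map_zero A).symm)
    ext i
    refine Fin.cases h2.symm (fun a => ?_) i
    exact congrArg (fun w : EuclideanSpace ℝ (Fin m) => w a) h3
  have hdet : IsUnit J.det :=
    (Matrix.isUnit_iff_isUnit_det _).1 (Matrix.mulVec_injective_iff_isUnit.1 hJi)
  refine ⟨J⁻¹ * α * J⁻¹.transpose, transpose_congruence hα _, ?_⟩
  have h1 : J⁻¹.transpose * J.transpose = 1 := by
    rw [← Matrix.transpose_mul, Matrix.mul_nonsing_inv _ hdet, Matrix.transpose_one]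
  calc _ = (J * J⁻¹) * α * (J⁻¹.transpose * J.transpose) := by simp only [Matrix.mul_assoc]
    _ = α := by rw [h1, Matrix.mul_nonsing_inv _ hdet, Matrix.one_mul, Matrix.mul_one]

variable {m : ℕ}
    {M₀ : Type*} [TopologicalSpace M₀] [T2Space M₀]
    [ChartedSpace (EuclideanHalfSpace (m + 1)) M₀] [IsManifold (𝓡∂ (m + 1)) ∞ M₀]
    {M₁ : Type*} [TopologicalSpace M₁]
    [ChartedSpace (EuclideanHalfSpace (m + 1)) M₁] [IsManifold (𝓡∂ (m + 1)) ∞ M₁]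
    {Γ : Type*} [TopologicalSpace Γ]
    [ChartedSpace (EuclideanSpace ℝ (Fin m)) Γ] [IsManifold (𝓡 m) ∞ Γ]
    {g₀ : SmoothMetric (m + 1) M₀} {g₁ : SmoothMetric (m + 1) M₁}
    {ι₀ : Γ → M₀} {ι₁ : Γ → M₁}
    (hι₀ : IsBoundaryEmbedding m ι₀) (hι₁ : IsBoundaryEmbedding m ι₁)
    {r : ℝ} (hr : IsFermiWidth g₀ r)
    {L : TensorField (m + 1) M₀} (hpar : IsNormallyParallel g₀ r L)

include hr hpar in
omit [T2Space M₀] in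
theorem frameForm_curvature_collarMetric {q : M₀} (hq : q ∈ (𝓡∂ (m + 1)).boundary M₀) (t : ℝ)
    {ι : Type*} [Fintype ι] (F : ι → EuclideanSpace ℝ (Fin (m + 1))) (β : Matrix ι ι ℝ) :
    frameForm (curvature (halfSpace (m + 1)) (inChart (collarMetric g₀ L t) q)
        (extChartAt (𝓡∂ (m + 1)) q q)) F β
      = frameForm (curvature (halfSpace (m + 1)) (inChart g₀.inner q)
          (extChartAt (𝓡∂ (m + 1)) q q)) F β
        + (t * (1 / 2) * (frameForm (curvature (halfSpace (m + 1)) (inChart (collarMetric g₀ L 1) q)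
              (extChartAt (𝓡∂ (m + 1)) q q)) F β
            + -1 * frameForm (curvature (halfSpace (m + 1)) (inChart (collarMetric g₀ L (-1)) q)
              (extChartAt (𝓡∂ (m + 1)) q q)) F β)
          + t ^ 2 * ((1 / 2) *
            (frameForm (curvature (halfSpace (m + 1)) (inChart (collarMetric g₀ L 1) q)
              (extChartAt (𝓡∂ (m + 1)) q q)) F β
            + frameForm (curvature (halfSpace (m + 1)) (inChart (collarMetric g₀ L (-1)) q)
              (extChartAt (𝓡∂ (m + 1)) q q)) F β)
            + -1 * frameForm (curvature (halfSpace (m + 1)) (inChart g₀.inner q)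
              (extChartAt (𝓡∂ (m + 1)) q q)) F β)) := by
  simp only [frameForm, ← quadForm_add, ← quadForm_const_mul]
  congr 1
  funext i j k l
  exact curvature_collarMetric hr hpar hq t _ _ _ _

include hι₀ hι₁ in
omit [T2Space M₀] in
theorem boundaryFormIn_add (hext : ∀ (y : Γ) (X Y : TangentSpace (𝓡 m) y),
      L (ι₀ y) (mfderiv (𝓡 m) (𝓡∂ (m + 1)) ι₀ y X) (mfderiv (𝓡 m) (𝓡∂ (m + 1)) ι₀ y Y) =
        sumForm g₀.inner g₁.inner ι₀ ι₁ y X Y) (y₀ : Γ) (u v : EuclideanSpace ℝ (Fin m)) :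
    boundaryFormIn g₀.inner ι₀ y₀ (extChartAt (𝓡 m) y₀ y₀) u v
      + boundaryFormIn g₁.inner ι₁ y₀ (extChartAt (𝓡 m) y₀ y₀) u v
      = inChart L (ι₀ y₀) (extChartAt (𝓡∂ (m + 1)) (ι₀ y₀) (ι₀ y₀))
        (fderivWithin ℝ (boundaryChart ι₀ y₀) univ (extChartAt (𝓡 m) y₀ y₀) u)
        (fderivWithin ℝ (boundaryChart ι₀ y₀) univ (extChartAt (𝓡 m) y₀ y₀) v) := by
  have hs := mem_extChartAt_source (I := 𝓡 m) y₀
  have hs₀ := mem_extChartAt_source (I := 𝓡∂ (m + 1)) (ι₀ y₀)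
  have hs₁ := mem_extChartAt_source (I := 𝓡∂ (m + 1)) (ι₁ y₀)
  rw [boundaryFormIn, normalAlong, hι₀.hessian_normal hs hs₀ (SmoothMetric.isMetricNear g₀ _),
    boundaryFormIn, normalAlong, hι₁.hessian_normal hs hs₁ (SmoothMetric.isMetricNear g₁ _),
    ← boundaryChart_apply hs, hι₀.inChart_apply hs hs₀]
  exact (hext y₀ _ _).symm

include hι₀ in
omit [T2Space M₀] in
theorem inChart_nonneg_of_tangent
    (hL : ∀ (y : Γ) (X : TangentSpace (𝓡 m) y), 0 ≤ sumForm g₀.inner g₁.inner ι₀ ι₁ y X X)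
    (hext : ∀ (y : Γ) (X Y : TangentSpace (𝓡 m) y),
      L (ι₀ y) (mfderiv (𝓡 m) (𝓡∂ (m + 1)) ι₀ y X) (mfderiv (𝓡 m) (𝓡∂ (m + 1)) ι₀ y Y) =
        sumForm g₀.inner g₁.inner ι₀ ι₁ y X Y) (y₀ : Γ) (u : EuclideanSpace ℝ (Fin m)) :
    0 ≤ inChart L (ι₀ y₀) (extChartAt (𝓡∂ (m + 1)) (ι₀ y₀) (ι₀ y₀))
        (fderivWithin ℝ (boundaryChart ι₀ y₀) univ (extChartAt (𝓡 m) y₀ y₀) u)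
        (fderivWithin ℝ (boundaryChart ι₀ y₀) univ (extChartAt (𝓡 m) y₀ y₀) u) := by
  have hs := mem_extChartAt_source (I := 𝓡 m) y₀
  have hs₀ := mem_extChartAt_source (I := 𝓡∂ (m + 1)) (ι₀ y₀)
  rw [← boundaryChart_apply hs, hι₀.inChart_apply hs hs₀]
  exact (hL y₀ _).trans_eq (hext y₀ _ _).symm

/-- The frame at the point `ι y` which consists of the inward unit normal of the boundary and of the
coordinate vectors of the boundary. -/
def boundaryFrame (g : SmoothMetric (m + 1) M₀) (ι : Γ → M₀) (y : Γ) :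
    Fin (m + 1) → EuclideanSpace ℝ (Fin (m + 1)) :=
  normalFrame (unitNormal (centreMetric g (ι y)))
    (fderivWithin ℝ (boundaryChart ι y) univ (extChartAt (𝓡 m) y y)) stdVec

variable (hiso : ∀ (y : Γ) (X Y : TangentSpace (𝓡 m) y),
      g₀.inner (ι₀ y) (mfderiv (𝓡 m) (𝓡∂ (m + 1)) ι₀ y X) (mfderiv (𝓡 m) (𝓡∂ (m + 1)) ι₀ y Y) =
      g₁.inner (ι₁ y) (mfderiv (𝓡 m) (𝓡∂ (m + 1)) ι₁ y X) (mfderiv (𝓡 m) (𝓡∂ (m + 1)) ι₁ y Y))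
    (hL : ∀ (y : Γ) (X : TangentSpace (𝓡 m) y), 0 ≤ sumForm g₀.inner g₁.inner ι₀ ι₁ y X X)
    (hext : ∀ (y : Γ) (X Y : TangentSpace (𝓡 m) y),
      L (ι₀ y) (mfderiv (𝓡 m) (𝓡∂ (m + 1)) ι₀ y X) (mfderiv (𝓡 m) (𝓡∂ (m + 1)) ι₀ y Y) =
        sumForm g₀.inner g₁.inner ι₀ ι₁ y X Y)

include hι₀ hι₁ hr hpar hiso hL hext in
/-- The comparison of the curvatures of `g₀`, `g₀ + 2 t x^n L` and `g₁` at a boundary point. The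
frame `F₁` for `g₁` consists of the outward normal and of the coordinate vectors of the boundary. -/
theorem exists_frame_comparison (y₀ : Γ) {t : ℝ} (ht : t ∈ Icc (0 : ℝ) 1) :
    ∃ F₁ : Fin (m + 1) → EuclideanSpace ℝ (Fin (m + 1)),
      gram (centreMetric g₁ (ι₁ y₀)) F₁ = gram (centreMetric g₀ (ι₀ y₀)) (boundaryFrame g₀ ι₀ y₀) ∧
      ∀ β : Matrix (Fin (m + 1)) (Fin (m + 1)) ℝ, β.transpose = -β →
        frameForm (curvature (halfSpace (m + 1)) (inChart (collarMetric g₀ L t) (ι₀ y₀))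
            (extChartAt (𝓡∂ (m + 1)) (ι₀ y₀) (ι₀ y₀))) (boundaryFrame g₀ ι₀ y₀) (mixedPart β)
          - (1 - t) * frameForm (curvature (halfSpace (m + 1)) (inChart g₀.inner (ι₀ y₀))
            (extChartAt (𝓡∂ (m + 1)) (ι₀ y₀) (ι₀ y₀))) (boundaryFrame g₀ ι₀ y₀) (mixedPart β)
          - t * frameForm (curvature (halfSpace (m + 1)) (inChart g₁.inner (ι₁ y₀))
            (extChartAt (𝓡∂ (m + 1)) (ι₁ y₀) (ι₁ y₀))) F₁ (mixedPart β)
        ≤ frameForm (curvature (halfSpace (m + 1)) (inChart (collarMetric g₀ L t) (ι₀ y₀))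
            (extChartAt (𝓡∂ (m + 1)) (ι₀ y₀) (ι₀ y₀))) (boundaryFrame g₀ ι₀ y₀) β
          - (1 - t) * frameForm (curvature (halfSpace (m + 1)) (inChart g₀.inner (ι₀ y₀))
            (extChartAt (𝓡∂ (m + 1)) (ι₀ y₀) (ι₀ y₀))) (boundaryFrame g₀ ι₀ y₀) β
          - t * frameForm (curvature (halfSpace (m + 1)) (inChart g₁.inner (ι₁ y₀))
            (extChartAt (𝓡∂ (m + 1)) (ι₁ y₀) (ι₁ y₀))) F₁ β := by
  have hq := hι₀.mem_boundary y₀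
  have hs := mem_extChartAt_source (I := 𝓡 m) y₀
  have hs₀ := mem_extChartAt_source (I := 𝓡∂ (m + 1)) (ι₀ y₀)
  -- the three hypersurfaces, the last one with the outward normal
  have h₀ := hι₀.isHypersurfaceAt (SmoothMetric.isMetricNear g₀ (ι₀ y₀)) (Filter.EventuallyEq.rfl)
  have h := hι₀.isHypersurfaceAt (isMetricNear_collarMetric hr hpar t hq)
    (eventually_inducedMetric_collarMetric hι₀ t y₀)
  have h₁ := (hι₁.isHypersurfaceAt (SmoothMetric.isMetricNear g₁ (ι₁ y₀))
    (eventually_inducedMetric_eq hι₀ hι₁ hiso y₀)).neg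
  have hII := eventually_boundaryFormIn hι₀ hι₁ hr hpar hext t y₀
  have hb : boundaryChart ι₀ y₀ (extChartAt (𝓡 m) y₀ y₀)
    = extChartAt (𝓡∂ (m + 1)) (ι₀ y₀) (ι₀ y₀) := boundaryChart_apply hs
  have hb₁ : boundaryChart ι₁ y₀ (extChartAt (𝓡 m) y₀ y₀)
    = extChartAt (𝓡∂ (m + 1)) (ι₁ y₀) (ι₁ y₀) := boundaryChart_apply hs
  have hN₀ : normalAlong g₀.inner ι₀ y₀ (extChartAt (𝓡 m) y₀ y₀)
      = unitNormal (centreMetric g₀ (ι₀ y₀)) := by rw [normalAlong, hb]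
  have hNt : normalAlong (collarMetric g₀ L t) ι₀ y₀ (extChartAt (𝓡 m) y₀ y₀)
      = unitNormal (centreMetric g₀ (ι₀ y₀)) := by
    rw [normalAlong, hb, inChart_collarMetric_self hq]
  have hl : (Matrix.of fun a b : Fin m => boundaryFormIn g₀.inner ι₀ y₀ (extChartAt (𝓡 m) y₀ y₀)
        (stdVec a) (stdVec b)
      - -boundaryFormIn g₁.inner ι₁ y₀ (extChartAt (𝓡 m) y₀ y₀) (stdVec a)
        (stdVec b)).PosSemidef := by
    have h1 := gram_posSemidef (G := pullBilin
      (fderivWithin ℝ (boundaryChart ι₀ y₀) univ (extChartAt (𝓡 m) y₀ y₀)) (inChart L (ι₀ y₀)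
      (extChartAt (𝓡∂ (m + 1)) (ι₀ y₀) (ι₀ y₀))))
      (fun u v => hpar.inChart_symm (mem_tube_of_mem g₀ hr.pos hq) hs₀ _ _)
      (fun u => inChart_nonneg_of_tangent hι₀ hL hext y₀ u) (stdVec : Fin m → _)
    convert h1 using 1
    ext a b
    rw [Matrix.of_apply, sub_neg_eq_add, boundaryFormIn_add hι₀ hι₁ hext y₀]
    rfl
  refine ⟨normalFrame (-normalAlong g₁.inner ι₁ y₀ (extChartAt (𝓡 m) y₀ y₀))
    (fderivWithin ℝ (boundaryChart ι₁ y₀) univ (extChartAt (𝓡 m) y₀ y₀)) stdVec, ?_, fun β hβ => ?_⟩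
  · have hgram := (h₁.gram_eq (stdVec : Fin m → _)).trans (h₀.gram_eq stdVec).symm
    rw [hN₀, hb, hb₁] at hgram
    exact hgram
  · have hcomp := h.frameForm_comparison isBody_halfSpace isBody_halfSpace isBody_halfSpace
      isBody_univ h₀ h₁ ht hII stdVec hl hβ
    rw [hN₀, hNt, hb, hb₁] at hcomp
    exact hcomp

end BoundaryBound

section UniformBound

/-- The arithmetic of the bound: `f` denotes values on the mixed part of a two-vector, `c` values on
the two-vector; the indices refer to the parameters `t`, `0`, `1`, `-1` and to the metric `g₁`. The
factor `5 = 1 + 2 + 2` collects the linear term, the quadratic term and `f₀ - f₁`. -/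
theorem mixed_bound {κ K t I J ft f₀ f₁ fp fm ct c₀ c₁ : ℝ} (ht : t ∈ Icc (0 : ℝ) 1)
    (hp : |fp| ≤ K * J) (hm : |fm| ≤ K * J) (h0 : |f₀| ≤ K * J) (h1 : |f₁| ≤ K * J)
    (hft : ft = f₀ + (t * (1 / 2) * (fp + -1 * fm) + t ^ 2 * ((1 / 2) * (fp + fm) + -1 * f₀)))
    (hc : ft - (1 - t) * f₀ - t * f₁ ≤ ct - (1 - t) * c₀ - t * c₁) (hc0 : κ * I ≤ c₀)
    (hc1 : κ * I ≤ c₁) : κ * I ≤ ct + 5 * K * t * J := by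
  obtain ⟨ht0, ht1⟩ := ht
  rw [abs_le] at hp hm h0 h1
  have e1 : (1 - t) * (κ * I) ≤ (1 - t) * c₀ := mul_le_mul_of_nonneg_left hc0 (by linarith)
  have e2 : t * (κ * I) ≤ t * c₁ := mul_le_mul_of_nonneg_left hc1 ht0
  have e3 : t * (-(K * J)) ≤ t * ((1 / 2) * (fp + -1 * fm)) :=
    mul_le_mul_of_nonneg_left (by linarith) ht0
  have e4 : t * (-(2 * (K * J))) ≤ t * (t * ((1 / 2) * (fp + fm) + -1 * f₀)) := by
    refine mul_le_mul_of_nonneg_left ?_ ht0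
    have h5 : t * (-(2 * (K * J))) ≤ t * ((1 / 2) * (fp + fm) + -1 * f₀) :=
      mul_le_mul_of_nonneg_left (by linarith) ht0
    nlinarith
  have e5 : t * (-(2 * (K * J))) ≤ t * (f₀ - f₁) := mul_le_mul_of_nonneg_left (by linarith) ht0
  subst hft
  linarith

variable {m : ℕ}
    {M₀ : Type*} [TopologicalSpace M₀] [T2Space M₀]
    [ChartedSpace (EuclideanHalfSpace (m + 1)) M₀] [IsManifold (𝓡∂ (m + 1)) ∞ M₀]
    {M₁ : Type*} [TopologicalSpace M₁]
    [ChartedSpace (EuclideanHalfSpace (m + 1)) M₁] [IsManifold (𝓡∂ (m + 1)) ∞ M₁]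
    {Γ : Type*} [TopologicalSpace Γ] [CompactSpace Γ]
    [ChartedSpace (EuclideanSpace ℝ (Fin m)) Γ] [IsManifold (𝓡 m) ∞ Γ]
    {g₀ : SmoothMetric (m + 1) M₀} {g₁ : SmoothMetric (m + 1) M₁}
    {ι₀ : Γ → M₀} {ι₁ : Γ → M₁}
    (hι₀ : IsBoundaryEmbedding m ι₀) (hι₁ : IsBoundaryEmbedding m ι₁)
    {r : ℝ} (hr : IsFermiWidth g₀ r)
    {L : TensorField (m + 1) M₀} (hpar : IsNormallyParallel g₀ r L)
    (hiso : ∀ (y : Γ) (X Y : TangentSpace (𝓡 m) y),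
      g₀.inner (ι₀ y) (mfderiv (𝓡 m) (𝓡∂ (m + 1)) ι₀ y X) (mfderiv (𝓡 m) (𝓡∂ (m + 1)) ι₀ y Y) =
      g₁.inner (ι₁ y) (mfderiv (𝓡 m) (𝓡∂ (m + 1)) ι₁ y X) (mfderiv (𝓡 m) (𝓡∂ (m + 1)) ι₁ y Y))
    (hL : ∀ (y : Γ) (X : TangentSpace (𝓡 m) y), 0 ≤ sumForm g₀.inner g₁.inner ι₀ ι₁ y X X)
    (hext : ∀ (y : Γ) (X Y : TangentSpace (𝓡 m) y),
      L (ι₀ y) (mfderiv (𝓡 m) (𝓡∂ (m + 1)) ι₀ y X) (mfderiv (𝓡 m) (𝓡∂ (m + 1)) ι₀ y Y) =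
        sumForm g₀.inner g₁.inner ι₀ ι₁ y X Y)

include hι₀ hι₁ hr hpar hiso hL hext in
/-- At a boundary point, the curvature operator of `g + 2 t x^n L` is at least `κ` up to a multiple
of `t |w|²`, where `w` is the tangential part of the contraction of the two-vector with the
conormal. -/
theorem exists_curvature_collarMetric_ge
    {κ : ℝ} (hR₀ : CurvatureGE g₀.inner κ) (hR₁ : CurvatureGE g₁.inner κ) :
    ∃ C₀ : ℝ, ∀ q ∈ (𝓡∂ (m + 1)).boundary M₀, ∀ t ∈ Icc (0 : ℝ) 1,
      ∀ α : Matrix (Fin (m + 1)) (Fin (m + 1)) ℝ, α.transpose = -α →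
        κ * frameForm (bivec (centreMetric g₀ q)) stdVec α
          ≤ frameForm (curvature (halfSpace (m + 1)) (inChart (collarMetric g₀ L t) q)
              (extChartAt (𝓡∂ (m + 1)) q q)) stdVec α
            + C₀ * t * (centreMetric g₀ q (contraction (centreDifferential g₀ q) stdVec α)
                (contraction (centreDifferential g₀ q) stdVec α)
              - centreDifferential g₀ q (contraction (centreDifferential g₀ q) stdVec α)
                * centreDifferential g₀ q (contraction (centreDifferential g₀ q) stdVec α)) := by
  -- a common bound for the curvature operators on the compact boundary; those of `g₀ + 2 t x^n L`
  -- are determined by the values for `t = 0, 1, -1`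
  have hS₀ : IsCompact (range ι₀) := isCompact_range hι₀.smooth.continuous
  have hS₁ : IsCompact (range ι₁) := isCompact_range hι₁.smooth.continuous
  have hcol : ∀ t, ∀ q ∈ range ι₀, ∀ᶠ p in 𝓝 q, IsMetricNear (collarMetric g₀ L t) p :=
    fun t q hq => eventually_isMetricNear_collarMetric hr hpar t (hι₀.range_eq ▸ hq)
  obtain ⟨K₁, hK₁⟩ := exists_abs_curvatureForm_le hS₀ (hcol 1)
  obtain ⟨K₂, hK₂⟩ := exists_abs_curvatureForm_le hS₀ (hcol (-1))
  obtain ⟨K₃, hK₃⟩ := exists_abs_curvatureForm_le hS₀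
    fun q _ => .of_forall fun p => SmoothMetric.isMetricNear g₀ p
  obtain ⟨K₄, hK₄⟩ := exists_abs_curvatureForm_le hS₁
    fun q _ => .of_forall fun p => SmoothMetric.isMetricNear g₁ p
  have l₁ : max (max K₁ K₂) (max K₃ K₄) ≥ K₁ := (le_max_left _ _).trans (le_max_left _ _)
  have l₂ : max (max K₁ K₂) (max K₃ K₄) ≥ K₂ := (le_max_right _ _).trans (le_max_left _ _)
  have l₃ : max (max K₁ K₂) (max K₃ K₄) ≥ K₃ := (le_max_left _ _).trans (le_max_right _ _)
  have l₄ : max (max K₁ K₂) (max K₃ K₄) ≥ K₄ := (le_max_right _ _).trans (le_max_right _ _)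
  generalize max (max K₁ K₂) (max K₃ K₄) = K at l₁ l₂ l₃ l₄
  refine ⟨5 * K, fun q hq t ht α hα => ?_⟩
  obtain ⟨y₀, rfl⟩ : q ∈ range ι₀ := hι₀.range_eq ▸ hq
  have hs := mem_extChartAt_source (I := 𝓡 m) y₀
  have hs₀ := mem_extChartAt_source (I := 𝓡∂ (m + 1)) (ι₀ y₀)
  have hG := isInner_centreMetric g₀ (ι₀ y₀)
  have hA0 : ∀ v, fderivWithin ℝ (boundaryChart ι₀ y₀) univ (extChartAt (𝓡 m) y₀ y₀) v 0 = 0 :=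
    (hι₀.eventually_fderivWithin_firstCoord hs hs₀).self_of_nhdsWithin (mem_univ _)
  have hdA : ∀ v, centreDifferential g₀ (ι₀ y₀) (fderivWithin ℝ (boundaryChart ι₀ y₀) univ
    (extChartAt (𝓡 m) y₀ y₀) v) = 0 := fun v => fderivWithin_normalCoordIn_tangent hr hq (hA0 v)
  have hdN := centreDifferential_unitNormal hr hq
  obtain ⟨F₁, hgram, hcomp⟩ := exists_frame_comparison hι₀ hι₁ hr hpar hiso hL hext y₀ ht
  -- pass to the frame which consists of the normal and of tangent vectors
  obtain ⟨β, hβ, rfl⟩ := exists_congruence_eq hdN hdA (hι₀.injective_fderivWithin y₀) hα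
  have hw := quadForm_mixedPart_eq (F := boundaryFrame g₀ ι₀ y₀) hG.symm hG.unitNormal_unit
      (fun a => hG.unitNormal_tangent (hA0 (stdVec a))) hdN (fun a => hdA _) hβ
  change (frameMatrix (boundaryFrame g₀ ι₀ y₀) * β
    * (frameMatrix (boundaryFrame g₀ ι₀ y₀)).transpose).transpose
    = -(frameMatrix (boundaryFrame g₀ ι₀ y₀) * β
    * (frameMatrix (boundaryFrame g₀ ι₀ y₀)).transpose) at hα
  rw [contraction_change (e := stdVec) (J := frameMatrix (boundaryFrame g₀ ι₀ y₀)) _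
    fun j => (sum_smul_stdVec (boundaryFrame g₀ ι₀ y₀ j)).symm] at hw
  have hβ' := mixedPart_transpose hβ
  have hα' := transpose_congruence hβ' (frameMatrix (boundaryFrame g₀ ι₀ y₀))
  have b₁ := hK₁ _ ⟨y₀, rfl⟩ K l₁ _ hα'
  have b₂ := hK₂ _ ⟨y₀, rfl⟩ K l₂ _ hα'
  have b₃ := hK₃ _ ⟨y₀, rfl⟩ K l₃ _ hα'
  have b₄ := hK₄ _ ⟨y₀, rfl⟩ K l₄ _ (transpose_congruence hβ' (frameMatrix F₁))
  have b₅ := hR₀ (ι₀ y₀) _ hα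
  have b₆ := hR₁ (ι₁ y₀) _ (transpose_congruence hβ (frameMatrix F₁))
  rw [curvatureForm_frame (isMetricNear_collarMetric hr hpar _ hq), bivectorForm_frame,
    inChart_collarMetric_self hq, frameForm_bivec] at b₁ b₂
  rw [curvatureForm_frame (SmoothMetric.isMetricNear _ _), bivectorForm_frame,
    frameForm_bivec] at b₃ b₄ b₅ b₆
  rw [hgram] at b₄ b₆
  have hquad := frameForm_curvature_collarMetric hr hpar hq t (boundaryFrame g₀ ι₀ y₀) (mixedPart β)
  have key := mixed_bound ht b₁ b₂ b₃ b₄ hquad (hcomp β hβ) b₅ b₆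
  rw [hw, ← frameForm_bivec, (isQuadrilinear_bivec _).frameForm_change (e := stdVec)
      (J := frameMatrix (boundaryFrame g₀ ι₀ y₀))
      fun j => (sum_smul_stdVec (boundaryFrame g₀ ι₀ y₀ j)).symm,
    (isQuadrilinear_curvature _ _ _).frameForm_change (e := stdVec)
      (J := frameMatrix (boundaryFrame g₀ ι₀ y₀))
      fun j => (sum_smul_stdVec (boundaryFrame g₀ ι₀ y₀ j)).symm] at key
  exact key

end UniformBound

/-! ### The tensor field `L` is positive semidefinite near the boundary -/

section Positivity

variable {n : ℕ} [NeZero n] {M : Type*} [TopologicalSpace M]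
  [ChartedSpace (EuclideanHalfSpace n) M] [IsManifold (𝓡∂ n) ∞ M]

/-- If `A` is positive definite at `p`, then `A + ε B` is nonnegative near `p` for small `ε`. -/
theorem eventually_nonneg_add_smul {A B : TensorField n M} {p : M} (hA : IsSmoothAt A p)
    (hB : IsSmoothAt B p) (hAs : ∀ᶠ q in 𝓝 p, ∀ u v, tensorAt A q u v = tensorAt A q v u)
    (hBs : ∀ᶠ q in 𝓝 p, ∀ u v, tensorAt B q u v = tensorAt B q v u) (hp : IsInner (tensorAt A p)) :
    ∀ᶠ z : ℝ × M in 𝓝 (0, p), ∀ v, 0 ≤ tensorAt A z.2 v v + z.1 * tensorAt B z.2 v v := by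
  have hm := mem_extChartAt_source (I := 𝓡∂ n) p
  rw [← inChart_self] at hp
  have h2 : Tendsto (fun z : ℝ × M => z.2) (𝓝 (0, p)) (𝓝 p) := continuous_snd.tendsto _
  have h1 : Tendsto (fun z : ℝ × M => z.1) (𝓝 (0, p)) (𝓝 0) := continuous_fst.tendsto _
  have hc := (tendsto_chart hm).comp h2
  have hT := (((hA.contDiffWithinAt hm).continuousWithinAt.tendsto.comp hc).add
    (h1.smul ((hB.contDiffWithinAt hm).continuousWithinAt.tendsto.comp hc)))
  rw [zero_smul, add_zero] at hT
  filter_upwards [hT.eventually hp.eventually, h2.eventually hAs, h2.eventually hBs,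
    h2.eventually ((isOpen_extChartAt_source (I := 𝓡∂ n) p).mem_nhds hm)] with z h1 hAq hBq hqs v
  have e : ∀ h : TensorField n M, inChart h p (extChartAt (𝓡∂ n) p z.2)
      = pullBilin (chartFrame p (extChartAt (𝓡∂ n) p z.2)) (tensorAt h z.2) := by
    intro h
    rw [inChart, (extChartAt (𝓡∂ n) p).left_inv hqs]
  simp only [Function.comp_apply, e] at h1
  obtain ⟨w, rfl⟩ := (chartFrame_bijective hqs).2 v
  have h2 := h1 fun u v => by
    simp only [add_apply, smul_apply, pullBilin_apply, hAq _ (chartFrame p _ v),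
      hBq _ (chartFrame p _ v)]
  by_cases hw : w = 0
  · simp [hw]
  · exact (h2.pos w hw).le

variable {g : SmoothMetric n M} {r : ℝ} {L : TensorField n M}

theorem differential_chart (hr : IsFermiWidth g r) {p q : M} (hp : p ∈ tube g r)
    (hq : p ∈ (extChartAt (𝓡∂ n) q).source) (v : EuclideanSpace ℝ (Fin n)) :
    fderivWithin ℝ (normalCoordIn g q) (halfSpace n) (extChartAt (𝓡∂ n) q p) v
      = centreDifferential g p (chartFrame q (extChartAt (𝓡∂ n) q p) v) := by
  have h1 := fderivWithin_comp_chart (contMDiffAt_normalCoord g hr hp) hq v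
  have h2 := fderivWithin_comp_chart (contMDiffAt_normalCoord g hr hp) (mem_extChartAt_source p)
    (chartFrame q (extChartAt (𝓡∂ n) q p) v)
  rw [chartFrame_self] at h2
  exact h1.trans h2.symm

/-- The distance to the boundary has no critical points near the boundary. -/
theorem eventually_centreDifferential_ne_zero [T2Space M] (hr : IsFermiWidth g r) {q : M}
    (hq : q ∈ (𝓡∂ n).boundary M) : ∀ᶠ p in 𝓝 q, centreDifferential g p ≠ 0 := by
  have hqt := mem_tube_of_mem g hr.pos hq
  have hs := mem_extChartAt_source (I := 𝓡∂ n) q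
  have h0 : centreDifferential g q ≠ 0 := by
    intro h
    have := fderivWithin_normalCoordIn_gradient hr hq
    rw [show fderivWithin ℝ (normalCoordIn g q) (halfSpace n) (extChartAt (𝓡∂ n) q q) = 0 from h]
      at this
    simp at this
  have hc := (contDiffWithinAt_fderivWithin isBody_halfSpace (chart_mem q q)
    (contDiffWithinAt_normalCoordIn g hr hqt hs)).continuousWithinAt.eventually_ne h0
  filter_upwards [(tendsto_chart hs).eventually hc, (isOpen_tube g r).mem_nhds hqt,
    (isOpen_extChartAt_source (I := 𝓡∂ n) q).mem_nhds hs] with p h1 h2 h3 h4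
  refine h1 (ContinuousLinearMap.ext fun v => ?_)
  rw [differential_chart hr h2 h3, h4]
  simp

/-- Every neighbourhood of the boundary contains a closed tube. -/
theorem exists_tube_subset [T2Space M] (hr : IsFermiWidth g r) {P : M → Prop}
    (hP : ∀ q ∈ (𝓡∂ n).boundary M, ∀ᶠ p in 𝓝 q, P p) :
    ∃ s > 0, s < r ∧ ∀ p, boundaryEDist g p ≤ ENNReal.ofReal s → P p := by
  have hr2 : r / 2 < r := by linarith [hr.pos]
  have hsub : ∀ p, boundaryEDist g p ≤ ENNReal.ofReal (r / 2) → p ∈ tube g r := fun p hp =>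
    hp.trans_lt ((ENNReal.ofReal_lt_ofReal_iff hr.pos).2 hr2)
  set K : Set M := {p | boundaryEDist g p ≤ ENNReal.ofReal (r / 2)} \ {p | ∀ᶠ q in 𝓝 p, P q} with hK
  have hKc : IsCompact K := (hr.compact _ hr2).diff isOpen_setOfPred_eventually_nhds
  have hcont : ContinuousOn (normalCoord g) K := fun p hp =>
    (contMDiffAt_normalCoord g hr (hsub p hp.1)).continuousAt.continuousWithinAt
  rcases K.eq_empty_or_nonempty with hE | hne
  · refine ⟨r / 2, by linarith [hr.pos], hr2, fun p hp => ?_⟩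
    by_contra hn
    have : p ∈ K := ⟨hp, fun h => hn (Filter.Eventually.self_of_nhds h)⟩
    rw [hE] at this
    exact this
  -- the distance to the boundary is bounded from below on the compact complement
  · obtain ⟨p₀, hp₀, hmin⟩ := hKc.exists_isMinOn hne hcont
    have hpos : 0 < normalCoord g p₀ :=
      normalCoord_pos g (hsub p₀ hp₀.1) fun h => hp₀.2 (hP p₀ h)
    refine ⟨min (r / 2) (normalCoord g p₀ / 2), lt_min (by linarith [hr.pos]) (by linarith),
      (min_le_left _ _).trans_lt hr2, fun p hp => ?_⟩
    have hp2 : boundaryEDist g p ≤ ENNReal.ofReal (r / 2) :=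
      hp.trans (ENNReal.ofReal_le_ofReal (min_le_left _ _))
    by_contra hn
    have h1 := hmin (show p ∈ K from ⟨hp2, fun h => hn (Filter.Eventually.self_of_nhds h)⟩)
    have h2 := (boundaryEDist_le_iff g (hsub p hp2)
      (le_min (by linarith [hr.pos]) (by linarith))).1 hp
    have h3 := h2.trans (min_le_right _ _)
    have h4 : normalCoord g p₀ ≤ normalCoord g p := h1
    linarith

variable (hr : IsFermiWidth g r) (hpar : IsNormallyParallel g r L)
include hr hpar

/-- The quadratic form `L + (η x^n + c) g` cannot vanish at an interior point near which it is
nonnegative on the side of smaller `x^n`: moving the vector parallelly in the direction `-N`, its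
values under `L` and `g` are constant to first order, whereas `x^n` decreases. -/
theorem not_vanishing_of_nonneg {p : M} (hp : p ∈ tube g r)
    (hpb : p ∉ (𝓡∂ n).boundary M) (hd : centreDifferential g p ≠ 0) {η c : ℝ} (hη : 0 < η)
    (hnn : ∀ᶠ q in 𝓝 p, normalCoord g q ≤ normalCoord g p → ∀ v,
      0 ≤ tensorAt L q v v + (η * normalCoord g q + c) * tensorAt g.inner q v v)
    {v : EuclideanSpace ℝ (Fin n)} (hv : v ≠ 0) :
    tensorAt L p v v + (η * normalCoord g p + c) * tensorAt g.inner p v v ≠ 0 := by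
  intro h0
  have hs := mem_extChartAt_source (I := 𝓡∂ n) p
  have hx := chart_mem (n := n) p p
  have hnhds : halfSpace n ∈ 𝓝 (extChartAt (𝓡∂ n) p p) := by
    have h1 : 0 < extChartAt (𝓡∂ n) p p 0 :=
      lt_of_le_of_ne (mem_halfSpace.1 hx) fun h => hpb ((mem_boundary_iff hs).2 h.symm)
    have h2 : ContinuousAt (fun x : EuclideanSpace ℝ (Fin n) => x 0) (extChartAt (𝓡∂ n) p p) := by
      fun_prop
    filter_upwards [h2.eventually (lt_mem_nhds h1)] with x hx
    exact mem_halfSpace.2 hx.le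
  have hgm := (SmoothMetric.isMetricNear g p).isMetricAt hs
  have dG := hgm.differentiableWithinAt.hasFDerivWithinAt.hasFDerivAt hnhds
  have dL := (((hpar.isSmoothAt hp).contDiffWithinAt hs).differentiableWithinAt
    (by simp)).hasFDerivWithinAt.hasFDerivAt hnhds
  have dU := ((contDiffWithinAt_normalCoordIn g hr hp hs).differentiableWithinAt
    (by simp)).hasFDerivWithinAt.hasFDerivAt hnhds
  have hLN := hpar.fderivWithin_normalField hp v v
  have hGN := hgm.deriv_eq isBody_halfSpace (normalField g p) v v
  have hGs := hgm.isInner.symm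
  have hLs := hpar.inChart_symm hp hs
  have hdN : 0 < centreDifferential g p (normalField g p) := by
    rw [← centreMetric_normalField]
    refine (isInner_centreMetric g p).pos _ fun h => hd ?_
    rw [← centreMetric_normalField, h, map_zero]
  have hgv : 0 < inChart g.inner p (extChartAt (𝓡∂ n) p p) v v := hgm.isInner.pos v hv
  have hinL := inChart_self L p
  have hinG := inChart_self g.inner p
  have hinU : normalCoordIn g p (extChartAt (𝓡∂ n) p p) = normalCoord g p := by
    rw [normalCoordIn, extChartAt_to_inv]
  rw [← hinL, ← hinG, ← hinU] at h0
  set x₀ := extChartAt (𝓡∂ n) p p with hx₀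
  set N := normalField g p
  set b := connection (halfSpace n) (inChart g.inner p) x₀ N v with hb
  -- to first order, `v + τ b` is the parallel translate of `v` along the ray `x₀ - τ N`
  have hray : HasDerivAt (fun τ : ℝ => x₀ - τ • N) (-N) 0 := by
    simpa using ((hasDerivAt_id (0 : ℝ)).smul_const N).const_sub x₀
  have hvec : HasDerivAt (fun τ : ℝ => v + τ • b) b 0 := by
    simpa using ((hasDerivAt_id (0 : ℝ)).smul_const b).const_add v
  have e0 : x₀ - (0 : ℝ) • N = x₀ := by simp
  have e1 : v + (0 : ℝ) • b = v := by simp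
  have dG' := HasFDerivAt.comp_hasDerivAt (0 : ℝ) (by rw [e0]; exact dG) hray
  have dL' := HasFDerivAt.comp_hasDerivAt (0 : ℝ) (by rw [e0]; exact dL) hray
  have dU' := HasFDerivAt.comp_hasDerivAt (0 : ℝ) (by rw [e0]; exact dU) hray
  have hcoef := (dU'.const_mul η).add_const c
  have hphi := ((dL'.clm_apply hvec).clm_apply hvec).add
    (hcoef.mul ((dG'.clm_apply hvec).clm_apply hvec))
  -- the points `x₀ - τ N` are points of the manifold with smaller `x^n`
  have hU0 : ∀ᶠ τ in 𝓝[≥] (0 : ℝ), normalCoordIn g p (x₀ - τ • N) ≤ normalCoordIn g p x₀ := by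
    have hneg : fderivWithin ℝ (normalCoordIn g p) (halfSpace n) x₀ (-N) < 0 := by
      rw [map_neg]
      exact neg_neg_of_pos hdN
    have h1 := hasDerivWithinAt_iff_tendsto_slope.1 (dU'.hasDerivWithinAt (s := Ici 0))
    rw [Ici_sdiff_left] at h1
    have h2 := h1.eventually (gt_mem_nhds hneg)
    rw [← Ioi_insert, nhdsWithin_insert]
    refine eventually_sup.2 ⟨by simp, ?_⟩
    filter_upwards [h2, self_mem_nhdsWithin] with τ h3 h4
    rw [slope_def_field, div_lt_iff₀ (by simpa using h4)] at h3
    simp only [Function.comp_apply, e0, zero_mul] at h3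
    linarith
  have hnn' : ∀ᶠ x in 𝓝 x₀, normalCoordIn g p x ≤ normalCoordIn g p x₀ → ∀ w,
      0 ≤ inChart L p x w w + (η * normalCoordIn g p x + c) * inChart g.inner p x w w := by
    have h1 := eventually_chart hs hnn
    rw [nhdsWithin_eq_nhds.2 hnhds] at h1
    filter_upwards [h1] with x hx1 hx2 w
    exact hx1.2 (hx2.trans_eq hinU) (chartFrame p x w)
  have hev := hray.continuousAt.tendsto
  rw [e0] at hev
  have hge := ge_of_hasDerivWithinAt_Ici (c := 0) (hphi.hasDerivWithinAt (s := Ici 0)) (by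
    filter_upwards [hU0, (hev.eventually hnn').filter_mono nhdsWithin_le_nhds] with τ h1 h2
    have h3 := h2 h1 (v + τ • b)
    simp only [zero_mul, add_zero, Function.comp_apply, Pi.add_apply, Pi.mul_apply, e0, e1]
    rw [h0]
    exact h3)
  simp only [Function.comp_apply, e0, e1, map_neg, add_apply, neg_apply] at hge
  rw [hLN, hGN] at hge
  have h3 : 0 < η * fderivWithin ℝ (normalCoordIn g p) (halfSpace n) x₀ N
      * inChart g.inner p x₀ v v := mul_pos (mul_pos hη hdN) hgv
  refine h3.not_ge ?_
  linear_combination hge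

omit hr in
theorem add_smul_metric_symm (φ : M → ℝ) {p : M} (hp : p ∈ tube g r) :
    ∀ᶠ q in 𝓝 p, ∀ u v, tensorAt (fun q => L q + φ q • g.inner q) q u v
      = tensorAt (fun q => L q + φ q • g.inner q) q v u := by
  filter_upwards [(isOpen_tube g r).mem_nhds hp] with q hq u v
  have h1 : g.inner q u v = g.inner q v u := g.symm q u v
  have h2 : L q u v = L q v u := hpar.symm q hq u v
  change L q u v + φ q * g.inner q u v = L q v u + φ q * g.inner q v u
  rw [h1, h2]

/-- If `L` is positive semidefinite at the boundary, then it is so near the boundary: on a small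
closed tube, let `c` be the least nonnegative constant for which `L + (η x^n + c) g` is positive
semidefinite. If `c` were positive, the form would be degenerate somewhere, which is possible
neither at the boundary nor, by `not_vanishing_of_nonneg`, in the interior. -/
theorem exists_tube_nonneg [T2Space M]
    (hbd : ∀ q ∈ (𝓡∂ n).boundary M, ∀ v, 0 ≤ tensorAt L q v v) :
    ∃ s > 0, s < r ∧ ∀ p, boundaryEDist g p ≤ ENNReal.ofReal s → ∀ v, 0 ≤ tensorAt L p v v := by
  obtain ⟨s, hs, hsr, hd⟩ := exists_tube_subset hr fun q hq =>
    eventually_centreDifferential_ne_zero hr hq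
  refine ⟨s, hs, hsr, ?_⟩
  set K : Set M := {p | boundaryEDist g p ≤ ENNReal.ofReal s} with hK
  have hKc : IsCompact K := hr.compact s hsr
  have hKt : ∀ p ∈ K, p ∈ tube g r := fun p hp =>
    lt_of_le_of_lt hp ((ENNReal.ofReal_lt_ofReal_iff hr.pos).2 hsr)
  have hgin : ∀ p, IsInner (tensorAt g.inner p) := fun p => SmoothMetric.isInner g p
  have hgsm : ∀ p, IsSmoothAt g.inner p := fun p => (SmoothMetric.isMetricNear g p).smooth
  have hgsy : ∀ p, ∀ᶠ q in 𝓝 p, ∀ u v, tensorAt g.inner q u v = tensorAt g.inner q v u :=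
    fun p => Eventually.of_forall fun q => (hgin q).symm
  have hgnn : ∀ p v, 0 ≤ tensorAt g.inner p v v := fun p v => by
    by_cases hv : v = 0
    · simp [hv]
    · exact ((hgin p).pos v hv).le
  have hLsy : ∀ p ∈ K, ∀ᶠ q in 𝓝 p, ∀ u v, tensorAt L q u v = tensorAt L q v u := fun p hp => by
    filter_upwards [(isOpen_tube g r).mem_nhds (hKt p hp)] with q hq u v
    exact hpar.symm q hq u v
  have key : ∀ η > 0, ∀ p ∈ K, ∀ v,
      0 ≤ tensorAt L p v v + (η * normalCoord g p) * tensorAt g.inner p v v := by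
    intro η hη
    set C : Set ℝ := {c | 0 ≤ c ∧ ∀ p ∈ K, ∀ v,
      0 ≤ tensorAt L p v v + (η * normalCoord g p + c) * tensorAt g.inner p v v} with hC
    -- `g` dominates a multiple of `-L` on the compact tube
    have hne : C.Nonempty := by
      have h1 : ∀ᶠ ε : ℝ in 𝓝 0, ∀ p ∈ K, ∀ v,
          0 ≤ tensorAt g.inner p v v + ε * tensorAt L p v v :=
        hKc.eventually_forall_of_forall_eventually fun p hp =>
          eventually_nonneg_add_smul (hgsm p) (hpar.isSmoothAt (hKt p hp)) (hgsy p) (hLsy p hp)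
            (hgin p)
      obtain ⟨ε, h2, hε⟩ := ((h1.filter_mono nhdsWithin_le_nhds).and
        (self_mem_nhdsWithin (s := Ioi (0 : ℝ)))).exists
      have hε : 0 < ε := hε
      refine ⟨ε⁻¹, by positivity, fun p hp v => ?_⟩
      have h3 := mul_nonneg (inv_nonneg.2 hε.le) (h2 p hp v)
      rw [mul_add, ← mul_assoc, inv_mul_cancel₀ hε.ne', one_mul] at h3
      have h4 := mul_nonneg (mul_nonneg hη.le (normalCoord_nonneg g p)) (hgnn p v)
      linarith
    have hbdd : BddBelow C := ⟨0, fun c hc => hc.1⟩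
    have hc0 : 0 ≤ sInf C := le_csInf hne fun c hc => hc.1
    -- the infimum is attained
    have hmem : ∀ p ∈ K, ∀ v,
        0 ≤ tensorAt L p v v + (η * normalCoord g p + sInf C) * tensorAt g.inner p v v := by
      intro p hp v
      by_cases hv : v = 0
      · simp [hv]
      have hpos := (hgin p).pos v hv
      have h1 : -(tensorAt L p v v + η * normalCoord g p * tensorAt g.inner p v v)
          / tensorAt g.inner p v v ≤ sInf C := le_csInf hne fun c hc => by
        rw [div_le_iff₀ hpos]
        linarith [hc.2 p hp v]
      rw [div_le_iff₀ hpos] at h1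
      linarith
    rcases hc0.eq_or_lt with h0 | hpos
    · simpa [← h0] using hmem
    exfalso
    set φ : M → ℝ := fun p => η * normalCoord g p + sInf C with hφ
    -- the form with the least constant is positive definite, hence the constant can be decreased
    have hin : ∀ p ∈ K, IsInner (tensorAt (fun q => L q + φ q • g.inner q) p) := by
      refine fun p hp => ⟨(add_smul_metric_symm hpar φ (hKt p hp)).self_of_nhds, fun v hv => ?_⟩
      refine lt_of_le_of_ne (hmem p hp v) (Ne.symm ?_)
      by_cases hpb : p ∈ (𝓡∂ n).boundary M
      · have h1 := hbd p hpb v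
        have h2 := mul_pos hpos ((hgin p).pos v hv)
        have h3 : φ p = sInf C := by rw [hφ]; simp [normalCoord_of_mem g hpb]
        change tensorAt L p v v + φ p * tensorAt g.inner p v v ≠ 0
        rw [h3]
        linarith
      · refine not_vanishing_of_nonneg hr hpar (hKt p hp) hpb (hd p hp) hη ?_ hv
        filter_upwards [(isOpen_tube g r).mem_nhds (hKt p hp)] with q hq hqp
        refine hmem q ?_
        exact (boundaryEDist_le_iff g hq hs.le).2
          (hqp.trans ((boundaryEDist_le_iff g (hKt p hp) hs.le).1 hp))
    have h1 : ∀ᶠ ε : ℝ in 𝓝 0, ∀ p ∈ K, ∀ v,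
        0 ≤ tensorAt (fun q => L q + φ q • g.inner q) p v v
          + ε * tensorAt (fun q => -g.inner q) p v v := by
      refine hKc.eventually_forall_of_forall_eventually fun p hp =>
        eventually_nonneg_add_smul ?_ ?_ (add_smul_metric_symm hpar φ (hKt p hp)) ?_ (hin p hp)
      · have hm := mem_extChartAt_source (I := 𝓡∂ n) p
        rw [isSmoothAt_iff]
        exact ((hpar.isSmoothAt (hKt p hp)).contDiffWithinAt hm).add
          (((contDiffWithinAt_const.mul (contDiffWithinAt_normalCoordIn g hr (hKt p hp) hm)).add
            contDiffWithinAt_const).smul ((hgsm p).contDiffWithinAt hm))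
      · rw [isSmoothAt_iff]
        exact ((hgsm p).contDiffWithinAt (mem_extChartAt_source p)).neg
      · filter_upwards [hgsy p] with q hq u v
        exact congrArg Neg.neg (hq u v)
    obtain ⟨ε, ⟨h2, h3⟩, hε⟩ := (((h1.and (gt_mem_nhds hpos)).filter_mono nhdsWithin_le_nhds).and
        (self_mem_nhdsWithin (s := Ioi (0 : ℝ)))).exists
    have hε : 0 < ε := hε
    have h4 : sInf C - ε ∈ C := by
      refine ⟨by linarith, fun p hp v => ?_⟩
      have h5 : 0 ≤ tensorAt L p v v + φ p * tensorAt g.inner p v v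
        + ε * (-tensorAt g.inner p v v) := h2 p hp v
      have h6 : φ p = η * normalCoord g p + sInf C := rfl
      rw [h6] at h5
      linarith
    linarith [csInf_le hbdd h4]
  -- let `η` tend to zero
  intro p hp v
  refine le_of_forall_pos_le_add fun ε hε => ?_
  have hx := mul_nonneg (normalCoord_nonneg g p) (hgnn p v)
  set x := normalCoord g p * tensorAt g.inner p v v with hxdef
  have h1 := key (ε / (x + 1)) (by positivity) p hp v
  rw [mul_assoc, ← hxdef] at h1
  have h2 : ε / (x + 1) * x ≤ ε := by
    rw [div_mul_eq_mul_div, div_le_iff₀ (by linarith)]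
    nlinarith
  linarith

end Positivity

section BoundaryPositivity

/-- A symmetric form whose kernel contains a transversal vector `N` is nonnegative if it is so on
the tangent space of the boundary. -/
theorem nonneg_of_nonneg_range {m : ℕ} {B : Bilin (EuclideanSpace ℝ (Fin (m + 1)))}
    (hB : ∀ u v, B u v = B v u) {N : EuclideanSpace ℝ (Fin (m + 1))} (hN : N 0 ≠ 0)
    (hBN : ∀ w, B N w = 0) {A : EuclideanSpace ℝ (Fin m) →L[ℝ] EuclideanSpace ℝ (Fin (m + 1))}
    (hA : Function.Injective A) (h0 : ∀ u, A u 0 = 0) (h : ∀ u, 0 ≤ B (A u) (A u))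
    (v : EuclideanSpace ℝ (Fin (m + 1))) : 0 ≤ B v v := by
  obtain ⟨u, hu⟩ := exists_eq_of_tangent hA h0 (w := v - (v 0 / N 0) • N) (by simp [hN])
  have h1 := h u
  rw [hu] at h1
  have h2 : v = (v - (v 0 / N 0) • N) + (v 0 / N 0) • N := by abel
  rw [h2]
  generalize v - (v 0 / N 0) • N = w at h1 ⊢
  simp only [map_add, map_smul, add_apply, smul_apply, hB w N, hBN, smul_zero, add_zero]
  exact h1

variable {m : ℕ}
    {M₀ : Type*} [TopologicalSpace M₀] [T2Space M₀]
    [ChartedSpace (EuclideanHalfSpace (m + 1)) M₀] [IsManifold (𝓡∂ (m + 1)) ∞ M₀]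
    {M₁ : Type*} [TopologicalSpace M₁]
    [ChartedSpace (EuclideanHalfSpace (m + 1)) M₁] [IsManifold (𝓡∂ (m + 1)) ∞ M₁]
    {Γ : Type*} [TopologicalSpace Γ]
    [ChartedSpace (EuclideanSpace ℝ (Fin m)) Γ] [IsManifold (𝓡 m) ∞ Γ]
    {g₀ : SmoothMetric (m + 1) M₀} {g₁ : SmoothMetric (m + 1) M₁} {ι₀ : Γ → M₀} {ι₁ : Γ → M₁}

/-- On the boundary `L` is nonnegative on all tangent vectors of the manifold, since `L(N, ·) = 0`.
-/
theorem nonneg_of_mem_boundary (hι₀ : IsBoundaryEmbedding m ι₀)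
    (hL : ∀ (y : Γ) (X : TangentSpace (𝓡 m) y), 0 ≤ sumForm g₀.inner g₁.inner ι₀ ι₁ y X X)
    {r : ℝ} (hr : IsFermiWidth g₀ r) {L : TensorField (m + 1) M₀}
    (hpar : IsNormallyParallel g₀ r L)
    (hext : ∀ (y : Γ) (X Y : TangentSpace (𝓡 m) y),
      L (ι₀ y) (mfderiv (𝓡 m) (𝓡∂ (m + 1)) ι₀ y X) (mfderiv (𝓡 m) (𝓡∂ (m + 1)) ι₀ y Y) =
        sumForm g₀.inner g₁.inner ι₀ ι₁ y X Y)
    {q : M₀} (hq : q ∈ (𝓡∂ (m + 1)).boundary M₀) (v : EuclideanSpace ℝ (Fin (m + 1))) :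
    0 ≤ tensorAt L q v v := by
  have hqt := mem_tube_of_mem g₀ hr.pos hq
  obtain ⟨y, rfl⟩ : q ∈ range ι₀ := hι₀.range_eq ▸ hq
  rw [← inChart_self]
  exact nonneg_of_nonneg_range (hpar.inChart_symm hqt (mem_extChartAt_source (ι₀ y)))
    (isInner_centreMetric g₀ (ι₀ y)).unitNormal_zero_pos.ne'
    (fun w => by
      rw [← normalField_boundary hr hq]
      exact hpar.apply_normalField hqt w)
    (hι₀.injective_fderivWithin y) ((hι₀.eventually_fderivWithin_firstCoord
        (mem_extChartAt_source y) (mem_extChartAt_source (ι₀ y))).self_of_nhdsWithin (mem_univ _))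
     (inChart_nonneg_of_tangent hι₀ hL hext y) v

end BoundaryPositivity

/-! ### Perturbations of a metric by functions of one coordinate -/

section Perturbation

variable {V : Type*} [NormedAddCommGroup V] [NormedSpace ℝ V] {s : Set V} {u : V → ℝ}
  {G L P : V → Bilin V} {x : V}

/-- The first derivative of `a(u) L`, where `a` and `a₁` are the values of the function `a` and of
its derivative. -/
def multipleDeriv (s : Set V) (u : V → ℝ) (L : V → Bilin V) (x : V) (a a₁ : ℝ) :
    V →L[ℝ] Bilin V :=
  prodDeriv a (a₁ • fderivWithin ℝ u s x) (L x) (fderivWithin ℝ L s x)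

/-- The second derivative of `a(u) L`, where `a`, `a₁` and `a₂` are the values of the function `a`
and of its first two derivatives. -/
def multipleDeriv₂ (s : Set V) (u : V → ℝ) (L : V → Bilin V) (x : V) (a a₁ a₂ : ℝ) :
    V →L[ℝ] V →L[ℝ] Bilin V :=
  prodDeriv₂ a (a₁ • fderivWithin ℝ u s x)
    (a₁ • fderivWithin ℝ (fderivWithin ℝ u s) s x
      + a₂ • (fderivWithin ℝ u s x).smulRight (fderivWithin ℝ u s x))
    (L x) (fderivWithin ℝ L s x) (fderivWithin ℝ (fderivWithin ℝ L s) s x)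

/-- The curvature of the metric `G + a(u) L + b(u) P` as a function of the values of `a`, `b` and of
their first two derivatives. -/
def perturbedCurvature (s : Set V) (u : V → ℝ) (G L P : V → Bilin V) (x : V)
    (a a₁ a₂ b b₁ b₂ : ℝ) : V → V → V → V → ℝ :=
  curvatureOf (G x + a • L x + b • P x)
    (fderivWithin ℝ G s x + multipleDeriv s u L x a a₁ + multipleDeriv s u P x b b₁)
    (fderivWithin ℝ (fderivWithin ℝ G s) s x + multipleDeriv₂ s u L x a a₁ a₂
      + multipleDeriv₂ s u P x b b₁ b₂)

/-- The jet of `a(u) L`. The function `a` is differentiated on `[0, ∞)` only, where `u` has its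
values. -/
theorem hasJetWithinAt_multiple (hs : IsBody s) (hx : x ∈ s) (hu : ContDiffWithinAt ℝ ∞ u s x)
    (hu0 : ∀ y, 0 ≤ u y) (hL : ContDiffWithinAt ℝ ∞ L s x) {a a₁ : ℝ → ℝ} {a₂ : ℝ}
    (ha : ∀ t ∈ Ici (0 : ℝ), HasDerivWithinAt a (a₁ t) (Ici 0) t)
    (ha₁ : HasDerivWithinAt a₁ a₂ (Ici 0) (u x)) :
    HasJetWithinAt (fun y => a (u y) • L y)
      (fun y => multipleDeriv s u L y (a (u y)) (a₁ (u y)))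
      (multipleDeriv₂ s u L x (a (u x)) (a₁ (u x)) a₂) s x := by
  have h1 := (Gluing.ContDiffWithinAt.hasJetWithinAt hs hx hu).comp_halfLine hu0 ha ha₁
  have h2 := h1.smul (Gluing.ContDiffWithinAt.hasJetWithinAt hs hx hL)
  unfold multipleDeriv multipleDeriv₂
  exact h2

theorem curvature_perturbation (hs : IsBody s) (hx : x ∈ s) (hu : ContDiffWithinAt ℝ ∞ u s x)
    (hu0 : ∀ y, 0 ≤ u y) (hG : ContDiffWithinAt ℝ ∞ G s x) (hL : ContDiffWithinAt ℝ ∞ L s x)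
    (hP : ContDiffWithinAt ℝ ∞ P s x) {a a₁ b b₁ : ℝ → ℝ} {a₂ b₂ : ℝ}
    (ha : ∀ t ∈ Ici (0 : ℝ), HasDerivWithinAt a (a₁ t) (Ici 0) t)
    (ha₁ : HasDerivWithinAt a₁ a₂ (Ici 0) (u x))
    (hb : ∀ t ∈ Ici (0 : ℝ), HasDerivWithinAt b (b₁ t) (Ici 0) t)
    (hb₁ : HasDerivWithinAt b₁ b₂ (Ici 0) (u x)) :
    curvature s (fun y => G y + a (u y) • L y + b (u y) • P y) x
      = perturbedCurvature s u G L P x (a (u x)) (a₁ (u x)) a₂ (b (u x)) (b₁ (u x)) b₂ := by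
  have h0 := Gluing.ContDiffWithinAt.hasJetWithinAt hs hx hG
  have h1 := hasJetWithinAt_multiple (a₁ := a₁) hs hx hu hu0 hL ha ha₁
  have h2 := hasJetWithinAt_multiple (a₁ := b₁) hs hx hu hu0 hP hb hb₁
  have h3 := (h0.add h1).add h2
  rw [h3.curvature_eq hs, perturbedCurvature]

theorem multipleDeriv₂_add (a a₁ a₂ c : ℝ) :
    multipleDeriv₂ s u L x a a₁ (a₂ + c) = multipleDeriv₂ s u L x a a₁ a₂
      + c • (((ContinuousLinearMap.smulRightL ℝ V (Bilin V)).flip (L x)) ∘L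
        (fderivWithin ℝ u s x).smulRight (fderivWithin ℝ u s x)) := by
  rw [multipleDeriv₂, add_smul, ← add_assoc, prodDeriv₂_add_smul]
  rfl

/-- The second derivatives of `a` and `b` enter the curvature operator only through the values of
`L` and `P` on the contraction of the two-vector with the differential of `u`. -/
theorem frameForm_perturbedCurvature_add {ι : Type*} [Fintype ι] (a a₁ a₂ b b₁ b₂ c d : ℝ)
    (e : ι → V) {α : Matrix ι ι ℝ} (hα : α.transpose = -α) :
    frameForm (perturbedCurvature s u G L P x a a₁ (a₂ + c) b b₁ (b₂ + d)) e α
      = frameForm (perturbedCurvature s u G L P x a a₁ a₂ b b₁ b₂) e α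
        - c / 2 * L x (contraction (fderivWithin ℝ u s x) e α)
            (contraction (fderivWithin ℝ u s x) e α)
        - d / 2 * P x (contraction (fderivWithin ℝ u s x) e α)
            (contraction (fderivWithin ℝ u s x) e α) := by
  have h : ∀ A B C D E : V →L[ℝ] V →L[ℝ] Bilin V, A + (B + C) + (D + E) = A + B + D + C + E := by
    intros; abel
  rw [perturbedCurvature, multipleDeriv₂_add, multipleDeriv₂_add, h,
    frameForm_curvatureOf_add_normal _ _ _ _ _ _ _ hα,
    frameForm_curvatureOf_add_normal _ _ _ _ _ _ _ hα]
  rfl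

theorem tendsto_multipleDeriv {X : Type*} {l : Filter X} (hs : IsBody s) (hx : x ∈ s)
    (hu : ContDiffWithinAt ℝ ∞ u s x) (hL : ContDiffWithinAt ℝ ∞ L s x) {y : X → V}
    (hy : Tendsto y l (𝓝[s] x)) {a a₁ : X → ℝ} {c c₁ : ℝ} (ha : Tendsto a l (𝓝 c))
    (ha₁ : Tendsto a₁ l (𝓝 c₁)) :
    Tendsto (fun z => multipleDeriv s u L (y z) (a z) (a₁ z)) l
      (𝓝 (multipleDeriv s u L x c c₁)) := by
  have hu₁ := (contDiffWithinAt_fderivWithin hs hx hu).continuousWithinAt.tendsto.comp hy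
  have hL₁ := (contDiffWithinAt_fderivWithin hs hx hL).continuousWithinAt.tendsto.comp hy
  have hL₀ := hL.continuousWithinAt.tendsto.comp hy
  exact (ha.smul hL₁).add (tendsto_clm_apply (tendsto_clm_apply
    (tendsto_const_nhds (x := ContinuousLinearMap.smulRightL ℝ V (Bilin V))) (ha₁.smul hu₁)) hL₀)

theorem tendsto_multipleDeriv₂ {X : Type*} {l : Filter X} (hs : IsBody s) (hx : x ∈ s)
    (hu : ContDiffWithinAt ℝ ∞ u s x) (hL : ContDiffWithinAt ℝ ∞ L s x) {y : X → V}
    (hy : Tendsto y l (𝓝[s] x)) {a a₁ a₂ : X → ℝ} {c c₁ c₂ : ℝ} (ha : Tendsto a l (𝓝 c))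
    (ha₁ : Tendsto a₁ l (𝓝 c₁)) (ha₂ : Tendsto a₂ l (𝓝 c₂)) :
    Tendsto (fun z => multipleDeriv₂ s u L (y z) (a z) (a₁ z) (a₂ z)) l
      (𝓝 (multipleDeriv₂ s u L x c c₁ c₂)) := by
  have hu₁' := contDiffWithinAt_fderivWithin hs hx hu
  have hL₁' := contDiffWithinAt_fderivWithin hs hx hL
  have hu₁ := hu₁'.continuousWithinAt.tendsto.comp hy
  have hL₁ := hL₁'.continuousWithinAt.tendsto.comp hy
  have hu₂ := (contDiffWithinAt_fderivWithin hs hx hu₁').continuousWithinAt.tendsto.comp hy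
  have hL₂ := (contDiffWithinAt_fderivWithin hs hx hL₁').continuousWithinAt.tendsto.comp hy
  have hL₀ := hL.continuousWithinAt.tendsto.comp hy
  have hR : ∀ {W : Type _} [NormedAddCommGroup W] [NormedSpace ℝ W] {f : X → V →L[ℝ] ℝ}
      {g : X → W} {f₀ : V →L[ℝ] ℝ} {g₀ : W}, Tendsto f l (𝓝 f₀) → Tendsto g l (𝓝 g₀) →
      Tendsto (fun z => (f z).smulRight (g z)) l (𝓝 (f₀.smulRight g₀)) := by
    intro W _ _ f g f₀ g₀ hf hg
    exact tendsto_clm_apply (tendsto_clm_apply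
      (tendsto_const_nhds (x := ContinuousLinearMap.smulRightL ℝ V W)) hf) hg
  have hC : ∀ {W W' : Type _} [NormedAddCommGroup W] [NormedSpace ℝ W] [NormedAddCommGroup W']
      [NormedSpace ℝ W'] {f : X → W →L[ℝ] W'}
      {g : X → V →L[ℝ] W} {f₀ : W →L[ℝ] W'} {g₀ : V →L[ℝ] W}, Tendsto f l (𝓝 f₀) →
      Tendsto g l (𝓝 g₀) → Tendsto (fun z => (f z) ∘L (g z)) l (𝓝 (f₀ ∘L g₀)) := by
    intro W W' _ _ _ _ f g f₀ g₀ hf hg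
    exact tendsto_clm_apply (tendsto_clm_apply
      (tendsto_const_nhds (x := ContinuousLinearMap.compL ℝ V W W')) hf) hg
  have hp₁ := ha₁.smul hu₁
  refine ((ha.smul hL₂).add (hR hp₁ hL₁)).add ((hC ?_ hL₁).add (hC ?_ ?_))
  · exact tendsto_clm_apply
      (tendsto_const_nhds (x := ContinuousLinearMap.smulRightL ℝ V (Bilin V))) hp₁
  · exact tendsto_clm_apply
      (tendsto_const_nhds (x := (ContinuousLinearMap.smulRightL ℝ V (Bilin V)).flip)) hL₀
  · exact (ha₁.smul hu₂).add (ha₂.smul (hR hu₁ hu₁))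

variable [FiniteDimensional ℝ V]

/-- If `a, b, a'', b'` tend to zero, `a'` is close to `2 t` and `b''` is close to `-2 C t` with `t`
in a compact set `K`, then a lower bound on the curvature operator which holds in the limit also
holds eventually up to `η > 0`, uniformly in `t`. -/
theorem eventually_frameForm_perturbedCurvature_ge {ι : Type*} [Fintype ι] {e : ι → V}
    (he : LinearIndependent ℝ e) (hs : IsBody s) (hx : x ∈ s)
    (hu : ContDiffWithinAt ℝ ∞ u s x) (hG : ContDiffWithinAt ℝ ∞ G s x)
    (hL : ContDiffWithinAt ℝ ∞ L s x) (hP : ContDiffWithinAt ℝ ∞ P s x)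
    (hGs : ∀ᶠ y in 𝓝[s] x, ∀ v w, G y v w = G y w v)
    (hLs : ∀ᶠ y in 𝓝[s] x, ∀ v w, L y v w = L y w v)
    (hPs : ∀ᶠ y in 𝓝[s] x, ∀ v w, P y v w = P y w v) (hGx : IsInner (G x))
    {K : Set ℝ} (hK : IsCompact K) {κ C η : ℝ} (hη : 0 < η)
    (hKC : ∀ t ∈ K, ∀ α : Matrix ι ι ℝ, α.transpose = -α → κ * frameForm (bivec (G x)) e α
      ≤ frameForm (perturbedCurvature s u G L P x 0 (2 * t) 0 0 0 (-(2 * C * t))) e α)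
    {X : Type*} {l : Filter X} {y : X → V} (hy : Tendsto y l (𝓝[s] x))
    {a a₁ a₂ b b₁ b₂ : X → ℝ} (ha : Tendsto a l (𝓝 0)) (ha₁ : Tendsto a₁ l (𝓝 0))
    (ha₂ : Tendsto a₂ l (𝓝 0)) (hb : Tendsto b l (𝓝 0)) (hb₁ : Tendsto b₁ l (𝓝 0))
    (hb₂ : Tendsto b₂ l (𝓝 0)) :
    ∀ᶠ z in l, ∀ t ∈ K, IsInner (G (y z) + a z • L (y z) + b z • P (y z)) ∧
      ∀ α : Matrix ι ι ℝ, α.transpose = -α →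
        (κ - η) * frameForm (bivec (G (y z) + a z • L (y z) + b z • P (y z))) e α
          ≤ frameForm (perturbedCurvature s u G L P (y z) (a z) (2 * t + a₁ z) (a₂ z) (b z) (b₁ z)
              (-(2 * C * t) + b₂ z)) e α := by
  suffices h : ∀ t ∈ K, ∀ᶠ z in l ×ˢ 𝓝 t, IsInner (G (y z.1) + a z.1 • L (y z.1) + b z.1 • P (y z.1)) ∧
      ∀ α : Matrix ι ι ℝ, α.transpose = -α →
        (κ - η) * frameForm (bivec (G (y z.1) + a z.1 • L (y z.1) + b z.1 • P (y z.1))) e α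
          ≤ frameForm (perturbedCurvature s u G L P (y z.1) (a z.1) (2 * z.2 + a₁ z.1) (a₂ z.1)
              (b z.1) (b₁ z.1) (-(2 * C * z.2) + b₂ z.1)) e α by
    have h1 := hK.mem_prod_nhdsSet_of_forall h
    exact (Filter.Eventually.curry h1).mono fun z hz => hz.self_of_nhdsSet
  intro t ht
  have hf := tendsto_fst (f := l) (g := 𝓝 t)
  have ht' : Tendsto (fun z : X × ℝ => z.2) (l ×ˢ 𝓝 t) (𝓝 t) := tendsto_snd
  have hA := ha.comp hf
  have hB := hb.comp hf
  have hY := hy.comp hf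
  have hA₁ : Tendsto (fun z : X × ℝ => 2 * z.2 + a₁ z.1) (l ×ˢ 𝓝 t) (𝓝 (2 * t)) := by
    simpa using (ht'.const_mul 2).add (ha₁.comp hf)
  have hB₂ : Tendsto (fun z : X × ℝ => -(2 * C * z.2) + b₂ z.1) (l ×ˢ 𝓝 t) (𝓝 (-(2 * C * t))) := by
    simpa using (ht'.const_mul (2 * C)).neg.add (hb₂.comp hf)
  have hG₁ := contDiffWithinAt_fderivWithin hs hx hG
  have hG₂ := contDiffWithinAt_fderivWithin hs hx hG₁
  have hM : Tendsto (fun z : X × ℝ => G (y z.1) + a z.1 • L (y z.1) + b z.1 • P (y z.1))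
      (l ×ˢ 𝓝 t) (𝓝 (G x)) := by
    simpa using ((hG.continuousWithinAt.tendsto.comp hY).add
      (hA.smul (hL.continuousWithinAt.tendsto.comp hY))).add
        (hB.smul (hP.continuousWithinAt.tendsto.comp hY))
  have e0 : G x + (0 : ℝ) • L x + (0 : ℝ) • P x = G x := by simp
  have hR : ∀ v₁ v₂ v₃ v₄, Tendsto (fun z : X × ℝ => perturbedCurvature s u G L P (y z.1) (a z.1)
      (2 * z.2 + a₁ z.1) (a₂ z.1) (b z.1) (b₁ z.1) (-(2 * C * z.2) + b₂ z.1) v₁ v₂ v₃ v₄)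
      (l ×ˢ 𝓝 t) (𝓝 (perturbedCurvature s u G L P x 0 (2 * t) 0 0 0 (-(2 * C * t)) v₁ v₂ v₃ v₄)) := by
    intro v₁ v₂ v₃ v₄
    refine tendsto_curvatureOf (by rwa [e0]) (by rwa [e0]) ?_ ?_ v₁ v₂ v₃ v₄
    · exact ((hG₁.continuousWithinAt.tendsto.comp hY).add
        (tendsto_multipleDeriv hs hx hu hL hY hA hA₁)).add
          (tendsto_multipleDeriv hs hx hu hP hY hB (hb₁.comp hf))
    · exact ((hG₂.continuousWithinAt.tendsto.comp hY).add
        (tendsto_multipleDeriv₂ hs hx hu hL hY hA hA₁ (ha₂.comp hf))).add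
          (tendsto_multipleDeriv₂ hs hx hu hP hY hB (hb₁.comp hf) hB₂)
  have hI : ∀ v₁ v₂ v₃ v₄, Tendsto (fun z : X × ℝ => bivec (G (y z.1) + a z.1 • L (y z.1)
      + b z.1 • P (y z.1)) v₁ v₂ v₃ v₄) (l ×ˢ 𝓝 t) (𝓝 (bivec (G x) v₁ v₂ v₃ v₄)) := by
    intro v₁ v₂ v₃ v₄
    have hc : ∀ v w, Tendsto (fun z : X × ℝ => (G (y z.1) + a z.1 • L (y z.1)
      + b z.1 • P (y z.1)) v w) (l ×ˢ 𝓝 t) (𝓝 (G x v w)) := fun v w =>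
      tendsto_clm_apply (tendsto_clm_apply hM tendsto_const_nhds) tendsto_const_nhds
    exact ((hc v₁ v₃).mul (hc v₂ v₄)).sub ((hc v₂ v₃).mul (hc v₁ v₄))
  have hT : Tendsto (fun (z : X × ℝ) (i j k l : ι) =>
      perturbedCurvature s u G L P (y z.1) (a z.1) (2 * z.2 + a₁ z.1) (a₂ z.1) (b z.1) (b₁ z.1)
        (-(2 * C * z.2) + b₂ z.1) (e i) (e j) (e k) (e l)
      + -(κ - η) * bivec (G (y z.1) + a z.1 • L (y z.1) + b z.1 • P (y z.1)) (e i) (e j) (e k) (e l))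
      (l ×ˢ 𝓝 t) (𝓝 fun i j k l => perturbedCurvature s u G L P x 0 (2 * t) 0 0 0 (-(2 * C * t))
        (e i) (e j) (e k) (e l) + -(κ - η) * bivec (G x) (e i) (e j) (e k) (e l)) :=
    tendsto_pi_nhds.2 fun i => tendsto_pi_nhds.2 fun j => tendsto_pi_nhds.2 fun k =>
      tendsto_pi_nhds.2 fun l => (hR _ _ _ _).add ((hI _ _ _ _).const_mul _)
  have hpos := hT.eventually (eventually_quadForm_nonneg fun α hα h0 => by
    rw [quadForm_add, quadForm_const_mul]
    have h1 := hKC t ht α hα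
    have h2 := quadForm_bivectorTensor_pos (hGx.gram_posDef he) hα h0
    rw [← frameForm_bivec] at h2
    have h3 := mul_pos hη h2
    change 0 < frameForm _ e α + -(κ - η) * frameForm _ e α
    linarith)
  filter_upwards [hpos, hM.eventually hGx.eventually, hY.eventually hGs, hY.eventually hLs,
    hY.eventually hPs] with z h1 h2 h3 h4 h5
  simp only [Function.comp_apply] at h3 h4 h5
  refine ⟨h2 fun v w => by simp only [add_apply, smul_apply, h3 v w, h4 v w, h5 v w],
    fun α hα => ?_⟩
  have h6 := h1 α hα
  rw [quadForm_add, quadForm_const_mul] at h6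
  change 0 ≤ frameForm _ e α + -(κ - η) * frameForm _ e α at h6
  linarith

end Perturbation

/-! ### The auxiliary functions -/

section Primitive

variable {f : ℝ → ℝ}

/-- On `[0, ∞)` the primitive only depends on `f` there, hence on a continuous function on `ℝ`. -/
theorem primitive_eq_max (f : ℝ → ℝ) {x : ℝ} (hx : 0 ≤ x) :
    primitive f x = primitive (fun t => f (max t 0)) x := by
  refine intervalIntegral.integral_congr fun t ht => ?_
  rw [uIcc_of_le hx] at ht
  simp only [max_eq_left ht.1]

theorem hasDerivWithinAt_primitive (hf : ContinuousOn f (Ici 0)) {x : ℝ} (hx : x ∈ Ici (0 : ℝ)) :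
    HasDerivWithinAt (primitive f) (f x) (Ici 0) x := by
  have hc : Continuous fun t : ℝ => f (max t 0) :=
    hf.comp_continuous (by fun_prop) fun t => le_max_right t 0
  have h := (hc.integral_hasStrictDerivAt 0 x).hasDerivAt.hasDerivWithinAt (s := Ici 0)
  rw [max_eq_left hx] at h
  exact h.congr (fun y hy => primitive_eq_max f hy) (primitive_eq_max f hx)

theorem contDiffOn_primitive (hf : ContDiffOn ℝ ∞ f (Ici 0)) :
    ContDiffOn ℝ ∞ (primitive f) (Ici 0) := by
  have h : ∀ x ∈ Ici (0 : ℝ), HasDerivWithinAt (primitive f) (f x) (Ici 0) x := fun x hx =>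
    hasDerivWithinAt_primitive hf.continuousOn hx
  refine (contDiffOn_infty_iff_derivWithin (uniqueDiffOn_Ici 0)).2
    ⟨fun x hx => (h x hx).differentiableWithinAt, hf.congr fun x hx => ?_⟩
  exact (h x hx).derivWithin (uniqueDiffOn_Ici (0 : ℝ) x hx)

theorem abs_primitive_le {c δ : ℝ} (hc : ∀ x ≥ 0, |f x| ≤ c) {x : ℝ} (hx : 0 ≤ x) (hxδ : x ≤ δ) :
    |primitive f x| ≤ c * δ := by
  have h := intervalIntegral.norm_integral_le_of_norm_le_const (f := f) (a := 0) (b := x) (C := c)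
    fun t ht => hc t (by rw [uIoc_of_le hx] at ht; exact ht.1.le)
  rw [sub_zero, abs_of_nonneg hx] at h
  exact h.trans (mul_le_mul_of_nonneg_left hxδ ((abs_nonneg _).trans (hc 0 le_rfl)))

theorem primitive_eq_of_eq_zero (hf : ContinuousOn f (Ici 0)) {δ : ℝ} (hδ : 0 ≤ δ)
    (h0 : ∀ x ≥ δ, f x = 0) {x : ℝ} (hx : δ ≤ x) : primitive f x = primitive f δ := by
  have hi : ∀ a b : ℝ, 0 ≤ a → 0 ≤ b → IntervalIntegrable f volume a b := fun a b ha hb =>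
    (hf.mono fun t ht => (le_min ha hb).trans ht.1).intervalIntegrable
  rw [primitive, primitive, ← intervalIntegral.integral_add_adjacent_intervals
    (hi 0 δ le_rfl hδ) (hi δ x hδ (hδ.trans hx))]
  have : ∫ t in δ..x, f t = ∫ t in δ..x, (0 : ℝ) := intervalIntegral.integral_congr fun t ht => by
    rw [uIcc_of_le hx] at ht
    exact h0 t ht.1
  rw [this]
  simp

end Primitive

namespace IsAuxFun

variable {δ : ℝ} {f : ℝ → ℝ}

theorem neg_sq_le (h : IsAuxFun δ f) (hδ : 0 < δ) {x : ℝ} (hx : 0 ≤ x) : -δ ^ 2 ≤ f x := by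
  have h2 : 0 ≤ δ ^ 2 := sq_nonneg δ
  rcases le_total x (δ ^ 4) with h1 | h1
  · rw [h.eq_linear x ⟨hx, h1⟩]
    have : x / δ ^ 4 ≤ 1 := (div_le_one (by positivity)).2 h1
    linarith
  · rcases le_total x δ with h3 | h3
    · exact h.lower x ⟨h1, h3⟩
    · rw [h.eq_zero x h3]
      linarith

theorem le_one (h : IsAuxFun δ f) {x : ℝ} (hx : 0 ≤ x) : f x ≤ 1 := by
  rcases le_total x (δ ^ 4) with h1 | h1
  · rw [h.eq_linear x ⟨hx, h1⟩]
    have : 0 ≤ x / δ ^ 4 := div_nonneg hx (by positivity)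
    linarith
  · rcases le_total x δ with h3 | h3
    · linarith [h.upper x ⟨h1, h3⟩]
    · rw [h.eq_zero x h3]
      linarith

theorem abs_le_one (h : IsAuxFun δ f) (hδ : 0 < δ) (hδ1 : δ ≤ 1) {x : ℝ} (hx : 0 ≤ x) :
    |f x| ≤ 1 :=
  abs_le.2 ⟨(neg_le_neg (by nlinarith)).trans (h.neg_sq_le hδ hx), h.le_one hx⟩

theorem hasDerivWithinAt (h : IsAuxFun δ f) {x : ℝ} (hx : x ∈ Ici (0 : ℝ)) :
    HasDerivWithinAt f (derivWithin f (Ici 0) x) (Ici 0) x :=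
  ((h.smooth.differentiableOn (by simp)) x hx).hasDerivWithinAt

theorem derivWithin_eq_zero (h : IsAuxFun δ f) {x : ℝ} (hx : δ < x) :
    derivWithin f (Ici 0) x = 0 := by
  have h1 : f =ᶠ[𝓝[Ici 0] x] fun _ => 0 :=
    mem_nhdsWithin_of_mem_nhds (by
      filter_upwards [lt_mem_nhds hx] with y hy
      exact h.eq_zero y (le_of_lt hy))
  rw [h1.derivWithin_eq (h.eq_zero x (le_of_lt hx))]
  simp

theorem derivWithin_le (h : IsAuxFun δ f) (hδ : 0 < δ) {x : ℝ} (hx : 0 ≤ x) :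
    derivWithin f (Ici 0) x ≤ δ := by
  rcases lt_or_ge x (δ ^ 4) with h1 | h1
  · have h2 : f =ᶠ[𝓝[Ici 0] x] fun y => 1 - y / δ ^ 4 := by
      filter_upwards [mem_nhdsWithin_of_mem_nhds (gt_mem_nhds h1), self_mem_nhdsWithin] with y hy hy0
      exact h.eq_linear y ⟨hy0, le_of_lt hy⟩
    have h3 : HasDerivWithinAt (fun y : ℝ => 1 - y / δ ^ 4) (-(1 / δ ^ 4)) (Ici 0) x :=
      (((hasDerivAt_id x).div_const _).const_sub 1).hasDerivWithinAt
    rw [h2.derivWithin_eq (h.eq_linear x ⟨hx, h1.le⟩),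
      h3.derivWithin (uniqueDiffOn_Ici (0 : ℝ) x hx)]
    have : 0 ≤ 1 / δ ^ 4 := by positivity
    linarith
  · rcases le_or_gt x δ with h3 | h3
    · exact h.deriv_le x ⟨h1, h3⟩
    · rw [h.derivWithin_eq_zero h3]
      exact hδ.le

theorem primitive_eq_zero (h : IsAuxFun δ f) (hδ : 0 < δ) {x : ℝ} (hx : δ ≤ x) :
    primitive f x = 0 :=
  (primitive_eq_of_eq_zero h.smooth.continuousOn hδ.le h.eq_zero hx).trans h.integral_eq

theorem abs_primitive_le (h : IsAuxFun δ f) (hδ : 0 < δ) (hδ1 : δ ≤ 1) {x : ℝ} (hx : 0 ≤ x) :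
    |primitive f x| ≤ δ := by
  rcases le_total x δ with h1 | h1
  · simpa using Gluing.abs_primitive_le (fun y hy => h.abs_le_one hδ hδ1 hy) hx h1
  · rw [h.primitive_eq_zero hδ h1, abs_zero]
    exact hδ.le

theorem abs_primitive_primitive_le (h : IsAuxFun δ f) (hδ : 0 < δ) (hδ1 : δ ≤ 1) {x : ℝ}
    (hx : 0 ≤ x) : |primitive (primitive f) x| ≤ δ := by
  have hle : ∀ y, 0 ≤ y → y ≤ δ → |primitive (primitive f) y| ≤ δ := fun y hy hyδ =>
    (Gluing.abs_primitive_le (fun y hy => h.abs_primitive_le hδ hδ1 hy) hy hyδ).trans (by nlinarith)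
  rcases le_total x δ with h1 | h1
  · exact hle x hx h1
  · rw [primitive_eq_of_eq_zero (contDiffOn_primitive h.smooth).continuousOn hδ.le
      (fun y hy => h.primitive_eq_zero hδ hy) h1]
    exact hle δ hδ.le le_rfl

end IsAuxFun

/-! ### Curvature of the perturbed metric near a point of the tube -/

section PerturbedMetric

variable {n : ℕ} [NeZero n] {M : Type*} [TopologicalSpace M]
  [ChartedSpace (EuclideanHalfSpace n) M] [IsManifold (𝓡∂ n) ∞ M]

/-- The tensor field `g + a(x^n) L + b(x^n) P^T`. -/
def perturbedMetric (g : SmoothMetric n M) (L : TensorField n M) (a b : ℝ → ℝ) :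
    TensorField n M := fun p =>
  g.inner p + a (normalCoord g p) • L p + b (normalCoord g p) • tangentialPart g p

variable {g : SmoothMetric n M} {r : ℝ} {L : TensorField n M}

theorem inChart_perturbedMetric (g : SmoothMetric n M) (L : TensorField n M) (a b : ℝ → ℝ) (q : M) :
    inChart (perturbedMetric g L a b) q = fun x => inChart g.inner q x
      + a (normalCoordIn g q x) • inChart L q x
      + b (normalCoordIn g q x) • inChart (tangentialPart g) q x := rfl

theorem inChart_tangentialPart (hr : IsFermiWidth g r) {p q : M} (hp : p ∈ tube g r)
    (hq : p ∈ (extChartAt (𝓡∂ n) q).source) :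
    inChart (tangentialPart g) q (extChartAt (𝓡∂ n) q p)
      = inChart g.inner q (extChartAt (𝓡∂ n) q p)
        - (fderivWithin ℝ (normalCoordIn g q) (halfSpace n) (extChartAt (𝓡∂ n) q p)).smulRight
          (fderivWithin ℝ (normalCoordIn g q) (halfSpace n) (extChartAt (𝓡∂ n) q p)) := by
  have h : ∀ v, differential (normalCoord g) p (chartFrame q (extChartAt (𝓡∂ n) q p) v)
      = fderivWithin ℝ (normalCoordIn g q) (halfSpace n) (extChartAt (𝓡∂ n) q p) v := fun v =>
    (fderivWithin_comp_chart (contMDiffAt_normalCoord g hr hp) hq v).symm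
  refine ContinuousLinearMap.ext fun v => ContinuousLinearMap.ext fun w => ?_
  simp only [sub_apply, ContinuousLinearMap.smulRight_apply, smul_apply, smul_eq_mul, ← h]
  simp only [inChart, (extChartAt (𝓡∂ n) q).left_inv hq, pullBilin_apply]
  rfl

theorem isSmoothAt_tangentialPart (hr : IsFermiWidth g r) {p : M} (hp : p ∈ tube g r) :
    IsSmoothAt (tangentialPart g) p := by
  have hs := mem_extChartAt_source (I := 𝓡∂ n) p
  have hx := chart_mem (n := n) p p
  have hu := contDiffWithinAt_fderivWithin isBody_halfSpace hx
    (contDiffWithinAt_normalCoordIn g hr hp hs)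
  rw [isSmoothAt_iff]
  have h1 : ContDiffWithinAt ℝ ∞ (fun x => inChart g.inner p x
      - (fderivWithin ℝ (normalCoordIn g p) (halfSpace n) x).smulRight
        (fderivWithin ℝ (normalCoordIn g p) (halfSpace n) x)) (halfSpace n)
      (extChartAt (𝓡∂ n) p p) :=
    ((SmoothMetric.isMetricNear g p).isMetricAt hs).smooth.sub
      ((contDiffWithinAt_const (c := ContinuousLinearMap.smulRightL ℝ (EuclideanSpace ℝ (Fin n))
        (EuclideanSpace ℝ (Fin n) →L[ℝ] ℝ))).clm_apply hu |>.clm_apply hu)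
  refine h1.congr_of_eventuallyEq ?_ (inChart_tangentialPart hr hp hs)
  filter_upwards [eventually_chart hs ((isOpen_tube g r).mem_nhds hp)] with x hx
  have h2 := inChart_tangentialPart hr hx.2 ((extChartAt (𝓡∂ n) p).map_target hx.1)
  rw [(extChartAt (𝓡∂ n) p).right_inv hx.1] at h2
  exact h2

theorem tangentialPart_symm (g : SmoothMetric n M) (p : M) (u v : EuclideanSpace ℝ (Fin n)) :
    tensorAt (tangentialPart g) p u v = tensorAt (tangentialPart g) p v u := by
  have h1 : g.inner p u v = g.inner p v u := g.symm p u v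
  change g.inner p u v - dNormalCoord g p u * dNormalCoord g p v
    = g.inner p v u - dNormalCoord g p v * dNormalCoord g p u
  rw [h1, mul_comm]

theorem collarMetric_eq_perturbedMetric (g : SmoothMetric n M) (L : TensorField n M) (t : ℝ) :
    collarMetric g L t = perturbedMetric g L (fun y => 2 * t * y) fun _ => 0 := by
  funext p
  rw [perturbedMetric, collarMetric, zero_smul, add_zero]

omit [IsManifold (𝓡∂ n) ∞ M] in
theorem eventually_inChart_symm {h : TensorField n M} {p : M} (hh : ∀ᶠ q in 𝓝 p, ∀ u v,
    tensorAt h q u v = tensorAt h q v u) : ∀ᶠ x in 𝓝[halfSpace n] (extChartAt (𝓡∂ n) p p),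
      ∀ u v, inChart h p x u v = inChart h p x v u := by
  filter_upwards [eventually_chart (mem_extChartAt_source p) hh] with x hx u v
  exact hx.2 _ _

section

variable (hr : IsFermiWidth g r) (hpar : IsNormallyParallel g r L)
include hr hpar

theorem curvature_perturbedMetric {p q : M} (hp : p ∈ tube g r)
    (hq : p ∈ (extChartAt (𝓡∂ n) q).source) {a a₁ b b₁ : ℝ → ℝ} {a₂ b₂ : ℝ}
    (ha : ∀ t ∈ Ici (0 : ℝ), HasDerivWithinAt a (a₁ t) (Ici 0) t)
    (ha₁ : HasDerivWithinAt a₁ a₂ (Ici 0) (normalCoord g p))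
    (hb : ∀ t ∈ Ici (0 : ℝ), HasDerivWithinAt b (b₁ t) (Ici 0) t)
    (hb₁ : HasDerivWithinAt b₁ b₂ (Ici 0) (normalCoord g p)) :
    curvature (halfSpace n) (inChart (perturbedMetric g L a b) q) (extChartAt (𝓡∂ n) q p)
      = perturbedCurvature (halfSpace n) (normalCoordIn g q) (inChart g.inner q) (inChart L q)
        (inChart (tangentialPart g) q) (extChartAt (𝓡∂ n) q p) (a (normalCoord g p))
        (a₁ (normalCoord g p)) a₂ (b (normalCoord g p)) (b₁ (normalCoord g p)) b₂ := by
  have e : normalCoordIn g q (extChartAt (𝓡∂ n) q p) = normalCoord g p := by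
    rw [normalCoordIn, (extChartAt (𝓡∂ n) q).left_inv hq]
  rw [← e] at ha₁ hb₁ ⊢
  rw [inChart_perturbedMetric]
  exact curvature_perturbation isBody_halfSpace (chart_mem q p)
    (contDiffWithinAt_normalCoordIn g hr hp hq) (fun y => normalCoord_nonneg g _)
    ((SmoothMetric.isMetricNear g p).smooth.contDiffWithinAt hq)
    ((hpar.isSmoothAt hp).contDiffWithinAt hq)
    ((isSmoothAt_tangentialPart hr hp).contDiffWithinAt hq) ha ha₁ hb hb₁

/-- The limit of the curvature forms: that of `g + a(x^n) L` with `a = 0` and `a' = 2 t` at `q`,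
increased by the contribution of `b'' = -2 C t`. -/
theorem frameForm_perturbedCurvature_center {q : M} (hq : q ∈ tube g r) (t C : ℝ)
    {a a₁ : ℝ → ℝ} (ha : ∀ t ∈ Ici (0 : ℝ), HasDerivWithinAt a (a₁ t) (Ici 0) t)
    (ha₁ : HasDerivWithinAt a₁ 0 (Ici 0) (normalCoord g q)) (h0 : a (normalCoord g q) = 0)
    (h1 : a₁ (normalCoord g q) = 2 * t)
    {α : Matrix (Fin n) (Fin n) ℝ} (hα : α.transpose = -α) :
    frameForm (perturbedCurvature (halfSpace n) (normalCoordIn g q) (inChart g.inner q) (inChart L q)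
        (inChart (tangentialPart g) q) (extChartAt (𝓡∂ n) q q) 0 (2 * t) 0 0 0 (-(2 * C * t)))
        stdVec α
      = frameForm (curvature (halfSpace n) (inChart (perturbedMetric g L a fun _ => 0) q)
          (extChartAt (𝓡∂ n) q q)) stdVec α
        + C * t * (centreMetric g q (contraction (centreDifferential g q) stdVec α)
              (contraction (centreDifferential g q) stdVec α)
            - centreDifferential g q (contraction (centreDifferential g q) stdVec α)
              * centreDifferential g q (contraction (centreDifferential g q) stdVec α)) := by
  have hs := mem_extChartAt_source (I := 𝓡∂ n) q
  have e := frameForm_perturbedCurvature_add (s := halfSpace n) (u := normalCoordIn g q)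
    (G := inChart g.inner q) (L := inChart L q) (P := inChart (tangentialPart g) q)
    (x := extChartAt (𝓡∂ n) q q) 0 (2 * t) 0 0 0 0 0 (-(2 * C * t)) stdVec hα
  rw [zero_add, zero_add] at e
  rw [e, curvature_perturbedMetric hr hpar hq hs ha ha₁
    (fun y _ => hasDerivWithinAt_const y _ (0 : ℝ)) (hasDerivWithinAt_const _ _ (0 : ℝ)), h0, h1,
    inChart_tangentialPart hr hq hs]
  simp only [sub_apply, ContinuousLinearMap.smulRight_apply, smul_apply, smul_eq_mul]
  ring

end

/-- The function `a` on `[0, ∞)` has the derivative `a₁`, whose derivative at `y` is `a₂`. -/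
structure IsTwoJet (a a₁ : ℝ → ℝ) (a₂ y : ℝ) : Prop where
  first : ∀ t ∈ Ici (0 : ℝ), HasDerivWithinAt a (a₁ t) (Ici 0) t
  second : HasDerivWithinAt a₁ a₂ (Ici 0) y

/-- The convergence argument for `g + a(x^n) L + b(x^n) P^T` near the point `q`. The second
derivative `a₂` of `a` may be unbounded: by `hLA` it may be replaced by a function `A₂` which tends to zero. -/
theorem eventually_perturbedMetric_ge (hr : IsFermiWidth g r) (hpar : IsNormallyParallel g r L)
    {q : M} (hq : q ∈ tube g r) {K : Set ℝ} (hK : IsCompact K) {κ C η : ℝ} (hη : 0 < η)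
    (hKC : ∀ t ∈ K, ∀ α : Matrix (Fin n) (Fin n) ℝ, α.transpose = -α →
      κ * frameForm (bivec (centreMetric g q)) stdVec α
        ≤ frameForm (perturbedCurvature (halfSpace n) (normalCoordIn g q) (inChart g.inner q)
          (inChart L q) (inChart (tangentialPart g) q) (extChartAt (𝓡∂ n) q q)
          0 (2 * t) 0 0 0 (-(2 * C * t))) stdVec α)
    {X : Type*} {l : Filter X} {p : X → M} (hp : Tendsto p l (𝓝 q))
    {a a₁ b b₁ : X → ℝ → ℝ} {a₂ b₂ A₂ t : X → ℝ}
    (hja : ∀ᶠ z in l, IsTwoJet (a z) (a₁ z) (a₂ z) (normalCoord g (p z)))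
    (hjb : ∀ᶠ z in l, IsTwoJet (b z) (b₁ z) (b₂ z) (normalCoord g (p z)))
    (ht : ∀ᶠ z in l, t z ∈ K)
    (hLA : ∀ᶠ z in l, ∀ v, 0 ≤ (A₂ z - a₂ z) * tensorAt L (p z) v v)
    (ha : Tendsto (fun z => a z (normalCoord g (p z))) l (𝓝 0))
    (ha₁ : Tendsto (fun z => a₁ z (normalCoord g (p z)) - 2 * t z) l (𝓝 0))
    (hA₂ : Tendsto A₂ l (𝓝 0))
    (hb : Tendsto (fun z => b z (normalCoord g (p z))) l (𝓝 0))
    (hb₁ : Tendsto (fun z => b₁ z (normalCoord g (p z))) l (𝓝 0))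
    (hb₂ : Tendsto (fun z => b₂ z + 2 * C * t z) l (𝓝 0)) :
    ∀ᶠ z in l, IsInner (inChart (perturbedMetric g L (a z) (b z)) q (extChartAt (𝓡∂ n) q (p z))) ∧
      ∀ α : Matrix (Fin n) (Fin n) ℝ, α.transpose = -α →
        (κ - η) * frameForm (bivec (inChart (perturbedMetric g L (a z) (b z)) q
            (extChartAt (𝓡∂ n) q (p z)))) stdVec α
          ≤ frameForm (curvature (halfSpace n) (inChart (perturbedMetric g L (a z) (b z)) q)
            (extChartAt (𝓡∂ n) q (p z))) stdVec α := by
  have hs := mem_extChartAt_source (I := 𝓡∂ n) q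
  have hP := isSmoothAt_tangentialPart hr hq
  have hLs : ∀ᶠ p in 𝓝 q, ∀ u v, tensorAt L p u v = tensorAt L p v u := by
    filter_upwards [(isOpen_tube g r).mem_nhds hq] with p hp u v
    exact hpar.symm p hp u v
  have key := eventually_frameForm_perturbedCurvature_ge linearIndependent_stdVec isBody_halfSpace
    (chart_mem q q) (contDiffWithinAt_normalCoordIn g hr hq hs)
    ((SmoothMetric.isMetricNear g q).smooth.contDiffWithinAt hs)
    ((hpar.isSmoothAt hq).contDiffWithinAt hs) (hP.contDiffWithinAt hs)
    (eventually_inChart_symm (.of_forall fun p => (SmoothMetric.isInner g p).symm))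
    (eventually_inChart_symm hLs)
    (eventually_inChart_symm (.of_forall fun p => tangentialPart_symm g p))
    (isInner_centreMetric g q) hK hη hKC ((tendsto_chart hs).comp hp) ha ha₁ hA₂ hb hb₁ hb₂
  filter_upwards [key, ht, hja, hjb, hLA, hp.eventually ((isOpen_tube g r).mem_nhds hq),
    hp.eventually ((isOpen_extChartAt_source (I := 𝓡∂ n) q).mem_nhds hs)]
    with z h1 h2 h3 h4 h5 h6 h7
  have e : normalCoordIn g q (extChartAt (𝓡∂ n) q (p z)) = normalCoord g (p z) := by
    rw [normalCoordIn, (extChartAt (𝓡∂ n) q).left_inv h7]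
  obtain ⟨h8, h9⟩ := h1 (t z) h2
  simp only [Function.comp_apply] at h8 h9
  have e2 : inChart (perturbedMetric g L (a z) (b z)) q (extChartAt (𝓡∂ n) q (p z))
      = inChart g.inner q (extChartAt (𝓡∂ n) q (p z))
        + a z (normalCoord g (p z)) • inChart L q (extChartAt (𝓡∂ n) q (p z))
        + b z (normalCoord g (p z)) • inChart (tangentialPart g) q (extChartAt (𝓡∂ n) q (p z)) := by
    rw [inChart_perturbedMetric]
    simp only [e]
  rw [e2]
  refine ⟨h8, fun α hα => (h9 α hα).trans ?_⟩
  rw [curvature_perturbedMetric hr hpar h6 h7 h3.first h3.second h4.first h4.second]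
  have h10 := frameForm_perturbedCurvature_add (s := halfSpace n) (u := normalCoordIn g q)
    (G := inChart g.inner q) (L := inChart L q) (P := inChart (tangentialPart g) q)
    (x := extChartAt (𝓡∂ n) q (p z)) (a z (normalCoord g (p z))) (a₁ z (normalCoord g (p z)))
    (a₂ z) (b z (normalCoord g (p z))) (b₁ z (normalCoord g (p z))) (b₂ z) (A₂ z - a₂ z) 0 stdVec hα
  rw [add_sub_cancel, add_zero, zero_div, zero_mul, sub_zero] at h10
  rw [add_sub_cancel, show -(2 * C * t z) + (b₂ z + 2 * C * t z) = b₂ z by ring, h10]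
  have h11 : ∀ w, 0 ≤ (A₂ z - a₂ z) * inChart L q (extChartAt (𝓡∂ n) q (p z)) w w := fun w => by
    rw [inChart, (extChartAt (𝓡∂ n) q).left_inv h7]
    exact h5 _
  have h12 := h11 (contraction (fderivWithin ℝ (normalCoordIn g q) (halfSpace n)
    (extChartAt (𝓡∂ n) q (p z))) stdVec α)
  linarith

end PerturbedMetric

/-! ### Curvature of the modified metric near a point of the tube -/

section Coefficients

/-- The coefficient `2 F` of `L` in the modified metric. -/
def bendingFactor (f : ℝ → ℝ) (y : ℝ) : ℝ := 2 * primitive f y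

/-- The coefficient `-2 C χ 𝓕` of `P^T` in the modified metric. -/
def shrinkingFactor (χ : ℝ → ℝ) (C : ℝ) (f : ℝ → ℝ) (y : ℝ) : ℝ :=
  -(2 * C * χ y * primitive (primitive f) y)

variable {δ : ℝ} {f χ : ℝ → ℝ}

theorem IsAuxFun.isTwoJet_bendingFactor (h : IsAuxFun δ f) {y : ℝ} (hy : 0 ≤ y) :
    IsTwoJet (bendingFactor f) (fun y => 2 * f y) (2 * derivWithin f (Ici 0) y) y where
  first _ ht := (hasDerivWithinAt_primitive h.smooth.continuousOn ht).const_mul 2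
  second := (h.hasDerivWithinAt hy).const_mul 2

theorem IsAuxFun.isTwoJet_shrinkingFactor (h : IsAuxFun δ f) (hχ : ContDiff ℝ ∞ χ) (C : ℝ) {y : ℝ}
    (hy : 0 ≤ y) : IsTwoJet (shrinkingFactor χ C f)
      (fun y => -(2 * C) * (deriv χ y * primitive (primitive f) y + χ y * primitive f y))
      (-(2 * C) * (deriv (deriv χ) y * primitive (primitive f) y + deriv χ y * primitive f y
        + (deriv χ y * primitive f y + χ y * f y))) y := by
  have hχ' : ContDiff ℝ ∞ (deriv χ) := hχ.deriv'
  have h0 : ∀ t, HasDerivWithinAt χ (deriv χ t) (Ici 0) t := fun t =>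
    (hχ.differentiable (by simp) t).hasDerivAt.hasDerivWithinAt
  have h1 : ∀ t, HasDerivWithinAt (deriv χ) (deriv (deriv χ) t) (Ici 0) t := fun t =>
    (hχ'.differentiable (by simp) t).hasDerivAt.hasDerivWithinAt
  have hF : ∀ t ∈ Ici (0 : ℝ), HasDerivWithinAt (primitive f) (f t) (Ici 0) t := fun t ht =>
    hasDerivWithinAt_primitive h.smooth.continuousOn ht
  have hFF : ∀ t ∈ Ici (0 : ℝ), HasDerivWithinAt (primitive (primitive f)) (primitive f t) (Ici 0) t :=
    fun t ht => hasDerivWithinAt_primitive (contDiffOn_primitive h.smooth).continuousOn ht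
  refine ⟨fun t ht => ?_, ?_⟩
  · refine (((h0 t).mul (hFF t ht)).const_mul (-(2 * C))).congr (fun x _ => ?_) ?_ <;>
      simp only [shrinkingFactor, Pi.mul_apply] <;> ring
  · exact (((h1 y).mul (hFF y hy)).add ((h0 y).mul (hF y hy))).const_mul (-(2 * C))

end Coefficients

section LocalBound

variable {n : ℕ} [NeZero n] {M : Type*} [TopologicalSpace M]
  [ChartedSpace (EuclideanHalfSpace n) M] [IsManifold (𝓡∂ n) ∞ M]
  {g : SmoothMetric n M} {r : ℝ} {L : TensorField n M} {χ : ℝ → ℝ}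

theorem modifiedMetric_eq {p : M} (hp : p ∈ tube g r) (C : ℝ) (f : ℝ → ℝ) :
    modifiedMetric g r L χ C f p
      = perturbedMetric g L (bendingFactor f) (shrinkingFactor χ C f) p := by
  rw [modifiedMetric, if_pos hp, perturbedMetric, bendingFactor, shrinkingFactor, neg_smul,
    sub_eq_add_neg]

/-- The filter of triples of a parameter `δ`, a point and an admissible function `f_δ`, as `δ` tends
to zero and the point tends to `q`. -/
def auxFilter (q : M) : Filter ((ℝ × M) × (ℝ → ℝ)) :=
  comap Prod.fst (𝓝[>] 0 ×ˢ 𝓝 q) ⊓ 𝓟 {z | IsAuxFun z.1.1 z.2}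

theorem eventually_auxFilter {q : M} {P : (ℝ × M) × (ℝ → ℝ) → Prop} :
    (∀ᶠ z in auxFilter q, P z) ↔
      ∀ᶠ w in 𝓝[>] 0 ×ˢ 𝓝 q, ∀ f, IsAuxFun w.1 f → P (w, f) := by
  rw [auxFilter, eventually_inf_principal, eventually_comap]
  exact eventually_congr (.of_forall fun w =>
    ⟨fun h f hf => h (w, f) rfl hf, fun h z hz hf => by subst hz; exact h z.2 hf⟩)

theorem eventually_isAuxFun (q : M) : ∀ᶠ z in auxFilter q, IsAuxFun z.1.1 z.2 ∧ 0 < z.1.1 ∧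
    z.1.1 ≤ 1 := by
  refine eventually_auxFilter.2 ?_
  have h : ∀ᶠ δ : ℝ in 𝓝[>] 0, 0 < δ ∧ δ ≤ 1 :=
    Filter.Eventually.and self_mem_nhdsWithin
      ((eventually_le_nhds zero_lt_one).filter_mono nhdsWithin_le_nhds)
  filter_upwards [tendsto_fst.eventually h] with w hw f hf
  exact ⟨hf, hw⟩

theorem tendsto_auxFilter_param (q : M) : Tendsto (fun z => z.1.1) (auxFilter q) (𝓝 0) :=
  (tendsto_nhdsWithin_iff.1 tendsto_fst).1.comp (tendsto_comap.mono_left inf_le_left)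

theorem tendsto_auxFilter_point (q : M) : Tendsto (fun z => z.1.2) (auxFilter q) (𝓝 q) :=
  tendsto_snd.comp (tendsto_comap.mono_left inf_le_left)

theorem tendsto_auxFilter_of_abs_le {q : M} {φ : (ℝ × M) × (ℝ → ℝ) → ℝ}
    (h : ∀ z, IsAuxFun z.1.1 z.2 → 0 < z.1.1 → z.1.1 ≤ 1 → |φ z| ≤ z.1.1) :
    Tendsto φ (auxFilter q) (𝓝 0) :=
  squeeze_zero_norm' ((eventually_isAuxFun q).mono fun z hz => h z hz.1 hz.2.1 hz.2.2)
    (tendsto_auxFilter_param q)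

theorem tendsto_primitive (g : SmoothMetric n M) (q : M) :
    Tendsto (fun z => primitive z.2 (normalCoord g z.1.2)) (auxFilter q) (𝓝 0) :=
  tendsto_auxFilter_of_abs_le fun _ h h0 h1 => h.abs_primitive_le h0 h1 (normalCoord_nonneg g _)

theorem tendsto_primitive_primitive (g : SmoothMetric n M) (q : M) :
    Tendsto (fun z => primitive (primitive z.2) (normalCoord g z.1.2)) (auxFilter q) (𝓝 0) :=
  tendsto_auxFilter_of_abs_le fun _ h h0 h1 =>
    h.abs_primitive_primitive_le h0 h1 (normalCoord_nonneg g _)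

theorem tendsto_sub_max (g : SmoothMetric n M) (q : M) :
    Tendsto (fun z => z.2 (normalCoord g z.1.2) - max (z.2 (normalCoord g z.1.2)) 0) (auxFilter q)
      (𝓝 0) := by
  refine tendsto_auxFilter_of_abs_le fun z h h0 h1 => ?_
  have h2 := h.neg_sq_le h0 (normalCoord_nonneg g z.1.2)
  rcases le_total (z.2 (normalCoord g z.1.2)) 0 with h3 | h3
  · rw [max_eq_right h3, sub_zero, abs_of_nonpos h3]
    nlinarith
  · rw [max_eq_left h3, sub_self, abs_zero]
    exact h0.le

theorem tendsto_normalCoord (hr : IsFermiWidth g r) {q : M} (hq : q ∈ tube g r) {φ : ℝ → ℝ}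
    (hφ : Continuous φ) :
    Tendsto (fun z => φ (normalCoord g z.1.2)) (auxFilter q) (𝓝 (φ (normalCoord g q))) :=
  (hφ.tendsto _).comp ((contMDiffAt_normalCoord g hr hq).continuousAt.tendsto.comp
    (tendsto_auxFilter_point q))

/-- The modified metric is positive definite at `p`, with the lower bound `k` on its curvature
operator, both expressed in the chart at `q`. -/
def HasLocalBound (g : SmoothMetric n M) (L : TensorField n M) (χ : ℝ → ℝ) (C k : ℝ) (q p : M)
    (f : ℝ → ℝ) : Prop :=
  IsInner (inChart (perturbedMetric g L (bendingFactor f) (shrinkingFactor χ C f)) q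
      (extChartAt (𝓡∂ n) q p)) ∧
    ∀ α : Matrix (Fin n) (Fin n) ℝ, α.transpose = -α →
      k * frameForm (bivec (inChart (perturbedMetric g L (bendingFactor f) (shrinkingFactor χ C f)) q
          (extChartAt (𝓡∂ n) q p))) stdVec α
        ≤ frameForm (curvature (halfSpace n)
          (inChart (perturbedMetric g L (bendingFactor f) (shrinkingFactor χ C f)) q)
          (extChartAt (𝓡∂ n) q p)) stdVec α

variable (hr : IsFermiWidth g r) (hpar : IsNormallyParallel g r L) (hχ : ContDiff ℝ ∞ χ) {κ C η : ℝ}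
  (hη : 0 < η)
include hr hpar hχ hη

/-- Away from the boundary the functions `F_δ` vanish near a given point for small `δ`, and the
functions `𝓕_δ` are small constants. -/
theorem eventually_hasLocalBound_interior [T2Space M] {q : M} (hq : q ∈ tube g r)
    (hqb : q ∉ (𝓡∂ n).boundary M)
    (hκ : ∀ α : Matrix (Fin n) (Fin n) ℝ, α.transpose = -α →
      κ * frameForm (bivec (centreMetric g q)) stdVec α
        ≤ frameForm (curvature (halfSpace n) (inChart g.inner q) (extChartAt (𝓡∂ n) q q)) stdVec α) :
    ∀ᶠ z in auxFilter q, HasLocalBound g L χ C (κ - η) q z.1.2 z.2 := by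
  have hu : 0 < normalCoord g q := normalCoord_pos g hq hqb
  have hlt : ∀ᶠ z in auxFilter q, z.1.1 < normalCoord g z.1.2 := by
    filter_upwards [(tendsto_auxFilter_param q).eventually (gt_mem_nhds (half_pos hu)),
      (tendsto_normalCoord hr hq continuous_id).eventually (lt_mem_nhds (half_lt_self hu))]
      with z h1 h2
    exact lt_trans h1 h2
  have hf0 : ∀ᶠ z in auxFilter q, z.2 (normalCoord g z.1.2) = 0 := by
    filter_upwards [hlt, eventually_isAuxFun q] with z h1 h2
    exact h2.1.eq_zero _ (le_of_lt h1)
  have hf : Tendsto (fun z => z.2 (normalCoord g z.1.2)) (auxFilter q) (𝓝 0) :=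
    tendsto_const_nhds.congr' (hf0.mono fun z hz => hz.symm)
  have hF := tendsto_primitive g q
  have hFF := tendsto_primitive_primitive g q
  have t0 := tendsto_normalCoord hr hq hχ.continuous
  have hχ' : ContDiff ℝ ∞ (deriv χ) := hχ.deriv'
  have t1 := tendsto_normalCoord hr hq hχ'.continuous
  have hχ'' : ContDiff ℝ ∞ (deriv (deriv χ)) := hχ'.deriv'
  have t2 := tendsto_normalCoord hr hq hχ''.continuous
  refine eventually_perturbedMetric_ge hr hpar hq (K := {0}) isCompact_singleton (C := C) hη ?_
    (tendsto_auxFilter_point q) (t := fun _ => 0) (A₂ := fun _ => 0)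
    ((eventually_isAuxFun q).mono fun z hz =>
      hz.1.isTwoJet_bendingFactor (normalCoord_nonneg g _))
    ((eventually_isAuxFun q).mono fun z hz =>
      hz.1.isTwoJet_shrinkingFactor hχ C (normalCoord_nonneg g _)) (by simp) ?_ ?_ ?_
    tendsto_const_nhds ?_ ?_ ?_
  · rintro t rfl α hα
    rw [frameForm_perturbedCurvature_center hr hpar hq 0 C (a := fun _ => 0) (a₁ := fun _ => 0)
      (fun y _ => hasDerivWithinAt_const y _ (0 : ℝ)) (hasDerivWithinAt_const _ _ (0 : ℝ)) rfl
      (by simp) hα]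
    have e : perturbedMetric g L (fun _ => 0) (fun _ => 0) = g.inner := by
      funext p
      simp [perturbedMetric]
    rw [e, mul_zero, zero_mul, add_zero]
    exact hκ α hα
  · filter_upwards [hlt, eventually_isAuxFun q] with z h1 h2 v
    rw [h2.1.derivWithin_eq_zero h1]
    simp
  · simpa [bendingFactor] using hF.const_mul 2
  · simpa using hf.const_mul 2
  · simpa [shrinkingFactor, mul_assoc] using ((t0.mul hFF).const_mul (2 * C)).neg
  · simpa using ((t1.mul hFF).add (t0.mul hF)).const_mul (-(2 * C))
  · simpa using (((t2.mul hFF).add (t1.mul hF)).add ((t1.mul hF).add (t0.mul hf))).const_mul (-(2 * C))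

/-- At the boundary `f_δ` may take any value `t` between `0` and `1`, and the limit of the curvature
operators is that of `g + 2 t x^n L` increased by the contribution `C t P^T` of the term with `𝓕_δ`.
The derivative of `f_δ` may be arbitrarily negative, but it enters with a favourable sign. -/
theorem eventually_hasLocalBound_boundary [T2Space M] {q : M} (hq : q ∈ (𝓡∂ n).boundary M)
    (hχ1 : ∃ s > 0, ∀ x ∈ Icc 0 s, χ x = 1)
    (hL : ∀ᶠ p in 𝓝 q, ∀ v, 0 ≤ tensorAt L p v v)
    (hκ : ∀ t ∈ Icc (0 : ℝ) 1, ∀ α : Matrix (Fin n) (Fin n) ℝ, α.transpose = -α →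
      κ * frameForm (bivec (centreMetric g q)) stdVec α
        ≤ frameForm (curvature (halfSpace n) (inChart (collarMetric g L t) q)
          (extChartAt (𝓡∂ n) q q)) stdVec α
          + C * t * (centreMetric g q (contraction (centreDifferential g q) stdVec α)
              (contraction (centreDifferential g q) stdVec α)
            - centreDifferential g q (contraction (centreDifferential g q) stdVec α)
              * centreDifferential g q (contraction (centreDifferential g q) stdVec α))) :
    ∀ᶠ z in auxFilter q, HasLocalBound g L χ C (κ - η) q z.1.2 z.2 := by
  have hqt := mem_tube_of_mem g hr.pos hq
  have hu : normalCoord g q = 0 := normalCoord_of_mem g hq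
  have hf := tendsto_sub_max g q
  have hF := tendsto_primitive g q
  have hFF := tendsto_primitive_primitive g q
  have t0 := tendsto_normalCoord hr hqt hχ.continuous
  have hχ' : ContDiff ℝ ∞ (deriv χ) := hχ.deriv'
  have t1 := tendsto_normalCoord hr hqt hχ'.continuous
  have hχ'' : ContDiff ℝ ∞ (deriv (deriv χ)) := hχ'.deriv'
  have t2 := tendsto_normalCoord hr hqt hχ''.continuous
  obtain ⟨s, hs, hχs⟩ := hχ1
  have hone : ∀ᶠ z in auxFilter q, χ (normalCoord g z.1.2) = 1 := by
    have h1 := tendsto_normalCoord hr hqt continuous_id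
    simp only [id, hu] at h1
    filter_upwards [h1.eventually (gt_mem_nhds hs)] with z hz
    exact hχs _ ⟨normalCoord_nonneg g _, le_of_lt hz⟩
  refine eventually_perturbedMetric_ge hr hpar hqt (K := Icc 0 1) isCompact_Icc (C := C) hη ?_
    -- `t` is the value of `f_δ`, which is at least `-δ²`, and `f_δ' ≤ δ`
    (tendsto_auxFilter_point q) (t := fun z => max (z.2 (normalCoord g z.1.2)) 0)
    (A₂ := fun z => 2 * z.1.1)
    ((eventually_isAuxFun q).mono fun z hz =>
      hz.1.isTwoJet_bendingFactor (normalCoord_nonneg g _))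
    ((eventually_isAuxFun q).mono fun z hz =>
      hz.1.isTwoJet_shrinkingFactor hχ C (normalCoord_nonneg g _)) ?_ ?_ ?_ ?_
    ?_ ?_ ?_ ?_
  · intro t ht α hα
    rw [frameForm_perturbedCurvature_center hr hpar hqt t C (a := fun y => 2 * t * y)
      (a₁ := fun _ => 2 * t)
      (fun y _ => by simpa using (hasDerivWithinAt_id y (Ici (0 : ℝ))).const_mul (2 * t))
      (hasDerivWithinAt_const _ _ (2 * t)) (by rw [hu, mul_zero]) rfl hα,
      ← collarMetric_eq_perturbedMetric]
    exact hκ t ht α hα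
  · filter_upwards [eventually_isAuxFun q] with z hz
    exact ⟨le_max_right _ _, max_le (hz.1.le_one (normalCoord_nonneg g _)) zero_le_one⟩
  · filter_upwards [(tendsto_auxFilter_point q).eventually hL, eventually_isAuxFun q] with z h1 h2 v
    have h3 := h2.1.derivWithin_le h2.2.1 (normalCoord_nonneg g z.1.2)
    exact mul_nonneg (by linarith) (h1 v)
  · simpa [bendingFactor] using hF.const_mul 2
  · simpa [mul_sub] using hf.const_mul 2
  · simpa using (tendsto_auxFilter_param q).const_mul 2
  · simpa [shrinkingFactor, mul_assoc] using ((t0.mul hFF).const_mul (2 * C)).neg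
  · simpa using ((t1.mul hFF).add (t0.mul hF)).const_mul (-(2 * C))
  · have h1 := (((t2.mul hFF).add (t1.mul hF)).add ((t1.mul hF).add hf)).const_mul (-(2 * C))
    simp only [mul_zero, add_zero] at h1
    refine h1.congr' (hone.mono fun z hz => ?_)
    simp only [hz]
    ring

end LocalBound

/-! ### The modified metric on the whole manifold -/

/-- The unit ball of an inner product is bounded: it is bounded below by a multiple of the norm. -/
theorem IsInner.isVonNBounded {V : Type*} [NormedAddCommGroup V] [InnerProductSpace ℝ V]
    [FiniteDimensional ℝ V] {G : Bilin V} (hG : IsInner G) :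
    Bornology.IsVonNBounded ℝ {v : V | G v v < 1} := by
  set E : Bilin V := (isBoundedBilinearMap_inner (𝕜 := ℝ) (E := V)).toContinuousLinearMap
  have hE : ∀ u v, E u v = inner ℝ u v := fun u v => rfl
  have h1 : Tendsto (fun ε : ℝ => G - ε • E) (𝓝[>] 0) (𝓝 G) := by
    have h2 : Continuous fun ε : ℝ => G - ε • E := by fun_prop
    have h3 := h2.tendsto 0
    rw [zero_smul, sub_zero] at h3
    exact h3.mono_left nhdsWithin_le_nhds
  obtain ⟨ε, h2, hε⟩ := ((h1.eventually hG.eventually).and self_mem_nhdsWithin).exists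
  have hε : 0 < ε := hε
  have h3 := h2 fun u v => by
    simp only [sub_apply, smul_apply, hE, hG.symm u v, real_inner_comm]
  refine (NormedSpace.isVonNBounded_iff ℝ).2 (isBounded_iff_forall_norm_le.2 ⟨1 + ε⁻¹, fun v hv => ?_⟩)
  have hv : G v v < 1 := hv
  have h4 : ε * ‖v‖ ^ 2 ≤ G v v := by
    by_cases h0 : v = 0
    · simp [h0]
    · have := h3.pos v h0
      simp only [sub_apply, smul_apply, hE, smul_eq_mul, real_inner_self_eq_norm_sq]
        at this
      linarith
  have h5 : ‖v‖ ^ 2 ≤ ε⁻¹ := by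
    rw [← one_div, le_div_iff₀ hε]
    linarith
  nlinarith [sq_nonneg (‖v‖ - 1), norm_nonneg v, inv_pos.2 hε]

section Global

variable {n : ℕ} [NeZero n] {M : Type*} [TopologicalSpace M]
  [ChartedSpace (EuclideanHalfSpace n) M] [IsManifold (𝓡∂ n) ∞ M]

theorem isInner_of_inChart {h : TensorField n M} {p q : M}
    (hq : p ∈ (extChartAt (𝓡∂ n) q).source) (hh : IsInner (inChart h q (extChartAt (𝓡∂ n) q p))) :
    IsInner (tensorAt h p) := by
  rw [inChart, (extChartAt (𝓡∂ n) q).left_inv hq] at hh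
  have hb := (chartFrame_bijective hq).2
  refine ⟨fun u v => ?_, fun u hu => ?_⟩
  · obtain ⟨u, rfl⟩ := hb u
    obtain ⟨v, rfl⟩ := hb v
    exact hh.symm u v
  · obtain ⟨u, rfl⟩ := hb u
    exact hh.pos u fun h => hu (by rw [h, map_zero])

/-- A smooth field of inner products is a smooth Riemannian metric. -/
def metricOfInner (h : TensorField n M) (hs : ∀ p, IsSmoothAt h p)
    (hh : ∀ p, IsInner (tensorAt h p)) : SmoothMetric n M where
  inner := h
  symm p := (hh p).symm
  pos p := (hh p).pos
  isVonNBounded p := (hh p).isVonNBounded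
  contMDiff := hs

omit [IsManifold (𝓡∂ n) ∞ M] in
theorem tensorAt_congr {h h' : TensorField n M} {p : M} (e : ∀ᶠ p in 𝓝 p, h p = h' p) :
    tensorAt h p = tensorAt h' p := e.self_of_nhds

omit [IsManifold (𝓡∂ n) ∞ M] in
theorem eventuallyEq_inChart {h h' : TensorField n M} {p q : M}
    (hq : p ∈ (extChartAt (𝓡∂ n) q).source) (e : ∀ᶠ p in 𝓝 p, h p = h' p) :
    inChart h q =ᶠ[𝓝[halfSpace n] (extChartAt (𝓡∂ n) q p)] inChart h' q := by
  filter_upwards [eventually_chart hq e] with x hx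
  rw [inChart, inChart, tensorAt, tensorAt, hx.2]

omit [IsManifold (𝓡∂ n) ∞ M] in
theorem curvature_congr {h h' : TensorField n M} {p q : M}
    (hq : p ∈ (extChartAt (𝓡∂ n) q).source) (e : ∀ᶠ p in 𝓝 p, h p = h' p) :
    curvature (halfSpace n) (inChart h q) (extChartAt (𝓡∂ n) q p)
      = curvature (halfSpace n) (inChart h' q) (extChartAt (𝓡∂ n) q p) := by
  have h1 := eventuallyEq_inChart hq e
  have hx := chart_mem (n := n) q p
  funext u v w z
  rw [curvature, curvature, h1.fderivWithin_eq_of_mem hx,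
    h1.fderivWithin.fderivWithin_eq_of_mem hx, h1.eq_of_nhdsWithin hx]

theorem IsSmoothAt.congr {h h' : TensorField n M} {p : M} (hs : IsSmoothAt h' p)
    (e : ∀ᶠ p in 𝓝 p, h p = h' p) : IsSmoothAt h p := by
  have hp := mem_extChartAt_source (I := 𝓡∂ n) p
  have h1 := eventuallyEq_inChart hp e
  rw [isSmoothAt_iff] at hs ⊢
  exact hs.congr_of_eventuallyEq h1 (h1.eq_of_nhdsWithin (chart_mem p p))

variable {g : SmoothMetric n M} {r : ℝ} {L : TensorField n M} {χ : ℝ → ℝ}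

theorem isSmoothAt_perturbedMetric (hr : IsFermiWidth g r) (hpar : IsNormallyParallel g r L)
    {a b : ℝ → ℝ} (ha : ContDiffOn ℝ ∞ a (Ici 0)) (hb : ContDiffOn ℝ ∞ b (Ici 0)) {p : M}
    (hp : p ∈ tube g r) : IsSmoothAt (perturbedMetric g L a b) p := by
  have hs := mem_extChartAt_source (I := 𝓡∂ n) p
  have hu := contDiffWithinAt_normalCoordIn g hr hp hs
  have hc : ∀ {a : ℝ → ℝ}, ContDiffOn ℝ ∞ a (Ici 0) → ContDiffWithinAt ℝ ∞
      (fun x => a (normalCoordIn g p x)) (halfSpace n) (extChartAt (𝓡∂ n) p p) := fun ha =>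
    ContDiffWithinAt.comp (t := Ici 0) (f := normalCoordIn g p) _ (ha _ (normalCoord_nonneg g _)) hu
      fun x _ => normalCoord_nonneg g _
  rw [isSmoothAt_iff, inChart_perturbedMetric]
  exact (((SmoothMetric.isMetricNear g p).smooth.contDiffWithinAt hs).add
    ((hc ha).smul ((hpar.isSmoothAt hp).contDiffWithinAt hs))).add
      ((hc hb).smul ((isSmoothAt_tangentialPart hr hp).contDiffWithinAt hs))

theorem bivectorForm_nonneg (g : SmoothMetric n M) (p : M) {α : Matrix (Fin n) (Fin n) ℝ}
    (hα : α.transpose = -α) : 0 ≤ bivectorForm g.inner p α := by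
  have h := isInner_centreMetric g p
  rw [bivectorForm_eq, frameForm_bivec]
  exact quadForm_bivectorTensor_nonneg
    (gram_posSemidef h.symm (fun u => by
      by_cases hu : u = 0
      · simp [hu]
      · exact (h.pos u hu).le) _) hα

/-- The metric is not changed outside a tube which contains the support of the cutoff function:
there `F_δ` vanishes as well, since `f_δ` has integral zero. -/
theorem modifiedMetric_eq_of_le (p : M) (C : ℝ) {s δ : ℝ} {f : ℝ → ℝ} (hs : 0 < s) (hδ : 0 < δ)
    (hδs : δ ≤ s) (hχ : ∀ x ∈ Ici s, χ x = 0) (hf : IsAuxFun δ f)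
    (hp : ¬ boundaryEDist g p ≤ ENNReal.ofReal s) :
    modifiedMetric g r L χ C f p = g.inner p := by
  by_cases hpt : p ∈ tube g r
  · have h1 : s < normalCoord g p := lt_of_not_ge fun h =>
      hp ((boundaryEDist_le_iff g hpt hs.le).2 h)
    rw [modifiedMetric, if_pos hpt, hf.primitive_eq_zero hδ (hδs.trans h1.le), hχ _ h1.le]
    simp
  · rw [modifiedMetric, if_neg hpt]

omit [IsManifold (𝓡∂ n) ∞ M] in
theorem bivectorForm_congr {h h' : TensorField n M} {p : M} (e : ∀ᶠ p in 𝓝 p, h p = h' p)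
    (α : Matrix (Fin n) (Fin n) ℝ) : bivectorForm h p α = bivectorForm h' p α := by
  rw [bivectorForm_eq, bivectorForm_eq, (eventuallyEq_inChart (mem_extChartAt_source p)
    e).eq_of_nhdsWithin (chart_mem p p)]

theorem curvatureForm_congr {h : TensorField n M} {p : M} (hh : IsMetricNear h p)
    (e : ∀ᶠ p in 𝓝 p, h p = g.inner p) (α : Matrix (Fin n) (Fin n) ℝ) :
    curvatureForm h p α = curvatureForm g.inner p α := by
  rw [curvatureForm_eq hh, curvatureForm_eq (SmoothMetric.isMetricNear g p),
    curvature_congr (mem_extChartAt_source p) e]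

theorem curvatureForm_ge_of_localBound {h : TensorField n M} {p q : M} (hh : IsMetricNear h p)
    (hq : p ∈ (extChartAt (𝓡∂ n) q).source) {C k : ℝ} {f : ℝ → ℝ}
    (e : ∀ᶠ p in 𝓝 p, h p = perturbedMetric g L (bendingFactor f) (shrinkingFactor χ C f) p)
    (hb : HasLocalBound g L χ C k q p f) {α : Matrix (Fin n) (Fin n) ℝ} (hα : α.transpose = -α) :
    k * bivectorForm h p α ≤ curvatureForm h p α := by
  rw [curvatureForm_eq_chart hh hq, bivectorForm_eq_chart _ hq, curvature_congr hq e,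
    (eventuallyEq_inChart hq e).eq_of_nhdsWithin (chart_mem q p)]
  exact hb.2 _ (transpose_congruence hα _)

variable (hr : IsFermiWidth g r) (hpar : IsNormallyParallel g r L) (hχ : ContDiff ℝ ∞ χ)
include hr hpar hχ

/-- The local bounds near the points of a closed tube outside of which the metric is unchanged
give a lower bound for the curvature operator. -/
theorem exists_metric_of_localBound [T2Space M] {C κ k s δ : ℝ} {f : ℝ → ℝ} (hs : 0 < s)
    (hsr : s < r) (hδ : 0 < δ) (hδs : δ ≤ s) (hχ0 : ∀ x ∈ Ici s, χ x = 0) (hf : IsAuxFun δ f)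
    (hR : CurvatureGE g.inner κ) (hk : k ≤ κ)
    (h : ∀ p, boundaryEDist g p ≤ ENNReal.ofReal s → ∃ q, p ∈ (extChartAt (𝓡∂ n) q).source ∧
      HasLocalBound g L χ C k q p f) :
    ∃ gδ : SmoothMetric n M, (∀ p, gδ.inner p = modifiedMetric g r L χ C f p) ∧
      CurvatureGE gδ.inner k := by
  have hK : IsClosed {p : M | boundaryEDist g p ≤ ENNReal.ofReal s} := (hr.compact s hsr).isClosed
  have hin : ∀ p, boundaryEDist g p ≤ ENNReal.ofReal s → p ∈ tube g r ∧ ∀ᶠ p in 𝓝 p,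
      modifiedMetric g r L χ C f p
        = perturbedMetric g L (bendingFactor f) (shrinkingFactor χ C f) p := fun p hp => by
    have hpt : p ∈ tube g r := lt_of_le_of_lt hp ((ENNReal.ofReal_lt_ofReal_iff hr.pos).2 hsr)
    refine ⟨hpt, ?_⟩
    filter_upwards [(isOpen_tube g r).mem_nhds hpt] with p hp
    exact modifiedMetric_eq hp C f
  have hout : ∀ p, ¬ boundaryEDist g p ≤ ENNReal.ofReal s → ∀ᶠ p in 𝓝 p,
      modifiedMetric g r L χ C f p = g.inner p := fun p hp => by
    filter_upwards [hK.isOpen_compl.mem_nhds hp] with p hp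
    exact modifiedMetric_eq_of_le p C hs hδ hδs hχ0 hf hp
  have hF := contDiffOn_primitive hf.smooth
  have hsm : ∀ p, IsSmoothAt (modifiedMetric g r L χ C f) p := fun p => by
    by_cases hp : boundaryEDist g p ≤ ENNReal.ofReal s
    · exact (isSmoothAt_perturbedMetric hr hpar (contDiffOn_const.mul hF)
        ((contDiffOn_const.mul hχ.contDiffOn).mul (contDiffOn_primitive hF)).neg
        (hin p hp).1).congr (hin p hp).2
    · exact (SmoothMetric.isMetricNear g p).smooth.congr (hout p hp)
  have hinner : ∀ p, IsInner (tensorAt (modifiedMetric g r L χ C f) p) := fun p => by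
    by_cases hp : boundaryEDist g p ≤ ENNReal.ofReal s
    · obtain ⟨q, hq, h1, -⟩ := h p hp
      have h2 := isInner_of_inChart hq h1
      rwa [← tensorAt_congr (hin p hp).2] at h2
    · rw [tensorAt_congr (hout p hp)]
      exact SmoothMetric.isInner g p
  refine ⟨metricOfInner _ hsm hinner, fun p => rfl, fun p α hα => ?_⟩
  have hnear : IsMetricNear (modifiedMetric g r L χ C f) p := ⟨hsm p, .of_forall hinner⟩
  change k * bivectorForm (modifiedMetric g r L χ C f) p α
    ≤ curvatureForm (modifiedMetric g r L χ C f) p α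
  by_cases hp : boundaryEDist g p ≤ ENNReal.ofReal s
  · obtain ⟨q, hq, h1⟩ := h p hp
    exact curvatureForm_ge_of_localBound hnear hq (hin p hp).2 h1 hα
  · rw [curvatureForm_congr hnear (hout p hp), bivectorForm_congr (hout p hp)]
    exact (mul_le_mul_of_nonneg_right hk (bivectorForm_nonneg g p hα)).trans (hR p α hα)

end Global

/-! ### Uniform estimates on a compact tube -/

section Covering

variable {n : ℕ} [NeZero n] {M : Type*} [TopologicalSpace M] [T2Space M]
  [ChartedSpace (EuclideanHalfSpace n) M] [IsManifold (𝓡∂ n) ∞ M]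
  {g : SmoothMetric n M} {r : ℝ} {L : TensorField n M} {χ : ℝ → ℝ}

/-- The projection onto the tangent space of the boundary is positive semidefinite. -/
theorem tangential_nonneg (hr : IsFermiWidth g r) {q : M} (hq : q ∈ (𝓡∂ n).boundary M)
    (w : EuclideanSpace ℝ (Fin n)) :
    0 ≤ centreMetric g q w w - centreDifferential g q w * centreDifferential g q w := by
  have h1 : centreDifferential g q (normalField g q) = 1 := fderivWithin_normalCoordIn_gradient hr hq
  have h2 := (isInner_centreMetric g q).cauchy_schwarz (normalField g q) w
  rw [centreMetric_normalField, h1, one_mul, sq] at h2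
  linarith

variable (hr : IsFermiWidth g r) (hpar : IsNormallyParallel g r L) {κ C : ℝ}
  (hR : CurvatureGE g.inner κ)
  (hL : ∃ s > 0, s < r ∧ ∀ p, boundaryEDist g p ≤ ENNReal.ofReal s → ∀ v, 0 ≤ tensorAt L p v v)
  (hκ : ∀ q ∈ (𝓡∂ n).boundary M, ∀ t ∈ Icc (0 : ℝ) 1, ∀ α : Matrix (Fin n) (Fin n) ℝ,
    α.transpose = -α → κ * frameForm (bivec (centreMetric g q)) stdVec α
      ≤ frameForm (curvature (halfSpace n) (inChart (collarMetric g L t) q)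
        (extChartAt (𝓡∂ n) q q)) stdVec α
        + C * t * (centreMetric g q (contraction (centreDifferential g q) stdVec α)
            (contraction (centreDifferential g q) stdVec α)
          - centreDifferential g q (contraction (centreDifferential g q) stdVec α)
            * centreDifferential g q (contraction (centreDifferential g q) stdVec α)))
include hr hpar hR hL hκ

/-- The local lower bounds hold at all points of a closed tube as soon as `δ` is small, by
compactness. -/
theorem eventually_forall_hasLocalBound (hχ : ContDiff ℝ ∞ χ)
    (hχ1 : ∃ s > 0, ∀ x ∈ Icc 0 s, χ x = 1) {s η : ℝ} (hsr : s < r) (hη : 0 < η) :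
    ∀ᶠ δ in 𝓝[>] (0 : ℝ), ∀ p, boundaryEDist g p ≤ ENNReal.ofReal s → ∀ f, IsAuxFun δ f →
      ∃ q, p ∈ (extChartAt (𝓡∂ n) q).source ∧ HasLocalBound g L χ C (κ - η) q p f := by
  have hlocal : ∀ q ∈ {p : M | boundaryEDist g p ≤ ENNReal.ofReal s},
      ∀ᶠ w : ℝ × M in 𝓝[>] 0 ×ˢ 𝓝 q, ∀ f, IsAuxFun w.1 f →
        ∃ q, w.2 ∈ (extChartAt (𝓡∂ n) q).source ∧ HasLocalBound g L χ C (κ - η) q w.2 f := by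
    intro q hq
    have hqt : q ∈ tube g r := lt_of_le_of_lt hq ((ENNReal.ofReal_lt_ofReal_iff hr.pos).2 hsr)
    have hev : ∀ᶠ z in auxFilter q, HasLocalBound g L χ C (κ - η) q z.1.2 z.2 := by
      by_cases hqb : q ∈ (𝓡∂ n).boundary M
      · obtain ⟨s₀, hs₀, -, hnn⟩ := hL
        refine eventually_hasLocalBound_boundary hr hpar hχ hη hqb hχ1 ?_ (hκ q hqb)
        filter_upwards [(isOpen_tube g s₀).mem_nhds (mem_tube_of_mem g hs₀ hqb)] with p hp
        exact hnn p (le_of_lt hp)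
      · refine eventually_hasLocalBound_interior hr hpar hχ hη hqt hqb fun α hα => ?_
        have h1 := hR q α hα
        rwa [curvatureForm_eq (SmoothMetric.isMetricNear g q), bivectorForm_eq] at h1
    have hsrc := (tendsto_auxFilter_point q).eventually
      ((isOpen_extChartAt_source (I := 𝓡∂ n) q).mem_nhds (mem_extChartAt_source q))
    filter_upwards [eventually_auxFilter.1 (hev.and hsrc)] with w hw f hf
    exact ⟨q, (hw f hf).2, (hw f hf).1⟩
  have h1 := (hr.compact s hsr).mem_prod_nhdsSet_of_forall hlocal
  exact (Filter.Eventually.curry h1).mono fun δ hδ p hp f hf => hδ.self_of_nhdsSet p hp f hf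

theorem exists_modified_metrics (hχ : IsCutoff r χ) :
    ∃ ε : ℝ → ℝ, Tendsto ε (𝓝[>] 0) (𝓝 0) ∧
      ∀ᶠ δ in 𝓝[>] (0 : ℝ), ∀ f : ℝ → ℝ, IsAuxFun δ f →
        ∃ gδ : SmoothMetric n M, (∀ p, gδ.inner p = modifiedMetric g r L χ C f p) ∧
          CurvatureGE gδ.inner (κ - ε δ) := by
  -- the cutoff function may vanish on `[s', ∞)` with `s' ≤ 0`
  obtain ⟨s', hs', hχ0'⟩ := hχ.eq_zero
  obtain ⟨s, hs, hsr, hχ0⟩ : ∃ s > 0, s < r ∧ ∀ x ∈ Ici s, χ x = 0 :=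
    ⟨max s' (r / 2), lt_max_of_lt_right (half_pos hr.pos), max_lt hs' (half_lt_self hr.pos),
      fun x hx => hχ0' x ((le_max_left s' (r / 2)).trans (mem_Ici.1 hx))⟩
  set S : ℝ → Set ℝ := fun δ => {η | 0 < η ∧ ∀ p, boundaryEDist g p ≤ ENNReal.ofReal s →
    ∀ f, IsAuxFun δ f → ∃ q, p ∈ (extChartAt (𝓡∂ n) q).source ∧
      HasLocalBound g L χ C (κ - η) q p f} with hS
  have hmem : ∀ η > 0, ∀ᶠ δ in 𝓝[>] (0 : ℝ), η ∈ S δ := fun η hη =>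
    (eventually_forall_hasLocalBound hr hpar hR hL hκ hχ.smooth hχ.eq_one hsr hη).mono
      fun δ hδ => ⟨hη, hδ⟩
  have hnn : ∀ δ, 0 ≤ sInf (S δ) := fun δ => Real.sInf_nonneg fun η hη => hη.1.le
  have hbdd : ∀ δ, BddBelow (S δ) := fun δ => ⟨0, fun η hη => hη.1.le⟩
  -- the best error, increased by `δ` so that it is admissible
  refine ⟨fun δ => sInf (S δ) + δ, ?_, ?_⟩
  · refine tendsto_order.2 ⟨fun a ha => ?_, fun a ha => ?_⟩
    · filter_upwards [self_mem_nhdsWithin] with δ hδ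
      have hδ : 0 < δ := hδ
      linarith [hnn δ]
    · filter_upwards [hmem (a / 2) (half_pos ha),
        (gt_mem_nhds (half_pos ha)).filter_mono nhdsWithin_le_nhds] with δ h1 h2
      linarith [csInf_le (hbdd δ) h1]
  · filter_upwards [hmem 1 one_pos, self_mem_nhdsWithin,
      (eventually_le_nhds hs).filter_mono nhdsWithin_le_nhds] with δ h1 hδ hδs f hf
    have hδ : 0 < δ := hδ
    obtain ⟨η, ⟨hη, h2⟩, h3⟩ := exists_lt_of_csInf_lt ⟨1, h1⟩ (lt_add_of_pos_right (sInf (S δ)) hδ)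
    obtain ⟨gδ, h4, h5⟩ := exists_metric_of_localBound hr hpar hχ.smooth hs hsr hδ hδs hχ0 hf hR
      (sub_le_self κ hη.le) fun p hp => h2 p hp f hf
    refine ⟨gδ, h4, fun p α hα => (mul_le_mul_of_nonneg_right ?_
      (bivectorForm_nonneg gδ p hα)).trans (h5 p α hα)⟩
    linarith

end Covering

end Gluing

end

theorem mainTheorem8 {m : ℕ}
    {M₀ : Type*} [TopologicalSpace M₀] [T2Space M₀]
    [ChartedSpace (EuclideanHalfSpace (m + 1)) M₀] [IsManifold (𝓡∂ (m + 1)) ∞ M₀]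
    {M₁ : Type*} [TopologicalSpace M₁] [T2Space M₁]
    [ChartedSpace (EuclideanHalfSpace (m + 1)) M₁] [IsManifold (𝓡∂ (m + 1)) ∞ M₁]
    {Γ : Type*} [TopologicalSpace Γ] [CompactSpace Γ]
    [ChartedSpace (EuclideanSpace ℝ (Fin m)) Γ] [IsManifold (𝓡 m) ∞ Γ]
    (g₀ : Gluing.SmoothMetric (m + 1) M₀) (g₁ : Gluing.SmoothMetric (m + 1) M₁)
    (ι₀ : Γ → M₀) (ι₁ : Γ → M₁)
    (hι₀ : Gluing.IsBoundaryEmbedding m ι₀) (hι₁ : Gluing.IsBoundaryEmbedding m ι₁)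
    -- the gluing map `ι₁ ∘ ι₀⁻¹` of the boundaries is an isometry
    (hiso : ∀ (y : Γ) (X Y : TangentSpace (𝓡 m) y),
      g₀.inner (ι₀ y) (mfderiv (𝓡 m) (𝓡∂ (m + 1)) ι₀ y X) (mfderiv (𝓡 m) (𝓡∂ (m + 1)) ι₀ y Y) =
      g₁.inner (ι₁ y) (mfderiv (𝓡 m) (𝓡∂ (m + 1)) ι₁ y X) (mfderiv (𝓡 m) (𝓡∂ (m + 1)) ι₁ y Y))
    (κ : ℝ)
    (hR₀ : Gluing.CurvatureGE g₀.inner κ) (hR₁ : Gluing.CurvatureGE g₁.inner κ)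
    -- `L = L₀ + L₁` is positive semidefinite on `Γ`
    (hL : ∀ (y : Γ) (X : TangentSpace (𝓡 m) y),
      0 ≤ Gluing.sumForm g₀.inner g₁.inner ι₀ ι₁ y X X)
    (r : ℝ) (hr : Gluing.IsFermiWidth g₀ r)
    -- the extension of `L` to the tube around `Γ` in `M₀` with `L N = 0`, `∇_N L = 0`
    (L : Gluing.TensorField (m + 1) M₀) (hpar : Gluing.IsNormallyParallel g₀ r L)
    (hext : ∀ (y : Γ) (X Y : TangentSpace (𝓡 m) y),
      L (ι₀ y) (mfderiv (𝓡 m) (𝓡∂ (m + 1)) ι₀ y X) (mfderiv (𝓡 m) (𝓡∂ (m + 1)) ι₀ y Y) =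
        Gluing.sumForm g₀.inner g₁.inner ι₀ ι₁ y X Y) :
    ∃ C₀ : ℝ, ∀ χ : ℝ → ℝ, Gluing.IsCutoff r χ → ∀ C ≥ C₀,
      ∃ ε : ℝ → ℝ, Tendsto ε (𝓝[>] 0) (𝓝 0) ∧
        ∀ᶠ δ in 𝓝[>] (0 : ℝ), ∀ f : ℝ → ℝ, Gluing.IsAuxFun δ f →
          ∃ gδ : Gluing.SmoothMetric (m + 1) M₀,
            (∀ p, gδ.inner p = Gluing.modifiedMetric g₀ r L χ C f p) ∧
            Gluing.CurvatureGE gδ.inner (κ - ε δ) := by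
  obtain ⟨C₀, hC₀⟩ := Gluing.exists_curvature_collarMetric_ge hι₀ hι₁ hr hpar hiso hL hext hR₀ hR₁
  refine ⟨C₀, fun χ hχ C hC => Gluing.exists_modified_metrics hr hpar hR₀ ?_ ?_ hχ⟩
  · exact Gluing.exists_tube_nonneg hr hpar fun q hq =>
      Gluing.nonneg_of_mem_boundary hι₀ hL hr hpar hext hq
  · intro q hq t ht α hα
    refine (hC₀ q hq t ht α hα).trans (add_le_add_right (mul_le_mul_of_nonneg_right
      (mul_le_mul_of_nonneg_right hC ht.1) (Gluing.tangential_nonneg hr hq _)) _)
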